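/- Let $X=\mathbb{R}^\nu$ with $\nu\ge 1$, let $\mathcal H^s$ be the usual Sobolev spaces on $X$, $q$ the operator of multiplication by $x$ and $p=-i\nabla$. Let $\alpha>0$, $\beta\in\mathbb{R}$, $k\in\mathbb{R}\setminus\{0\}$, let $\kappa\in C_c^\infty(\mathbb{R},\mathbb{R})$ satisfy $\kappa=1$ on $[-1,1]$ and $0\le\kappa\le1$, and let $$W(x)=W_{\alpha\beta}(x)=(1-\kappa(|x|))\,\frac{\sin(k|x|^\alpha)}{|x|^\beta}.$$ Let $u:X\to X$ be a $C^\infty$ vector field, bounded with all its derivatives, such that $x\cdot u(x)>0$ for all $x\ne0$, and let $A_u$ be the closure in $L^2(X)$ of $\frac12(u(p)\cdot q+q\cdot u(p))$ defined on $C_c^\infty(X)$; it generates a unitary group $e^{i\tau A_u}$, which acts in all the spaces $\mathcal H^s$. A bounded operator $T:\mathcal H^s\to\mathcal H^{-s}$ is of class $C^{1,1}(A_u,\mathcal H^s,\mathcal H^{-s})$ if $\int_0^1\|T_\tau+T_{-\tau}-2T\|_{B(\mathcal H^s,\mathcal H^{-s})}\,\frac{d\tau}{\tau^2}<\infty$,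 where $T_\tau=e^{i\tau A_u}Te^{-i\tau A_u}$. Then: 1. If $\alpha+\beta>2$, then multiplication by $W$ defines a compact operator $\mathcal H^1\to\mathcal H^{-1}$, of class $C^{1,1}(A_u,\mathcal H^1,\mathcal H^{-1})$. 2. If $2\alpha+\beta>3$ and $\beta>0$, then multiplication by $W$ defines a bounded operator $\mathcal H^2\to\mathcal H^{-2}$, of class $C^{1,1}(A_u,\mathcal H^2,\mathcal H^{-2})$. In particular, in both cases $W$ satisfies the hypotheses of the two limiting absorption theorems for $H=\Delta+W$, $\Delta=-\nabla^2$ (the one with conjugate operator $A_u$, and the one with a condition on the differences of the potential). That is, with $s=1$ in case 1 and $s=2$ in case 2: * multiplication by $W$ is symmetric $\mathcal H^s\to\mathcal H^{-s}$, of class $C^{1,1}(A_u,\mathcal H^s,\mathcal H^{-s})$, and compact $\mathcal H^1\to\mathcal H^{-1}$ in case 1, compact $\mathcal H^2\to L^2$ in case 2; * for every $a\in\mathbb{R}$, every vector $e$ of the canonical basis of $\mathbb{R}^\nu$ and every real $\xi\in C^\infty(X)$ with $\xi(x)=0$ for $|x|<1$ and $\xi(x)=1$ for $|x|>2$, $$\int_1^\infty\big\|\xi(q/r)\,|q|\,(W(q+ae)-W(q))\big\|_{B(\mathcal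 H^s,\mathcal H^{-s})}\frac{dr}{r}<\infty;$$ * for all $0<a<b$ one has $\inf\{x\cdot u(x) : x\in X,\ a<|x|^2<b\}>0$, so that every open energy interval $J=(a,b)$ is admissible. -/

import Mathlib

open MeasureTheory Set Filter Topology
open scoped SchwartzMap ENNReal ContDiff

noncomputable section

namespace OscPot

/-- The configuration space `ℝ^ν` with its Euclidean norm. -/
abbrev X (ν : ℕ) : Type := EuclideanSpace ℝ (Fin ν)

/-- The Hilbert space `L²(ℝ^ν)` of complex-valued functions. -/
abbrev L2 (ν : ℕ) : Type := Lp ℂ 2 (volume : Measure (X ν))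

/-! ### Sobolev spaces of real order -/

/-- The tempered distributions `f` on `ℝ^ν` with `⟨p⟩^s f ∈ L²`, as a subspace of the space of
tempered distributions. -/
def sobolevSubmodule (ν : ℕ) (s : ℝ) : Submodule ℂ 𝓢'(X ν, ℂ) where
  carrier := {f | TemperedDistribution.MemSobolev s 2 f}
  add_mem' hf hg := hf.add hg
  zero_mem' := TemperedDistribution.memSobolev_fun_zero (X ν) ℂ s 2
  smul_mem' c _ hf := hf.smul c

/-- The Sobolev space `H^s(ℝ^ν)`, for every real `s`. -/
def Sob (ν : ℕ) (s : ℝ) : Type := sobolevSubmodule ν s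

namespace Sob

variable {ν : ℕ} {s : ℝ}

instance : AddCommGroup (Sob ν s) := inferInstanceAs (AddCommGroup (sobolevSubmodule ν s))

instance : Module ℂ (Sob ν s) := inferInstanceAs (Module ℂ (sobolevSubmodule ν s))

/-- The tempered distribution underlying an element of `H^s`. -/
def toDist : Sob ν s →ₗ[ℂ] 𝓢'(X ν, ℂ) := (sobolevSubmodule ν s).subtype

theorem toDist_injective : Function.Injective (toDist : Sob ν s →ₗ[ℂ] 𝓢'(X ν, ℂ)) :=
  Subtype.val_injective

theorem toTemperedDistributionCLM_injective :
    Function.Injective (Lp.toTemperedDistributionCLM ℂ (volume : Measure (X ν)) 2) :=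
  LinearMap.ker_eq_bot.mp
    (Lp.ker_toTemperedDistributionCLM_eq_bot (F := ℂ) (μ := (volume : Measure (X ν))) (p := 2))

theorem exists_bessel (f : Sob ν s) : ∃ g : L2 ν,
    Lp.toTemperedDistributionCLM ℂ volume 2 g
      = TemperedDistribution.besselPotential (X ν) ℂ s (toDist f) := by
  obtain ⟨g, hg⟩ := f.2
  exact ⟨g, hg.symm⟩

/-- The `L²` function `⟨p⟩^s f` attached to `f ∈ H^s`, as a plain function of `f`. -/
def besselFun (f : Sob ν s) : L2 ν := (exists_bessel f).choose

theorem besselFun_spec (f : Sob ν s) :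
    Lp.toTemperedDistributionCLM ℂ volume 2 (besselFun f)
      = TemperedDistribution.besselPotential (X ν) ℂ s (toDist f) :=
  (exists_bessel f).choose_spec

/-- The `L²` function `⟨p⟩^s f` attached to `f ∈ H^s`, as a linear map. -/
def bessel : Sob ν s →ₗ[ℂ] L2 ν where
  toFun := besselFun
  map_add' f g := by
    apply toTemperedDistributionCLM_injective
    simp only [map_add, besselFun_spec]
  map_smul' c f := by
    apply toTemperedDistributionCLM_injective
    simp only [map_smul, besselFun_spec, RingHom.id_apply]

theorem bessel_spec (f : Sob ν s) :
    Lp.toTemperedDistributionCLM ℂ volume 2 (bessel f)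
      = TemperedDistribution.besselPotential (X ν) ℂ s (toDist f) :=
  besselFun_spec f

theorem bessel_injective : Function.Injective (bessel : Sob ν s →ₗ[ℂ] L2 ν) := by
  intro f g h
  apply toDist_injective
  have h' : TemperedDistribution.besselPotential (X ν) ℂ s (toDist f)
      = TemperedDistribution.besselPotential (X ν) ℂ s (toDist g) := by
    rw [← bessel_spec, ← bessel_spec, h]
  have h2 := congrArg (TemperedDistribution.besselPotential (X ν) ℂ (-s)) h'
  simpa using h2

/-- The norm of `H^s` is `‖⟨p⟩^s f‖_{L²}`, with the weight `(1 + |ξ|²)^{s/2}` in the frequency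
variable `ξ` of the kernel `e^{-2πi x·ξ}` (equivalent to the weight `(1 + |2πξ|²)^{s/2}`). -/
instance : NormedAddCommGroup (Sob ν s) :=
  NormedAddCommGroup.induced (Sob ν s) (L2 ν) bessel bessel_injective

instance : NormedSpace ℂ (Sob ν s) := NormedSpace.induced ℂ (Sob ν s) (L2 ν) bessel

/-- A Schwartz function as an element of `H^s`. -/
def ofSchwartz (s : ℝ) (φ : 𝓢(X ν, ℂ)) : Sob ν s :=
  ⟨(φ : 𝓢'(X ν, ℂ)), φ.memSobolev⟩

/-- The duality pairing `(F, g)` of `F ∈ H^{-s}` and `g ∈ H^s`, which extends the scalar product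
`∫ conj F * g` of `L²` (antilinear in the first variable). -/
def pairing (F : Sob ν (-s)) (g : Sob ν s) : ℂ := inner ℂ (bessel F) (bessel g)

end Sob

/-! ### Multiplication operators -/

/-- `V : H^s → H^t` is the operator of multiplication by the function `m`: for every Schwartz
function `φ`, the distribution `V φ` is the function `m φ`. Since Schwartz functions are dense,
there is at most one such bounded `V`. -/
def IsMultiplicationBy {ν : ℕ} {s t : ℝ} (m : X ν → ℝ) (V : Sob ν s →L[ℂ] Sob ν t) : Prop :=
  ∀ φ ψ : 𝓢(X ν, ℂ),
    Integrable (fun x => (m x : ℂ) * φ x * ψ x) volume ∧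
      (V (Sob.ofSchwartz s φ)).toDist ψ = ∫ x, (m x : ℂ) * φ x * ψ x

/-- `V : H^s → H^{-s}` is symmetric: `(V f, g) = (f, V g)` for all `f, g ∈ H^s`. -/
def IsSymm {ν : ℕ} {s : ℝ} (V : Sob ν s →L[ℂ] Sob ν (-s)) : Prop :=
  ∀ f g : Sob ν s, Sob.pairing (V f) g = starRingEnd ℂ (Sob.pairing (V g) f)

/-! ### The conjugate operators `A_u` and the groups they generate -/

/-- The class `𝒰`: smooth vector fields, bounded together with all their derivatives, with
`x · u(x) > 0` for `x ≠ 0`. -/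
structure IsInClassU {ν : ℕ} (u : X ν → X ν) : Prop where
  smooth : ContDiff ℝ ∞ u
  bounded : ∀ n : ℕ, ∃ C : ℝ, ∀ x, ‖iteratedFDeriv ℝ n u x‖ ≤ C
  pos : ∀ x, x ≠ 0 → 0 < inner ℝ x (u x)

/-- Multiplication by the coordinate `x_j` on Schwartz functions. -/
def qOp {ν : ℕ} (j : Fin ν) : 𝓢(X ν, ℂ) →L[ℂ] 𝓢(X ν, ℂ) :=
  SchwartzMap.smulLeftCLM ℂ (fun x : X ν => ((x j : ℝ) : ℂ))

/-- `u_j(p)` on Schwartz functions, with `p = -i∇`. In the frequency variable `ξ` of the kernel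
`e^{-2πi x·ξ}`, the operator `p` is multiplication by `2πξ`. -/
def uOp {ν : ℕ} (u : X ν → X ν) (j : Fin ν) : 𝓢(X ν, ℂ) →L[ℂ] 𝓢(X ν, ℂ) :=
  SchwartzMap.fourierMultiplierCLM ℂ (fun ξ : X ν => ((u ((2 * Real.pi) • ξ) j : ℝ) : ℂ))

/-- `½ (u(p)·q + q·u(p))` on Schwartz functions. -/
def conjSchwartz {ν : ℕ} (u : X ν → X ν) : 𝓢(X ν, ℂ) →L[ℂ] 𝓢(X ν, ℂ) :=
  (1 / 2 : ℂ) • ∑ j : Fin ν, (uOp u j ∘L qOp j + qOp j ∘L uOp u j)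

/-- `C_c^∞(ℝ^ν)`, as a space of Schwartz functions. -/
def testFun (ν : ℕ) : Submodule ℂ 𝓢(X ν, ℂ) where
  carrier := {φ | HasCompactSupport φ}
  add_mem' hf hg := HasCompactSupport.add hf hg
  zero_mem' := HasCompactSupport.zero
  smul_mem' c _ hf := HasCompactSupport.smul_left (f := fun _ => c) hf

/-- The inclusion of `C_c^∞` in `L²`. -/
def testFunToL2 (ν : ℕ) : testFun ν →ₗ[ℂ] L2 ν :=
  (SchwartzMap.toLpCLM ℂ ℂ 2 (volume : Measure (X ν))).toLinearMap ∘ₗ (testFun ν).subtype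

theorem testFunToL2_injective (ν : ℕ) : Function.Injective (testFunToL2 ν) := by
  intro f g h
  exact Subtype.val_injective (SchwartzMap.injective_toLp 2 volume h)

/-- The operator `½ (u(p)·q + q·u(p))` in `L²` with domain `C_c^∞`. -/
def conjOpMin {ν : ℕ} (u : X ν → X ν) : L2 ν →ₗ.[ℂ] L2 ν where
  domain := LinearMap.range (testFunToL2 ν)
  toFun := (SchwartzMap.toLpCLM ℂ ℂ 2 (volume : Measure (X ν))).toLinearMap ∘ₗ
    (conjSchwartz u).toLinearMap ∘ₗ (testFun ν).subtype ∘ₗ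
    (LinearEquiv.ofInjective (testFunToL2 ν) (testFunToL2_injective ν)).symm.toLinearMap

/-- The operator `A_u`: the closure of `½ (u(p)·q + q·u(p))` defined on `C_c^∞`. -/
def conjOp {ν : ℕ} (u : X ν → X ν) : L2 ν →ₗ.[ℂ] L2 ν := (conjOpMin u).closure

/-- `U τ = e^{iτA}`: a strongly continuous one-parameter unitary group in `L²` whose infinitesimal
generator (domain included) is `iA`. -/
structure IsUnitaryGroupOf {ν : ℕ} (A : L2 ν →ₗ.[ℂ] L2 ν) (U : ℝ → (L2 ν ≃ₗᵢ[ℂ] L2 ν)) :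
    Prop where
  map_zero : ∀ f, U 0 f = f
  map_add : ∀ σ τ f, U (σ + τ) f = U σ (U τ f)
  continuous : ∀ f, Continuous fun τ => U τ f
  generator : ∀ f g : L2 ν,
    (f, g) ∈ A.graph ↔ HasDerivAt (fun τ : ℝ => U τ f) (Complex.I • g) 0

/-- `S τ` is the bounded operator in `H^s` that `U τ` induces: the restriction of `U τ` to `H^s`
if `s ≥ 0`, its continuous extension to `H^s` if `s ≤ 0`. -/
def IsInducedOn {ν : ℕ} (s : ℝ) (U : ℝ → (L2 ν ≃ₗᵢ[ℂ] L2 ν))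
    (S : ℝ → (Sob ν s →L[ℂ] Sob ν s)) : Prop :=
  ∀ (τ : ℝ) (f : L2 ν) (g : Sob ν s), g.toDist = (f : 𝓢'(X ν, ℂ)) →
    (S τ g).toDist = ((U τ f : L2 ν) : 𝓢'(X ν, ℂ))

/-- `T : H^s → H^{-s}` is of class `C^{1,1}(A, H^s, H^{-s})`: the group `e^{iτA}` exists, it acts
in `H^s` and in `H^{-s}`, and `∫_0^1 ‖T_τ + T_{-τ} - 2T‖ dτ/τ² < ∞`, where
`T_τ = e^{iτA} T e^{-iτA}`. -/
def IsC11 {ν : ℕ} {s : ℝ} (A : L2 ν →ₗ.[ℂ] L2 ν) (T : Sob ν s →L[ℂ] Sob ν (-s)) : Prop :=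
  ∃ (U : ℝ → (L2 ν ≃ₗᵢ[ℂ] L2 ν)) (S : ℝ → (Sob ν s →L[ℂ] Sob ν s))
    (S' : ℝ → (Sob ν (-s) →L[ℂ] Sob ν (-s))),
    IsUnitaryGroupOf A U ∧ IsInducedOn s U S ∧ IsInducedOn (-s) U S' ∧
    ∫⁻ τ in Ioc (0 : ℝ) 1,
      ‖S' τ ∘L T ∘L S (-τ) + S' (-τ) ∘L T ∘L S τ - (2 : ℂ) • T‖ₑ / ENNReal.ofReal (τ ^ 2) < ⊤

/-! ### The potential and the difference condition -/

/-- `W(x) = (1 - κ(|x|)) sin(k|x|^α) / |x|^β`. -/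
def oscPotential (ν : ℕ) (α β k : ℝ) (κ : ℝ → ℝ) (x : X ν) : ℝ :=
  (1 - κ ‖x‖) * (Real.sin (k * ‖x‖ ^ α) / ‖x‖ ^ β)

/-- The condition `∫_1^∞ ‖ξ(q/r) |q| (W(q + a e) - W(q))‖_{B(H^s, H^{-s})} dr/r < ∞` for every
vector `e` of the canonical basis and every smooth real `ξ` with `ξ(x) = 0` for `|x| < 1` and
`ξ(x) = 1` for `|x| > 2`. -/
def DifferenceCondition {ν : ℕ} (s : ℝ) (W : X ν → ℝ) (a : ℝ) : Prop :=
  ∀ (j : Fin ν) (ξ : X ν → ℝ), ContDiff ℝ ∞ ξ → (∀ x, ‖x‖ < 1 → ξ x = 0) →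
    (∀ x, 2 < ‖x‖ → ξ x = 1) →
    ∃ B : ℝ → (Sob ν s →L[ℂ] Sob ν (-s)),
      (∀ r, 1 ≤ r → IsMultiplicationBy
        (fun x => ξ (r⁻¹ • x) * ‖x‖ * (W (x + a • EuclideanSpace.single j 1) - W x)) (B r)) ∧
      ∫⁻ r in Ici (1 : ℝ), ‖B r‖ₑ / ENNReal.ofReal r < ⊤

end OscPot

end

open OscPot

/-! The proof rests on one oscillatory estimate and on an explicit description of the group
`e^{iτA_u}`.

The estimate. Since `x · ∇ e^{ik|x|^α} = ikα |x|^α e^{ik|x|^α}`, the function `a e^{ik|x|^α}` is, up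
to a constant, the divergence of `x |x|^{-α} a e^{ik|x|^α}` minus a term in which the oscillation is
no longer differentiated. One integration by parts therefore trades a growth `|x|^{α-1}` of the
symbol `a` for one derivative of the test function. After `n` of them (`exists_osc_bound`), a symbol
of order at most `nα + β - n` times `W` is a bounded form on `H^n`
(`exists_formBound_mul_oscPotential`): the `L¹` norms of the derivatives of a product of two test
functions are controlled by their `H^n` norms. The two cases are `n = 1` and `n = 2`, and both
hypotheses say `nα + β - n > 1`: `W` keeps more than one power of `|x|` in reserve.

The group. In the frequency variable `iA_u` is `v · ∇ + ½ div v` for a bounded smooth field `v`. Its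
flow, with the integral of `½ div v` along the orbits as a logarithmic weight, gives transport
operators which are isometric in `L²` because the generator is skew-symmetric. That the generator of
the resulting group is exactly the closure from `C_c^∞` follows from an invariant dense class of
`C^1` functions whose orbits stay in the closed graph (`generatorGraph_le`,
`isUnitaryGroupOf_positionGroup`). As the flow displaces points by at most a constant times `|τ|`,
the group acts in every `H^s`.

Regularity. `A_u⟨q⟩⁻¹` and `A_u²⟨q⟩⁻²` are bounded in `H^{-n}`, so first and second differences of
the group, after `⟨q⟩⁻¹` and `⟨q⟩⁻²`, are `O(τ)` and `O(τ²)`; duality gives the same in `H^n`. For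
each `τ` the potential is cut at `|x| ~ 1/τ`. With `1 < δ ≤ 2` and `δ ≤ nα + β - n`, the outer part
has norm `O(τ^δ)`, and `⟨q⟩²` times the inner part has norm `O(τ^{δ-2})`
(`exists_potential_splitting`). So the second difference of `W` is `O(τ^δ)`, which is integrable
against `dτ/τ²`.

Differences. No cancellation in `W(q+ae) - W(q)` is needed: `ξ(x/r)|x|` is a symbol of order `1`
vanishing for `|x| < r`, hence of order `δ = nα + β - n` with constant `O(r^{1-δ})`, and translating
the integral reduces the first term to the second.

Compactness. `a(q)b(p)` is compact when both functions vanish at infinity. This applies directly to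
`W` if `β > 0`; in form sense `W` is the norm limit of its compactly supported truncations, whatever
the sign of `β`. -/

open MeasureTheory Set Filter Topology
open scoped SchwartzMap ENNReal ContDiff

noncomputable section

namespace OscPot

section

/-! ### Global flows of bounded Lipschitz vector fields -/

section Flow

variable {E : Type*} [NormedAddCommGroup E] [NormedSpace ℝ E]

/-- `φ` is the global flow of the vector field `v`. -/
structure IsFlow (v : E → E) (φ : ℝ → E → E) : Prop where
  zero : ∀ x, φ 0 x = x
  deriv : ∀ t x, HasDerivAt (fun s => φ s x) (v (φ t x)) t

namespace IsFlow

variable {v : E → E} {φ : ℝ → E → E} {K : NNReal}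

theorem eq_of_hasDerivAt (h : IsFlow v φ) (hv : LipschitzWith K v) {γ : ℝ → E}
    (hγ : ∀ t, HasDerivAt γ (v (γ t)) t) (t : ℝ) : γ t = φ t (γ 0) := by
  have := ODE_solution_unique_univ (v := fun _ => v) (s := fun _ => univ) (K := K) (t₀ := 0)
    (f := γ) (g := fun t => φ t (γ 0)) (fun _ => hv.lipschitzOnWith)
    (fun t => ⟨hγ t, trivial⟩) (fun t => ⟨h.deriv t _, trivial⟩) (h.zero _).symm
  exact congrFun this t

theorem add (h : IsFlow v φ) (hv : LipschitzWith K v) (s t : ℝ) (x : E) :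
    φ (s + t) x = φ s (φ t x) := by
  have := h.eq_of_hasDerivAt hv (γ := fun s => φ (s + t) x)
    (fun s => (h.deriv (s + t) x).comp_add_const s t) s
  simpa using this

/-- Lets estimates proved for nonnegative times be used for all times. -/
theorem reverse (h : IsFlow v φ) : IsFlow (fun x => -v x) (fun t => φ (-t)) where
  zero x := by simpa using h.zero x
  deriv t x := by
    have := (h.deriv (-t) x).scomp t (hasDerivAt_neg t)
    rw [neg_one_smul] at this
    exact this

theorem continuous_time (h : IsFlow v φ) (x : E) : Continuous fun t => φ t x :=
  continuous_iff_continuousAt.2 fun t => (h.deriv t x).continuousAt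

theorem norm_sub_le (h : IsFlow v φ) {L : ℝ} (hL : ∀ x, ‖v x‖ ≤ L) (t : ℝ) (x : E) :
    ‖φ t x - x‖ ≤ L * |t| := by
  have := convex_univ.norm_image_sub_le_of_norm_hasDerivWithin_le
    (f := fun s => φ s x) (x := 0) (y := t)
    (fun s _ => (h.deriv s x).hasDerivWithinAt) (fun s _ => hL _) (mem_univ _) (mem_univ _)
  simpa [h.zero] using this

theorem dist_le_of_nonneg (h : IsFlow v φ) (hv : LipschitzWith K v) {t : ℝ} (ht : 0 ≤ t)
    (x y : E) : dist (φ t x) (φ t y) ≤ dist x y * Real.exp (K * t) := by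
  have := dist_le_of_trajectories_ODE (v := fun _ => v) (K := K) (a := 0) (b := t)
    (f := fun s => φ s x) (g := fun s => φ s y) (δ := dist x y) (fun _ => hv)
    (h.continuous_time x).continuousOn (fun s _ => (h.deriv s x).hasDerivWithinAt)
    (h.continuous_time y).continuousOn (fun s _ => (h.deriv s y).hasDerivWithinAt)
    (by simp [h.zero]) t ⟨ht, le_rfl⟩
  simpa using this

theorem dist_le (h : IsFlow v φ) (hv : LipschitzWith K v) (t : ℝ)
    (x y : E) : dist (φ t x) (φ t y) ≤ dist x y * Real.exp (K * |t|) := by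
  rcases le_total 0 t with ht | ht
  · simpa [abs_of_nonneg ht] using h.dist_le_of_nonneg hv ht x y
  · have := h.reverse.dist_le_of_nonneg (K := K) hv.neg (neg_nonneg.2 ht) x y
    simpa [abs_of_nonpos ht] using this

end IsFlow

/-- A bounded field cannot leave the ball of radius `L(n+1)` around its starting point within time
`n+1`, so Picard–Lindelöf applies on the whole of each interval `[-(n+1), n+1]`; uniqueness glues
the solutions. -/
theorem exists_isFlow [CompleteSpace E] {v : E → E} {K : NNReal} (hv : LipschitzWith K v) {L : ℝ}
    (hL : ∀ x, ‖v x‖ ≤ L) : ∃ φ, IsFlow v φ := by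
  have hL0 : 0 ≤ L := (norm_nonneg _).trans (hL 0)
  have key : ∀ (n : ℕ) (x : E), ∃ α : ℝ → E, α 0 = x ∧
      ∀ t ∈ Icc (-(n + 1 : ℝ)) (n + 1), HasDerivWithinAt α (v (α t)) (Icc (-(n + 1 : ℝ)) (n + 1)) t := by
    intro n x
    have h0 : (0 : ℝ) ∈ Icc (-(n + 1 : ℝ)) (n + 1) := by
      constructor <;> [skip; positivity]
      have : (0 : ℝ) ≤ n + 1 := by positivity
      linarith
    have hp : IsPicardLindelof (fun _ => v) (⟨0, h0⟩ : Icc (-(n + 1 : ℝ)) (n + 1)) x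
        (⟨L * (n + 1), by positivity⟩) 0 ⟨L, hL0⟩ K :=
      { lipschitzOnWith := fun _ _ => hv.lipschitzOnWith
        continuousOn := fun _ _ => continuousOn_const
        norm_le := fun _ _ y _ => hL y
        mul_max_le := by
          simp only [sub_zero, zero_sub, neg_neg, max_self, NNReal.coe_zero]
          exact le_rfl }
    exact hp.exists_eq_forall_mem_Icc_hasDerivWithinAt₀
  choose α hα0 hα using key
  have hαd : ∀ (n : ℕ) x, ∀ t ∈ Ioo (-(n + 1 : ℝ)) (n + 1),
      HasDerivAt (α n x) (v (α n x t)) t := fun n x t ht =>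
    (hα n x t (Ioo_subset_Icc_self ht)).hasDerivAt (Icc_mem_nhds ht.1 ht.2)
  have hag : ∀ (n m : ℕ) x, n ≤ m → ∀ t ∈ Ioo (-(n + 1 : ℝ)) (n + 1), α n x t = α m x t := by
    intro n m x hnm t ht
    have hnm' : (n : ℝ) ≤ m := by exact_mod_cast hnm
    refine ODE_solution_unique_of_mem_Ioo (v := fun _ => v) (s := fun _ => univ) (K := K) (t₀ := 0)
      (fun _ _ => hv.lipschitzOnWith) ?_ (fun s hs => ⟨hαd n x s hs, trivial⟩)
      (fun s hs => ⟨hαd m x s ⟨by linarith [hs.1], by linarith [hs.2]⟩, trivial⟩) ?_ ht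
    · constructor <;> [skip; positivity]
      have : (0 : ℝ) < n + 1 := by positivity
      linarith
    · rw [hα0, hα0]
  have hmem : ∀ (t : ℝ) (n : ℕ), |t| ≤ n → t ∈ Ioo (-(n + 1 : ℝ)) (n + 1) := by
    intro t n h
    have := abs_le.1 h
    constructor <;> linarith [this.1, this.2]
  -- The interval with index `⌈|t|⌉₊` has half-length `⌈|t|⌉₊ + 1`, so `t` lies in its interior. For
  -- the derivative one passes to the next index, which also serves all times near `t`.
  refine ⟨fun t x => α ⌈|t|⌉₊ x t, fun x => hα0 _ _, fun t x => ?_⟩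
  have ht := hmem t _ (Nat.le_ceil |t|)
  refine (hαd (⌈|t|⌉₊ + 1) x t (hmem t _ ?_)).congr_of_eventuallyEq ?_ |>.congr_deriv ?_
  · push_cast; linarith [Nat.le_ceil |t|]
  · have : ∀ᶠ s in 𝓝 t, |s| < |t| + 1 :=
      (continuous_abs.tendsto t).eventually (gt_mem_nhds (by linarith))
    filter_upwards [this] with s hs
    refine hag _ _ x ?_ s (hmem s _ (Nat.le_ceil _))
    refine Nat.ceil_le.2 ?_
    push_cast; linarith [Nat.le_ceil |t|]
  · rw [hag _ _ x (Nat.le_succ _) t ht]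

/-- On a short time interval, the linearised equation along a flow line has a bounded solution, and
it is the derivative of the flow, up to a uniform quadratic error. -/
theorem IsFlow.exists_linearization [CompleteSpace E] {v : E → E} {φ : ℝ → E → E} (h : IsFlow v φ)
    (hd : Differentiable ℝ v) {K K' : NNReal} (hv : LipschitzWith K v)
    (hK' : LipschitzWith K' (fderiv ℝ v)) :
    ∃ M : ℝ → E → E →L[ℝ] E, ∃ C : ℝ, ∀ t ∈ Icc (0 : ℝ) (1 / (2 * K + 1)), ∀ x,
      (∀ y, ‖φ t y - φ t x - M t x (y - x)‖ ≤ C * ‖y - x‖ ^ 2) ∧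
      ∀ y, ‖M t x - M t y‖ ≤ C * ‖x - y‖ := by
  have hDK : ∀ x, ‖fderiv ℝ v x‖ ≤ K := fun x => norm_fderiv_le_of_lipschitz ℝ hv
  -- Short enough that the solution of the linearised equation stays within distance `1` of the
  -- identity; this is the ball in which Picard–Lindelöf is run.
  set T : ℝ := 1 / (2 * K + 1) with hT
  have hT0 : 0 < T := by positivity
  have hT1 : 2 * K * T ≤ 1 := by
    rw [hT, mul_one_div, div_le_one (by positivity)]; linarith
  have key : ∀ x, ∃ α : ℝ → E →L[ℝ] E, α 0 = ContinuousLinearMap.id ℝ E ∧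
      (∀ t ∈ Icc 0 T, α t ∈ Metric.closedBall (ContinuousLinearMap.id ℝ E) 1) ∧
      ∀ t ∈ Icc 0 T, HasDerivWithinAt α ((fderiv ℝ v (φ t x)).comp (α t)) (Icc 0 T) t := by
    intro x
    have hp : IsPicardLindelof (fun t (A : E →L[ℝ] E) => (fderiv ℝ v (φ t x)).comp A)
        (⟨0, by simp [hT0.le]⟩ : Icc 0 T) (ContinuousLinearMap.id ℝ E) 1 0 (2 * K) K :=
      { lipschitzOnWith := fun t _ => by
          refine LipschitzOnWith.of_dist_le_mul fun A _ B _ => ?_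
          rw [dist_eq_norm, dist_eq_norm, ← ContinuousLinearMap.comp_sub]
          exact (ContinuousLinearMap.opNorm_comp_le _ _).trans
            (mul_le_mul_of_nonneg_right (hDK _) (norm_nonneg _))
        continuousOn := fun A _ => by
          have : Continuous fun t => fderiv ℝ v (φ t x) :=
            hK'.continuous.comp (h.continuous_time x)
          exact (this.clm_comp continuous_const).continuousOn
        norm_le := fun t _ A hA => by
          have h1 : ‖A‖ ≤ 2 := by
            have := norm_le_of_mem_closedBall hA
            have h2 := ContinuousLinearMap.norm_id_le (𝕜 := ℝ) (E := E)
            simp only [NNReal.coe_one] at this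
            linarith
          have := (ContinuousLinearMap.opNorm_comp_le (fderiv ℝ v (φ t x)) A).trans
            (mul_le_mul (hDK _) h1 (norm_nonneg _) K.2)
          push_cast
          linarith
        mul_max_le := by
          simp only [sub_zero, sub_self, NNReal.coe_mul, NNReal.coe_one, NNReal.coe_zero]
          rw [max_eq_left hT0.le]; simpa using hT1 }
    obtain ⟨β, hβ0, hβ⟩ := hp.exists_eq_forall_mem_Icc_hasDerivWithinAt₀
    refine ⟨β, hβ0, ?_, hβ⟩
    intro t ht
    -- Gronwall for `β - id`: its derivative is bounded by `K‖β‖ ≤ K‖β - id‖ + K`.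
    have hb : ∀ s ∈ Icc 0 T, ‖β s - ContinuousLinearMap.id ℝ E‖ ≤ gronwallBound 0 K K (s - 0) := by
      refine norm_le_gronwallBound_of_norm_deriv_right_le
        (f' := fun t => (fderiv ℝ v (φ t x)).comp (β t)) ?_ ?_ ?_ ?_
      · exact fun s hs => ((hβ s hs).continuousWithinAt.sub continuousWithinAt_const)
      · intro s hs
        exact ((hβ s (Ico_subset_Icc_self hs)).sub_const _).mono_of_mem_nhdsWithin
          (Icc_mem_nhdsGE_of_mem hs)
      · simp [hβ0]
      · intro s hs
        refine (ContinuousLinearMap.opNorm_comp_le _ _).trans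
          ((mul_le_mul_of_nonneg_right (hDK _) (norm_nonneg _)).trans ?_)
        have : ‖β s‖ ≤ ‖β s - ContinuousLinearMap.id ℝ E‖ + 1 := by
          calc ‖β s‖ = ‖(β s - ContinuousLinearMap.id ℝ E) + ContinuousLinearMap.id ℝ E‖ := by simp
            _ ≤ _ := (norm_add_le _ _).trans (by gcongr; exact ContinuousLinearMap.norm_id_le)
        nlinarith [K.2, mul_le_mul_of_nonneg_left this K.2]
    rw [mem_closedBall_iff_norm]
    refine (hb t ht).trans ?_
    -- `gronwallBound` has a separate formula when the Lipschitz constant is zero.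
    rcases eq_or_ne (K : ℝ) 0 with hK0 | hK0
    · simp [hK0, gronwallBound_K0]
    · rw [gronwallBound_of_K_ne_0 hK0]
      simp only [zero_mul, zero_add, sub_zero, div_self hK0, one_mul]
      have h1 : (K : ℝ) * t ≤ 1 / 2 := by nlinarith [ht.1, ht.2, K.2]
      have h0 : 0 ≤ (K : ℝ) * t := mul_nonneg K.2 ht.1
      have h2 : Real.exp (K * t) ≤ Real.exp (1 / 2) := Real.exp_le_exp.2 h1
      have h3 : Real.exp (1 / 2) ≤ 2 := by
        have h4 : Real.exp (1 / 2) * Real.exp (1 / 2) = Real.exp 1 := by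
          rw [← Real.exp_add]; norm_num
        nlinarith [Real.exp_one_lt_d9, Real.exp_pos (1 / 2)]
      linarith
  choose M hM0 hMb hM using key
  have hM2 : ∀ x, ∀ t ∈ Icc 0 T, ‖M x t‖ ≤ 2 := by
    intro x t ht
    have h1 := norm_le_of_mem_closedBall (hMb x t ht)
    have h2 := ContinuousLinearMap.norm_id_le (𝕜 := ℝ) (E := E)
    linarith
  have hMc : ∀ x, ContinuousOn (M x) (Icc 0 T) := fun x t ht => (hM x t ht).continuousWithinAt
  have hMd : ∀ x, ∀ t ∈ Ico 0 T, HasDerivWithinAt (M x) ((fderiv ℝ v (φ t x)).comp (M x t)) (Ici t) t :=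
    fun x t ht => (hM x t (Ico_subset_Icc_self ht)).mono_of_mem_nhdsWithin
      (Icc_mem_nhdsGE_of_mem ht)
  -- With zero initial distance the Gronwall bound is linear in the error `ε`; this turns a
  -- quadratic defect into a quadratic distance.
  have hg : ∀ t ∈ Icc 0 T, ∀ ε : ℝ, 0 ≤ ε → gronwallBound 0 K ε (t - 0) ≤ (gronwallBound 0 K 1 T) * ε := by
    intro t ht ε hε
    have h1 : gronwallBound 0 K ε (t - 0) ≤ gronwallBound 0 K ε T :=
      gronwallBound_mono le_rfl hε K.2 (by simpa using ht.2)
    refine h1.trans (le_of_eq ?_)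
    unfold gronwallBound
    split_ifs <;> ring
  have hquad : ∀ a b, ‖v b - v a - fderiv ℝ v a (b - a)‖ ≤ K' * ‖b - a‖ ^ 2 := by
    intro a b
    have := (convex_segment a b).norm_image_sub_le_of_norm_fderiv_le' (𝕜 := ℝ) (f := v)
      (φ := fderiv ℝ v a) (C := K' * ‖b - a‖) (fun z _ => hd z) (fun z hz => ?_)
      (left_mem_segment ℝ a b) (right_mem_segment ℝ a b)
    · exact this.trans (le_of_eq (by ring))
    · rw [← dist_eq_norm]
      refine (hK'.dist_le_mul z a).trans ?_
      gcongr
      rw [dist_eq_norm]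
      obtain ⟨p, q, hp, hq, hpq, rfl⟩ := hz
      have : p • a + q • b - a = q • (b - a) := by
        obtain rfl : p = 1 - q := by linarith
        module
      rw [this, norm_smul, Real.norm_of_nonneg hq]
      exact mul_le_of_le_one_left (norm_nonneg _) (by linarith)
  refine ⟨fun t x => M x t, max (gronwallBound 0 K 1 T * (4 * K'))
    (gronwallBound 0 K 1 T * (K' * Real.exp (K * T) * 2)), fun t ht x => ⟨fun y => ?_, fun y => ?_⟩⟩
  -- `φ s x + M x s (y - x)` solves the equation up to the second-order Taylor remainder of `v`, and
  -- it starts at `y`, so it stays close to the true orbit of `y`.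
  · have := dist_le_of_approx_trajectories_ODE (v := fun _ => v) (K := K) (a := 0) (b := T)
      (f := fun s => φ s x + M x s (y - x)) (g := fun s => φ s y)
      (f' := fun s => v (φ s x) + (fderiv ℝ v (φ s x)).comp (M x s) (y - x))
      (g' := fun s => v (φ s y)) (δ := 0) (εf := K' * 4 * ‖y - x‖ ^ 2) (εg := 0) (fun _ => hv)
      ((h.continuous_time x).continuousOn.add ((hMc x).clm_apply continuousOn_const))
      (fun s hs => (h.deriv s x).hasDerivWithinAt.add
        (((ContinuousLinearMap.apply ℝ E (y - x)).hasFDerivAt.comp_hasDerivWithinAt s (hMd x s hs))))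
      (fun s hs => ?_)
      (h.continuous_time y).continuousOn (fun s _ => (h.deriv s y).hasDerivWithinAt)
      (by simp) (by simp [h.zero, hM0]) t ht
    · rw [dist_comm, dist_eq_norm, add_zero] at this
      rw [sub_sub]
      refine this.trans ((hg t ht _ (by positivity)).trans ?_)
      rw [← mul_assoc, mul_comm (K' : ℝ) 4]
      gcongr
      exact le_max_left _ _
    · rw [dist_comm, dist_eq_norm]
      have h1 := hquad (φ s x) (φ s x + M x s (y - x))
      simp only [add_sub_cancel_left] at h1
      rw [← sub_sub]
      refine h1.trans ?_
      have h2 : ‖M x s (y - x)‖ ≤ 2 * ‖y - x‖ :=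
        (ContinuousLinearMap.le_opNorm _ _).trans
          (mul_le_mul_of_nonneg_right (hM2 x s (Ico_subset_Icc_self hs)) (norm_nonneg _))
      have h3 : ‖M x s (y - x)‖ ^ 2 ≤ 4 * ‖y - x‖ ^ 2 := by
        nlinarith [norm_nonneg (M x s (y - x)), norm_nonneg (y - x)]
      nlinarith [K'.2, mul_le_mul_of_nonneg_left h3 K'.2]
  -- `M x` solves the linearised equation along the orbit of `y` up to the difference of the
  -- coefficients, which is Lipschitz in the base point.
  · have := dist_le_of_approx_trajectories_ODE (K := K)
      (v := fun t (A : E →L[ℝ] E) => (fderiv ℝ v (φ t y)).comp A) (a := 0) (b := T)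
      (f := M x) (g := M y) (f' := fun s => (fderiv ℝ v (φ s x)).comp (M x s))
      (g' := fun s => (fderiv ℝ v (φ s y)).comp (M y s)) (δ := 0)
      (εf := K' * Real.exp (K * T) * 2 * ‖x - y‖) (εg := 0)
      (fun t => LipschitzWith.of_dist_le_mul fun A B => ?_) (hMc x) (hMd x) (fun s hs => ?_)
      (hMc y) (hMd y) (by simp) (by simp [hM0]) t ht
    · rw [dist_eq_norm, add_zero] at this
      refine this.trans ((hg t ht _ (by positivity)).trans ?_)
      rw [← mul_assoc]
      gcongr
      exact le_max_right _ _
    · rw [dist_eq_norm, dist_eq_norm, ← ContinuousLinearMap.comp_sub]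
      exact (ContinuousLinearMap.opNorm_comp_le _ _).trans
        (mul_le_mul_of_nonneg_right (hDK _) (norm_nonneg _))
    · rw [dist_eq_norm, ← ContinuousLinearMap.sub_comp]
      refine (ContinuousLinearMap.opNorm_comp_le _ _).trans ?_
      have h1 : ‖fderiv ℝ v (φ s x) - fderiv ℝ v (φ s y)‖ ≤ K' * (‖x - y‖ * Real.exp (K * T)) := by
        rw [← dist_eq_norm, ← dist_eq_norm]
        refine (hK'.dist_le_mul _ _).trans ?_
        gcongr
        refine (h.dist_le_of_nonneg hv hs.1 x y).trans ?_
        gcongr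
        exact hs.2.le
      refine (mul_le_mul h1 (hM2 x s (Ico_subset_Icc_self hs)) (norm_nonneg _) (by positivity)).trans
        (le_of_eq (by ring))

/-- The quadratic error identifies the derivative of the flow with `M`, and the Lipschitz dependence
of `M` on the point makes it continuous. -/
theorem IsFlow.contDiff_of_small [CompleteSpace E] {v : E → E} {φ : ℝ → E → E} (h : IsFlow v φ)
    (hd : Differentiable ℝ v) {K K' : NNReal} (hv : LipschitzWith K v)
    (hK' : LipschitzWith K' (fderiv ℝ v)) {t : ℝ} (ht : t ∈ Icc (0 : ℝ) (1 / (2 * K + 1))) :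
    ContDiff ℝ 1 (φ t) := by
  obtain ⟨M, C, hM⟩ := h.exists_linearization hd hv hK'
  have hf : ∀ x, HasFDerivAt (φ t) (M t x) x := by
    intro x
    rw [hasFDerivAt_iff_isLittleO]
    refine (Asymptotics.IsBigO.of_bound C (Eventually.of_forall fun y => ?_)).trans_isLittleO
      (g := fun y => ‖y - x‖ ^ 2) ?_
    · simpa using (hM t ht x).1 y
    · have := (Asymptotics.isLittleO_pow_id (𝕜 := ℝ) (n := 2) (by norm_num))
      have h2 : Tendsto (fun y : E => ‖y - x‖) (𝓝 x) (𝓝 0) := by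
        have : Continuous fun y : E => ‖y - x‖ := by fun_prop
        simpa using this.tendsto x
      exact (this.comp_tendsto h2).trans_isBigO (Asymptotics.isBigO_refl _ _).norm_left
  refine contDiff_one_iff_hasFDerivAt.2 ⟨M t, ?_, hf⟩
  have hC : ∀ x y, dist (M t x) (M t y) ≤ (Real.toNNReal C) * dist x y := fun x y => by
    rw [dist_eq_norm, dist_eq_norm]
    refine ((hM t ht x).2 y).trans ?_
    gcongr
    exact Real.le_coe_toNNReal C
  exact (LipschitzWith.of_dist_le_mul hC).continuous

/-- By the group law the flow at time `t` is the `n`-fold iterate of the flow at time `t / n`, which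
falls in the short interval already treated. -/
theorem IsFlow.contDiff [CompleteSpace E] {v : E → E} {φ : ℝ → E → E} (h : IsFlow v φ)
    (hd : Differentiable ℝ v) {K K' : NNReal} (hv : LipschitzWith K v)
    (hK' : LipschitzWith K' (fderiv ℝ v)) (t : ℝ) : ContDiff ℝ 1 (φ t) := by
  set T : ℝ := 1 / (2 * K + 1) with hT
  have hT0 : 0 < T := by positivity
  have hsmall : ∀ s, |s| ≤ T → ContDiff ℝ 1 (φ s) := by
    intro s hs
    rcases le_total 0 s with h0 | h0
    · exact h.contDiff_of_small hd hv hK' ⟨h0, by rwa [abs_of_nonneg h0] at hs⟩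
    · have := h.reverse.contDiff_of_small (K := K) (K' := K') hd.neg hv.neg
        (by
          rw [show fderiv ℝ (fun x => -v x) = fun x => -fderiv ℝ v x from
            funext fun x => fderiv_fun_neg]
          exact hK'.neg) (t := -s)
        ⟨by linarith, by rwa [abs_of_nonpos h0] at hs⟩
      simpa using this
  have hmul : ∀ (n : ℕ) s, |s| ≤ T → ContDiff ℝ 1 (φ (n * s)) := by
    intro n s hs
    induction n with
    | zero => 
      have : φ ((0 : ℕ) * s) = id := by ext x; simp [h.zero]
      rw [this]
      exact contDiff_id
    | succ n ih =>
      have : φ ((n + 1 : ℕ) * s) = fun x => φ (n * s) (φ s x) := by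
        ext x
        rw [← h.add hv]; congr 1; push_cast; ring
      rw [this]
      exact ih.comp (hsmall s hs)
  obtain ⟨n, hn⟩ := exists_nat_gt (|t| / T)
  have hn0 : (0 : ℝ) < n := lt_of_le_of_lt (by positivity) hn
  have := hmul n (t / n) (by
    rw [abs_div, abs_of_pos hn0, div_le_iff₀ hn0]
    rw [div_lt_iff₀ hT0] at hn
    linarith)
  rwa [mul_div_cancel₀ _ hn0.ne'] at this

end Flow

end

section

/-! ### Smooth functions bounded with all their derivatives -/

section BddSmooth

variable {E F G : Type*} [NormedAddCommGroup E] [NormedSpace ℝ E] [NormedAddCommGroup F]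
  [NormedSpace ℝ F] [NormedAddCommGroup G] [NormedSpace ℝ G]

/-- Smooth functions which are bounded together with all their derivatives. -/
structure BddSmooth (f : E → F) : Prop where
  smooth : ContDiff ℝ ∞ f
  bounded : ∀ n : ℕ, ∃ C : ℝ, ∀ x, ‖iteratedFDeriv ℝ n f x‖ ≤ C

namespace BddSmooth

theorem hasTemperateGrowth {f : E → F} (hf : BddSmooth f) : f.HasTemperateGrowth :=
  ⟨hf.smooth, fun n => by
    obtain ⟨C, hC⟩ := hf.bounded n
    exact ⟨0, C, by simpa using hC⟩⟩

theorem exists_norm_le {f : E → F} (hf : BddSmooth f) : ∃ C, ∀ x, ‖f x‖ ≤ C := by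
  obtain ⟨C, hC⟩ := hf.bounded 0
  exact ⟨C, by simpa using hC⟩

theorem const (c : F) : BddSmooth (fun _ : E => c) :=
  ⟨contDiff_const, fun n => by
    rcases n with _ | n
    · exact ⟨‖c‖, by simp⟩
    · exact ⟨0, fun x => by rw [iteratedFDeriv_succ_const]; simp⟩⟩

theorem add {f g : E → F} (hf : BddSmooth f) (hg : BddSmooth g) :
    BddSmooth (fun x => f x + g x) :=
  ⟨hf.smooth.add hg.smooth, fun n => by
    obtain ⟨C, hC⟩ := hf.bounded n
    obtain ⟨D, hD⟩ := hg.bounded n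
    refine ⟨C + D, fun x => ?_⟩
    rw [fun_iteratedFDeriv_add_apply (hf.smooth.of_le (mod_cast le_top)).contDiffAt
      (hg.smooth.of_le (mod_cast le_top)).contDiffAt]
    exact (norm_add_le _ _).trans (add_le_add (hC x) (hD x))⟩

theorem clm_comp {f : E → F} (hf : BddSmooth f) (L : F →L[ℝ] G) : BddSmooth (fun x => L (f x)) :=
  ⟨L.contDiff.comp hf.smooth, fun n => by
    obtain ⟨C, hC⟩ := hf.bounded n
    refine ⟨‖L‖ * C, fun x => ?_⟩
    exact (L.norm_iteratedFDeriv_comp_left hf.smooth.contDiffAt (mod_cast le_top)).trans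
      (mul_le_mul_of_nonneg_left (hC x) (norm_nonneg _))⟩

theorem comp_clm {f : F → G} (hf : BddSmooth f) (L : E →L[ℝ] F) : BddSmooth (fun x => f (L x)) :=
  ⟨hf.smooth.comp L.contDiff, fun n => by
    obtain ⟨C, hC⟩ := hf.bounded n
    refine ⟨C * ‖L‖ ^ n, fun x => ?_⟩
    have := L.iteratedFDeriv_comp_right hf.smooth x (i := n) (mod_cast le_top)
    change ‖iteratedFDeriv ℝ n (f ∘ L) x‖ ≤ _
    rw [this]
    refine (ContinuousMultilinearMap.norm_compContinuousLinearMap_le _ _).trans ?_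
    simp only [Finset.prod_const, Finset.card_univ, Fintype.card_fin]
    exact mul_le_mul_of_nonneg_right (hC _) (by positivity)⟩

theorem prodMk {f : E → F} {g : E → G} (hf : BddSmooth f) (hg : BddSmooth g) :
    BddSmooth (fun x => (f x, g x)) := by
  have := (hf.clm_comp (ContinuousLinearMap.inl ℝ F G)).add
    (hg.clm_comp (ContinuousLinearMap.inr ℝ F G))
  simpa using this

theorem fderiv {f : E → F} (hf : BddSmooth f) : BddSmooth (fderiv ℝ f) :=
  ⟨hf.smooth.fderiv_right (by simp), fun n => by
    obtain ⟨C, hC⟩ := hf.bounded (n + 1)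
    exact ⟨C, fun x => by rw [norm_iteratedFDeriv_fderiv]; exact hC x⟩⟩

theorem sum {ι : Type*} {s : Finset ι} {f : ι → E → F} (hf : ∀ i ∈ s, BddSmooth (f i)) :
    BddSmooth (fun x => ∑ i ∈ s, f i x) := by
  classical
  induction s using Finset.induction_on with
  | empty => simpa using const (0 : F)
  | insert a s ha ih =>
    simp only [Finset.sum_insert ha]
    exact (hf a (by simp)).add (ih fun i hi => hf i (by simp [hi]))

theorem exists_lipschitzWith {f : E → F} (hf : BddSmooth f) : ∃ K : NNReal, LipschitzWith K f := by
  obtain ⟨C, hC⟩ := hf.bounded 1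
  refine ⟨Real.toNNReal C, lipschitzWith_of_nnnorm_fderiv_le
    (hf.smooth.differentiable (by simp)) fun x => ?_⟩
  rw [← NNReal.coe_le_coe, coe_nnnorm, ← norm_iteratedFDeriv_one]
  exact (hC x).trans (Real.le_coe_toNNReal C)

theorem ofReal {f : E → ℝ} (hf : BddSmooth f) : BddSmooth (fun x => (f x : ℂ)) :=
  hf.clm_comp Complex.ofRealCLM

end BddSmooth

end BddSmooth

/-! ### Flows with a logarithmic weight -/

section WeightedFlow

variable {E : Type*} [NormedAddCommGroup E] [NormedSpace ℝ E]

/-- The flow `φ` of `v`, together with the integrals `z t x = ∫_0^t d (φ s x) ds`. -/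
structure IsWeightedFlow (v : E → E) (d : E → ℝ) (φ : ℝ → E → E) (z : ℝ → E → ℝ) : Prop where
  flow_zero : ∀ x, φ 0 x = x
  weight_zero : ∀ x, z 0 x = 0
  flow_deriv : ∀ t x, HasDerivAt (fun s => φ s x) (v (φ t x)) t
  weight_deriv : ∀ t x, HasDerivAt (fun s => z s x) (d (φ t x)) t
  flow_add : ∀ s t x, φ (s + t) x = φ s (φ t x)
  weight_add : ∀ s t x, z (s + t) x = z t x + z s (φ t x)
  flow_contDiff : ∀ t, ContDiff ℝ 1 (φ t)
  weight_contDiff : ∀ t, ContDiff ℝ 1 (z t)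
  norm_flow_sub_le : ∃ L, 0 ≤ L ∧ ∀ t x, ‖φ t x - x‖ ≤ L * |t|
  norm_weight_le : ∃ L, 0 ≤ L ∧ ∀ t x, ‖z t x‖ ≤ L * |t|
  flow_lipschitz : ∀ t, ∃ K, LipschitzWith K (φ t)
  weight_lipschitz : ∀ t, ∃ K, LipschitzWith K (z t)

/-- The field `(v, d)` on `E × ℝ`, independent of the last coordinate, carries the integral of `d`
as the last coordinate of its flow. Existence, regularity and bounds for the weight are thus those
of a flow. -/
theorem exists_isWeightedFlow [CompleteSpace E] {v : E → E} {d : E → ℝ} (hv : BddSmooth v)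
    (hd : BddSmooth d) : ∃ φ z, IsWeightedFlow v d φ z := by
  have hw : BddSmooth (fun y : E × ℝ => (v y.1, d y.1)) :=
    (hv.prodMk hd).comp_clm (ContinuousLinearMap.fst ℝ E ℝ)
  obtain ⟨K, hK⟩ := hw.exists_lipschitzWith
  obtain ⟨K', hK'⟩ := hw.fderiv.exists_lipschitzWith
  obtain ⟨L, hL⟩ := hw.exists_norm_le
  have hL0 : 0 ≤ L := (norm_nonneg _).trans (hL 0)
  obtain ⟨Φ, hΦ⟩ := exists_isFlow hK hL
  have hcd := hΦ.contDiff (hw.smooth.differentiable (by simp)) hK hK'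
  -- The flow commutes with translations of the last coordinate; this is where the additive cocycle
  -- law of the weight comes from.
  have hshift : ∀ t x a, Φ t (x, a) = ((Φ t (x, 0)).1, (Φ t (x, 0)).2 + a) := by
    intro t x a
    have := hΦ.eq_of_hasDerivAt hK (γ := fun t => Φ t (x, 0) + (0, a)) (fun s => by
      simpa using (hΦ.deriv s (x, 0)).add_const (0, a)) t
    simp only [hΦ.zero] at this
    rw [show ((x, 0) : E × ℝ) + (0, a) = (x, a) by simp] at this
    rw [← this]; ext <;> simp
  have hi : ContDiff ℝ 1 (fun x : E => (x, (0 : ℝ))) := contDiff_id.prodMk contDiff_const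
  have hlip : ∀ t, ∃ C : NNReal, LipschitzWith C fun x : E => Φ t (x, 0) := fun t =>
    ⟨⟨Real.exp (K * |t|), (Real.exp_pos _).le⟩, LipschitzWith.of_dist_le_mul fun x y => by
      refine (hΦ.dist_le hK t _ _).trans (le_of_eq ?_)
      rw [mul_comm, Prod.dist_eq, dist_self, max_eq_left dist_nonneg]; rfl⟩
  have hbd : ∀ t x, ‖Φ t (x, 0) - (x, 0)‖ ≤ L * |t| := fun t x => hΦ.norm_sub_le hL t _
  refine ⟨fun t x => (Φ t (x, 0)).1, fun t x => (Φ t (x, 0)).2, ?_⟩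
  have hadd : ∀ s t x, Φ (s + t) (x, 0) =
      ((Φ s ((Φ t (x, 0)).1, 0)).1, (Φ t (x, 0)).2 + (Φ s ((Φ t (x, 0)).1, 0)).2) := by
    intro s t x
    rw [hΦ.add hK]
    conv_lhs => rw [← Prod.mk.eta (p := Φ t (x, 0)), hshift]
    rw [add_comm]
  exact
    { flow_zero := fun x => by simp [hΦ.zero]
      weight_zero := fun x => by simp [hΦ.zero]
      flow_deriv := fun t x => (hΦ.deriv t (x, 0)).fst
      weight_deriv := fun t x => (hΦ.deriv t (x, 0)).snd
      flow_add := fun s t x => by rw [hadd]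
      weight_add := fun s t x => by rw [hadd]
      flow_contDiff := fun t => contDiff_fst.comp ((hcd t).comp hi)
      weight_contDiff := fun t => contDiff_snd.comp ((hcd t).comp hi)
      norm_flow_sub_le := ⟨L, hL0, fun t x => by
        refine le_trans ?_ (hbd t x)
        exact norm_fst_le (Φ t (x, 0) - (x, 0))⟩
      norm_weight_le := ⟨L, hL0, fun t x => by
        refine le_trans ?_ (hbd t x)
        have := norm_snd_le (Φ t (x, 0) - (x, 0))
        rwa [Prod.snd_sub, sub_zero] at this⟩
      flow_lipschitz := fun t => by
        obtain ⟨C, hC⟩ := hlip t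
        exact ⟨_, LipschitzWith.prod_fst.comp hC⟩
      weight_lipschitz := fun t => by
        obtain ⟨C, hC⟩ := hlip t
        exact ⟨_, LipschitzWith.prod_snd.comp hC⟩ }

namespace IsWeightedFlow

variable {v : E → E} {d : E → ℝ} {φ : ℝ → E → E} {z : ℝ → E → ℝ}

end IsWeightedFlow

end WeightedFlow

end

section

/-! ### Continuously differentiable functions with decay -/

section Decay

variable {ν : ℕ}

/-- The weight `(1 + |x|)^{-(ν+1)}`. -/
def decayWeight (ν : ℕ) (x : X ν) : ℝ := ((1 + ‖x‖) ^ (ν + 1))⁻¹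

theorem decayWeight_pos (x : X ν) : 0 < decayWeight ν x := by unfold decayWeight; positivity

theorem decayWeight_le_one (x : X ν) : decayWeight ν x ≤ 1 := by
  unfold decayWeight
  exact inv_le_one_of_one_le₀ (one_le_pow₀ (by linarith [norm_nonneg x]))

theorem continuous_decayWeight : Continuous (decayWeight ν) := by
  unfold decayWeight
  exact Continuous.inv₀ (by fun_prop) fun x => by positivity

theorem integrable_decayWeight : Integrable (decayWeight ν) := by
  have := integrable_one_add_norm (E := X ν) (μ := volume) (r := ν + 1) (by simp)
  refine this.congr (Eventually.of_forall fun x => ?_)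
  simp only [decayWeight]
  rw [Real.rpow_neg (by positivity)]
  norm_cast

theorem memLp_decayWeight : MemLp (decayWeight ν) 2 volume := by
  rw [memLp_two_iff_integrable_sq continuous_decayWeight.aestronglyMeasurable]
  refine integrable_decayWeight.mono' (by have := continuous_decayWeight (ν := ν); fun_prop) ?_
  refine Eventually.of_forall fun x => ?_
  rw [Real.norm_of_nonneg (sq_nonneg _)]
  nlinarith [decayWeight_pos x, decayWeight_le_one x]

/-- A bounded displacement changes the weight by a bounded factor. Hence the decaying functions are
preserved by composition with the flow. -/
theorem decayWeight_le {x y : X ν} {c : ℝ} (h : ‖y - x‖ ≤ c) :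
    decayWeight ν y ≤ (1 + c) ^ (ν + 1) * decayWeight ν x := by
  unfold decayWeight
  have hc : 0 ≤ c := (norm_nonneg _).trans h
  rw [← div_eq_mul_inv, inv_eq_one_div, div_le_div_iff₀ (by positivity) (by positivity), one_mul,
    ← mul_pow]
  refine pow_le_pow_left₀ (by positivity) ?_ _
  have : ‖x‖ ≤ ‖y‖ + c := by
    have := norm_sub_norm_le x y
    rw [norm_sub_rev] at this
    linarith
  nlinarith [norm_nonneg y]

/-- `C^1` functions which are, together with their derivative, `O((1 + |x|)^{-(ν+1)})`. -/
structure Decay (f : X ν → ℂ) : Prop where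
  contDiff : ContDiff ℝ 1 f
  bound : ∃ C, 0 ≤ C ∧ ∀ x, ‖f x‖ ≤ C * decayWeight ν x ∧ ‖fderiv ℝ f x‖ ≤ C * decayWeight ν x

theorem memLp_two_of_le_decayWeight {f : X ν → ℂ} (hf : Continuous f) {C : ℝ}
    (h : ∀ x, ‖f x‖ ≤ C * decayWeight ν x) : MemLp f 2 volume :=
  (memLp_decayWeight.const_mul C).mono' hf.aestronglyMeasurable (Eventually.of_forall h)

theorem integrable_mul_of_le_decayWeight {f g : X ν → ℂ} (hf : Continuous f) {C : ℝ}
    (h : ∀ x, ‖f x‖ ≤ C * decayWeight ν x) (hg : Continuous g) {D : ℝ} (h' : ∀ x, ‖g x‖ ≤ D) :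
    Integrable (fun x => f x * g x) :=
  (integrable_decayWeight.const_mul (C * D)).mono' (hf.mul hg).aestronglyMeasurable
    (Eventually.of_forall fun x => by
      rw [norm_mul]
      calc ‖f x‖ * ‖g x‖ ≤ (C * decayWeight ν x) * D :=
            mul_le_mul (h x) (h' x) (norm_nonneg _) ((norm_nonneg _).trans (h x))
        _ = _ := by ring)

namespace Decay

theorem differentiable {f : X ν → ℂ} (hf : Decay f) : Differentiable ℝ f :=
  hf.contDiff.differentiable (by simp)

theorem continuous_fderiv {f : X ν → ℂ} (hf : Decay f) : Continuous (fderiv ℝ f) :=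
  hf.contDiff.continuous_fderiv (by simp)

theorem memLp {f : X ν → ℂ} (hf : Decay f) : MemLp f 2 volume := by
  obtain ⟨C, -, hC⟩ := hf.bound
  exact memLp_two_of_le_decayWeight hf.contDiff.continuous fun x => (hC x).1

theorem zero : Decay (0 : X ν → ℂ) :=
  ⟨contDiff_const, 0, le_rfl, fun x => by simp⟩

theorem add {f g : X ν → ℂ} (hf : Decay f) (hg : Decay g) : Decay (f + g) := by
  obtain ⟨C, hC0, hC⟩ := hf.bound
  obtain ⟨D, hD0, hD⟩ := hg.bound
  refine ⟨hf.contDiff.add hg.contDiff, C + D, by positivity, fun x => ⟨?_, ?_⟩⟩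
  · rw [add_mul]
    exact (norm_add_le _ _).trans (add_le_add (hC x).1 (hD x).1)
  · rw [add_mul, fderiv_add (hf.differentiable x) (hg.differentiable x)]
    exact (norm_add_le _ _).trans (add_le_add (hC x).2 (hD x).2)

theorem smul {f : X ν → ℂ} (hf : Decay f) (c : ℂ) : Decay (c • f) := by
  obtain ⟨C, hC0, hC⟩ := hf.bound
  refine ⟨contDiff_const.smul hf.contDiff, ‖c‖ * C, by positivity, fun x => ⟨?_, ?_⟩⟩
  · rw [Pi.smul_apply, norm_smul, mul_assoc]
    exact mul_le_mul_of_nonneg_left (hC x).1 (norm_nonneg _)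
  · rw [fderiv_const_smul (hf.differentiable x), norm_smul, mul_assoc]
    exact mul_le_mul_of_nonneg_left (hC x).2 (norm_nonneg _)

theorem hasFDerivAt_conj {f : X ν → ℂ} (hf : Decay f) (x : X ν) :
    HasFDerivAt (fun x => starRingEnd ℂ (f x))
      ((Complex.conjCLE : ℂ →L[ℝ] ℂ).comp (fderiv ℝ f x)) x :=
  (Complex.conjCLE : ℂ →L[ℝ] ℂ).hasFDerivAt.comp x (hf.differentiable x).hasFDerivAt

theorem conj {f : X ν → ℂ} (hf : Decay f) : Decay (fun x => starRingEnd ℂ (f x)) := by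
  obtain ⟨C, hC0, hC⟩ := hf.bound
  refine ⟨Complex.conjCLE.contDiff.comp hf.contDiff, C, hC0, fun x => ⟨?_, ?_⟩⟩
  · simpa using (hC x).1
  · rw [(hf.hasFDerivAt_conj x).fderiv]
    refine (ContinuousLinearMap.opNorm_le_bound _ (norm_nonneg _) fun y => ?_).trans (hC x).2
    simpa using (fderiv ℝ f x).le_opNorm y

theorem of_schwartz (f : 𝓢(X ν, ℂ)) : Decay (f : X ν → ℂ) := by
  have key : ∀ n, ∃ C, 0 ≤ C ∧ ∀ x, ‖iteratedFDeriv ℝ n f x‖ ≤ C * decayWeight ν x := by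
    intro n
    refine ⟨2 ^ (ν + 1) * ((Finset.Iic (ν + 1, n)).sup
      fun m => SchwartzMap.seminorm ℂ m.1 m.2) f, by positivity, fun x => ?_⟩
    have := SchwartzMap.one_add_le_sup_seminorm_apply (𝕜 := ℂ) (m := (ν + 1, n)) (k := ν + 1)
      (n := n) le_rfl le_rfl f x
    rw [decayWeight, ← div_eq_mul_inv, le_div_iff₀ (by positivity), mul_comm]
    exact this
  obtain ⟨C, hC0, hC⟩ := key 0
  obtain ⟨D, hD0, hD⟩ := key 1
  refine ⟨f.smooth 1, max C D, le_max_of_le_left hC0, fun x => ⟨?_, ?_⟩⟩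
  · have := hC x
    rw [norm_iteratedFDeriv_zero] at this
    exact this.trans (mul_le_mul_of_nonneg_right (le_max_left _ _) (decayWeight_pos x).le)
  · have := hD x
    rw [norm_iteratedFDeriv_one] at this
    exact this.trans (mul_le_mul_of_nonneg_right (le_max_right _ _) (decayWeight_pos x).le)

end Decay

/-- The `C^1` functions with decay, as a subspace of the space of functions. -/
def decaySubmodule (ν : ℕ) : Submodule ℂ (X ν → ℂ) where
  carrier := {f | Decay f}
  add_mem' hf hg := Decay.add hf hg
  zero_mem' := Decay.zero
  smul_mem' c _ hf := Decay.smul hf c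

/-- The class in `L²` of a `C^1` function with decay. -/
def decayToL2 (ν : ℕ) : decaySubmodule ν →ₗ[ℂ] L2 ν where
  toFun f := (Decay.memLp f.2).toLp f.1
  map_add' _ _ := MemLp.toLp_add _ _
  map_smul' c _ := MemLp.toLp_const_smul c _

theorem denseRange_decayToL2 : DenseRange (decayToL2 ν) := by
  refine (SchwartzMap.denseRange_toLpCLM (F := ℂ) (E := X ν) (p := 2) (μ := volume)
    ENNReal.ofNat_ne_top).mono ?_
  rintro _ ⟨f, rfl⟩
  exact ⟨⟨f, Decay.of_schwartz f⟩, rfl⟩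

theorem norm_toLp_sq {f : X ν → ℂ} (hf : MemLp f 2 volume) :
    ‖hf.toLp f‖ ^ 2 = ∫ x, ‖f x‖ ^ 2 := by
  have h : ((‖hf.toLp f‖ ^ 2 : ℝ) : ℂ) = ((∫ x, ‖f x‖ ^ 2 : ℝ) : ℂ) := by
    rw [← integral_complex_ofReal, Complex.ofReal_pow]
    refine (inner_self_eq_norm_sq_to_K (𝕜 := ℂ) (hf.toLp f)).symm.trans ?_
    rw [L2.inner_def]
    refine integral_congr_ae ?_
    filter_upwards [hf.coeFn_toLp] with x hx
    rw [hx, inner_self_eq_norm_sq_to_K]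
    simp
  exact_mod_cast h

/-- Differentiation in `L²` under a uniform bound by an `L²` function. -/
theorem hasDerivAt_toLp_of_dominated {F F' : ℝ → X ν → ℂ} (hF : ∀ t, MemLp (F t) 2 volume)
    (hF' : ∀ t, MemLp (F' t) 2 volume) (hd : ∀ t x, HasDerivAt (fun s => F s x) (F' t x) t)
    {g : X ν → ℝ} (hg : MemLp g 2 volume) (hb : ∀ t x, |t| ≤ 1 → ‖F' t x‖ ≤ g x) :
    HasDerivAt (fun t => (hF t).toLp (F t)) ((hF' 0).toLp (F' 0)) 0 := by
  rw [hasDerivAt_iff_tendsto_slope]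
  have hmem : ∀ t : ℝ, MemLp (fun x => (t : ℂ)⁻¹ * (F t x - F 0 x) - F' 0 x) 2 volume := fun t =>
    (((hF t).sub (hF 0)).const_mul _).sub (hF' 0)
  have hnorm : ∀ t, ‖slope (fun t => (hF t).toLp (F t)) 0 t - (hF' 0).toLp (F' 0)‖ ^ 2
      = ∫ x, ‖(t : ℂ)⁻¹ * (F t x - F 0 x) - F' 0 x‖ ^ 2 := by
    intro t
    have e : slope (fun t => (hF t).toLp (F t)) 0 t - (hF' 0).toLp (F' 0) = (hmem t).toLp _ := by
      rw [slope_def_module, sub_zero, ← MemLp.toLp_sub, ← MemLp.toLp_const_smul, ← MemLp.toLp_sub]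
      congr 1
      ext x
      simp
    rw [e, norm_toLp_sq]
  rw [tendsto_iff_norm_sub_tendsto_zero]
  -- The squared `L²` norm of the error is an integral of squares, to which dominated convergence
  -- applies with majorant `(2g)²`: one `g` bounds the difference quotient by the mean value
  -- theorem, the other bounds the derivative.
  have hsq : Tendsto (fun t => ‖slope (fun t => (hF t).toLp (F t)) 0 t
      - (hF' 0).toLp (F' 0)‖ ^ 2) (𝓝[≠] 0) (𝓝 0) := by
    simp_rw [hnorm]
    rw [show 𝓝 (0 : ℝ) = 𝓝 (∫ _ : X ν, (0 : ℝ)) by simp]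
    refine tendsto_integral_filter_of_dominated_convergence (fun x => (2 * g x) ^ 2) ?_ ?_ ?_ ?_
    · exact Eventually.of_forall fun t => ((hmem t).aestronglyMeasurable.norm.pow 2)
    · have h1 : ∀ᶠ t : ℝ in 𝓝[≠] 0, |t| ≤ 1 := by
        refine nhdsWithin_le_nhds ?_
        have := Metric.closedBall_mem_nhds (0 : ℝ) one_pos
        filter_upwards [this] with t ht
        simpa using ht
      filter_upwards [h1, self_mem_nhdsWithin] with t ht ht0
      refine Eventually.of_forall fun x => ?_
      rw [Real.norm_of_nonneg (by positivity)]
      refine pow_le_pow_left₀ (norm_nonneg _) ?_ 2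
      have hgx := hb 0 x (by simp)
      have h2 : ‖F t x - F 0 x‖ ≤ g x * |t| := by
        have := (convex_uIcc (0 : ℝ) t).norm_image_sub_le_of_norm_hasDerivWithin_le
          (f := fun s => F s x) (fun s _ => (hd s x).hasDerivWithinAt)
          (fun s hs => hb s x ?_) left_mem_uIcc right_mem_uIcc
        · simpa using this
        · have := abs_sub_left_of_mem_uIcc hs
          simp only [sub_zero] at this
          exact this.trans ht
      have h3 : ‖(t : ℂ)⁻¹ * (F t x - F 0 x)‖ ≤ g x := by
        rw [norm_mul, norm_inv, Complex.norm_real, Real.norm_eq_abs, inv_mul_le_iff₀ (abs_pos.2 ht0),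
          mul_comm]
        exact h2
      calc _ ≤ _ := norm_sub_le _ _
        _ ≤ 2 * g x := by linarith
    · have := hg.integrable_sq.const_mul 4
      refine this.congr (Eventually.of_forall fun x => ?_)
      simp only; ring
    · refine Eventually.of_forall fun x => ?_
      have := (hasDerivAt_iff_tendsto_slope.1 (hd 0 x)).sub_const (F' 0 x)
      rw [sub_self] at this
      have := (this.norm.pow 2)
      simp only [norm_zero, ne_eq, OfNat.ofNat_ne_zero, not_false_eq_true, zero_pow] at this
      refine this.congr fun t => ?_
      rw [slope_def_module]
      simp
  have := hsq.sqrt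
  simpa [Real.sqrt_sq] using this

end Decay

end

section

/-! ### The unitary group attached to a vector field -/

section Transport

variable {ν : ℕ}

/-- `f ↦ e^{z_t} f ∘ φ_t`. -/
def transport (φ : ℝ → X ν → X ν) (z : ℝ → X ν → ℝ) (t : ℝ) (f : X ν → ℂ) (x : X ν) : ℂ :=
  (Real.exp (z t x) : ℂ) * f (φ t x)

/-- `f ↦ v · ∇f + d f`. -/
def transportGen (v : X ν → X ν) (d : X ν → ℝ) (f : X ν → ℂ) (x : X ν) : ℂ :=
  fderiv ℝ f x (v x) + (d x : ℂ) * f x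

variable {v : X ν → X ν} {d : X ν → ℝ} {φ : ℝ → X ν → X ν} {z : ℝ → X ν → ℝ}

theorem Decay.transportGen_le {f : X ν → ℂ} (hf : Decay f) (hv : BddSmooth v) (hd : BddSmooth d) :
    ∃ C, 0 ≤ C ∧ ∀ x, ‖transportGen v d f x‖ ≤ C * decayWeight ν x := by
  obtain ⟨C, hC0, hC⟩ := hf.bound
  obtain ⟨A, hA⟩ := hv.exists_norm_le
  obtain ⟨B, hB⟩ := hd.exists_norm_le
  have hA0 := (norm_nonneg _).trans (hA 0)
  have hB0 := (norm_nonneg _).trans (hB 0)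
  refine ⟨C * A + B * C, by positivity, fun x => ?_⟩
  have hw := (decayWeight_pos x).le
  refine (norm_add_le _ _).trans ?_
  have h1 : ‖fderiv ℝ f x (v x)‖ ≤ C * decayWeight ν x * A :=
    ((fderiv ℝ f x).le_opNorm _).trans
      (mul_le_mul (hC x).2 (hA x) (norm_nonneg _) (by positivity))
  have h2 : ‖(d x : ℂ) * f x‖ ≤ B * (C * decayWeight ν x) := by
    rw [norm_mul, Complex.norm_real]
    exact mul_le_mul (hB x) (hC x).1 (norm_nonneg _) hB0
  linarith

theorem Decay.continuous_transportGen {f : X ν → ℂ} (hf : Decay f) (hv : BddSmooth v)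
    (hd : BddSmooth d) : Continuous (transportGen v d f) := by
  have h1 := hf.continuous_fderiv
  have h2 := hf.contDiff.continuous
  have h3 := hv.smooth.continuous
  have h4 := hd.smooth.continuous
  unfold transportGen
  exact (h1.clm_apply h3).add ((Complex.continuous_ofReal.comp h4).mul h2)

theorem Decay.memLp_transportGen {f : X ν → ℂ} (hf : Decay f) (hv : BddSmooth v)
    (hd : BddSmooth d) : MemLp (transportGen v d f) 2 volume := by
  obtain ⟨C, -, hC⟩ := hf.transportGen_le hv hd
  exact memLp_two_of_le_decayWeight (hf.continuous_transportGen hv hd) hC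

/-- The skew-symmetry of `v · ∇ + ½ div v`. -/
theorem integral_transportGen_mul (hv : BddSmooth v) (hd : BddSmooth d)
    (hdiv : ∀ x, d x = 1 / 2 * ∑ j, fderiv ℝ v x (EuclideanSpace.single j 1) j)
    {f g : X ν → ℂ} (hf : Decay f) (hg : Decay g) :
    ∫ x, transportGen v d f x * g x = -∫ x, f x * transportGen v d g x := by
  obtain ⟨C, hC0, hC⟩ := hf.bound
  obtain ⟨D, hD0, hD⟩ := hg.bound
  obtain ⟨A, hA⟩ := hv.exists_norm_le
  obtain ⟨A', hA'⟩ := hv.fderiv.exists_norm_le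
  obtain ⟨B, hB⟩ := hd.exists_norm_le
  have hcd := hd.smooth.continuous
  have hcv := hv.smooth.continuous
  have hcv' := hv.fderiv.smooth.continuous
  have hcf := hf.contDiff.continuous
  have hcg := hg.contDiff.continuous
  have hcf' := hf.continuous_fderiv
  have hcg' := hg.continuous_fderiv
  have hle : ∀ x, decayWeight ν x ≤ 1 := decayWeight_le_one
  have hgD : ∀ x, ‖g x‖ ≤ D := fun x => (hD x).1.trans (mul_le_of_le_one_right hD0 (hle x))
  have hgD' : ∀ x, ‖fderiv ℝ g x‖ ≤ D := fun x => (hD x).2.trans (mul_le_of_le_one_right hD0 (hle x))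
  set e : Fin ν → X ν := fun j => EuclideanSpace.single j 1 with he
  have hne : ∀ j, ‖e j‖ = 1 := fun j => by simp [he]
  have hvj : ∀ x j, ‖((v x j : ℝ) : ℂ)‖ ≤ A := fun x j => by
    rw [Complex.norm_real]; exact (PiLp.norm_apply_le _ _).trans (hA x)
  have hvj' : ∀ x j, ‖((fderiv ℝ v x (e j) j : ℝ) : ℂ)‖ ≤ A' := fun x j => by
    rw [Complex.norm_real]
    refine (PiLp.norm_apply_le _ _).trans (((fderiv ℝ v x).le_opNorm _).trans ?_)
    rw [hne, mul_one]; exact hA' x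
  have hsum : ∀ x, v x = ∑ j, v x j • e j := fun x => by
    ext i; simp [he, Finset.sum_apply, Pi.single_apply]
  have hdvj : ∀ j x, HasFDerivAt (fun x => ((v x j : ℝ) : ℂ))
      (Complex.ofRealCLM.comp ((EuclideanSpace.proj j : X ν →L[ℝ] ℝ).comp (fderiv ℝ v x))) x :=
    fun j x => Complex.ofRealCLM.hasFDerivAt.comp x
      ((EuclideanSpace.proj j : X ν →L[ℝ] ℝ).hasFDerivAt.comp x
        (hv.smooth.differentiable (by simp) x).hasFDerivAt)
  have hcvj : ∀ j, Continuous fun x => ((v x j : ℝ) : ℂ) := fun j => by fun_prop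
  have hcvj' : ∀ j, Continuous fun x => ((fderiv ℝ v x (e j) j : ℝ) : ℂ) := fun j => by fun_prop
  have hi1 : ∀ j, Integrable fun x => (((v x j : ℝ) : ℂ) * g x) * fderiv ℝ f x (e j) := by
    intro j
    refine (integrable_mul_of_le_decayWeight (f := fun x => fderiv ℝ f x (e j))
        (hcf'.clm_apply continuous_const) (C := C) (fun x => ?_)
        (g := fun x => ((v x j : ℝ) : ℂ) * g x) ((hcvj j).mul hcg) (D := A * D) (fun x => ?_)).congr
        (Eventually.of_forall fun x => mul_comm _ _)
    · have := (fderiv ℝ f x).le_opNorm (e j)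
      rw [hne, mul_one] at this
      exact this.trans (hC x).2
    · rw [norm_mul]
      exact mul_le_mul (hvj x j) (hgD x) (norm_nonneg _) ((norm_nonneg _).trans (hA x))
  have hi2 : ∀ j, Integrable fun x => (((v x j : ℝ) : ℂ) * fderiv ℝ g x (e j)
        + ((fderiv ℝ v x (e j) j : ℝ) : ℂ) * g x) * f x := by
    intro j
    refine (integrable_mul_of_le_decayWeight hcf (fun x => (hC x).1)
        (g := fun x => ((v x j : ℝ) : ℂ) * fderiv ℝ g x (e j)
          + ((fderiv ℝ v x (e j) j : ℝ) : ℂ) * g x) ?_ (D := A * D + A' * D) ?_).congr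
        (Eventually.of_forall fun x => mul_comm _ _)
    · have := hcvj j; have := hcvj' j
      fun_prop
    · intro x
      refine (norm_add_le _ _).trans (add_le_add ?_ ?_)
      · rw [norm_mul]
        refine mul_le_mul (hvj x j) ?_ (norm_nonneg _) ((norm_nonneg _).trans (hA x))
        have := (fderiv ℝ g x).le_opNorm (e j)
        rw [hne, mul_one] at this
        exact this.trans (hgD' x)
      · rw [norm_mul]
        exact mul_le_mul (hvj' x j) (hgD x) (norm_nonneg _) ((norm_nonneg _).trans (hA' x))
  -- Integration by parts in one direction, with the field component attached to `g`; its derivative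
  -- produces one term of the divergence.
  have hone : ∀ j, ∫ x, (((v x j : ℝ) : ℂ) * g x) * fderiv ℝ f x (e j)
      = -∫ x, (((v x j : ℝ) : ℂ) * fderiv ℝ g x (e j)
        + ((fderiv ℝ v x (e j) j : ℝ) : ℂ) * g x) * f x := by
    intro j
    have hder : ∀ x, fderiv ℝ (fun x => ((v x j : ℝ) : ℂ) * g x) x (e j)
        = ((v x j : ℝ) : ℂ) * fderiv ℝ g x (e j) + ((fderiv ℝ v x (e j) j : ℝ) : ℂ) * g x := by
      intro x
      rw [((hdvj j x).fun_mul (hg.differentiable x).hasFDerivAt).fderiv]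
      simp [mul_comm]
    have := integral_mul_fderiv_eq_neg_fderiv_mul_of_integrable (μ := (volume : Measure (X ν)))
      (f := fun x => ((v x j : ℝ) : ℂ) * g x) (g := f) (v := e j) ?_ ?_ ?_ ?_ ?_
    · simpa only [hder] using this
    · simpa only [hder] using hi2 j
    · exact hi1 j
    · refine (integrable_mul_of_le_decayWeight hcf (fun x => (hC x).1)
        (g := fun x => ((v x j : ℝ) : ℂ) * g x) ((hcvj j).mul hcg) (D := A * D) (fun x => ?_)).congr
        (Eventually.of_forall fun x => mul_comm _ _)
      rw [norm_mul]
      exact mul_le_mul (hvj x j) (hgD x) (norm_nonneg _) ((norm_nonneg _).trans (hA x))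
    · exact fun x _ => (hdvj j x).differentiableAt.mul (hg.differentiable x)
    · exact fun x _ => hf.differentiable x
  have hi3 : Integrable fun x => (d x : ℂ) * f x * g x := by
    refine (integrable_mul_of_le_decayWeight hcf (fun x => (hC x).1)
        (g := fun x => (d x : ℂ) * g x) (by fun_prop) (D := B * D) (fun x => ?_)).congr
        (Eventually.of_forall fun x => by simp only; ring)
    rw [norm_mul, Complex.norm_real]
    exact mul_le_mul (hB x) (hgD x) (norm_nonneg _) ((norm_nonneg _).trans (hB x))
  have hL : ∀ x, transportGen v d f x * g x
      = ∑ j, (((v x j : ℝ) : ℂ) * g x) * fderiv ℝ f x (e j) + (d x : ℂ) * f x * g x := by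
    intro x
    unfold transportGen
    conv_lhs => rw [hsum x]
    simp only [map_sum, map_smul, add_mul, Finset.sum_mul, Complex.real_smul]
    congr 1
    exact Finset.sum_congr rfl fun j _ => by ring
  have hR : ∀ x, f x * transportGen v d g x
      = ∑ j, (((v x j : ℝ) : ℂ) * fderiv ℝ g x (e j)
        + ((fderiv ℝ v x (e j) j : ℝ) : ℂ) * g x) * f x - (d x : ℂ) * f x * g x := by
    intro x
    unfold transportGen
    conv_lhs => rw [hsum x]
    simp only [map_sum, map_smul, mul_add, Complex.real_smul, add_mul, Finset.sum_add_distrib]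
    -- The full divergence is `2d`. Half of it cancels the zeroth order term of one side and leaves
    -- the `-d` needed for skew-symmetry.
    have h2 : ∑ j, ((fderiv ℝ v x (e j) j : ℝ) : ℂ) * g x * f x = 2 * (d x : ℂ) * f x * g x := by
      rw [← Finset.sum_mul, ← Finset.sum_mul, hdiv x]
      push_cast
      ring
    rw [h2, Finset.mul_sum]
    have : ∑ j, f x * (((v x j : ℝ) : ℂ) * fderiv ℝ g x (e j))
      = ∑ j, ((v x j : ℝ) : ℂ) * fderiv ℝ g x (e j) * f x :=
      Finset.sum_congr rfl fun j _ => by ring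
    rw [this]
    ring
  simp_rw [hL, hR]
  rw [integral_add (integrable_finsetSum _ fun j _ => hi1 j) hi3,
    integral_sub (integrable_finsetSum _ fun j _ => hi2 j) hi3,
    integral_finsetSum _ fun j _ => hi1 j, integral_finsetSum _ fun j _ => hi2 j]
  simp_rw [hone]
  rw [Finset.sum_neg_distrib]
  ring

namespace IsWeightedFlow

theorem hasDerivAt_transport (h : IsWeightedFlow v d φ z) {f : X ν → ℂ} (hf : Differentiable ℝ f)
    (t : ℝ) (x : X ν) :
    HasDerivAt (fun s => transport φ z s f x) (transport φ z t (transportGen v d f) x) t := by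
  have h1 : HasDerivAt (fun s => ((Real.exp (z s x) : ℝ) : ℂ))
      ((Real.exp (z t x) * d (φ t x) : ℝ) : ℂ) t := ((h.weight_deriv t x).exp).ofReal_comp
  have h2 : HasDerivAt (fun s => f (φ s x)) (fderiv ℝ f (φ t x) (v (φ t x))) t :=
    (hf (φ t x)).hasFDerivAt.comp_hasDerivAt t (h.flow_deriv t x)
  refine (h1.mul h2).congr_deriv ?_
  simp only [transport, transportGen]
  push_cast
  ring

theorem transport_zero (h : IsWeightedFlow v d φ z) (f : X ν → ℂ) : transport φ z 0 f = f := by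
  ext x; simp [transport, h.flow_zero, h.weight_zero]

theorem transport_add (h : IsWeightedFlow v d φ z) (s t : ℝ) (f : X ν → ℂ) :
    transport φ z s (transport φ z t f) = transport φ z (s + t) f := by
  ext x
  simp only [transport]
  rw [add_comm s t, h.flow_add, h.weight_add, Real.exp_add]
  push_cast
  ring

/-- For times up to `T` the exponential factor and the displacement of the argument are both
bounded, the latter absorbed by `decayWeight_le`. The bound involves only the size of `f`, so it
serves also for `transportGen v d f`, which is merely continuous. -/
theorem exists_transport_le (h : IsWeightedFlow v d φ z) (T : ℝ) : ∃ D, 0 ≤ D ∧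
    ∀ (f : X ν → ℂ) (C : ℝ), 0 ≤ C → (∀ x, ‖f x‖ ≤ C * decayWeight ν x) →
      ∀ t, |t| ≤ T → ∀ x, ‖transport φ z t f x‖ ≤ D * C * decayWeight ν x := by
  obtain ⟨L, hL0, hL⟩ := h.norm_flow_sub_le
  obtain ⟨M, hM0, hM⟩ := h.norm_weight_le
  refine ⟨Real.exp (M * |T|) * (1 + L * |T|) ^ (ν + 1), by positivity,
    fun f C hC0 hC t ht x => ?_⟩
  have ht' : |t| ≤ |T| := ht.trans (le_abs_self T)
  unfold transport
  rw [norm_mul, Complex.norm_real, Real.norm_of_nonneg (Real.exp_pos _).le]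
  have h1 : Real.exp (z t x) ≤ Real.exp (M * |T|) := Real.exp_le_exp.2
    ((Real.le_norm_self _).trans ((hM t x).trans (mul_le_mul_of_nonneg_left ht' hM0)))
  have h2 := decayWeight_le ((hL t x).trans (mul_le_mul_of_nonneg_left ht' hL0))
  calc _ ≤ Real.exp (M * |T|) * (C * ((1 + L * |T|) ^ (ν + 1) * decayWeight ν x)) :=
        mul_le_mul h1 ((hC _).trans (mul_le_mul_of_nonneg_left h2 hC0)) (norm_nonneg _)
          (Real.exp_pos _).le
    _ = _ := by ring

theorem continuous_transport (h : IsWeightedFlow v d φ z) (t : ℝ) {f : X ν → ℂ}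
    (hf : Continuous f) : Continuous (transport φ z t f) := by
  have h1 := (h.weight_contDiff t).continuous
  have h2 := (h.flow_contDiff t).continuous
  unfold transport
  fun_prop

theorem decay_transport (h : IsWeightedFlow v d φ z) (t : ℝ) {f : X ν → ℂ} (hf : Decay f) :
    Decay (transport φ z t f) := by
  obtain ⟨C, hC0, hC⟩ := hf.bound
  obtain ⟨D, hD0, hD⟩ := h.exists_transport_le |t|
  obtain ⟨K, hK⟩ := h.flow_lipschitz t
  obtain ⟨M, hM⟩ := h.weight_lipschitz t
  have hφ := h.flow_contDiff t
  have hz := h.weight_contDiff t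
  have hcd : ContDiff ℝ 1 (transport φ z t f) :=
    (Complex.ofRealCLM.contDiff.comp (Real.contDiff_exp.comp hz)).mul (hf.contDiff.comp hφ)
  have h1 := hD f C hC0 (fun x => (hC x).1) t le_rfl
  refine ⟨hcd, D * C + D * C * (M : ℝ) + D * C * (K : ℝ), ?_, fun x => ⟨?_, ?_⟩⟩
  · have := mul_nonneg (mul_nonneg hD0 hC0) M.coe_nonneg
    have := mul_nonneg (mul_nonneg hD0 hC0) K.coe_nonneg
    have := mul_nonneg hD0 hC0
    linarith
  · refine (h1 x).trans (mul_le_mul_of_nonneg_right ?_ (decayWeight_pos x).le)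
    have : 0 ≤ D * C * M + D * C * K := by positivity
    linarith
  · have hzd := (hz.differentiable (by simp) x).hasFDerivAt
    have hφd := (hφ.differentiable (by simp) x).hasFDerivAt
    have e1 : HasFDerivAt (fun y => ((Real.exp (z t y) : ℝ) : ℂ))
        (Complex.ofRealCLM.comp (Real.exp (z t x) • fderiv ℝ (z t) x)) x :=
      Complex.ofRealCLM.hasFDerivAt.comp x hzd.exp
    have e2 : HasFDerivAt (fun y => f (φ t y)) ((fderiv ℝ f (φ t x)).comp (fderiv ℝ (φ t) x)) x :=
      (hf.differentiable (φ t x)).hasFDerivAt.comp x hφd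
    have e3 := e1.fun_mul e2
    change ‖fderiv ℝ (fun y => ((Real.exp (z t y) : ℝ) : ℂ) * f (φ t y)) x‖ ≤ _
    rw [e3.fderiv]
    have hMx : ‖fderiv ℝ (z t) x‖ ≤ M := norm_fderiv_le_of_lipschitz ℝ hM
    have hKx : ‖fderiv ℝ (φ t) x‖ ≤ K := norm_fderiv_le_of_lipschitz ℝ hK
    have hE := (Real.exp_pos (z t x)).le
    have h2 : Real.exp (z t x) * ‖fderiv ℝ f (φ t x)‖ ≤ D * C * decayWeight ν x := by
      -- The estimate for functions is applied to the scalar function `‖Df‖`.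
      have := hD (fun y => ((‖fderiv ℝ f y‖ : ℝ) : ℂ)) C hC0 (fun y => by
        simpa using (hC y).2) t le_rfl x
      simpa [transport, abs_of_pos (Real.exp_pos _), Complex.norm_real] using this
    have h3 : Real.exp (z t x) * ‖f (φ t x)‖ ≤ D * C * decayWeight ν x := by
      have := h1 x
      simpa only [transport, norm_mul, Complex.norm_real, Real.norm_of_nonneg hE] using this
    refine (norm_add_le _ _).trans ?_
    have a1 : ‖((Real.exp (z t x) : ℝ) : ℂ) • (fderiv ℝ f (φ t x)).comp (fderiv ℝ (φ t) x)‖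
        ≤ D * C * decayWeight ν x * K := by
      rw [norm_smul, Complex.norm_real, Real.norm_of_nonneg hE]
      refine (mul_le_mul_of_nonneg_left (ContinuousLinearMap.opNorm_comp_le _ _) hE).trans ?_
      rw [← mul_assoc]
      exact mul_le_mul h2 hKx (norm_nonneg _) ((mul_nonneg hE (norm_nonneg _)).trans h2)
    have a2 : ‖f (φ t x) • Complex.ofRealCLM.comp (Real.exp (z t x) • fderiv ℝ (z t) x)‖
        ≤ D * C * decayWeight ν x * M := by
      rw [norm_smul]
      have : ‖Complex.ofRealCLM.comp (Real.exp (z t x) • fderiv ℝ (z t) x)‖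
          ≤ Real.exp (z t x) * ‖fderiv ℝ (z t) x‖ := by
        refine (ContinuousLinearMap.opNorm_comp_le _ _).trans ?_
        rw [Complex.ofRealCLM_norm, one_mul, norm_smul, Real.norm_of_nonneg hE]
      refine (mul_le_mul_of_nonneg_left this (norm_nonneg _)).trans ?_
      rw [← mul_assoc, mul_comm ‖f _‖]
      exact mul_le_mul h3 hMx (norm_nonneg _) ((mul_nonneg hE (norm_nonneg _)).trans h3)
    have : 0 ≤ D * C * decayWeight ν x := (mul_nonneg hE (norm_nonneg _)).trans h3
    refine (add_le_add a1 a2).trans ?_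
    nlinarith

theorem hasDerivAt_transport_toL2 (h : IsWeightedFlow v d φ z) (hv : BddSmooth v)
    (hd : BddSmooth d) {f : X ν → ℂ} (hf : Decay f) :
    HasDerivAt (fun t => (h.decay_transport t hf).memLp.toLp (transport φ z t f))
      ((hf.memLp_transportGen hv hd).toLp _) 0 := by
  obtain ⟨C, hC0, hC⟩ := hf.transportGen_le hv hd
  obtain ⟨D, hD0, hD⟩ := h.exists_transport_le (ν := ν) 1
  have hm : ∀ t, MemLp (transport φ z t (transportGen v d f)) 2 volume := fun t => by
    obtain ⟨D', -, hD'⟩ := h.exists_transport_le (ν := ν) |t|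
    exact memLp_two_of_le_decayWeight
      (h.continuous_transport t (hf.continuous_transportGen hv hd)) (hD' _ C hC0 hC t le_rfl)
  have := hasDerivAt_toLp_of_dominated (fun t => (h.decay_transport t hf).memLp) hm
    (fun t x => h.hasDerivAt_transport hf.differentiable t x)
    (memLp_decayWeight.const_mul (D * C)) (fun t x ht => hD _ C hC0 hC t ht x)
  simpa only [h.transport_zero] using this

end IsWeightedFlow

end Transport

end

section

/-! ### Multiplication by bounded continuous functions in `L²` -/

section MulL2

open scoped BoundedContinuousFunction

variable {ν : ℕ}

theorem memLp_bcf_mul (a : X ν →ᵇ ℂ) (f : L2 ν) : MemLp (fun x => a x * f x) 2 volume :=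
  (Lp.memLp f).of_le_mul (c := ‖a‖) (a.continuous.aestronglyMeasurable.mul (Lp.aestronglyMeasurable f))
    (Eventually.of_forall fun x => by
      rw [norm_mul]
      exact mul_le_mul_of_nonneg_right (a.norm_coe_le_norm x) (norm_nonneg _))

/-- Multiplication by a bounded continuous function in `L²`. -/
def mulL2 (a : X ν →ᵇ ℂ) : L2 ν →L[ℂ] L2 ν :=
  LinearMap.mkContinuous
    { toFun := fun f => (memLp_bcf_mul a f).toLp _
      map_add' := fun f g => by
        rw [← MemLp.toLp_add]
        refine MemLp.toLp_congr _ _ ?_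
        filter_upwards [Lp.coeFn_add f g] with x hx
        simp only [hx, Pi.add_apply, mul_add]
      map_smul' := fun c f => by
        rw [RingHom.id_apply, ← MemLp.toLp_const_smul]
        refine MemLp.toLp_congr _ _ ?_
        filter_upwards [Lp.coeFn_smul c f] with x hx
        simp only [hx, Pi.smul_apply, smul_eq_mul]
        ring } ‖a‖ (fun f => by
    refine Lp.norm_le_mul_norm_of_ae_le_mul ?_
    filter_upwards [(memLp_bcf_mul a f).coeFn_toLp] with x hx
    simp only [LinearMap.coe_mk, AddHom.coe_mk]
    rw [hx, norm_mul]
    exact mul_le_mul_of_nonneg_right (a.norm_coe_le_norm x) (norm_nonneg _))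

theorem coeFn_mulL2 (a : X ν →ᵇ ℂ) (f : L2 ν) : mulL2 a f =ᵐ[volume] fun x => a x * f x :=
  (memLp_bcf_mul a f).coeFn_toLp

theorem norm_mulL2_le (a : X ν →ᵇ ℂ) : ‖mulL2 a‖ ≤ ‖a‖ :=
  LinearMap.mkContinuous_norm_le _ (norm_nonneg _) _

theorem mulL2_toLp (a : X ν →ᵇ ℂ) {f : X ν → ℂ} (hf : MemLp f 2 volume)
    (hg : MemLp (fun x => a x * f x) 2 volume) : mulL2 a (hf.toLp f) = hg.toLp _ := by
  refine Lp.ext ?_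
  filter_upwards [coeFn_mulL2 a (hf.toLp f), hf.coeFn_toLp, hg.coeFn_toLp] with x h1 h2 h3
  rw [h1, h2, h3]

theorem mulL2_schwartz (a : X ν →ᵇ ℂ) (ha : Function.HasTemperateGrowth a) (f : 𝓢(X ν, ℂ)) :
    mulL2 a (f.toLp 2) = (SchwartzMap.smulLeftCLM ℂ a f).toLp 2 := by
  refine Lp.ext ?_
  filter_upwards [coeFn_mulL2 a (f.toLp 2), f.coeFn_toLp 2,
    (SchwartzMap.smulLeftCLM ℂ a f).coeFn_toLp 2] with x h1 h2 h3
  rw [h1, h2, h3, SchwartzMap.smulLeftCLM_apply_apply ha, smul_eq_mul]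

theorem mulL2_mulL2 (a b : X ν →ᵇ ℂ) (f : L2 ν) : mulL2 a (mulL2 b f) = mulL2 (a * b) f := by
  refine Lp.ext ?_
  filter_upwards [coeFn_mulL2 a (mulL2 b f), coeFn_mulL2 b f, coeFn_mulL2 (a * b) f] with x h1 h2 h3
  rw [h1, h2, h3, BoundedContinuousFunction.mul_apply, mul_assoc]

theorem mulL2_comm (a b : X ν →ᵇ ℂ) (f : L2 ν) : mulL2 a (mulL2 b f) = mulL2 b (mulL2 a f) := by
  rw [mulL2_mulL2, mulL2_mulL2, mul_comm]

theorem toTemperedDistribution_mulL2 (a : X ν →ᵇ ℂ) (ha : Function.HasTemperateGrowth a)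
    (f : L2 ν) : ((mulL2 a f : L2 ν) : 𝓢'(X ν, ℂ)) =
      TemperedDistribution.smulLeftCLM ℂ a (f : 𝓢'(X ν, ℂ)) := by
  ext u
  simp only [Lp.toTemperedDistribution_apply, TemperedDistribution.smulLeftCLM_apply_apply]
  refine integral_congr_ae ?_
  filter_upwards [coeFn_mulL2 a f] with x hx
  rw [hx, SchwartzMap.smulLeftCLM_apply_apply ha]
  simp only [smul_eq_mul]
  ring

theorem inner_mulL2_left (a : X ν →ᵇ ℂ) (f g : L2 ν) :
    inner ℂ (mulL2 a f) g = inner ℂ f (mulL2 (star a) g) := by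
  rw [L2.inner_def, L2.inner_def]
  refine integral_congr_ae ?_
  filter_upwards [coeFn_mulL2 a f, coeFn_mulL2 (star a) g] with x h1 h2
  rw [h1, h2]
  simp only [RCLike.inner_apply, BoundedContinuousFunction.star_apply, map_mul, RCLike.star_def]
  ring

end MulL2

/-! ### The unitary group attached to a vector field, on `L²` -/

section TransportGroup

variable {ν : ℕ} {v : X ν → X ν} {d : X ν → ℝ} {φ : ℝ → X ν → X ν} {z : ℝ → X ν → ℝ}

/-- The derivative of the squared norm along an orbit is twice the real part of the product of a
function with its image under a skew-symmetric operator, hence zero. -/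
theorem IsWeightedFlow.norm_transport (h : IsWeightedFlow v d φ z) (hv : BddSmooth v)
    (hd : BddSmooth d)
    (hdiv : ∀ x, d x = 1 / 2 * ∑ j, fderiv ℝ v x (EuclideanSpace.single j 1) j)
    (t : ℝ) {f : X ν → ℂ} (hf : Decay f) :
    ‖(h.decay_transport t hf).memLp.toLp (transport φ z t f)‖ = ‖hf.memLp.toLp f‖ := by
  set F : ℝ → L2 ν := fun t => (h.decay_transport t hf).memLp.toLp (transport φ z t f) with hF
  have hre : ∀ {g : X ν → ℂ} (hg : Decay g),
      inner ℝ (hg.memLp.toLp g) ((hg.memLp_transportGen hv hd).toLp _) = 0 := by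
    intro g hg
    have e1 : inner ℂ (hg.memLp.toLp g) ((hg.memLp_transportGen hv hd).toLp _)
        = ∫ x, transportGen v d g x * starRingEnd ℂ (g x) := by
      rw [L2.inner_def]
      refine integral_congr_ae ?_
      filter_upwards [hg.memLp.coeFn_toLp, (hg.memLp_transportGen hv hd).coeFn_toLp] with x h1 h2
      rw [h1, h2, RCLike.inner_apply]
    have e2 := integral_transportGen_mul hv hd hdiv hg hg.conj
    have e3 : ∀ x, g x * transportGen v d (fun x => starRingEnd ℂ (g x)) x
        = starRingEnd ℂ (transportGen v d g x * starRingEnd ℂ (g x)) := by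
      intro x
      have : fderiv ℝ (fun x => starRingEnd ℂ (g x)) x (v x)
          = starRingEnd ℂ (fderiv ℝ g x (v x)) := by
        rw [(hg.hasFDerivAt_conj x).fderiv]; rfl
      simp only [transportGen, this, map_mul, map_add, Complex.conj_conj, Complex.conj_ofReal]
      ring
    simp_rw [e3] at e2
    rw [integral_conj, ← e1] at e2
    -- With the conjugate of `g` as second function, the integration by parts reads `w = -conj w`
    -- for the scalar product `w`.
    have e4 : (inner ℂ (hg.memLp.toLp g) ((hg.memLp_transportGen hv hd).toLp _)).re = 0 := by
      have := congrArg Complex.re e2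
      simp only [Complex.neg_re, Complex.conj_re] at this
      linarith
    rw [L2.inner_def] at e4 ⊢
    rw [← e4]
    change _ = RCLike.re (K := ℂ) _
    rw [← integral_re (𝕜 := ℂ) (L2.integrable_inner _ _)]
    rfl
  have hder : ∀ t, HasDerivAt (fun t => ‖F t‖ ^ 2) 0 t := by
    intro t
    have h0 := h.hasDerivAt_transport_toL2 hv hd (h.decay_transport t hf)
    have h1 : HasDerivAt F (((h.decay_transport t hf).memLp_transportGen hv hd).toLp _) t := by
      rw [← sub_self t] at h0
      refine (h0.comp_sub_const t t).congr_of_eventuallyEq (Eventually.of_forall fun s => ?_)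
      simp only [hF, h.transport_add, sub_add_cancel]
    have := h1.norm_sq
    rwa [hre (h.decay_transport t hf), mul_zero] at this
  have hconst := is_const_of_deriv_eq_zero (fun t => (hder t).differentiableAt)
    (fun t => (hder t).deriv) t 0
  have h2 : ‖F t‖ = ‖F 0‖ := by
    have := congrArg Real.sqrt hconst
    simpa [Real.sqrt_sq] using this
  rw [show (hf.memLp.toLp f) = F 0 by simp only [hF, h.transport_zero]]
  exact h2

/-- The extension of `transport` to unitary operators of `L²`. -/
structure IsTransportGroup (φ : ℝ → X ν → X ν) (z : ℝ → X ν → ℝ)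
    (U : ℝ → (L2 ν ≃ₗᵢ[ℂ] L2 ν)) : Prop where
  apply_decay : ∀ (t : ℝ) (f : X ν → ℂ) (hf : Decay f), ∃ hf' : Decay (transport φ z t f),
    U t (hf.memLp.toLp f) = hf'.memLp.toLp _

/-- On decaying functions the transport is an isometric bijection, its inverse being the transport
by `-t`; it extends by density of these functions in `L²`. -/
theorem IsWeightedFlow.exists_isTransportGroup (h : IsWeightedFlow v d φ z) (hv : BddSmooth v)
    (hd : BddSmooth d)
    (hdiv : ∀ x, d x = 1 / 2 * ∑ j, fderiv ℝ v x (EuclideanSpace.single j 1) j) :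
    ∃ U, IsTransportGroup φ z U := by
  let T : ℝ → decaySubmodule ν →ₗ[ℂ] decaySubmodule ν := fun t =>
    { toFun := fun f => ⟨transport φ z t f.1, h.decay_transport t f.2⟩
      map_add' := fun f g => by
        ext x; simp [transport, mul_add]
      map_smul' := fun c f => by
        ext x; simp [transport]; ring }
  have hT : ∀ s t f, s + t = 0 → T s (T t f) = f := by
    intro s t f hst
    ext x
    have := congrFun (h.transport_add s t f.1) x
    rw [hst, h.transport_zero] at this
    exact this
  let e : ℝ → decaySubmodule ν ≃ₗ[ℂ] decaySubmodule ν := fun t =>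
    LinearEquiv.ofLinearMap (T t) (T (-t)) (LinearMap.ext fun f => hT _ _ f (by ring))
      (LinearMap.ext fun f => hT _ _ f (by ring))
  refine ⟨fun t => (e t).extendOfIsometry (decayToL2 ν) (decayToL2 ν) denseRange_decayToL2
    denseRange_decayToL2 (fun f => h.norm_transport hv hd hdiv t f.2), ⟨fun t f hf => ?_⟩⟩
  exact ⟨h.decay_transport t hf, LinearEquiv.extendOfIsometry_eq (f := e t) (e₁ := decayToL2 ν)
    (e₂ := decayToL2 ν) denseRange_decayToL2 denseRange_decayToL2
    (fun f => h.norm_transport hv hd hdiv t f.2) ⟨f, hf⟩⟩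

namespace IsTransportGroup

variable {U : ℝ → (L2 ν ≃ₗᵢ[ℂ] L2 ν)}

theorem eq_of_decay {A B : L2 ν → L2 ν} (hA : Continuous A) (hB : Continuous B)
    (h : ∀ (f : X ν → ℂ) (hf : Decay f), A (hf.memLp.toLp f) = B (hf.memLp.toLp f)) (f : L2 ν) :
    A f = B f :=
  denseRange_decayToL2.induction_on (p := fun f => A f = B f) f (isClosed_eq hA hB)
    fun g => h g.1 g.2

theorem map_zero (hU : IsTransportGroup φ z U) (h : IsWeightedFlow v d φ z) (f : L2 ν) :
    U 0 f = f := by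
  refine eq_of_decay (A := fun f => U 0 f) (U 0).continuous continuous_id (fun f hf => ?_) f
  obtain ⟨_, e⟩ := hU.apply_decay 0 f hf
  rw [e]
  simp only [h.transport_zero, id]

theorem map_add (hU : IsTransportGroup φ z U) (h : IsWeightedFlow v d φ z) (s t : ℝ) (f : L2 ν) :
    U (s + t) f = U s (U t f) := by
  refine eq_of_decay (A := fun f => U (s + t) f) (B := fun f => U s (U t f)) (U _).continuous
    ((U s).continuous.comp (U t).continuous) (fun f hf => ?_) f
  obtain ⟨_, e⟩ := hU.apply_decay (s + t) f hf
  obtain ⟨h2, e2⟩ := hU.apply_decay t f hf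
  obtain ⟨_, e3⟩ := hU.apply_decay s _ h2
  rw [e, e2, e3]
  simp only [h.transport_add]

theorem hasDerivAt_decay (hU : IsTransportGroup φ z U) (h : IsWeightedFlow v d φ z)
    (hv : BddSmooth v) (hd : BddSmooth d) {f : X ν → ℂ} (hf : Decay f) :
    HasDerivAt (fun t => U t (hf.memLp.toLp f)) ((hf.memLp_transportGen hv hd).toLp _) 0 := by
  refine (h.hasDerivAt_transport_toL2 hv hd hf).congr_of_eventuallyEq
    (Eventually.of_forall fun t => ?_)
  obtain ⟨_, e⟩ := hU.apply_decay t f hf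
  exact e

theorem hasDerivAt_of_zero (hU : IsTransportGroup φ z U) (h : IsWeightedFlow v d φ z)
    {f g : L2 ν} (hf : HasDerivAt (fun t => U t f) g 0) (t : ℝ) :
    HasDerivAt (fun t => U t f) (U t g) t := by
  have h1 : HasDerivAt (fun s => U t (U s f)) (U t g) 0 :=
    ((U t).toContinuousLinearEquiv.toContinuousLinearMap.restrictScalars ℝ).hasFDerivAt.comp_hasDerivAt
      0 hf
  rw [← sub_self t] at h1
  refine (h1.comp_sub_const t t).congr_of_eventuallyEq (Eventually.of_forall fun s => ?_)
  simp only [← hU.map_add h, add_sub_cancel]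

/-- Orbits of decaying functions are differentiable, and isometry makes the approximation of any
vector by such functions uniform in time. -/
theorem continuous_apply (hU : IsTransportGroup φ z U) (h : IsWeightedFlow v d φ z)
    (hv : BddSmooth v) (hd : BddSmooth d) (f : L2 ν) : Continuous fun t => U t f := by
  refine continuous_of_uniform_approx_of_continuous fun u hu => ?_
  obtain ⟨ε, hε, hu⟩ := Metric.mem_uniformity_dist.1 hu
  obtain ⟨g, hg⟩ := denseRange_decayToL2.exists_dist_lt f hε
  refine ⟨fun t => U t (decayToL2 ν g), continuous_iff_continuousAt.2 fun t =>
    (hU.hasDerivAt_of_zero h (hU.hasDerivAt_decay h hv hd g.2) t).continuousAt, fun t => hu ?_⟩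
  rwa [(U t).dist_map]

theorem symm_eq (hU : IsTransportGroup φ z U) (h : IsWeightedFlow v d φ z) (t : ℝ) (f : L2 ν) :
    (U t).symm f = U (-t) f := by
  rw [LinearIsometryEquiv.symm_apply_eq, ← hU.map_add h, add_neg_cancel, hU.map_zero h]

open scoped BoundedContinuousFunction in
/-- `U_t` intertwines the multiplications by `a` and by `a ∘ φ_t`. -/
theorem apply_mulL2 (hU : IsTransportGroup φ z U) (t : ℝ) (a b : X ν →ᵇ ℂ)
    (ha : ContDiff ℝ 1 a) {C : ℝ} (hC : ∀ x, ‖fderiv ℝ a x‖ ≤ C) (hab : ∀ x, b x = a (φ t x))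
    (f : L2 ν) : U t (mulL2 a f) = mulL2 b (U t f) := by
  refine eq_of_decay (A := fun f => U t (mulL2 a f)) (B := fun f => mulL2 b (U t f))
    ((U t).continuous.comp (mulL2 a).continuous) ((mulL2 b).continuous.comp (U t).continuous)
    (fun f hf => ?_) f
  have hC0 : 0 ≤ C := (norm_nonneg _).trans (hC 0)
  -- The bound on the derivative of `a` keeps the product in the class where `U` is given by a
  -- formula.
  have haf : Decay (fun x => a x * f x) := by
    obtain ⟨D, hD0, hD⟩ := hf.bound
    refine ⟨ha.mul hf.contDiff, ‖a‖ * D + C * D, by positivity, fun x => ⟨?_, ?_⟩⟩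
    · rw [norm_mul, add_mul]
      have := mul_le_mul (a.norm_coe_le_norm x) (hD x).1 (norm_nonneg _) (norm_nonneg _)
      have h2 : 0 ≤ C * D * decayWeight ν x := by have := decayWeight_pos x; positivity
      linarith
    · rw [((ha.differentiable (by simp) x).hasFDerivAt.fun_mul
        (hf.differentiable x).hasFDerivAt).fderiv, add_mul]
      refine (norm_add_le _ _).trans (add_le_add ?_ ?_)
      · rw [norm_smul, mul_assoc]
        exact mul_le_mul (a.norm_coe_le_norm x) (hD x).2 (norm_nonneg _) (norm_nonneg _)
      · rw [norm_smul, mul_comm, mul_assoc]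
        exact mul_le_mul (hC x) (hD x).1 (norm_nonneg _) hC0
  rw [mulL2_toLp a hf.memLp haf.memLp]
  obtain ⟨h1, e1⟩ := hU.apply_decay t _ haf
  obtain ⟨h2, e2⟩ := hU.apply_decay t _ hf
  have key : transport φ z t (fun x => a x * f x) = fun x => b x * transport φ z t f x := by
    ext x; simp only [transport, hab]; ring
  rw [e1, e2, mulL2_toLp b h2.memLp (by rw [← key]; exact h1.memLp)]
  simp only [key]

end IsTransportGroup

end TransportGroup

end

section

/-! ### Generators of one-parameter groups of isometries -/

section Generator

variable {H : Type*} [NormedAddCommGroup H] [NormedSpace ℂ H]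
  {V : ℝ → (H ≃ₗᵢ[ℂ] H)}

theorem continuous_uncurry_group (hc : ∀ f, Continuous fun t => V t f) :
    Continuous (fun p : H × ℝ => V p.2 p.1) := by
  refine continuous_iff_continuousAt.2 fun ⟨f, t⟩ => ?_
  rw [ContinuousAt, tendsto_iff_norm_sub_tendsto_zero]
  have h1 : Tendsto (fun p : H × ℝ => ‖p.1 - f‖ + ‖V p.2 f - V t f‖) (𝓝 (f, t)) (𝓝 0) := by
    have : Continuous (fun p : H × ℝ => ‖p.1 - f‖ + ‖V p.2 f - V t f‖) := by
      have := (hc f).comp (continuous_snd (X := H))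
      simp only [Function.comp_def] at this
      fun_prop
    have h := this.tendsto (f, t)
    simpa using h
  refine squeeze_zero (fun _ => norm_nonneg _) (fun p => ?_) h1
  calc ‖V p.2 p.1 - V t f‖ = ‖V p.2 (p.1 - f) + (V p.2 f - V t f)‖ := by rw [map_sub]; abel_nf
    _ ≤ _ := (norm_add_le _ _).trans (by rw [LinearIsometryEquiv.norm_map])

theorem hasDerivAt_group (ha : ∀ s t f, V (s + t) f = V s (V t f)) {f g : H}
    (hf : HasDerivAt (fun t => V t f) g 0) (t : ℝ) : HasDerivAt (fun t => V t f) (V t g) t := by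
  have h1 : HasDerivAt (fun s => V t (V s f)) (V t g) 0 :=
    ((V t).toContinuousLinearEquiv.toContinuousLinearMap.restrictScalars ℝ).hasFDerivAt.comp_hasDerivAt
      0 hf
  rw [← sub_self t] at h1
  refine (h1.comp_sub_const t t).congr_of_eventuallyEq (Eventually.of_forall fun s => ?_)
  simp only [← ha, add_sub_cancel]

/-- The graph of the generator, as a submodule. -/
def generatorGraph (V : ℝ → (H ≃ₗᵢ[ℂ] H)) : Submodule ℂ (H × H) where
  carrier := {p | HasDerivAt (fun t => V t p.1) (Complex.I • p.2) 0}
  add_mem' {p q} hp hq := by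
    have := HasDerivAt.add hp hq
    simpa [Pi.add_def, smul_add] using this
  zero_mem' := by simpa using hasDerivAt_const (0 : ℝ) (0 : H)
  smul_mem' c p hp := by
    have := HasDerivAt.const_smul c hp
    simpa [Pi.smul_def, smul_comm c Complex.I] using this

theorem mem_generatorGraph {p : H × H} :
    p ∈ generatorGraph V ↔ HasDerivAt (fun t => V t p.1) (Complex.I • p.2) 0 := Iff.rfl

/-- If `(p_n, q_n)` converges, the derivatives `V_t(i q_n)` of the orbits converge uniformly in `t`,
because the `V_t` are isometries; so differentiation passes to the limit. -/
theorem isClosed_generatorGraph [CompleteSpace H] (ha : ∀ s t f, V (s + t) f = V s (V t f))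
    : IsClosed (generatorGraph V : Set (H × H)) := by
  refine isSeqClosed_iff_isClosed.1 fun p q hp hq => ?_
  have h1 : Tendsto (fun n => (p n).1) atTop (𝓝 q.1) := (continuous_fst.tendsto q).comp hq
  have h2 : Tendsto (fun n => (p n).2) atTop (𝓝 q.2) := (continuous_snd.tendsto q).comp hq
  have key : HasDerivAt (fun t => V t q.1) (V 0 (Complex.I • q.2)) 0 := by
    refine hasDerivAt_of_tendstoUniformly (l := atTop)
      (f := fun n t => V t (p n).1) (f' := fun n t => V t (Complex.I • (p n).2))
      (g' := fun t => V t (Complex.I • q.2)) ?_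
      (Eventually.of_forall fun n t => hasDerivAt_group ha (hp n) t) (fun t => ?_) 0
    · rw [Metric.tendstoUniformly_iff]
      intro ε hε
      filter_upwards [Metric.tendsto_nhds.1 (h2.const_smul Complex.I) ε hε] with n hn t
      rwa [dist_comm, (V t).dist_map]
    · exact ((V t).continuous.tendsto _).comp h1
  have h0 : ∀ f, V 0 f = f := fun f => (V 0).injective (by rw [← ha, add_zero])
  rwa [h0] at key

/-- A closed subspace containing the graph of the generator along the orbits of a dense set of
vectors contains the whole graph of the generator. -/
theorem generatorGraph_le [CompleteSpace H] (ha : ∀ s t f, V (s + t) f = V s (V t f))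
    (hc : ∀ f, Continuous fun t => V t f) {G : Submodule ℂ (H × H)} (hG : IsClosed (G : Set (H × H)))
    {D : Set H} (hD : Dense D) (h : ∀ p ∈ D, ∃ q, (p, q) ∈ generatorGraph V ∧
      ∀ s, (V s p, V s q) ∈ G) : generatorGraph V ≤ G := by
  have h0 : ∀ f, V 0 f = f := fun f => (V 0).injective (by rw [← ha, add_zero])
  have hcc := continuous_uncurry_group hc
  -- Averages of orbits lie in the domain of the generator `B`, with `B ∫₀ᵗ V_s f ds = -i(V_t f -
  -- f)`. Both components are continuous in `f`, so it suffices to place this pair in `G` for `f` in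
  -- the dense set.
  have key : ∀ t f, ((∫ s in (0 : ℝ)..t, V s f), -(Complex.I • (V t f - f))) ∈ G := by
    intro t f
    have hcl : IsClosed {f | ((∫ s in (0 : ℝ)..t, V s f), -(Complex.I • (V t f - f))) ∈ G} := by
      refine hG.preimage ?_
      have h1 : Continuous fun f => ∫ s in (0 : ℝ)..t, V s f :=
        intervalIntegral.continuous_parametric_intervalIntegral_of_continuous' hcc _ _
      have h2 := (V t).continuous
      fun_prop
    refine hcl.closure_subset_iff.2 ?_ (hD f)
    intro p hp
    obtain ⟨q, hq, hs⟩ := h p hp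
    -- The curve `s ↦ (V_s p, V_s q)` lies in the closed subspace `G`; integrating it inside `G`
    -- keeps the integral there.
    have : CompleteSpace G := hG.completeSpace_coe
    let γ : ℝ → G := fun s => ⟨(V s p, V s q), hs s⟩
    have hγ : Continuous γ := Continuous.subtype_mk ((hc p).prodMk (hc q)) _
    have e1 : (∫ s in (0 : ℝ)..t, V s p) = ((∫ s in (0 : ℝ)..t, γ s : G) : H × H).1 := by
      have := ((ContinuousLinearMap.fst ℂ H H).comp G.subtypeL).intervalIntegral_comp_comm
        (hγ.intervalIntegrable 0 t (μ := volume))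
      exact this
    have e2 : (∫ s in (0 : ℝ)..t, V s q) = ((∫ s in (0 : ℝ)..t, γ s : G) : H × H).2 := by
      have := ((ContinuousLinearMap.snd ℂ H H).comp G.subtypeL).intervalIntegral_comp_comm
        (hγ.intervalIntegrable 0 t (μ := volume))
      exact this
    have e3 : (∫ s in (0 : ℝ)..t, V s (Complex.I • q)) = V t p - p := by
      rw [intervalIntegral.integral_eq_sub_of_hasDerivAt
        (fun s _ => hasDerivAt_group ha hq s) ((hc _).intervalIntegrable _ _), h0]
    have e4 : -(Complex.I • (V t p - p)) = ∫ s in (0 : ℝ)..t, V s q := by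
      rw [← e3]
      simp only [map_smul]
      rw [intervalIntegral.integral_smul, smul_smul, Complex.I_mul_I, neg_one_smul, neg_neg]
    change ((∫ s in (0 : ℝ)..t, V s p), -(Complex.I • (V t p - p))) ∈ G
    rw [e4, e1, e2]
    exact (∫ s in (0 : ℝ)..t, γ s : G).2
  rintro ⟨f, g⟩ hfg
  have hd1 : HasDerivAt (fun t => ∫ s in (0 : ℝ)..t, V s f) f 0 := by
    have := intervalIntegral.integral_hasDerivAt_right ((hc f).intervalIntegrable 0 0 (μ := volume))
      (hc f).stronglyMeasurable.stronglyMeasurableAtFilter (hc f).continuousAt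
    rwa [h0] at this
  have hd2 : HasDerivAt (fun t => -(Complex.I • (V t f - f))) g 0 := by
    have := ((hfg.sub_const f).const_smul Complex.I).neg
    rw [smul_smul, Complex.I_mul_I, neg_one_smul, neg_neg] at this
    exact this
  -- The averages divided by `t` tend to `(f, g)` as `t → 0`, and closedness of `G` concludes.
  have hd := (hd1.prodMk hd2).tendsto_slope_zero
  refine hG.mem_of_tendsto hd (Eventually.of_forall fun t => ?_)
  have e5 : ∀ (t : ℝ) (p : H × H), p ∈ G → t • p ∈ G := fun t p hp => by
    have := G.smul_mem (t : ℂ) hp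
    simpa using this
  refine e5 _ _ (G.sub_mem (key _ f) ?_)
  simp only [intervalIntegral.integral_same, h0, sub_self, smul_zero, neg_zero]
  exact G.zero_mem

end Generator

end

section

open FourierTransform LineDeriv
open scoped BoundedContinuousFunction

/-! ### Japanese brackets -/

section Bracket

variable {ν : ℕ}

/-- The weight `(1 + |x|²)^{s/2}`. -/
def bracket (s : ℝ) (x : X ν) : ℂ := ((1 + ‖x‖ ^ 2) ^ (s / 2) : ℝ)

theorem one_le_one_add_normSq (x : X ν) : 1 ≤ 1 + ‖x‖ ^ 2 := by
  have := sq_nonneg ‖x‖; linarith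

theorem one_add_normSq_pos (x : X ν) : 0 < 1 + ‖x‖ ^ 2 := zero_lt_one.trans_le (one_le_one_add_normSq x)

theorem bracket_ne_zero (s : ℝ) (x : X ν) : bracket s x ≠ 0 :=
  Complex.ofReal_ne_zero.2 (Real.rpow_pos_of_pos (one_add_normSq_pos x) _).ne'

theorem bracket_add (s t : ℝ) (x : X ν) : bracket (s + t) x = bracket s x * bracket t x := by
  rw [bracket, bracket, bracket, ← Complex.ofReal_mul, ← Real.rpow_add (one_add_normSq_pos x), add_div]

theorem bracket_zero (x : X ν) : bracket 0 x = 1 := by simp [bracket]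

theorem norm_bracket (s : ℝ) (x : X ν) : ‖bracket s x‖ = (1 + ‖x‖ ^ 2) ^ (s / 2) := by
  rw [bracket, Complex.norm_real, Real.norm_of_nonneg (Real.rpow_nonneg (one_add_normSq_pos x).le _)]

theorem norm_bracket_le_one {s : ℝ} (hs : s ≤ 0) (x : X ν) : ‖bracket s x‖ ≤ 1 := by
  rw [norm_bracket]
  exact Real.rpow_le_one_of_one_le_of_nonpos (one_le_one_add_normSq x) (by linarith)

theorem hasTemperateGrowth_bracket (s : ℝ) : Function.HasTemperateGrowth (bracket s : X ν → ℂ) := by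
  unfold bracket
  have := Function.hasTemperateGrowth_one_add_norm_sq_rpow (X ν) (s / 2)
  fun_prop

theorem continuous_bracket (s : ℝ) : Continuous (bracket s : X ν → ℂ) :=
  (hasTemperateGrowth_bracket s).1.continuous

/-- `bracket s` as a bounded continuous function, for `s ≤ 0`. -/
def bracketBCF {s : ℝ} (hs : s ≤ 0) : X ν →ᵇ ℂ :=
  BoundedContinuousFunction.ofNormedAddCommGroup (bracket s) (continuous_bracket s) 1
    (norm_bracket_le_one hs)

@[simp] theorem coe_bracketBCF {s : ℝ} (hs : s ≤ 0) : (bracketBCF hs : X ν → ℂ) = bracket s := rfl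

theorem bracket_neg_one_sq (x : X ν) : bracket (-1) x * bracket (-1) x = ((1 + ‖x‖ ^ 2)⁻¹ : ℝ) := by
  rw [← bracket_add, bracket, ← Real.rpow_neg_one]
  norm_num

theorem norm_coord_mul_bracket_le (j : Fin ν) (x : X ν) :
    ‖((x j : ℝ) : ℂ) * bracket (-1) x‖ ≤ 1 := by
  have h : ‖bracket (-1) x‖ ^ 2 = (1 + ‖x‖ ^ 2)⁻¹ := by
    rw [sq, ← norm_mul, bracket_neg_one_sq, Complex.norm_real,
      Real.norm_of_nonneg (inv_nonneg.2 (one_add_normSq_pos x).le)]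
  have h2 : |x j| ≤ ‖x‖ := PiLp.norm_apply_le x j
  rw [norm_mul, ← abs_of_nonneg (norm_nonneg (bracket (-1) x)), Complex.norm_real, Real.norm_eq_abs,
    ← abs_mul, ← sq_le_one_iff_abs_le_one, mul_pow, h, ← div_eq_mul_inv,
    div_le_one (one_add_normSq_pos x), ← sq_abs]
  have := pow_le_pow_left₀ (abs_nonneg _) h2 2
  linarith

/-- The bounded continuous function `x_j (1 + |x|²)^{-1/2}`. -/
def coordBCF (j : Fin ν) : X ν →ᵇ ℂ :=
  BoundedContinuousFunction.ofNormedAddCommGroup (fun x => ((x j : ℝ) : ℂ) * bracket (-1) x)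
    (by have := continuous_bracket (ν := ν) (-1); fun_prop) 1 (norm_coord_mul_bracket_le j)

theorem coordBCF_apply (j : Fin ν) (x : X ν) :
    coordBCF j x = ((x j : ℝ) : ℂ) * bracket (-1) x := rfl

theorem hasTemperateGrowth_coord (j : Fin ν) :
    Function.HasTemperateGrowth (fun x : X ν => ((x j : ℝ) : ℂ)) := by
  have h : Function.HasTemperateGrowth (fun x : X ν => x j) :=
    (EuclideanSpace.proj j : X ν →L[ℝ] ℝ).hasTemperateGrowth
  fun_prop

theorem hasTemperateGrowth_coordBCF (j : Fin ν) : Function.HasTemperateGrowth (coordBCF j : X ν → ℂ) :=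
  (hasTemperateGrowth_coord j).mul (hasTemperateGrowth_bracket _)

theorem mulL2_injective {a : X ν →ᵇ ℂ} (ha : ∀ x, a x ≠ 0) : Function.Injective (mulL2 a) := by
  intro f g h
  refine Lp.ext ?_
  filter_upwards [coeFn_mulL2 a f, coeFn_mulL2 a g] with x h1 h2
  rw [h, h2] at h1
  exact (mul_left_cancel₀ (ha x) h1).symm

/-- The identity `⟨x⟩⁻²(1 + ∑ x_j²) = 1`, written with bounded multipliers only. It serves to divide
by `⟨x⟩⁻¹` without unbounded operators. -/
theorem bracket_sq_add_sum_coord (f : L2 ν) :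
    mulL2 (bracketBCF (by norm_num : (-1 : ℝ) ≤ 0)) (mulL2 (bracketBCF (by norm_num : (-1 : ℝ) ≤ 0)) f)
      + ∑ j, mulL2 (coordBCF j) (mulL2 (coordBCF j) f) = f := by
  refine Lp.ext ?_
  have h1 : ∀ᵐ x, ∀ j : Fin ν, mulL2 (coordBCF j) (mulL2 (coordBCF j) f) x
      = coordBCF j x * coordBCF j x * f x := ae_all_iff.2 fun j => by
    rw [mulL2_mulL2]; exact coeFn_mulL2 _ f
  filter_upwards [Lp.coeFn_add (mulL2 (bracketBCF (by norm_num : (-1 : ℝ) ≤ 0))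
    (mulL2 (bracketBCF (by norm_num : (-1 : ℝ) ≤ 0)) f)) (∑ j, mulL2 (coordBCF j) (mulL2 (coordBCF j) f)),
    Lp.coeFn_finsetSum Finset.univ (fun j => mulL2 (coordBCF j) (mulL2 (coordBCF j) f)), h1,
    coeFn_mulL2 (bracketBCF (by norm_num : (-1 : ℝ) ≤ 0) * bracketBCF (by norm_num : (-1 : ℝ) ≤ 0)) f]
    with x e1 e2 e3 e4
  rw [e1, Pi.add_apply, e2, mulL2_mulL2, e4, Finset.sum_apply]
  simp_rw [e3]
  rw [← Finset.sum_mul, ← add_mul]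
  simp only [BoundedContinuousFunction.mul_apply, coe_bracketBCF, coordBCF_apply]
  have h2 : ∀ j : Fin ν, ((x j : ℝ) : ℂ) * bracket (-1) x * (((x j : ℝ) : ℂ) * bracket (-1) x)
      = ((x j ^ 2 : ℝ) : ℂ) * ((1 + ‖x‖ ^ 2)⁻¹ : ℝ) := fun j => by
    rw [← bracket_neg_one_sq]; push_cast; ring
  simp_rw [h2]
  rw [← Finset.sum_mul, ← Complex.ofReal_sum, bracket_neg_one_sq,
    ← EuclideanSpace.real_norm_sq_eq, ← one_add_mul, ← Complex.ofReal_one, ← Complex.ofReal_add,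
    ← Complex.ofReal_mul, mul_inv_cancel₀ (one_add_normSq_pos x).ne', Complex.ofReal_one, one_mul]

end Bracket

/-! ### Fourier transform of the conjugate operator -/

section Conj

variable {ν : ℕ} {u : X ν → X ν}

theorem IsInClassU.bddSmooth (hu : IsInClassU u) : BddSmooth u := ⟨hu.smooth, hu.bounded⟩

/-- The vector field of the frequency space whose flow implements `e^{iτA_u}`. -/
def freqField (u : X ν → X ν) (ξ : X ν) : X ν := -((2 * Real.pi)⁻¹ • u ((2 * Real.pi) • ξ))

/-- Half the divergence of `freqField u`. -/
def freqDiv (u : X ν → X ν) (ξ : X ν) : ℝ :=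
  1 / 2 * ∑ j, fderiv ℝ (freqField u) ξ (EuclideanSpace.single j 1) j

theorem bddSmooth_scaled (hu : BddSmooth u) : BddSmooth fun ξ : X ν => u ((2 * Real.pi) • ξ) :=
  hu.comp_clm ((2 * Real.pi) • ContinuousLinearMap.id ℝ (X ν))

theorem bddSmooth_freqField (hu : BddSmooth u) : BddSmooth (freqField u) :=
  (bddSmooth_scaled hu).clm_comp (-((2 * Real.pi)⁻¹ • ContinuousLinearMap.id ℝ (X ν)))

theorem bddSmooth_freqDiv (hu : BddSmooth u) : BddSmooth (freqDiv u) := by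
  have h1 : ∀ j : Fin ν, BddSmooth fun ξ =>
      fderiv ℝ (freqField u) ξ (EuclideanSpace.single j 1) j := fun j =>
    (bddSmooth_freqField hu).fderiv.clm_comp ((EuclideanSpace.proj j : X ν →L[ℝ] ℝ).comp
      (ContinuousLinearMap.apply ℝ (X ν) (EuclideanSpace.single j 1)))
  exact (BddSmooth.sum (s := Finset.univ) fun j _ => h1 j).clm_comp
    ((1 / 2 : ℝ) • ContinuousLinearMap.id ℝ ℝ)

theorem inner_single (x : X ν) (j : Fin ν) : inner ℝ x (EuclideanSpace.single j 1) = x j := by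
  simp [EuclideanSpace.inner_single_right]

theorem qOp_eq (j : Fin ν) (f : 𝓢(X ν, ℂ)) :
    qOp j f = SchwartzMap.smulLeftCLM ℂ (inner ℝ · (EuclideanSpace.single j (1 : ℝ))) f := by
  ext x
  have h1 : Function.HasTemperateGrowth (inner ℝ · (EuclideanSpace.single j (1 : ℝ)) : X ν → ℝ) := by
    fun_prop
  rw [qOp, SchwartzMap.smulLeftCLM_apply_apply (hasTemperateGrowth_coord j),
    SchwartzMap.smulLeftCLM_apply_apply h1, inner_single]
  simp

theorem fourier_qOp (j : Fin ν) (f : 𝓢(X ν, ℂ)) :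
    𝓕 (qOp j f) = (Complex.I / (2 * Real.pi)) • ∂_{EuclideanSpace.single j (1 : ℝ)} (𝓕 f) := by
  rw [SchwartzMap.lineDerivOp_fourier_eq, ← qOp_eq, FourierTransform.fourier_smul, smul_smul]
  have : (Complex.I / (2 * Real.pi)) * -(2 * Real.pi * Complex.I) = 1 := by
    have : (Real.pi : ℂ) ≠ 0 := Complex.ofReal_ne_zero.2 Real.pi_ne_zero
    field_simp
    rw [Complex.I_sq]; ring
  rw [this, one_smul]

theorem fourier_qOp_apply (j : Fin ν) (f : 𝓢(X ν, ℂ)) (ξ : X ν) :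
    𝓕 (qOp j f) ξ = (Complex.I / (2 * Real.pi)) *
      fderiv ℝ (𝓕 f : 𝓢(X ν, ℂ)) ξ (EuclideanSpace.single j 1) := by
  rw [fourier_qOp, smul_apply, SchwartzMap.lineDerivOp_apply_eq_fderiv, smul_eq_mul]

theorem hasTemperateGrowth_scaled (hu : BddSmooth u) (j : Fin ν) :
    Function.HasTemperateGrowth (fun ξ : X ν => ((u ((2 * Real.pi) • ξ) j : ℝ) : ℂ)) :=
  ((bddSmooth_scaled hu).clm_comp (EuclideanSpace.proj j : X ν →L[ℝ] ℝ)).ofReal.hasTemperateGrowth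

theorem fourier_uOp (j : Fin ν) (f : 𝓢(X ν, ℂ)) :
    𝓕 (uOp u j f) = SchwartzMap.smulLeftCLM ℂ (fun ξ : X ν => ((u ((2 * Real.pi) • ξ) j : ℝ) : ℂ)) (𝓕 f) := by
  rw [uOp, SchwartzMap.fourierMultiplierCLM_apply, FourierTransform.fourier_fourierInv_eq]

theorem fourier_uOp_apply (hu : BddSmooth u) (j : Fin ν) (f : 𝓢(X ν, ℂ)) (ξ : X ν) :
    𝓕 (uOp u j f) ξ = ((u ((2 * Real.pi) • ξ) j : ℝ) : ℂ) * 𝓕 f ξ := by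
  rw [fourier_uOp, SchwartzMap.smulLeftCLM_apply_apply (hasTemperateGrowth_scaled hu j), smul_eq_mul]

/-- Moving every `q_j` to the right of `u_j(p)` leaves half the sum of the commutators, a
multiplication by a derivative of `u`; the factors of `2π` in the frequency field make it `-i` times
its half divergence. -/
theorem fourier_conjSchwartz_apply (hu : BddSmooth u) (f : 𝓢(X ν, ℂ)) (ξ : X ν) :
    𝓕 (conjSchwartz u f) ξ = ∑ j, ((u ((2 * Real.pi) • ξ) j : ℝ) : ℂ) * 𝓕 (qOp j f) ξ
      - Complex.I * (freqDiv u ξ : ℂ) * 𝓕 f ξ := by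
  have hpi : (Real.pi : ℂ) ≠ 0 := Complex.ofReal_ne_zero.2 Real.pi_ne_zero
  have hsc := bddSmooth_scaled hu
  have hcoord : ∀ j : Fin ν, BddSmooth fun ξ : X ν => u ((2 * Real.pi) • ξ) j := fun j =>
    hsc.clm_comp (EuclideanSpace.proj j : X ν →L[ℝ] ℝ)
  have h1 : ∀ j : Fin ν, 𝓕 (qOp j (uOp u j f)) ξ =
      ((u ((2 * Real.pi) • ξ) j : ℝ) : ℂ) * 𝓕 (qOp j f) ξ + (Complex.I / (2 * Real.pi)) *
        ((fderiv ℝ (fun ξ : X ν => u ((2 * Real.pi) • ξ) j) ξ (EuclideanSpace.single j 1) : ℝ) : ℂ) *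
        𝓕 f ξ := by
    intro j
    have e1 : ((𝓕 (uOp u j f) : 𝓢(X ν, ℂ)) : X ν → ℂ) =
        fun ξ => ((u ((2 * Real.pi) • ξ) j : ℝ) : ℂ) * 𝓕 f ξ := by
      ext ξ; exact fourier_uOp_apply hu j f ξ
    have e2 : HasFDerivAt (fun ξ : X ν => ((u ((2 * Real.pi) • ξ) j : ℝ) : ℂ))
        (Complex.ofRealCLM.comp (fderiv ℝ (fun ξ : X ν => u ((2 * Real.pi) • ξ) j) ξ)) ξ :=
      Complex.ofRealCLM.hasFDerivAt.comp ξ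
        ((hcoord j).smooth.differentiable (by simp) ξ).hasFDerivAt
    have e3 : HasFDerivAt (𝓕 f : 𝓢(X ν, ℂ)) (fderiv ℝ (𝓕 f : 𝓢(X ν, ℂ)) ξ) ξ :=
      ((𝓕 f : 𝓢(X ν, ℂ)).differentiable ξ).hasFDerivAt
    rw [fourier_qOp_apply, fourier_qOp_apply, e1, (e2.fun_mul e3).fderiv]
    simp only [add_apply, smul_apply, smul_eq_mul,
      ContinuousLinearMap.comp_apply, Complex.ofRealCLM_apply]
    ring
  have h2 : ∀ j : Fin ν,
      fderiv ℝ (fun ξ : X ν => u ((2 * Real.pi) • ξ) j) ξ (EuclideanSpace.single j 1)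
        = -(2 * Real.pi) * fderiv ℝ (freqField u) ξ (EuclideanSpace.single j 1) j := by
    intro j
    have hd : HasFDerivAt (fun ξ : X ν => u ((2 * Real.pi) • ξ))
        (fderiv ℝ (fun ξ : X ν => u ((2 * Real.pi) • ξ)) ξ) ξ :=
      (hsc.smooth.differentiable (by simp) ξ).hasFDerivAt
    have e1 : HasFDerivAt (freqField u)
        (-((2 * Real.pi)⁻¹ • fderiv ℝ (fun ξ : X ν => u ((2 * Real.pi) • ξ)) ξ)) ξ :=
      (hd.const_smul (2 * Real.pi)⁻¹).neg
    have e2 : HasFDerivAt (fun ξ : X ν => u ((2 * Real.pi) • ξ) j)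
        ((EuclideanSpace.proj j : X ν →L[ℝ] ℝ).comp
          (fderiv ℝ (fun ξ : X ν => u ((2 * Real.pi) • ξ)) ξ)) ξ :=
      (EuclideanSpace.proj j : X ν →L[ℝ] ℝ).hasFDerivAt.comp ξ hd
    rw [e1.fderiv, e2.fderiv]
    simp only [ContinuousLinearMap.comp_apply, neg_apply,
      smul_apply, PiLp.neg_apply, PiLp.smul_apply, smul_eq_mul]
    field_simp
    rfl
  have h3 : 𝓕 (conjSchwartz u f) = (1 / 2 : ℂ) • ∑ j, (𝓕 (uOp u j (qOp j f)) + 𝓕 (qOp j (uOp u j f))) := by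
    simp only [conjSchwartz, smul_apply, sum_apply,
      add_apply, ContinuousLinearMap.comp_apply, FourierTransform.fourier_smul]
    congr 1
    rw [show ∀ g : 𝓢(X ν, ℂ), 𝓕 g = FourierTransform.fourierCLM ℂ 𝓢(X ν, ℂ) g from fun _ => rfl, map_sum]
    simp
  rw [h3, smul_apply, sum_apply]
  simp only [add_apply, fourier_uOp_apply hu, h1, h2, freqDiv, smul_eq_mul]
  push_cast
  rw [Finset.mul_sum, Finset.mul_sum, Finset.mul_sum, Finset.sum_mul, ← Finset.sum_sub_distrib]
  refine Finset.sum_congr rfl fun j _ => ?_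
  field_simp
  ring

end Conj

end

section

open FourierTransform LineDeriv
open scoped BoundedContinuousFunction

/-! ### The generator of the transported group -/

section Generator

variable {ν : ℕ} {u : X ν → X ν}

/-- A bounded smooth real function, as a bounded continuous complex function. -/
def BddSmooth.toBCF {a : X ν → ℝ} (ha : BddSmooth a) : X ν →ᵇ ℂ :=
  BoundedContinuousFunction.ofNormedAddCommGroup (fun x => (a x : ℂ))
    ha.ofReal.smooth.continuous ha.ofReal.exists_norm_le.choose ha.ofReal.exists_norm_le.choose_spec

@[simp] theorem BddSmooth.toBCF_apply {a : X ν → ℝ} (ha : BddSmooth a) (x : X ν) :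
    ha.toBCF x = a x := rfl

theorem BddSmooth.hasTemperateGrowth_toBCF {a : X ν → ℝ} (ha : BddSmooth a) :
    Function.HasTemperateGrowth (ha.toBCF : X ν → ℂ) := ha.ofReal.hasTemperateGrowth

theorem bddSmooth_coord (hu : BddSmooth u) (j : Fin ν) :
    BddSmooth fun ξ : X ν => u ((2 * Real.pi) • ξ) j :=
  (bddSmooth_scaled hu).clm_comp (EuclideanSpace.proj j : X ν →L[ℝ] ℝ)

/-- The Fourier transform of `L²` as a linear isometry. -/
abbrev fourierL2 (ν : ℕ) : L2 ν ≃ₗᵢ[ℂ] L2 ν := Lp.fourierTransformₗᵢ (X ν) ℂ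

theorem fourierL2_schwartz (f : 𝓢(X ν, ℂ)) : fourierL2 ν (f.toLp 2) = (𝓕 f).toLp 2 :=
  SchwartzMap.toLp_fourier_eq f

abbrev bm1 (ν : ℕ) : X ν →ᵇ ℂ := bracketBCF (by norm_num : (-1 : ℝ) ≤ 0)

/-- The bounded operator `A_u ⟨q⟩⁻¹`. -/
def conjBracket (hu : BddSmooth u) : L2 ν →L[ℂ] L2 ν :=
  (fourierL2 ν).symm.toContinuousLinearEquiv.toContinuousLinearMap ∘L
    (∑ j, mulL2 (bddSmooth_coord hu j).toBCF ∘L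
        (fourierL2 ν).toContinuousLinearEquiv.toContinuousLinearMap ∘L mulL2 (coordBCF j) -
      Complex.I • (mulL2 (bddSmooth_freqDiv hu).toBCF ∘L
        (fourierL2 ν).toContinuousLinearEquiv.toContinuousLinearMap ∘L mulL2 (bm1 ν)))

theorem fourierL2_conjBracket (hu : BddSmooth u) (k : L2 ν) :
    fourierL2 ν (conjBracket hu k) =
      ∑ j, mulL2 (bddSmooth_coord hu j).toBCF (fourierL2 ν (mulL2 (coordBCF j) k)) -
      Complex.I • (mulL2 (bddSmooth_freqDiv hu).toBCF (fourierL2 ν (mulL2 (bm1 ν) k))) := by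
  simp only [conjBracket, ContinuousLinearMap.comp_apply]
  exact ((fourierL2 ν).apply_symm_apply _).trans (by simp)

theorem mulL2_coord_schwartz (j : Fin ν) (k : 𝓢(X ν, ℂ)) :
    mulL2 (coordBCF j) (k.toLp 2) =
      (qOp j (SchwartzMap.smulLeftCLM ℂ (bracket (-1)) k)).toLp 2 := by
  rw [mulL2_schwartz _ (hasTemperateGrowth_coordBCF j), qOp,
    SchwartzMap.smulLeftCLM_smulLeftCLM_apply (hasTemperateGrowth_coord j)
      (hasTemperateGrowth_bracket _)]
  rfl

theorem toLp_sum_sub {ι : Type*} (s : Finset ι) (F : ι → 𝓢(X ν, ℂ)) (c : ℂ) (G : 𝓢(X ν, ℂ)) :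
    (∑ j ∈ s, F j - c • G).toLp 2 volume = ∑ j ∈ s, (F j).toLp 2 volume - c • G.toLp 2 volume := by
  have h : ∀ f : 𝓢(X ν, ℂ), f.toLp 2 volume = SchwartzMap.toLpCLM ℂ ℂ 2 volume f := fun _ => rfl
  simp only [h, map_sub, map_sum, map_smul]

theorem conjBracket_schwartz (hu : BddSmooth u) (k : 𝓢(X ν, ℂ)) :
    conjBracket hu (k.toLp 2) =
      (conjSchwartz u (SchwartzMap.smulLeftCLM ℂ (bracket (-1)) k)).toLp 2 := by
  set g := SchwartzMap.smulLeftCLM ℂ (bracket (-1)) k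
  apply (fourierL2 ν).injective
  have hb : mulL2 (bm1 ν) (k.toLp 2) = g.toLp 2 := mulL2_schwartz _ (hasTemperateGrowth_bracket _) k
  obtain ⟨F, hF⟩ : ∃ F : Fin ν → 𝓢(X ν, ℂ), ∀ j, F j =
      SchwartzMap.smulLeftCLM ℂ (bddSmooth_coord hu j).toBCF (𝓕 (qOp j g)) := ⟨_, fun _ => rfl⟩
  obtain ⟨G, hG⟩ : ∃ G : 𝓢(X ν, ℂ), G =
      SchwartzMap.smulLeftCLM ℂ (bddSmooth_freqDiv hu).toBCF (𝓕 g) := ⟨_, rfl⟩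
  have h1 : ∀ j, mulL2 (bddSmooth_coord hu j).toBCF
      (fourierL2 ν (mulL2 (coordBCF j) (k.toLp 2))) = (F j).toLp 2 volume := fun j => by
    rw [hF, mulL2_coord_schwartz, fourierL2_schwartz]
    exact mulL2_schwartz _ (bddSmooth_coord hu j).hasTemperateGrowth_toBCF _
  have h2 : mulL2 (bddSmooth_freqDiv hu).toBCF (fourierL2 ν (mulL2 (bm1 ν) (k.toLp 2)))
      = G.toLp 2 volume := by
    rw [hG, hb, fourierL2_schwartz]
    exact mulL2_schwartz _ (bddSmooth_freqDiv hu).hasTemperateGrowth_toBCF _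
  have key : 𝓕 (conjSchwartz u g) = ∑ j, F j - Complex.I • G := by
    ext ξ
    rw [fourier_conjSchwartz_apply hu, sub_apply, sum_apply, smul_apply, hG,
      SchwartzMap.smulLeftCLM_apply_apply (bddSmooth_freqDiv hu).hasTemperateGrowth_toBCF]
    congr 1
    · refine Finset.sum_congr rfl fun j _ => ?_
      rw [hF, SchwartzMap.smulLeftCLM_apply_apply (bddSmooth_coord hu j).hasTemperateGrowth_toBCF]
      rfl
    · simp only [BddSmooth.toBCF_apply, smul_eq_mul]; ring
  rw [fourierL2_conjBracket, fourierL2_schwartz, key, h2]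
  simp_rw [h1]
  exact (toLp_sum_sub _ _ _ _).symm

theorem dense_range_testFunToL2 : DenseRange (testFunToL2 ν) := by
  intro f
  refine (mem_closure_iff_nhds_basis Metric.nhds_basis_closedBall).2 fun ε hε => ?_
  obtain ⟨g, hg₁, hg₂, hg₃⟩ := MemLp.exist_eLpNorm_sub_le (μ := (volume : Measure (X ν)))
    (ENNReal.ofNat_ne_top (n := 2)) one_le_two (Lp.memLp f) hε
  refine ⟨(hg₁.toSchwartzMap hg₂).toLp 2, ⟨⟨hg₁.toSchwartzMap hg₂, hg₁⟩, rfl⟩, ?_⟩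
  have : (f : X ν → ℂ) - ((hg₁.toSchwartzMap hg₂).toLp 2 (volume : Measure (X ν)) : X ν → ℂ) =ᵐ[volume]
      (f : X ν → ℂ) - g := by
    filter_upwards [(hg₁.toSchwartzMap hg₂).coeFn_toLp 2 volume]
    simp
  simp only [Metric.mem_closedBall', Lp.dist_def, eLpNorm_congr_ae this]
  grw [hg₃, ENNReal.toReal_ofReal hε.le]
  exact ENNReal.ofReal_ne_top

theorem mem_graph_conjOpMin (u : X ν → X ν) (f : testFun ν) :
    (testFunToL2 ν f, (conjSchwartz u f).toLp 2 volume) ∈ (conjOpMin u).graph := by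
  rw [LinearPMap.mem_graph_iff]
  refine ⟨⟨testFunToL2 ν f, f, rfl⟩, rfl, ?_⟩
  have : (LinearEquiv.ofInjective (testFunToL2 ν) (testFunToL2_injective ν)).symm
      ⟨testFunToL2 ν f, f, rfl⟩ = f := by
    rw [LinearEquiv.symm_apply_eq]; rfl
  change (conjSchwartz u ((LinearEquiv.ofInjective (testFunToL2 ν) (testFunToL2_injective ν)).symm
      ⟨testFunToL2 ν f, f, rfl⟩ : testFun ν)).toLp 2 = _
  rw [this]

theorem exists_of_mem_graph_conjOpMin {p : L2 ν × L2 ν} (h : p ∈ (conjOpMin u).graph) :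
    ∃ f : 𝓢(X ν, ℂ), p = (f.toLp 2, (conjSchwartz u f).toLp 2 volume) := by
  obtain ⟨y, h1, h2⟩ := (LinearPMap.mem_graph_iff _).1 h
  obtain ⟨f, hf⟩ := y.2
  have h3 := (LinearPMap.mem_graph_iff _).1 (mem_graph_conjOpMin u f)
  obtain ⟨y', h1', h2'⟩ := h3
  have : y' = y := Subtype.ext (by rw [h1', ← hf])
  subst this
  exact ⟨f, Prod.ext (by rw [← h1, h1']; rfl) (by rw [← h2, h2'])⟩

/-- For `k` in `C_c^∞` the pair is in the graph, since `⟨x⟩⁻¹` preserves compact supports. Both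
components depend continuously on `k`, so the closure of the operator is defined on `⟨q⟩⁻¹ L²`. -/
theorem mem_closure_graph_conjBracket (hu : BddSmooth u) (k : L2 ν) :
    (mulL2 (bm1 ν) k, conjBracket hu k) ∈ (conjOpMin u).graph.topologicalClosure := by
  have hcl : IsClosed {k | (mulL2 (bm1 ν) k, conjBracket hu k) ∈
      (conjOpMin u).graph.topologicalClosure} :=
    (Submodule.isClosed_topologicalClosure _).preimage
      ((mulL2 (bm1 ν)).continuous.prodMk (conjBracket hu).continuous)
  refine dense_range_testFunToL2.induction_on
    (p := fun k => (mulL2 (bm1 ν) k, conjBracket hu k) ∈ (conjOpMin u).graph.topologicalClosure)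
    k hcl fun f => ?_
  refine Submodule.le_topologicalClosure _ ?_
  change (mulL2 (bm1 ν) ((f : 𝓢(X ν, ℂ)).toLp 2), conjBracket hu ((f : 𝓢(X ν, ℂ)).toLp 2)) ∈ _
  rw [conjBracket_schwartz, mulL2_schwartz _ (hasTemperateGrowth_bracket _)]
  have hc : HasCompactSupport (SchwartzMap.smulLeftCLM ℂ (bracket (-1)) (f : 𝓢(X ν, ℂ))) := by
    have h1 : HasCompactSupport (f : 𝓢(X ν, ℂ)) := f.2
    refine h1.of_isClosed_subset (isClosed_tsupport _) ?_
    exact (SchwartzMap.tsupport_smulLeftCLM_subset _ _).trans inter_subset_left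
  exact mem_graph_conjOpMin u ⟨_, hc⟩

/-- `x_j F⁻¹ f = (i/2π) F⁻¹ ∂_j f`, with a bounded weight on both sides. -/
theorem mulL2_coord_fourier_symm {f : X ν → ℂ} (hf : Decay f) (j : Fin ν)
    (hf' : MemLp (fun x => fderiv ℝ f x (EuclideanSpace.single j 1)) 2 volume) :
    mulL2 (coordBCF j) ((fourierL2 ν).symm (hf.memLp.toLp f)) = mulL2 (bm1 ν)
      ((Complex.I / (2 * Real.pi)) • (fourierL2 ν).symm (hf'.toLp _)) := by
  set e : X ν := EuclideanSpace.single j 1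
  have hpi : (Real.pi : ℂ) ≠ 0 := Complex.ofReal_ne_zero.2 Real.pi_ne_zero
  -- The distributional derivative of a decaying `C^1` function is its classical one, by integration
  -- by parts against Schwartz functions.
  have h1 : ∂_{e} ((hf.memLp.toLp f : L2 ν) : 𝓢'(X ν, ℂ)) = ((hf'.toLp _ : L2 ν) : 𝓢'(X ν, ℂ)) := by
    ext ψ
    obtain ⟨C, hC0, hC⟩ := hf.bound
    have hψ := Decay.of_schwartz ψ
    obtain ⟨D, hD0, hD'⟩ := hψ.bound
    have hD : ∀ x, ‖ψ x‖ ≤ D ∧ ‖fderiv ℝ ψ x‖ ≤ D := fun x =>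
      ⟨(hD' x).1.trans (mul_le_of_le_one_right hD0 (decayWeight_le_one x)),
        (hD' x).2.trans (mul_le_of_le_one_right hD0 (decayWeight_le_one x))⟩
    have i1 : Integrable (fun x => fderiv ℝ f x e * ψ x) := by
      refine integrable_mul_of_le_decayWeight (C := C * ‖e‖) (D := D)
        ((hf.continuous_fderiv).clm_apply continuous_const) (fun x => ?_) ψ.continuous
        (fun x => (hD x).1)
      refine ((fderiv ℝ f x).le_opNorm e).trans ?_
      rw [mul_right_comm]
      exact mul_le_mul_of_nonneg_right (hC x).2 (norm_nonneg _)
    have i2 : Integrable (fun x => f x * fderiv ℝ ψ x e) := by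
      refine integrable_mul_of_le_decayWeight (C := C) (D := D * ‖e‖) hf.contDiff.continuous
        (fun x => (hC x).1) ((hψ.continuous_fderiv).clm_apply continuous_const) (fun x => ?_)
      refine ((fderiv ℝ ψ x).le_opNorm e).trans ?_
      exact mul_le_mul_of_nonneg_right (hD x).2 (norm_nonneg _)
    have i3 : Integrable (fun x => f x * ψ x) :=
      integrable_mul_of_le_decayWeight hf.contDiff.continuous (fun x => (hC x).1) ψ.continuous
        (fun x => (hD x).1)
    have key := integral_mul_fderiv_eq_neg_fderiv_mul_of_integrable (𝕜 := ℂ) (f := f) (g := ψ) (v := e) i1 i2 i3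
      (fun x _ => hf.differentiable x) (fun x _ => ψ.differentiable x)
    rw [TemperedDistribution.lineDerivOp_apply_apply, map_neg, Lp.toTemperedDistribution_apply,
      Lp.toTemperedDistribution_apply]
    rw [integral_congr_ae (g := fun x => f x * fderiv ℝ ψ x e), key, neg_neg]
    · refine integral_congr_ae ?_
      filter_upwards [hf'.coeFn_toLp] with x hx
      rw [hx, smul_eq_mul, mul_comm]
    · filter_upwards [hf.memLp.coeFn_toLp] with x hx
      rw [hx, smul_eq_mul, mul_comm, SchwartzMap.lineDerivOp_apply_eq_fderiv]
  have h2 : ∀ g : L2 ν, (((fourierL2 ν).symm g : L2 ν) : 𝓢'(X ν, ℂ)) = 𝓕⁻ (g : 𝓢'(X ν, ℂ)) :=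
    fun g => (Lp.fourierInv_toTemperedDistribution_eq g).symm
  apply Sob.toTemperedDistributionCLM_injective
  simp only [Lp.toTemperedDistributionCLM_apply]
  rw [toTemperedDistribution_mulL2 _ (hasTemperateGrowth_coordBCF j),
    toTemperedDistribution_mulL2 _ (hasTemperateGrowth_bracket _), h2]
  have h3 : ((((Complex.I / (2 * Real.pi)) • (fourierL2 ν).symm (hf'.toLp _) : L2 ν)) : 𝓢'(X ν, ℂ))
      = (Complex.I / (2 * Real.pi)) • 𝓕⁻ ((hf'.toLp _ : L2 ν) : 𝓢'(X ν, ℂ)) := by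
    rw [← h2]
    exact map_smul (Lp.toTemperedDistributionCLM ℂ (volume : Measure (X ν)) 2) _ _
  rw [h3, ← h1, TemperedDistribution.fourierInv_lineDerivOp_eq, smul_smul]
  have h4 : (Complex.I / (2 * Real.pi)) * -(2 * Real.pi * Complex.I) = 1 := by
    field_simp
    rw [Complex.I_sq]; ring
  have h5 : Function.HasTemperateGrowth (fun x : X ν => ((inner ℝ x e : ℝ) : ℂ)) := by fun_prop
  rw [h4, one_smul, coe_bracketBCF, TemperedDistribution.smulLeftCLM_smulLeftCLM_apply
    h5 (hasTemperateGrowth_bracket _)]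
  congr 2
  ext x
  simp only [coordBCF_apply, Pi.mul_apply, e, inner_single]

end Generator

end

section

open FourierTransform LineDeriv
open scoped BoundedContinuousFunction

/-! ### The group in position space and the identification of its generator -/

section Group

variable {ν : ℕ} {u : X ν → X ν} {φ : ℝ → X ν → X ν} {z : ℝ → X ν → ℝ}
  {U : ℝ → (L2 ν ≃ₗᵢ[ℂ] L2 ν)}

theorem map_eq_sum_single (L : X ν →L[ℝ] ℂ) (y : X ν) :
    L y = ∑ j, (y j : ℂ) * L (EuclideanSpace.single j 1) := by
  have : y = ∑ j, y j • EuclideanSpace.single j (1 : ℝ) := by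
    ext i
    rw [WithLp.ofLp_sum, Finset.sum_apply]
    simp
  conv_lhs => rw [this, map_sum]
  refine Finset.sum_congr rfl fun j _ => ?_
  rw [map_smul, Complex.real_smul]

theorem transportGen_freq (f : X ν → ℂ) (ξ : X ν) :
    -Complex.I * transportGen (freqField u) (freqDiv u) f ξ =
      ∑ j, ((u ((2 * Real.pi) • ξ) j : ℝ) : ℂ) * ((Complex.I / (2 * Real.pi)) *
        fderiv ℝ f ξ (EuclideanSpace.single j 1)) - Complex.I * (freqDiv u ξ : ℂ) * f ξ := by
  have hpi : (Real.pi : ℂ) ≠ 0 := Complex.ofReal_ne_zero.2 Real.pi_ne_zero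
  have h1 : ∀ j, ((freqField u ξ j : ℝ) : ℂ) = -(1 / (2 * Real.pi)) * (u ((2 * Real.pi) • ξ) j : ℝ) := by
    intro j
    simp [freqField]
  rw [transportGen, map_eq_sum_single]
  simp_rw [h1]
  rw [mul_add, Finset.mul_sum, sub_eq_add_neg]
  congr 1
  · refine Finset.sum_congr rfl fun j _ => ?_
    field_simp
  · ring

/-- The group `e^{iτA_u}` in position space. -/
def positionGroup (U : ℝ → (L2 ν ≃ₗᵢ[ℂ] L2 ν)) (t : ℝ) : L2 ν ≃ₗᵢ[ℂ] L2 ν :=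
  (fourierL2 ν).trans ((U t).trans (fourierL2 ν).symm)

theorem positionGroup_apply (t : ℝ) (f : L2 ν) :
    positionGroup U t f = (fourierL2 ν).symm (U t (fourierL2 ν f)) := rfl

theorem fourierL2_positionGroup (t : ℝ) (f : L2 ν) :
    fourierL2 ν (positionGroup U t f) = U t (fourierL2 ν f) := by
  rw [positionGroup_apply, LinearIsometryEquiv.apply_symm_apply]

theorem positionGroup_map_add (hU : IsTransportGroup φ z U)
    (h : IsWeightedFlow (freqField u) (freqDiv u) φ z) (s t : ℝ) (f : L2 ν) :
    positionGroup U (s + t) f = positionGroup U s (positionGroup U t f) := by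
  simp only [positionGroup_apply, hU.map_add h, LinearIsometryEquiv.apply_symm_apply]

theorem neg_I_smul_toLp_transportGen (hu : BddSmooth u) {f : X ν → ℂ} (hf : Decay f)
    (g : L2 ν) (hg : ∀ᵐ ξ, g ξ = ∑ j, ((u ((2 * Real.pi) • ξ) j : ℝ) : ℂ) * ((Complex.I / (2 * Real.pi)) *
        fderiv ℝ f ξ (EuclideanSpace.single j 1)) - Complex.I * (freqDiv u ξ : ℂ) * f ξ) :
    Complex.I • g =
      (hf.memLp_transportGen (bddSmooth_freqField hu) (bddSmooth_freqDiv hu)).toLp _ := by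
  refine Lp.ext ?_
  filter_upwards [Lp.coeFn_smul Complex.I g, hg,
    (hf.memLp_transportGen (bddSmooth_freqField hu) (bddSmooth_freqDiv hu)).coeFn_toLp]
    with ξ h1 h2 h3
  rw [h1, Pi.smul_apply, h2, h3, ← transportGen_freq, smul_eq_mul, ← mul_assoc, mul_neg,
    Complex.I_mul_I, neg_neg, one_mul]

theorem hasDerivAt_positionGroup (hu : BddSmooth u) (hU : IsTransportGroup φ z U)
    (h : IsWeightedFlow (freqField u) (freqDiv u) φ z) {f : X ν → ℂ} (hf : Decay f) :
    HasDerivAt (fun t => positionGroup U t ((fourierL2 ν).symm (hf.memLp.toLp f)))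
      ((fourierL2 ν).symm
        ((hf.memLp_transportGen (bddSmooth_freqField hu) (bddSmooth_freqDiv hu)).toLp _)) 0 := by
  have h1 := hU.hasDerivAt_decay h (bddSmooth_freqField hu) (bddSmooth_freqDiv hu) hf
  have h2 := (((fourierL2 ν).symm.toContinuousLinearEquiv.toContinuousLinearMap).restrictScalars
    ℝ).hasFDerivAt.comp_hasDerivAt 0 h1
  refine h2.congr_of_eventuallyEq (Eventually.of_forall fun t => ?_)
  change positionGroup U t _ = _
  rw [positionGroup_apply, LinearIsometryEquiv.apply_symm_apply]
  rfl

theorem hasDerivAt_positionGroup_schwartz (hu : BddSmooth u) (hU : IsTransportGroup φ z U)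
    (h : IsWeightedFlow (freqField u) (freqDiv u) φ z) (f : 𝓢(X ν, ℂ)) :
    HasDerivAt (fun t => positionGroup U t (f.toLp 2))
      (Complex.I • (conjSchwartz u f).toLp 2 (volume : Measure (X ν))) 0 := by
  have h1 := hasDerivAt_positionGroup hu hU h (Decay.of_schwartz (𝓕 f))
  have e1 : (fourierL2 ν).symm ((Decay.of_schwartz (𝓕 f)).memLp.toLp _) = f.toLp 2 := by
    rw [LinearIsometryEquiv.symm_apply_eq, fourierL2_schwartz]; rfl
  rw [e1, ← neg_I_smul_toLp_transportGen hu (Decay.of_schwartz (𝓕 f))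
    ((𝓕 (conjSchwartz u f)).toLp 2)] at h1
  · rwa [map_smul, ← fourierL2_schwartz, LinearIsometryEquiv.symm_apply_apply] at h1
  · filter_upwards [(𝓕 (conjSchwartz u f)).coeFn_toLp 2] with ξ hξ
    rw [hξ, fourier_conjSchwartz_apply hu]
    simp_rw [fourier_qOp_apply]

theorem conjOpMin_graph_le (hu : BddSmooth u) (hU : IsTransportGroup φ z U)
    (h : IsWeightedFlow (freqField u) (freqDiv u) φ z) :
    (conjOpMin u).graph ≤ generatorGraph (positionGroup U) := by
  intro p hp
  obtain ⟨f, rfl⟩ := exists_of_mem_graph_conjOpMin hp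
  exact mem_generatorGraph.2 (hasDerivAt_positionGroup_schwartz hu hU h f)

/-- Frequency functions which are only `C^1` need not come from Schwartz functions, yet transport
produces no better. They are reached in the closed graph because `⟨x⟩` times their inverse Fourier
transform is square integrable, so that `mem_closure_graph_conjBracket` applies. -/
theorem mem_closure_graph_decay (hu : BddSmooth u) {f : X ν → ℂ} (hf : Decay f) :
    ∃ g, Complex.I • g = (fourierL2 ν).symm
        ((hf.memLp_transportGen (bddSmooth_freqField hu) (bddSmooth_freqDiv hu)).toLp _) ∧
      ((fourierL2 ν).symm (hf.memLp.toLp f), g) ∈ (conjOpMin u).graph.topologicalClosure := by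
  set c : ℂ := Complex.I / (2 * Real.pi) with hc
  set h := (fourierL2 ν).symm (hf.memLp.toLp f) with hh
  have hf' : ∀ j : Fin ν, MemLp (fun x => fderiv ℝ f x (EuclideanSpace.single j 1)) 2 volume := by
    intro j
    obtain ⟨C, hC0, hC⟩ := hf.bound
    refine memLp_two_of_le_decayWeight (C := C * ‖EuclideanSpace.single j (1 : ℝ)‖)
      (hf.continuous_fderiv.clm_apply continuous_const) fun x => ?_
    refine ((fderiv ℝ f x).le_opNorm _).trans ?_
    rw [mul_right_comm]
    exact mul_le_mul_of_nonneg_right (hC x).2 (norm_nonneg _)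
  set w : Fin ν → L2 ν := fun j => c • (fourierL2 ν).symm ((hf' j).toLp _) with hw
  have h1 : ∀ j, mulL2 (coordBCF j) h = mulL2 (bm1 ν) (w j) := fun j =>
    mulL2_coord_fourier_symm hf j (hf' j)
  -- This `k` is `⟨x⟩h`: one has `w_j = x_j h`, and `⟨x⟩ = ⟨x⟩⁻¹(1 + ∑ x_j²)`.
  set k := mulL2 (bm1 ν) h + ∑ j, mulL2 (coordBCF j) (w j) with hk
  have h2 : mulL2 (bm1 ν) k = h := by
    rw [hk, map_add, map_sum]
    simp_rw [mulL2_comm (bm1 ν) (coordBCF _), ← h1]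
    exact bracket_sq_add_sum_coord h
  have h3 : ∀ j, mulL2 (coordBCF j) k = w j := fun j => by
    refine mulL2_injective (a := bm1 ν) (fun x => bracket_ne_zero _ x) ?_
    rw [mulL2_comm, h2, h1]
  refine ⟨conjBracket hu k, ?_, by
    have := mem_closure_graph_conjBracket hu k
    rwa [h2] at this⟩
  rw [LinearIsometryEquiv.eq_symm_apply, map_smul]
  refine neg_I_smul_toLp_transportGen hu hf _ ?_
  rw [fourierL2_conjBracket, h2]
  simp_rw [h3]
  have h4 : ∀ j, fourierL2 ν (w j) = c • (hf' j).toLp _ := fun j => by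
    rw [hw, map_smul, LinearIsometryEquiv.apply_symm_apply]
  have h5 : fourierL2 ν h = hf.memLp.toLp f := by rw [hh, LinearIsometryEquiv.apply_symm_apply]
  simp_rw [h4]
  rw [h5]
  have e1 : ∀ᵐ ξ, ∀ j, mulL2 (bddSmooth_coord hu j).toBCF (c • (hf' j).toLp _) ξ =
      ((u ((2 * Real.pi) • ξ) j : ℝ) : ℂ) * (c * fderiv ℝ f ξ (EuclideanSpace.single j 1)) := by
    refine ae_all_iff.2 fun j => ?_
    filter_upwards [coeFn_mulL2 (bddSmooth_coord hu j).toBCF (c • (hf' j).toLp _),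
      Lp.coeFn_smul c ((hf' j).toLp _), (hf' j).coeFn_toLp] with ξ a1 a2 a3
    rw [a1, a2, Pi.smul_apply, a3, BddSmooth.toBCF_apply, smul_eq_mul]
  filter_upwards [e1, Lp.coeFn_sub (∑ j, mulL2 (bddSmooth_coord hu j).toBCF (c • (hf' j).toLp _))
      (Complex.I • (mulL2 (bddSmooth_freqDiv hu).toBCF (hf.memLp.toLp f))),
    Lp.coeFn_finsetSum Finset.univ (fun j => mulL2 (bddSmooth_coord hu j).toBCF (c • (hf' j).toLp _)),
    Lp.coeFn_smul Complex.I (mulL2 (bddSmooth_freqDiv hu).toBCF (hf.memLp.toLp f)),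
    coeFn_mulL2 (bddSmooth_freqDiv hu).toBCF (hf.memLp.toLp f), hf.memLp.coeFn_toLp]
    with ξ a1 a2 a3 a4 a5 a6
  rw [a2, Pi.sub_apply, a3, Finset.sum_apply, a4, Pi.smul_apply, a5, a6]
  simp_rw [a1]
  rw [BddSmooth.toBCF_apply, smul_eq_mul, mul_assoc]

/-- The closed graph from `C_c^∞` lies in the graph of the generator, by differentiating on Schwartz
functions. Conversely the decaying frequency functions are dense, lie in the closed graph, and are
invariant under the group, so `generatorGraph_le` gives the other inclusion. -/
theorem isUnitaryGroupOf_positionGroup (hu : BddSmooth u) (hU : IsTransportGroup φ z U)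
    (h : IsWeightedFlow (freqField u) (freqDiv u) φ z) :
    IsUnitaryGroupOf (conjOp u) (positionGroup U) := by
  have hc : ∀ f, Continuous fun t => positionGroup U t f := fun f =>
    (fourierL2 ν).symm.continuous.comp
      (hU.continuous_apply h (bddSmooth_freqField hu) (bddSmooth_freqDiv hu) (fourierL2 ν f))
  have ha := positionGroup_map_add hU h
  have h0 : ∀ f, positionGroup U 0 f = f := fun f => by
    rw [positionGroup_apply, hU.map_zero h, LinearIsometryEquiv.symm_apply_apply]
  have hcl := isClosed_generatorGraph (V := positionGroup U) ha
  have hle1 : (conjOpMin u).graph.topologicalClosure ≤ generatorGraph (positionGroup U) :=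
    Submodule.topologicalClosure_minimal _ (conjOpMin_graph_le hu hU h) hcl
  have hle2 : generatorGraph (positionGroup U) ≤ (conjOpMin u).graph.topologicalClosure := by
    refine generatorGraph_le ha hc (Submodule.isClosed_topologicalClosure _)
      (D := range fun f : decaySubmodule ν => (fourierL2 ν).symm (decayToL2 ν f)) ?_ ?_
    · exact (fourierL2 ν).symm.surjective.denseRange.comp denseRange_decayToL2
        (fourierL2 ν).symm.continuous
    · rintro _ ⟨f, rfl⟩
      have hf : Decay f.1 := f.2
      obtain ⟨g, hg1, hg2⟩ := mem_closure_graph_decay hu hf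
      have hgen : ((fourierL2 ν).symm (hf.memLp.toLp f.1), g) ∈ generatorGraph (positionGroup U) :=
        hle1 hg2
      refine ⟨g, hgen, fun s => ?_⟩
      -- The orbit point is again a decaying function, hence has some image `g'` in the closed
      -- graph; it remains to recognise `g'` as the transported `g`.
      obtain ⟨hs, es⟩ := hU.apply_decay s f.1 hf
      obtain ⟨g', hg1', hg2'⟩ := mem_closure_graph_decay hu hs
      have e1 : positionGroup U s ((fourierL2 ν).symm (hf.memLp.toLp f.1)) =
          (fourierL2 ν).symm (hs.memLp.toLp _) := by
        rw [positionGroup_apply, LinearIsometryEquiv.apply_symm_apply, es]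
      change (positionGroup U s ((fourierL2 ν).symm (hf.memLp.toLp f.1)), _) ∈ _
      rw [e1]
      have hgen' : HasDerivAt (fun t => positionGroup U t ((fourierL2 ν).symm (hs.memLp.toLp _)))
        (Complex.I • g') 0 := hle1 hg2'
      rw [← e1] at hgen'
      -- The group commutes with itself, hence with its generator; uniqueness of the derivative then
      -- gives `g' = U_s g`.
      have hgen'' : HasDerivAt (fun t => positionGroup U t
          (positionGroup U s ((fourierL2 ν).symm (hf.memLp.toLp f.1))))
          (positionGroup U s (Complex.I • g)) 0 := by
        have := (((positionGroup U s).toContinuousLinearEquiv.toContinuousLinearMap).restrictScalars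
          ℝ).hasFDerivAt.comp_hasDerivAt 0 hgen
        refine this.congr_of_eventuallyEq (Eventually.of_forall fun t => ?_)
        change positionGroup U t (positionGroup U s _) = positionGroup U s (positionGroup U t _)
        rw [← ha, ← ha, add_comm]
      have e2 := hgen'.unique hgen''
      rw [map_smul] at e2
      have e3 := smul_right_injective (L2 ν) Complex.I_ne_zero e2
      rw [← e3]
      exact hg2'
  have hgr : (conjOpMin u).graph.topologicalClosure = generatorGraph (positionGroup U) :=
    le_antisymm hle1 hle2
  -- Needed because `LinearPMap.closure` of a non-closable operator is the operator itself.
  -- Closability follows since the closure of the graph is a generator's graph, which is single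
  -- valued.
  have hclosable : (conjOpMin u).IsClosable := by
    refine ⟨(generatorGraph (positionGroup U)).toLinearPMap, ?_⟩
    rw [Submodule.toLinearPMap_graph_eq, hgr]
    rintro ⟨x, y⟩ hxy hx
    simp only at hx
    subst hx
    have h1 : HasDerivAt (fun t => positionGroup U t 0) (Complex.I • y) 0 := hxy
    simp only [map_zero] at h1
    have := h1.unique (hasDerivAt_const (0 : ℝ) (0 : L2 ν))
    exact (smul_eq_zero.1 this).resolve_left Complex.I_ne_zero
  refine ⟨h0, ha, hc, fun f g => ?_⟩
  rw [conjOp, ← hclosable.graph_closure_eq_closure_graph, hgr]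
  exact Iff.rfl

end Group

end

section

open FourierTransform LineDeriv
open scoped BoundedContinuousFunction

/-! ### Sobolev spaces on the Fourier side -/

section SobolevMomentum

variable {ν : ℕ} {s : ℝ}

theorem smulLeftCLM_bracket_neg (s : ℝ) (f : 𝓢'(X ν, ℂ)) :
    TemperedDistribution.smulLeftCLM ℂ (bracket s)
      (TemperedDistribution.smulLeftCLM ℂ (bracket (-s)) f) = f := by
  rw [TemperedDistribution.smulLeftCLM_smulLeftCLM_apply (hasTemperateGrowth_bracket _)
    (hasTemperateGrowth_bracket _)]
  have : (bracket s * bracket (-s) : X ν → ℂ) = fun _ => 1 := by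
    ext x
    rw [Pi.mul_apply, ← bracket_add, add_neg_cancel, bracket_zero]
  first
    | rw [this, TemperedDistribution.smulLeftCLM_const, one_smul]
    | rw [mul_comm, this, TemperedDistribution.smulLeftCLM_const, one_smul]

theorem smulLeftCLM_neg_bracket (s : ℝ) (f : 𝓢'(X ν, ℂ)) :
    TemperedDistribution.smulLeftCLM ℂ (bracket (-s))
      (TemperedDistribution.smulLeftCLM ℂ (bracket s) f) = f := by
  simpa using smulLeftCLM_bracket_neg (-s) f

theorem memSobolev_of_mul {s : ℝ} (g : L2 ν) : TemperedDistribution.MemSobolev s 2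
    (𝓕⁻ (TemperedDistribution.smulLeftCLM ℂ (bracket (-s)) (g : 𝓢'(X ν, ℂ)))) := by
  rw [TemperedDistribution.memSobolev_iff_exists_smulLeftCLM_fourier]
  refine ⟨g, ?_⟩
  rw [FourierTransform.fourier_fourierInv_eq]
  change TemperedDistribution.smulLeftCLM ℂ (bracket s) _ = _
  exact smulLeftCLM_bracket_neg s _

theorem fourierL2_bessel (f : Sob ν s) :
    ((fourierL2 ν (Sob.bessel f) : L2 ν) : 𝓢'(X ν, ℂ)) =
      TemperedDistribution.smulLeftCLM ℂ (bracket s) (𝓕 f.toDist) := by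
  have h1 : ((fourierL2 ν (Sob.bessel f) : L2 ν) : 𝓢'(X ν, ℂ)) =
      𝓕 ((Sob.bessel f : L2 ν) : 𝓢'(X ν, ℂ)) :=
    (Lp.fourier_toTemperedDistribution_eq (Sob.bessel f)).symm
  rw [h1, ← Lp.toTemperedDistributionCLM_apply, Sob.bessel_spec,
    TemperedDistribution.fourier_besselPotential_eq_smulLeftCLM_fourier_apply]
  rfl

theorem L2_ext_dist {f g : L2 ν} (h : (f : 𝓢'(X ν, ℂ)) = (g : 𝓢'(X ν, ℂ))) : f = g :=
  Sob.toTemperedDistributionCLM_injective h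

/-- The isometry `f ↦ ⟨ξ⟩^s 𝓕 f` of `H^s` onto `L²`. -/
def mom (ν : ℕ) (s : ℝ) : Sob ν s ≃ₗᵢ[ℂ] L2 ν where
  toLinearEquiv := LinearEquiv.ofBijective
    ((fourierL2 ν).toLinearEquiv.toLinearMap ∘ₗ Sob.bessel)
    ⟨(fourierL2 ν).injective.comp Sob.bessel_injective, fun g => by
      refine ⟨⟨_, memSobolev_of_mul g⟩, L2_ext_dist ?_⟩
      refine (fourierL2_bessel _).trans ?_
      change TemperedDistribution.smulLeftCLM ℂ (bracket s) (𝓕 (𝓕⁻ (_ : 𝓢'(X ν, ℂ)) : 𝓢'(X ν, ℂ))) = _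
      rw [FourierTransform.fourier_fourierInv_eq]
      exact smulLeftCLM_bracket_neg s _⟩
  norm_map' f := (fourierL2 ν).norm_map (Sob.bessel f)

theorem mom_apply (f : Sob ν s) : mom ν s f = fourierL2 ν (Sob.bessel f) := rfl

theorem mom_spec (f : Sob ν s) : ((mom ν s f : L2 ν) : 𝓢'(X ν, ℂ)) =
    TemperedDistribution.smulLeftCLM ℂ (bracket s) (𝓕 f.toDist) := fourierL2_bessel f

instance : CompleteSpace (Sob ν s) :=
  (completeSpace_congr (e := (mom ν s).toEquiv) (mom ν s).isometry.isUniformEmbedding).2 inferInstance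

theorem pairing_eq (F : Sob ν (-s)) (g : Sob ν s) :
    Sob.pairing F g = inner ℂ (mom ν (-s) F) (mom ν s g) := by
  rw [mom_apply, mom_apply, LinearIsometryEquiv.inner_map_map, Sob.pairing]

theorem smulLeftCLM_bracket_injective {s : ℝ} :
    Function.Injective (TemperedDistribution.smulLeftCLM ℂ (bracket s : X ν → ℂ)) := by
  exact Function.LeftInverse.injective (smulLeftCLM_neg_bracket s)

theorem fourier_L2_dist (f : L2 ν) :
    ((fourierL2 ν f : L2 ν) : 𝓢'(X ν, ℂ)) = 𝓕 (f : 𝓢'(X ν, ℂ)) :=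
  (Lp.fourier_toTemperedDistribution_eq f).symm

theorem fourier_dist_injective : Function.Injective (fun f : 𝓢'(X ν, ℂ) => 𝓕 f) :=
  Function.LeftInverse.injective (g := fun f => 𝓕⁻ f) FourierTransform.fourierInv_fourier_eq

/-- For `s ≤ 0`: an `L²` function `f` as an element of `H^s`. -/
theorem toDist_eq_iff_of_nonpos (hs : s ≤ 0) (g : Sob ν s) (f : L2 ν) :
    g.toDist = (f : 𝓢'(X ν, ℂ)) ↔ mom ν s g = mulL2 (bracketBCF hs) (fourierL2 ν f) := by
  have h1 : ((mulL2 (bracketBCF hs) (fourierL2 ν f) : L2 ν) : 𝓢'(X ν, ℂ)) =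
      TemperedDistribution.smulLeftCLM ℂ (bracket s) (𝓕 (f : 𝓢'(X ν, ℂ))) := by
    rw [toTemperedDistribution_mulL2 _ (hasTemperateGrowth_bracket _), fourier_L2_dist]
    rfl
  constructor
  · intro h
    refine L2_ext_dist ?_
    rw [mom_spec, h1, h]
  · intro h
    have h2 := congrArg (fun f : L2 ν => (f : 𝓢'(X ν, ℂ))) h
    simp only [mom_spec, h1] at h2
    exact fourier_dist_injective (smulLeftCLM_bracket_injective h2)

theorem toDist_eq_iff_of_nonneg (hs : 0 ≤ s) (g : Sob ν s) (f : L2 ν) :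
    g.toDist = (f : 𝓢'(X ν, ℂ)) ↔
      mulL2 (bracketBCF (neg_nonpos.2 hs)) (mom ν s g) = fourierL2 ν f := by
  have h1 : ((mulL2 (bracketBCF (neg_nonpos.2 hs)) (mom ν s g) : L2 ν) : 𝓢'(X ν, ℂ)) = 𝓕 g.toDist := by
    rw [toTemperedDistribution_mulL2 _ (hasTemperateGrowth_bracket _), mom_spec]
    exact smulLeftCLM_neg_bracket s _
  constructor
  · intro h
    refine L2_ext_dist ?_
    rw [h1, h, fourier_L2_dist]
  · intro h
    have h2 := congrArg (fun f : L2 ν => (f : 𝓢'(X ν, ℂ))) h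
    simp only [h1, fourier_L2_dist] at h2
    exact fourier_dist_injective h2

theorem mom_ofSchwartz (φ : 𝓢(X ν, ℂ)) :
    mom ν s (Sob.ofSchwartz s φ) = (SchwartzMap.smulLeftCLM ℂ (bracket s) (𝓕 φ)).toLp 2 := by
  refine L2_ext_dist ?_
  rw [mom_spec, Lp.toTemperedDistribution_toLp_eq]
  change TemperedDistribution.smulLeftCLM ℂ (bracket s) (𝓕 (φ : 𝓢'(X ν, ℂ))) = _
  rw [TemperedDistribution.fourier_toTemperedDistributionCLM_eq]
  ext ψ
  simp only [TemperedDistribution.smulLeftCLM_apply_apply,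
    SchwartzMap.toTemperedDistributionCLM_apply_apply,
    SchwartzMap.smulLeftCLM_apply_apply (hasTemperateGrowth_bracket s), smul_eq_mul]
  exact integral_congr_ae (Eventually.of_forall fun x => by ring)

/-- `Sob.ofSchwartz` as a linear map. -/
def ofSchwartzₗ (s : ℝ) : 𝓢(X ν, ℂ) →ₗ[ℂ] Sob ν s where
  toFun := Sob.ofSchwartz s
  map_add' φ ψ := Sob.toDist_injective (map_add (SchwartzMap.toTemperedDistributionCLM (X ν) ℂ volume) φ ψ)
  map_smul' c φ := Sob.toDist_injective (map_smul (SchwartzMap.toTemperedDistributionCLM (X ν) ℂ volume) c φ)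

@[simp] theorem ofSchwartzₗ_apply (φ : 𝓢(X ν, ℂ)) : ofSchwartzₗ s φ = Sob.ofSchwartz s φ := rfl

theorem denseRange_toLp_schwartz : DenseRange fun φ : 𝓢(X ν, ℂ) => (φ.toLp 2 : L2 ν) :=
  SchwartzMap.denseRange_toLpCLM (p := 2) (F := ℂ) (μ := (volume : Measure (X ν))) (by simp)

theorem denseRange_ofSchwartz : DenseRange (ofSchwartzₗ s : 𝓢(X ν, ℂ) → Sob ν s) := by
  have h1 : DenseRange (fun φ : 𝓢(X ν, ℂ) => mom ν s (ofSchwartzₗ s φ)) := by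
    refine denseRange_toLp_schwartz.mono ?_
    rintro _ ⟨φ, rfl⟩
    refine ⟨𝓕⁻ (SchwartzMap.smulLeftCLM ℂ (bracket (-s)) φ), ?_⟩
    simp only [ofSchwartzₗ_apply]
    rw [mom_ofSchwartz, FourierTransform.fourier_fourierInv_eq]
    congr 1
    ext x
    rw [SchwartzMap.smulLeftCLM_apply_apply (hasTemperateGrowth_bracket _),
      SchwartzMap.smulLeftCLM_apply_apply (hasTemperateGrowth_bracket _), smul_eq_mul, smul_eq_mul,
      ← mul_assoc, ← bracket_add, add_neg_cancel, bracket_zero, one_mul]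
  have h2 := (mom ν s).symm.surjective.denseRange.comp h1 (mom ν s).symm.continuous
  refine h2.mono ?_
  rintro _ ⟨φ, rfl⟩
  exact ⟨φ, by simp⟩

/-- The embedding of `L²` in `H^{-s}`, for `s ≥ 0`. -/
def embed (hs : 0 ≤ s) : L2 ν →L[ℂ] Sob ν (-s) :=
  (mom ν (-s)).symm.toContinuousLinearEquiv.toContinuousLinearMap ∘L
    mulL2 (bracketBCF (neg_nonpos.2 hs)) ∘L (fourierL2 ν).toContinuousLinearEquiv.toContinuousLinearMap

theorem mom_embed (hs : 0 ≤ s) (f : L2 ν) :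
    mom ν (-s) (embed hs f) = mulL2 (bracketBCF (neg_nonpos.2 hs)) (fourierL2 ν f) :=
  (mom ν (-s)).apply_symm_apply _

theorem toDist_embed (hs : 0 ≤ s) (f : L2 ν) : (embed hs f).toDist = (f : 𝓢'(X ν, ℂ)) :=
  (toDist_eq_iff_of_nonpos (neg_nonpos.2 hs) _ f).2 (mom_embed hs f)

theorem embed_toLp (hs : 0 ≤ s) (φ : 𝓢(X ν, ℂ)) :
    embed hs (φ.toLp 2) = Sob.ofSchwartz (-s) φ := by
  apply Sob.toDist_injective
  rw [toDist_embed, Lp.toTemperedDistribution_toLp_eq]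
  rfl

theorem star_bracketBCF {s : ℝ} (hs : s ≤ 0) : star (bracketBCF hs : X ν →ᵇ ℂ) = bracketBCF hs := by
  ext x
  rw [BoundedContinuousFunction.star_apply]
  exact Complex.conj_ofReal _

theorem pairing_embed (hs : 0 ≤ s) (f : L2 ν) (ψ : 𝓢(X ν, ℂ)) :
    Sob.pairing (embed hs f) (Sob.ofSchwartz s ψ) = inner ℂ f (ψ.toLp 2) := by
  have h := (toDist_eq_iff_of_nonneg hs (Sob.ofSchwartz s ψ) (ψ.toLp 2)).1
    (by rw [Lp.toTemperedDistribution_toLp_eq]; rfl)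
  rw [pairing_eq, mom_embed, inner_mulL2_left, star_bracketBCF, h, LinearIsometryEquiv.inner_map_map]

theorem norm_pairing_le (F : Sob ν (-s)) (g : Sob ν s) : ‖Sob.pairing F g‖ ≤ ‖F‖ * ‖g‖ := by
  rw [pairing_eq]
  refine (norm_inner_le_norm _ _).trans ?_
  rw [LinearIsometryEquiv.norm_map, LinearIsometryEquiv.norm_map]

/-- The pairing with the element of `H^s` that has the same image in `L²` as `F` is `‖F‖²`, so
pairings detect the norm; density reduces the test to Schwartz functions. -/
theorem norm_le_of_pairing_schwartz {F : Sob ν (-s)} {C : ℝ} (hC : 0 ≤ C)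
    (h : ∀ ψ : 𝓢(X ν, ℂ), ‖Sob.pairing F (Sob.ofSchwartz s ψ)‖ ≤ C * ‖Sob.ofSchwartz s ψ‖) :
    ‖F‖ ≤ C := by
  have h1 : ∀ g : Sob ν s, ‖Sob.pairing F g‖ ≤ C * ‖g‖ := fun g => by
    refine denseRange_ofSchwartz.induction_on
      (p := fun g => ‖Sob.pairing F g‖ ≤ C * ‖g‖) g ?_ h
    refine isClosed_le ?_ (by fun_prop)
    have : Continuous fun g : Sob ν s => mom ν s g := (mom ν s).continuous
    simp only [pairing_eq]
    fun_prop
  have h2 := h1 ((mom ν s).symm (mom ν (-s) F))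
  rw [pairing_eq, LinearIsometryEquiv.apply_symm_apply, LinearIsometryEquiv.norm_map,
    LinearIsometryEquiv.norm_map, inner_self_eq_norm_sq_to_K, LinearIsometryEquiv.norm_map] at h2
  simp only [Complex.coe_algebraMap, norm_pow, Complex.norm_real, norm_norm] at h2
  rcases eq_or_lt_of_le (norm_nonneg F) with h3 | h3
  · rwa [← h3]
  · rw [sq] at h2
    exact le_of_mul_le_mul_right h2 h3

theorem exists_clm_of_schwartz {s t : ℝ} (T : 𝓢(X ν, ℂ) →ₗ[ℂ] Sob ν t) {C : ℝ} (hC : 0 ≤ C)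
    (h : ∀ φ, ‖T φ‖ ≤ C * ‖Sob.ofSchwartz s φ‖) :
    ∃ V : Sob ν s →L[ℂ] Sob ν t, (∀ φ, V (Sob.ofSchwartz s φ) = T φ) ∧ ‖V‖ ≤ C :=
  ⟨T.extendOfNorm (ofSchwartzₗ s), fun φ => LinearMap.extendOfNorm_eq denseRange_ofSchwartz ⟨C, h⟩ φ,
    LinearMap.opNorm_extendOfNorm_le denseRange_ofSchwartz hC h⟩

end SobolevMomentum

end

section

open FourierTransform LineDeriv
open scoped BoundedContinuousFunction

/-! ### Sobolev norms of Schwartz functions -/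

section SobolevNorm

variable {ν : ℕ} {s : ℝ}

/-- The norm of a Schwartz function in `H^s`. -/
def sobNorm (s : ℝ) (φ : 𝓢(X ν, ℂ)) : ℝ := ‖Sob.ofSchwartz s φ‖

theorem sobNorm_nonneg (s : ℝ) (φ : 𝓢(X ν, ℂ)) : 0 ≤ sobNorm s φ := norm_nonneg _

theorem sobNorm_add_le (s : ℝ) (φ ψ : 𝓢(X ν, ℂ)) :
    sobNorm s (φ + ψ) ≤ sobNorm s φ + sobNorm s ψ := by
  have := norm_add_le (ofSchwartzₗ s φ) (ofSchwartzₗ s ψ)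
  rwa [← map_add] at this

theorem sobNorm_smul (s : ℝ) (c : ℂ) (φ : 𝓢(X ν, ℂ)) : sobNorm s (c • φ) = ‖c‖ * sobNorm s φ := by
  have := norm_smul c (ofSchwartzₗ s φ)
  rwa [← map_smul] at this

theorem sobNorm_eq (s : ℝ) (φ : 𝓢(X ν, ℂ)) :
    sobNorm s φ = ‖(SchwartzMap.smulLeftCLM ℂ (bracket s) (𝓕 φ)).toLp 2 (volume : Measure (X ν))‖ := by
  rw [sobNorm, ← (mom ν s).norm_map, mom_ofSchwartz]

theorem sobNorm_zero (φ : 𝓢(X ν, ℂ)) : sobNorm 0 φ = ‖φ.toLp 2 (volume : Measure (X ν))‖ := by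
  rw [sobNorm_eq, show (bracket 0 : X ν → ℂ) = fun _ => 1 from funext bracket_zero]
  simp only [SchwartzMap.smulLeftCLM_const, one_smul]
  exact ((fourierL2 ν).norm_map (φ.toLp 2)) ▸ congrArg norm (fourierL2_schwartz φ).symm

theorem norm_toLp_schwartz_sq (φ : 𝓢(X ν, ℂ)) :
    ‖φ.toLp 2 (volume : Measure (X ν))‖ ^ 2 = ∫ x, ‖φ x‖ ^ 2 := norm_toLp_sq (φ.memLp 2 volume)

theorem integrable_schwartz_sq (φ : 𝓢(X ν, ℂ)) : Integrable fun x => ‖φ x‖ ^ 2 :=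
  (φ.memLp 2 volume).integrable_norm_pow (by norm_num)

theorem sobNorm_sq (s : ℝ) (φ : 𝓢(X ν, ℂ)) :
    sobNorm s φ ^ 2 = ∫ ξ, ‖bracket s ξ * 𝓕 φ ξ‖ ^ 2 := by
  rw [sobNorm_eq, norm_toLp_schwartz_sq]
  simp only [SchwartzMap.smulLeftCLM_apply_apply (hasTemperateGrowth_bracket s), smul_eq_mul]

theorem integrable_bracket_sq (s : ℝ) (φ : 𝓢(X ν, ℂ)) :
    Integrable fun ξ => ‖bracket s ξ * 𝓕 φ ξ‖ ^ 2 := by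
  have := integrable_schwartz_sq (SchwartzMap.smulLeftCLM ℂ (bracket s) (𝓕 φ))
  simpa only [SchwartzMap.smulLeftCLM_apply_apply (hasTemperateGrowth_bracket s), smul_eq_mul] using this

/-- The partial derivative `∂_j` on Schwartz functions. -/
abbrev pd (j : Fin ν) (φ : 𝓢(X ν, ℂ)) : 𝓢(X ν, ℂ) := ∂_{EuclideanSpace.single j (1 : ℝ)} φ

theorem pd_apply (j : Fin ν) (φ : 𝓢(X ν, ℂ)) (x : X ν) :
    pd j φ x = fderiv ℝ φ x (EuclideanSpace.single j 1) :=
  SchwartzMap.lineDerivOp_apply_eq_fderiv _ _ _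

theorem fourier_pd_apply (j : Fin ν) (φ : 𝓢(X ν, ℂ)) (ξ : X ν) :
    𝓕 (pd j φ) ξ = (2 * Real.pi * Complex.I) * ((ξ j : ℝ) : ℂ) * 𝓕 φ ξ := by
  have h1 : Function.HasTemperateGrowth (inner ℝ · (EuclideanSpace.single j (1 : ℝ)) : X ν → ℝ) := by
    fun_prop
  rw [pd, SchwartzMap.fourier_lineDerivOp_eq, smul_apply, SchwartzMap.smulLeftCLM_apply_apply h1,
    inner_single, smul_eq_mul, Complex.real_smul]
  ring

/-- Plancherel and `⟨ξ⟩² = 1 + ∑ ξ_j²`. The factor `(2π)⁻²` appears because `∂_j` is multiplication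
by `2πi ξ_j` while the weight uses `ξ` itself. -/
theorem sobNorm_succ_sq (s : ℝ) (φ : 𝓢(X ν, ℂ)) : sobNorm (s + 1) φ ^ 2 =
    sobNorm s φ ^ 2 + ((2 * Real.pi) ^ 2)⁻¹ * ∑ j, sobNorm s (pd j φ) ^ 2 := by
  simp_rw [sobNorm_sq]
  rw [← integral_finsetSum _ fun j _ => integrable_bracket_sq s (pd j φ), ← integral_const_mul,
    ← integral_add (integrable_bracket_sq s φ)
      ((integrable_finsetSum _ fun j _ => integrable_bracket_sq s (pd j φ)).const_mul _)]
  refine integral_congr_ae (Eventually.of_forall fun ξ => ?_)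
  have h1 : ‖bracket 1 ξ‖ ^ 2 = 1 + ‖ξ‖ ^ 2 := by
    rw [norm_bracket, ← Real.sqrt_eq_rpow, Real.sq_sqrt (one_add_normSq_pos ξ).le]
  have h2 : ∀ j : Fin ν, ‖bracket s ξ * 𝓕 (pd j φ) ξ‖ ^ 2 =
      (2 * Real.pi) ^ 2 * ξ j ^ 2 * ‖bracket s ξ * 𝓕 φ ξ‖ ^ 2 := fun j => by
    rw [fourier_pd_apply]
    simp only [norm_mul, Complex.norm_ofNat, Complex.norm_real, Complex.norm_I, mul_pow,
      Real.norm_eq_abs, sq_abs]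
    ring
  simp only [h2]
  rw [bracket_add, mul_assoc, mul_comm, mul_assoc, norm_mul, mul_pow, h1, EuclideanSpace.real_norm_sq_eq,
    ← Finset.sum_mul, ← Finset.mul_sum, mul_comm (𝓕 φ ξ)]
  have : (2 * Real.pi) ^ 2 ≠ 0 := by positivity
  field_simp

theorem sobNorm_le_succ (s : ℝ) (φ : 𝓢(X ν, ℂ)) : sobNorm s φ ≤ sobNorm (s + 1) φ := by
  refine (sq_le_sq₀ (sobNorm_nonneg _ _) (sobNorm_nonneg _ _)).1 ?_
  rw [sobNorm_succ_sq]
  have : 0 ≤ ((2 * Real.pi) ^ 2)⁻¹ * ∑ j, sobNorm s (pd j φ) ^ 2 := by positivity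
  linarith

theorem sobNorm_pd_le (s : ℝ) (j : Fin ν) (φ : 𝓢(X ν, ℂ)) :
    sobNorm s (pd j φ) ≤ (2 * Real.pi) * sobNorm (s + 1) φ := by
  refine (sq_le_sq₀ (sobNorm_nonneg _ _) (mul_nonneg (by positivity) (sobNorm_nonneg _ _))).1 ?_
  rw [mul_pow, sobNorm_succ_sq, mul_add, ← mul_assoc, mul_inv_cancel₀ (by positivity), one_mul]
  have h1 : sobNorm s (pd j φ) ^ 2 ≤ ∑ j, sobNorm s (pd j φ) ^ 2 :=
    Finset.single_le_sum (f := fun j => sobNorm s (pd j φ) ^ 2) (fun _ _ => sq_nonneg _)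
      (Finset.mem_univ j)
  have h2 : 0 ≤ (2 * Real.pi) ^ 2 * sobNorm s φ ^ 2 := by positivity
  linarith

theorem sobNorm_succ_le (s : ℝ) (φ : 𝓢(X ν, ℂ)) :
    sobNorm (s + 1) φ ≤ sobNorm s φ + ∑ j, sobNorm s (pd j φ) := by
  have h0 : 0 ≤ ∑ j, sobNorm s (pd j φ) := Finset.sum_nonneg fun _ _ => sobNorm_nonneg _ _
  refine (sq_le_sq₀ (sobNorm_nonneg _ _) (add_nonneg (sobNorm_nonneg _ _) h0)).1 ?_
  rw [sobNorm_succ_sq]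
  have h1 : ∑ j, sobNorm s (pd j φ) ^ 2 ≤ (∑ j, sobNorm s (pd j φ)) ^ 2 := by
    rw [sq (∑ j, _), Finset.sum_mul]
    refine Finset.sum_le_sum fun j hj => ?_
    rw [sq]
    exact mul_le_mul_of_nonneg_left (Finset.single_le_sum (f := fun j => sobNorm s (pd j φ))
      (fun _ _ => sobNorm_nonneg _ _) hj) (sobNorm_nonneg _ _)
  have h2 : ((2 * Real.pi) ^ 2)⁻¹ ≤ 1 := inv_le_one_of_one_le₀ (by nlinarith [Real.pi_gt_three])
  have h3 : 0 ≤ ∑ j, sobNorm s (pd j φ) ^ 2 := by positivity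
  nlinarith [sobNorm_nonneg s φ]

theorem pd_smulLeft {a : X ν → ℂ} (ha : Function.HasTemperateGrowth a)
    (j : Fin ν) (ha' : Function.HasTemperateGrowth fun x => fderiv ℝ a x (EuclideanSpace.single j 1))
    (φ : 𝓢(X ν, ℂ)) : pd j (SchwartzMap.smulLeftCLM ℂ a φ) =
      SchwartzMap.smulLeftCLM ℂ (fun x => fderiv ℝ a x (EuclideanSpace.single j 1)) φ +
        SchwartzMap.smulLeftCLM ℂ a (pd j φ) := by
  ext x
  have h1 : (SchwartzMap.smulLeftCLM ℂ a φ : X ν → ℂ) = fun x => a x * φ x := by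
    ext x; rw [SchwartzMap.smulLeftCLM_apply_apply ha, smul_eq_mul]
  rw [pd_apply, h1, ((ha.1.differentiable (by simp) x).hasFDerivAt.fun_mul
    (φ.differentiable x).hasFDerivAt).fderiv]
  simp only [add_apply, smul_apply, smul_eq_mul, SchwartzMap.smulLeftCLM_apply_apply ha',
    SchwartzMap.smulLeftCLM_apply_apply ha, pd_apply]
  ring

theorem BddSmooth.pd {a : X ν → ℂ} (ha : BddSmooth a) (j : Fin ν) :
    BddSmooth fun x => _root_.fderiv ℝ a x (EuclideanSpace.single j 1) :=
  ha.fderiv.clm_comp (ContinuousLinearMap.apply ℝ ℂ (EuclideanSpace.single j 1))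

theorem BddSmooth.sobNorm_smulLeft_zero_le {a : X ν → ℂ} (ha : BddSmooth a) :
    ∃ C, 0 ≤ C ∧ ∀ φ, sobNorm 0 (SchwartzMap.smulLeftCLM ℂ a φ) ≤ C * sobNorm 0 φ := by
  obtain ⟨C, hC⟩ := ha.exists_norm_le
  refine ⟨C, (norm_nonneg _).trans (hC 0), fun φ => ?_⟩
  rw [sobNorm_zero, sobNorm_zero]
  refine Lp.norm_le_mul_norm_of_ae_le_mul ?_
  filter_upwards [φ.coeFn_toLp 2, (SchwartzMap.smulLeftCLM ℂ a φ).coeFn_toLp 2] with x h1 h2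
  rw [h1, h2, SchwartzMap.smulLeftCLM_apply_apply ha.hasTemperateGrowth, norm_smul]
  exact mul_le_mul_of_nonneg_right (hC x) (norm_nonneg _)

/-- Only integer orders are needed, so the Leibniz rule and induction on the order suffice. -/
theorem BddSmooth.exists_sobNorm_smulLeft_le (n : ℕ) {a : X ν → ℂ} (ha : BddSmooth a) :
    ∃ C, 0 ≤ C ∧ ∀ φ, sobNorm n (SchwartzMap.smulLeftCLM ℂ a φ) ≤ C * sobNorm n φ := by
  induction n generalizing a with
  | zero => simpa using ha.sobNorm_smulLeft_zero_le
  | succ n ih =>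
    obtain ⟨C, hC0, hC⟩ := ih ha
    choose D hD0 hD using fun j => ih (ha.pd j)
    refine ⟨C + ∑ j : Fin ν, (D j + C * (2 * Real.pi)), add_nonneg hC0 (Finset.sum_nonneg fun j _ =>
      add_nonneg (hD0 j) (by positivity)), fun φ => ?_⟩
    rw [Nat.cast_succ]
    refine (sobNorm_succ_le _ _).trans ?_
    rw [add_mul, Finset.sum_mul]
    refine add_le_add ((hC φ).trans (mul_le_mul_of_nonneg_left (sobNorm_le_succ _ _) hC0))
      (Finset.sum_le_sum fun j _ => ?_)
    rw [pd_smulLeft ha.hasTemperateGrowth j (ha.pd j).hasTemperateGrowth]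
    refine (sobNorm_add_le _ _ _).trans ?_
    rw [add_mul, mul_assoc]
    exact add_le_add ((hD j φ).trans (mul_le_mul_of_nonneg_left (sobNorm_le_succ _ _) (hD0 j)))
      ((hC _).trans (mul_le_mul_of_nonneg_left (sobNorm_pd_le _ _ _) hC0))

theorem BddSmooth.conj {a : X ν → ℂ} (ha : BddSmooth a) : BddSmooth fun x => starRingEnd ℂ (a x) :=
  ha.clm_comp (Complex.conjCLE : ℂ →L[ℝ] ℂ)

theorem inner_smulLeft {a : X ν → ℂ} (ha : Function.HasTemperateGrowth a)
    (ha' : Function.HasTemperateGrowth fun x => starRingEnd ℂ (a x)) (φ ψ : 𝓢(X ν, ℂ)) :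
    inner ℂ ((SchwartzMap.smulLeftCLM ℂ a φ).toLp 2 (volume : Measure (X ν))) (ψ.toLp 2) =
      inner ℂ (φ.toLp 2 (volume : Measure (X ν)))
        ((SchwartzMap.smulLeftCLM ℂ (fun x => starRingEnd ℂ (a x)) ψ).toLp 2) := by
  rw [L2.inner_def, L2.inner_def]
  refine integral_congr_ae ?_
  filter_upwards [(SchwartzMap.smulLeftCLM ℂ a φ).coeFn_toLp 2, ψ.coeFn_toLp 2, φ.coeFn_toLp 2,
    (SchwartzMap.smulLeftCLM ℂ (fun x => starRingEnd ℂ (a x)) ψ).coeFn_toLp 2] with x h1 h2 h3 h4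
  rw [h1, h2, h3, h4, SchwartzMap.smulLeftCLM_apply_apply ha, SchwartzMap.smulLeftCLM_apply_apply ha']
  simp only [RCLike.inner_apply, smul_eq_mul, map_mul]
  ring

theorem pairing_ofSchwartz (hs : 0 ≤ s) (φ ψ : 𝓢(X ν, ℂ)) :
    Sob.pairing (Sob.ofSchwartz (-s) φ) (Sob.ofSchwartz s ψ) =
      inner ℂ (φ.toLp 2 (volume : Measure (X ν))) (ψ.toLp 2) := by
  rw [← embed_toLp hs, pairing_embed]

/-- Dual to the estimate of positive order for the conjugate multiplier. -/
theorem BddSmooth.exists_sobNorm_neg_smulLeft_le (n : ℕ) {a : X ν → ℂ} (ha : BddSmooth a) :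
    ∃ C, 0 ≤ C ∧ ∀ φ, sobNorm (-n) (SchwartzMap.smulLeftCLM ℂ a φ) ≤ C * sobNorm (-n) φ := by
  obtain ⟨C, hC0, hC⟩ := ha.conj.exists_sobNorm_smulLeft_le n
  refine ⟨C, hC0, fun φ => ?_⟩
  refine norm_le_of_pairing_schwartz (s := n) (mul_nonneg hC0 (sobNorm_nonneg _ _)) fun ψ => ?_
  rw [pairing_ofSchwartz n.cast_nonneg, inner_smulLeft ha.hasTemperateGrowth
    ha.conj.hasTemperateGrowth, ← pairing_ofSchwartz n.cast_nonneg]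
  refine (norm_pairing_le _ _).trans ?_
  rw [mul_right_comm, mul_comm]
  exact mul_le_mul_of_nonneg_right (hC ψ) (sobNorm_nonneg _ _)

theorem sobNorm_fourierMultiplier_le {a : X ν → ℂ} (ha : Function.HasTemperateGrowth a) {C : ℝ}
    (hC : ∀ x, ‖a x‖ ≤ C) (s : ℝ) (φ : 𝓢(X ν, ℂ)) :
    sobNorm s (SchwartzMap.fourierMultiplierCLM ℂ a φ) ≤ C * sobNorm s φ := by
  rw [sobNorm_eq, sobNorm_eq, SchwartzMap.fourierMultiplierCLM_apply,
    FourierTransform.fourier_fourierInv_eq]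
  refine Lp.norm_le_mul_norm_of_ae_le_mul ?_
  filter_upwards [(SchwartzMap.smulLeftCLM ℂ (bracket s) (𝓕 φ)).coeFn_toLp 2,
    (SchwartzMap.smulLeftCLM ℂ (bracket s) (SchwartzMap.smulLeftCLM ℂ a (𝓕 φ))).coeFn_toLp 2]
    with x h1 h2
  rw [h1, h2]
  simp only [SchwartzMap.smulLeftCLM_apply_apply (hasTemperateGrowth_bracket s),
    SchwartzMap.smulLeftCLM_apply_apply ha, norm_smul]
  rw [mul_left_comm]
  exact mul_le_mul_of_nonneg_right (hC x) (by positivity)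

end SobolevNorm

/-! ### `L²` and `L¹` Sobolev norms of Schwartz functions -/

section IntegralNorms

variable {ν : ℕ}

/-- The sum of the `L²` norms of the derivatives of order at most `n`. -/
def l2Deriv : ℕ → 𝓢(X ν, ℂ) → ℝ
  | 0, φ => ‖φ.toLp 2 (volume : Measure (X ν))‖
  | n + 1, φ => l2Deriv n φ + ∑ j, l2Deriv n (pd j φ)

/-- The sum of the `L¹` norms of the derivatives of order at most `n`. -/
def l1Deriv : ℕ → 𝓢(X ν, ℂ) → ℝ
  | 0, φ => ∫ x, ‖φ x‖
  | n + 1, φ => l1Deriv n φ + ∑ j, l1Deriv n (pd j φ)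

theorem l2Deriv_nonneg (n : ℕ) (φ : 𝓢(X ν, ℂ)) : 0 ≤ l2Deriv n φ := by
  induction n generalizing φ with
  | zero => exact norm_nonneg _
  | succ n ih => exact add_nonneg (ih _) (Finset.sum_nonneg fun _ _ => ih _)

theorem l1Deriv_nonneg (n : ℕ) (φ : 𝓢(X ν, ℂ)) : 0 ≤ l1Deriv n φ := by
  induction n generalizing φ with
  | zero => exact integral_nonneg fun _ => norm_nonneg _
  | succ n ih => exact add_nonneg (ih _) (Finset.sum_nonneg fun _ _ => ih _)

theorem exists_l2Deriv_le (n : ℕ) : ∃ C, 0 ≤ C ∧ ∀ φ : 𝓢(X ν, ℂ), l2Deriv n φ ≤ C * sobNorm n φ := by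
  induction n with
  | zero => exact ⟨1, zero_le_one, fun φ => by simp [l2Deriv, sobNorm_zero]⟩
  | succ n ih =>
    obtain ⟨C, hC0, hC⟩ := ih
    refine ⟨C + ∑ _j : Fin ν, C * (2 * Real.pi), by positivity, fun φ => ?_⟩
    rw [Nat.cast_succ, add_mul, Finset.sum_mul]
    refine add_le_add ((hC φ).trans (mul_le_mul_of_nonneg_left (sobNorm_le_succ _ _) hC0))
      (Finset.sum_le_sum fun j _ => ?_)
    rw [mul_assoc]
    exact (hC _).trans (mul_le_mul_of_nonneg_left (sobNorm_pd_le _ _ _) hC0)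

theorem pd_add (j : Fin ν) (φ ψ : 𝓢(X ν, ℂ)) : pd j (φ + ψ) = pd j φ + pd j ψ :=
  LineDeriv.lineDerivOp_add _ _ _

theorem l1Deriv_add_le (n : ℕ) (φ ψ : 𝓢(X ν, ℂ)) :
    l1Deriv n (φ + ψ) ≤ l1Deriv n φ + l1Deriv n ψ := by
  induction n generalizing φ ψ with
  | zero =>
    simp only [l1Deriv]
    rw [← integral_add φ.integrable.norm ψ.integrable.norm]
    exact integral_mono (φ + ψ).integrable.norm (φ.integrable.norm.add ψ.integrable.norm)
      fun x => norm_add_le _ _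
  | succ n ih =>
    simp only [l1Deriv, pd_add]
    have := Finset.sum_le_sum fun j (_ : j ∈ Finset.univ) => ih (pd j φ) (pd j ψ)
    rw [Finset.sum_add_distrib] at this
    linarith [ih φ ψ]

/-- The product of two Schwartz functions. -/
def mulS (φ ψ : 𝓢(X ν, ℂ)) : 𝓢(X ν, ℂ) := SchwartzMap.smulLeftCLM ℂ φ ψ

theorem mulS_apply (φ ψ : 𝓢(X ν, ℂ)) (x : X ν) : mulS φ ψ x = φ x * ψ x := by
  rw [mulS, SchwartzMap.smulLeftCLM_apply_apply φ.hasTemperateGrowth, smul_eq_mul]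

theorem pd_mulS (j : Fin ν) (φ ψ : 𝓢(X ν, ℂ)) :
    pd j (mulS φ ψ) = mulS (pd j φ) ψ + mulS φ (pd j ψ) := by
  have h : (pd j φ : X ν → ℂ) = fun x => fderiv ℝ φ x (EuclideanSpace.single j 1) :=
    funext fun x => pd_apply j φ x
  have h1 := (pd j φ).hasTemperateGrowth
  rw [h] at h1
  rw [mulS, pd_smulLeft φ.hasTemperateGrowth j h1, ← h]
  rfl

/-- Leibniz rule, and Cauchy–Schwarz at order zero. Each order contributes three of the four terms
of the expanded product, whence the factor `3`. -/
theorem l1Deriv_mulS_le (n : ℕ) (φ ψ : 𝓢(X ν, ℂ)) :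
    l1Deriv n (mulS φ ψ) ≤ 3 ^ n * (l2Deriv n φ * l2Deriv n ψ) := by
  induction n generalizing φ ψ with
  | zero =>
    simp only [l1Deriv, l2Deriv, mulS_apply, norm_mul, pow_zero, one_mul]
    have := integral_mul_norm_le_Lp_mul_Lq (μ := (volume : Measure (X ν))) Real.HolderConjugate.two_two
      (f := φ) (g := ψ) (by simpa using φ.memLp 2 volume) (by simpa using ψ.memLp 2 volume)
    refine this.trans (le_of_eq ?_)
    have h : ∀ φ : 𝓢(X ν, ℂ), (∫ x, ‖φ x‖ ^ (2 : ℝ)) ^ (1 / 2 : ℝ)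
        = ‖φ.toLp 2 (volume : Measure (X ν))‖ := fun φ => by
      simp only [Real.rpow_two]
      rw [← norm_toLp_schwartz_sq, ← Real.sqrt_eq_rpow, Real.sqrt_sq (norm_nonneg _)]
    rw [h, h]
  | succ n ih =>
    simp only [l1Deriv, l2Deriv, pd_mulS]
    have h1 : ∀ j, l1Deriv n (mulS (pd j φ) ψ + mulS φ (pd j ψ)) ≤
        3 ^ n * (l2Deriv n (pd j φ) * l2Deriv n ψ) + 3 ^ n * (l2Deriv n φ * l2Deriv n (pd j ψ)) :=
      fun j => (l1Deriv_add_le _ _ _).trans (add_le_add (ih _ _) (ih _ _))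
    have h2 := Finset.sum_le_sum fun j (_ : j ∈ Finset.univ) => h1 j
    rw [Finset.sum_add_distrib, ← Finset.mul_sum, ← Finset.mul_sum, ← Finset.sum_mul,
      ← Finset.mul_sum] at h2
    have h3 := ih φ ψ
    have a1 := l2Deriv_nonneg n φ
    have a2 := l2Deriv_nonneg n ψ
    have a3 : 0 ≤ ∑ j, l2Deriv n (pd j φ) := Finset.sum_nonneg fun _ _ => l2Deriv_nonneg _ _
    have a4 : 0 ≤ ∑ j, l2Deriv n (pd j ψ) := Finset.sum_nonneg fun _ _ => l2Deriv_nonneg _ _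
    have h4 : 0 ≤ (3 : ℝ) ^ n := by positivity
    calc _ ≤ 3 ^ n * (l2Deriv n φ * l2Deriv n ψ) +
          (3 ^ n * ((∑ j, l2Deriv n (pd j φ)) * l2Deriv n ψ) +
            3 ^ n * (l2Deriv n φ * ∑ j, l2Deriv n (pd j ψ))) := add_le_add h3 h2
      _ ≤ _ := by
        rw [pow_succ, mul_assoc, ← mul_add, ← mul_add]
        refine mul_le_mul_of_nonneg_left ?_ h4
        nlinarith [mul_nonneg a1 a2, mul_nonneg a1 a4, mul_nonneg a3 a2, mul_nonneg a3 a4]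

/-- Complex conjugation of Schwartz functions. -/
def conjS (φ : 𝓢(X ν, ℂ)) : 𝓢(X ν, ℂ) := φ.postcompCLM (𝕜 := ℝ) (Complex.conjCLE : ℂ →L[ℝ] ℂ)

theorem conjS_apply (φ : 𝓢(X ν, ℂ)) (x : X ν) : conjS φ x = starRingEnd ℂ (φ x) := rfl

theorem pd_conjS (j : Fin ν) (φ : 𝓢(X ν, ℂ)) : pd j (conjS φ) = conjS (pd j φ) := by
  ext x
  have h : (conjS φ : X ν → ℂ) = fun x => starRingEnd ℂ (φ x) := rfl
  rw [pd_apply, conjS_apply, pd_apply, h, ((Decay.of_schwartz φ).hasFDerivAt_conj x).fderiv]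
  rfl

theorem l2Deriv_conjS (n : ℕ) (φ : 𝓢(X ν, ℂ)) : l2Deriv n (conjS φ) = l2Deriv n φ := by
  induction n generalizing φ with
  | zero =>
    simp only [l2Deriv]
    rw [← sq_eq_sq₀ (norm_nonneg _) (norm_nonneg _), norm_toLp_schwartz_sq, norm_toLp_schwartz_sq]
    simp only [conjS_apply, RCLike.norm_conj]
  | succ n ih => simp only [l2Deriv, pd_conjS, ih]

end IntegralNorms

end

section

/-! ### Symbols with homogeneous bounds -/

section Symbols

variable {ν : ℕ}

/-- The partial derivative `∂_j` of a function. -/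
def pdf (j : Fin ν) (a : X ν → ℂ) (x : X ν) : ℂ := fderiv ℝ a x (EuclideanSpace.single j 1)

/-- `|∂^J a(x)| ≤ A |x|^{m - |J|}` on `O` for `|J| ≤ n`. -/
def Symb (O : Set (X ν)) : ℕ → ℝ → ℝ → (X ν → ℂ) → Prop
  | 0, m, A, a => ∀ x ∈ O, ‖a x‖ ≤ A * ‖x‖ ^ m
  | n + 1, m, A, a => (∀ x ∈ O, ‖a x‖ ≤ A * ‖x‖ ^ m) ∧ (∀ x ∈ O, DifferentiableAt ℝ a x) ∧
      ∀ j, Symb O n (m - 1) A (pdf j a)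

variable {O O' : Set (X ν)} {n : ℕ} {m m' A B : ℝ} {a b : X ν → ℂ}

theorem pdf_congr (hO : IsOpen O) (hab : ∀ x ∈ O, a x = b x) (j : Fin ν) {x : X ν} (hx : x ∈ O) :
    pdf j a x = pdf j b x := by
  have : a =ᶠ[𝓝 x] b := by
    filter_upwards [hO.mem_nhds hx] with y hy using hab y hy
  rw [pdf, pdf, this.fderiv_eq]

namespace Symb

theorem bound (h : Symb O n m A a) {x : X ν} (hx : x ∈ O) : ‖a x‖ ≤ A * ‖x‖ ^ m := by
  cases n with
  | zero => exact h x hx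
  | succ n => exact h.1 x hx

theorem of_succ (h : Symb O (n + 1) m A a) : Symb O n m A a := by
  induction n generalizing m a with
  | zero => exact h.1
  | succ n ih => exact ⟨h.1, h.2.1, fun j => ih (h.2.2 j)⟩

theorem mono_const (h : Symb O n m A a) (hAB : A ≤ B) : Symb O n m B a := by
  induction n generalizing m a with
  | zero =>
    exact fun x hx => (h x hx).trans
      (mul_le_mul_of_nonneg_right hAB (Real.rpow_nonneg (norm_nonneg _) _))
  | succ n ih =>
    exact ⟨fun x hx => (h.1 x hx).trans
      (mul_le_mul_of_nonneg_right hAB (Real.rpow_nonneg (norm_nonneg _) _)), h.2.1,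
      fun j => ih (h.2.2 j)⟩

theorem mono_set (h : Symb O n m A a) (hO : O' ⊆ O) : Symb O' n m A a := by
  induction n generalizing m a with
  | zero => exact fun x hx => h x (hO hx)
  | succ n ih => exact ⟨fun x hx => h.1 x (hO hx), fun x hx => h.2.1 x (hO hx), fun j => ih (h.2.2 j)⟩

theorem congr (h : Symb O n m A a) (hO : IsOpen O) (hab : ∀ x ∈ O, a x = b x) : Symb O n m A b := by
  induction n generalizing m a b with
  | zero => exact fun x hx => (hab x hx) ▸ h x hx
  | succ n ih =>
    refine ⟨fun x hx => (hab x hx) ▸ h.1 x hx, fun x hx => ?_, fun j => ih (h.2.2 j) fun x hx =>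
      pdf_congr hO hab j hx⟩
    refine (h.2.1 x hx).congr_of_eventuallyEq ?_
    filter_upwards [hO.mem_nhds hx] with y hy using (hab y hy).symm

theorem zero (hA : 0 ≤ A) : Symb O n m A (fun _ : X ν => (0 : ℂ)) := by
  have h0 : ∀ (m : ℝ) (x : X ν), ‖(0 : ℂ)‖ ≤ A * ‖x‖ ^ m := fun m x => by
    rw [norm_zero]; exact mul_nonneg hA (Real.rpow_nonneg (norm_nonneg _) _)
  induction n generalizing m with
  | zero => exact fun x _ => h0 m x
  | succ n ih =>
    refine ⟨fun x _ => h0 m x, fun x _ => differentiableAt_const _, fun j => ?_⟩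
    have : pdf j (fun _ : X ν => (0 : ℂ)) = fun _ => 0 := by ext x; simp [pdf]
    rw [this]
    exact ih

theorem const (c : ℂ) : Symb O n 0 ‖c‖ (fun _ : X ν => c) := by
  have h0 : ∀ x : X ν, ‖c‖ ≤ ‖c‖ * ‖x‖ ^ (0 : ℝ) := fun x => by simp
  cases n with
  | zero => exact fun x _ => h0 x
  | succ n =>
    refine ⟨fun x _ => h0 x, fun x _ => differentiableAt_const _, fun j => ?_⟩
    have : pdf j (fun _ : X ν => c) = fun _ => 0 := by ext x; simp [pdf]
    rw [this]
    exact zero (norm_nonneg _)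

theorem add (hO : IsOpen O) (ha : Symb O n m A a) (hb : Symb O n m B b) :
    Symb O n m (A + B) (fun x => a x + b x) := by
  induction n generalizing m a b with
  | zero => exact fun x hx => (norm_add_le _ _).trans (by rw [add_mul]; exact add_le_add (ha x hx) (hb x hx))
  | succ n ih =>
    refine ⟨fun x hx => (norm_add_le _ _).trans (by
      rw [add_mul]; exact add_le_add (ha.1 x hx) (hb.1 x hx)),
      fun x hx => (ha.2.1 x hx).add (hb.2.1 x hx), fun j => ?_⟩
    refine (ih (ha.2.2 j) (hb.2.2 j)).congr hO fun x hx => ?_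
    change _ = fderiv ℝ (fun x => a x + b x) x _
    rw [fderiv_fun_add (ha.2.1 x hx) (hb.2.1 x hx)]
    rfl

/-- The Leibniz rule gives two terms at each derivative, hence the `2 ^ n`. The origin is excluded
because powers of `|x|` are added. -/
theorem mul (hO : IsOpen O) (h0 : (0 : X ν) ∉ O) (hA : 0 ≤ A) (hB : 0 ≤ B) (ha : Symb O n m A a)
    (hb : Symb O n m' B b) : Symb O n (m + m') (2 ^ n * (A * B)) (fun x => a x * b x) := by
  have key : ∀ x ∈ O, ‖a x‖ ≤ A * ‖x‖ ^ m → ‖b x‖ ≤ B * ‖x‖ ^ m' →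
      ‖a x * b x‖ ≤ A * B * ‖x‖ ^ (m + m') := fun x hx h1 h2 => by
    have hx0 : 0 < ‖x‖ := norm_pos_iff.2 fun h => h0 (h ▸ hx)
    rw [norm_mul, Real.rpow_add hx0, mul_mul_mul_comm]
    exact mul_le_mul h1 h2 (norm_nonneg _) (by positivity)
  induction n generalizing m m' a b with
  | zero => exact fun x hx => by rw [pow_zero, one_mul]; exact key x hx (ha x hx) (hb x hx)
  | succ n ih =>
    refine ⟨fun x hx => (key x hx (ha.1 x hx) (hb.1 x hx)).trans ?_,
      fun x hx => (ha.2.1 x hx).mul (hb.2.1 x hx), fun j => ?_⟩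
    · refine mul_le_mul_of_nonneg_right ?_ (Real.rpow_nonneg (norm_nonneg _) _)
      exact le_mul_of_one_le_left (by positivity) (one_le_pow₀ one_le_two)
    · have k2 : ∀ {m m' : ℝ} {a b : X ν → ℂ}, ∀ x ∈ O, ‖a x‖ ≤ A * ‖x‖ ^ m → ‖b x‖ ≤ B * ‖x‖ ^ m' →
          ‖a x * b x‖ ≤ A * B * ‖x‖ ^ (m + m') := fun {m m' a b} x hx h1 h2 => by
        have hx0 : 0 < ‖x‖ := norm_pos_iff.2 fun h => h0 (h ▸ hx)
        rw [norm_mul, Real.rpow_add hx0, mul_mul_mul_comm]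
        exact mul_le_mul h1 h2 (norm_nonneg _) (by positivity)
      have e1 := ih ha.of_succ (hb.2.2 j) k2
      have e2 := ih (ha.2.2 j) hb.of_succ k2
      rw [← add_sub_assoc] at e1
      rw [sub_add_eq_add_sub] at e2
      have e3 := (add hO e1 e2).mono_const (B := 2 ^ (n + 1) * (A * B)) (by rw [pow_succ]; linarith)
      refine e3.congr hO fun x hx => ?_
      change _ = fderiv ℝ (fun x => a x * b x) x _
      rw [((ha.2.1 x hx).hasFDerivAt.fun_mul (hb.2.1 x hx).hasFDerivAt).fderiv]
      simp only [add_apply, smul_apply, smul_eq_mul, pdf]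
      ring

theorem const_mul (hO : IsOpen O) (h0 : (0 : X ν) ∉ O) (hA : 0 ≤ A) (c : ℂ) (ha : Symb O n m A a) :
    Symb O n m (2 ^ n * (‖c‖ * A)) (fun x => c * a x) := by
  have := mul hO h0 (norm_nonneg c) hA (const c) ha
  rwa [zero_add] at this

theorem coord (j : Fin ν) : Symb O n 1 1 (fun x : X ν => ((x j : ℝ) : ℂ)) := by
  have h0 : ∀ x : X ν, ‖((x j : ℝ) : ℂ)‖ ≤ 1 * ‖x‖ ^ (1 : ℝ) := fun x => by
    rw [Real.rpow_one, one_mul, Complex.norm_real]; exact PiLp.norm_apply_le x j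
  have hd : ∀ x : X ν, HasFDerivAt (fun x : X ν => ((x j : ℝ) : ℂ))
      (Complex.ofRealCLM.comp (EuclideanSpace.proj j : X ν →L[ℝ] ℝ)) x := fun x =>
    (Complex.ofRealCLM.comp (EuclideanSpace.proj j : X ν →L[ℝ] ℝ)).hasFDerivAt
  cases n with
  | zero => exact fun x _ => h0 x
  | succ n =>
    refine ⟨fun x _ => h0 x, fun x _ => (hd x).differentiableAt, fun i => ?_⟩
    have : pdf i (fun x : X ν => ((x j : ℝ) : ℂ)) =
        fun _ => (((EuclideanSpace.single i (1 : ℝ) : X ν) j : ℝ) : ℂ) := by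
      ext x; rw [pdf, (hd x).fderiv]; rfl
    rw [this, sub_self]
    refine (const _).mono_const ?_
    rw [Complex.norm_real]
    refine (PiLp.norm_apply_le _ j).trans ?_
    simp

theorem hasFDerivAt_rpow_norm (γ : ℝ) {x : X ν} (hx : x ≠ 0) :
    HasFDerivAt (fun x : X ν => ((‖x‖ ^ γ : ℝ) : ℂ))
      (Complex.ofRealCLM.comp ((γ * ‖x‖ ^ (γ - 2)) • innerSL ℝ x)) x := by
  have hx0 : 0 < ‖x‖ := norm_pos_iff.2 hx
  have h1 : HasFDerivAt (fun x : X ν => (‖x‖ ^ 2) ^ (γ / 2))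
      (((γ / 2) * (‖x‖ ^ 2) ^ (γ / 2 - 1)) • (2 • innerSL ℝ x)) x :=
    (hasStrictFDerivAt_norm_sq x).hasFDerivAt.rpow_const (Or.inl (by positivity))
  have h2 : ∀ y : X ν, (‖y‖ ^ 2) ^ (γ / 2) = ‖y‖ ^ γ := fun y => by
    rw [← Real.rpow_natCast, ← Real.rpow_mul (norm_nonneg _)]
    congr 1; push_cast; ring
  have h3 : (‖x‖ ^ 2) ^ (γ / 2 - 1) = ‖x‖ ^ (γ - 2) := by
    rw [← Real.rpow_natCast, ← Real.rpow_mul (norm_nonneg _)]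
    congr 1; push_cast; ring
  simp only [h2, h3] at h1
  refine Complex.ofRealCLM.hasFDerivAt.comp x (h1.congr_fderiv ?_)
  ext y
  simp only [smul_apply, smul_eq_mul, nsmul_eq_mul]
  push_cast
  ring

theorem pdf_rpow_norm (γ : ℝ) (j : Fin ν) {x : X ν} (hx : x ≠ 0) :
    pdf j (fun x : X ν => ((‖x‖ ^ γ : ℝ) : ℂ)) x =
      (γ : ℂ) * (((x j : ℝ) : ℂ) * ((‖x‖ ^ (γ - 2) : ℝ) : ℂ)) := by
  rw [pdf, (hasFDerivAt_rpow_norm γ hx).fderiv]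
  simp only [ContinuousLinearMap.comp_apply, smul_apply, innerSL_apply_apply, inner_single,
    smul_eq_mul, Complex.ofRealCLM_apply]
  push_cast
  ring

/-- Each derivative of `|x|^γ` is `γ x_j |x|^{γ-2}`, a product of symbols already known at the lower
level of regularity. -/
theorem exists_rpow_norm (hO : IsOpen O) (h0 : (0 : X ν) ∉ O) (n : ℕ) (γ : ℝ) :
    ∃ A, 0 ≤ A ∧ Symb O n γ A (fun x : X ν => ((‖x‖ ^ γ : ℝ) : ℂ)) := by
  have hb : ∀ γ : ℝ, ∀ x : X ν, ‖((‖x‖ ^ γ : ℝ) : ℂ)‖ = ‖x‖ ^ γ := fun γ x => by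
    rw [Complex.norm_real, Real.norm_of_nonneg (Real.rpow_nonneg (norm_nonneg _) _)]
  induction n generalizing γ with
  | zero => exact ⟨1, zero_le_one, fun x _ => by rw [hb, one_mul]⟩
  | succ n ih =>
    obtain ⟨A, hA, h⟩ := ih (γ - 2)
    have h1 : ∀ j, Symb O n (γ - 1) (2 ^ n * (‖(γ : ℂ)‖ * (2 ^ n * (1 * A))))
        (pdf j (fun x : X ν => ((‖x‖ ^ γ : ℝ) : ℂ))) := fun j => by
      have h2 := const_mul hO h0 (by positivity) (γ : ℂ) (mul hO h0 zero_le_one hA (coord j) h)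
      rw [show 1 + (γ - 2) = γ - 1 by ring] at h2
      exact h2.congr hO fun x hx => (pdf_rpow_norm γ j fun h => h0 (h ▸ hx)).symm
    refine ⟨max 1 (2 ^ n * (‖(γ : ℂ)‖ * (2 ^ n * (1 * A)))), by positivity, fun x _ => ?_,
      fun x hx => (hasFDerivAt_rpow_norm γ fun h => h0 (h ▸ hx)).differentiableAt,
      fun j => (h1 j).mono_const (le_max_right _ _)⟩
    rw [hb]
    exact le_mul_of_one_le_left (Real.rpow_nonneg (norm_nonneg _) _) (le_max_left _ _)

theorem pdf_eq_zero {s : Set (X ν)} (hs : IsOpen s) (h : ∀ x ∈ s, a x = 0) (j : Fin ν) :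
    ∀ x ∈ s, pdf j a x = 0 := fun x hx => by
  rw [pdf_congr hs (b := fun _ => 0) h j hx, pdf]; simp

/-- On the support `|x| ≥ R` one has `1 ≤ R^{-δ}|x|^δ`, and derivatives vanish where the symbol
does. The gain `R^{-δ}` is the source of the powers of `τ` and `r` in the final estimates. -/
theorem raise (h0 : (0 : X ν) ∉ O) (hA : 0 ≤ A) {R δ : ℝ} (hR : 0 < R) (hδ : 0 ≤ δ)
    (ha : Symb O n m A a) (hz : ∀ x, ‖x‖ < R → a x = 0) : Symb O n (m + δ) (A * R ^ (-δ)) a := by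
  have key : ∀ {m : ℝ} {a : X ν → ℂ}, (∀ x ∈ O, ‖a x‖ ≤ A * ‖x‖ ^ m) →
      (∀ x, ‖x‖ < R → a x = 0) → ∀ x ∈ O, ‖a x‖ ≤ A * R ^ (-δ) * ‖x‖ ^ (m + δ) :=
    fun {m a} h hz x hx => by
      have hx0 : 0 < ‖x‖ := norm_pos_iff.2 fun h => h0 (h ▸ hx)
      rcases lt_or_ge ‖x‖ R with h1 | h1
      · rw [hz x h1, norm_zero]; positivity
      · refine (h x hx).trans ?_
        rw [Real.rpow_add hx0, mul_assoc, mul_left_comm (R ^ (-δ))]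
        refine mul_le_mul_of_nonneg_left (le_mul_of_one_le_right (by positivity) ?_) hA
        rw [Real.rpow_neg hR.le, inv_mul_eq_div, one_le_div (by positivity)]
        exact Real.rpow_le_rpow hR.le h1 hδ
  induction n generalizing m a with
  | zero => exact key ha hz
  | succ n ih =>
    refine ⟨key ha.1 hz, ha.2.1, fun j => ?_⟩
    rw [← sub_add_eq_add_sub]
    exact ih (ha.2.2 j) fun x hx => pdf_eq_zero (s := {x | ‖x‖ < R})
      (isOpen_lt continuous_norm continuous_const) hz j x hx

/-- The counterpart of `raise` for a symbol supported in `|x| ≤ R`, where `1 ≤ R^δ|x|^{-δ}`. -/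
theorem lower (h0 : (0 : X ν) ∉ O) (hA : 0 ≤ A) {R δ : ℝ} (hR : 0 < R) (hδ : 0 ≤ δ)
    (ha : Symb O n m A a) (hz : ∀ x, R < ‖x‖ → a x = 0) : Symb O n (m - δ) (A * R ^ δ) a := by
  have key : ∀ {m : ℝ} {a : X ν → ℂ}, (∀ x ∈ O, ‖a x‖ ≤ A * ‖x‖ ^ m) →
      (∀ x, R < ‖x‖ → a x = 0) → ∀ x ∈ O, ‖a x‖ ≤ A * R ^ δ * ‖x‖ ^ (m - δ) :=
    fun {m a} h hz x hx => by
      have hx0 : 0 < ‖x‖ := norm_pos_iff.2 fun h => h0 (h ▸ hx)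
      rcases lt_or_ge R ‖x‖ with h1 | h1
      · rw [hz x h1, norm_zero]; positivity
      · refine (h x hx).trans ?_
        rw [sub_eq_add_neg, Real.rpow_add hx0, mul_assoc, mul_left_comm (R ^ δ)]
        refine mul_le_mul_of_nonneg_left (le_mul_of_one_le_right (by positivity) ?_) hA
        rw [Real.rpow_neg hx0.le, ← div_eq_mul_inv, one_le_div (by positivity)]
        exact Real.rpow_le_rpow hx0.le h1 hδ
  induction n generalizing m a with
  | zero => exact key ha hz
  | succ n ih =>
    refine ⟨key ha.1 hz, ha.2.1, fun j => ?_⟩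
    rw [sub_right_comm]
    exact ih (ha.2.2 j) fun x hx => pdf_eq_zero (s := {x | R < ‖x‖})
      (isOpen_lt continuous_const continuous_norm) hz j x hx

/-- Homogeneity of the bounds: the `t` from each derivative compensates the lowered order. In order
`0` the constant does not depend on `t`, which is what cutoffs at a variable scale require. -/
theorem scale {t : ℝ} (ht : 0 < t) (ha : Symb {x : X ν | x ≠ 0} n m A a) :
    Symb {x : X ν | x ≠ 0} n m (A * t ^ m) (fun x => a (t • x)) := by
  have key : ∀ {m : ℝ} {a : X ν → ℂ}, (∀ x ∈ {x : X ν | x ≠ 0}, ‖a x‖ ≤ A * ‖x‖ ^ m) →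
      ∀ x ∈ {x : X ν | x ≠ 0}, ‖a (t • x)‖ ≤ A * t ^ m * ‖x‖ ^ m := fun {m a} h x hx => by
    refine (h (t • x) (smul_ne_zero ht.ne' hx)).trans (le_of_eq ?_)
    rw [norm_smul, Real.norm_of_nonneg ht.le, Real.mul_rpow ht.le (norm_nonneg _), mul_assoc]
  induction n generalizing m a with
  | zero => exact key ha
  | succ n ih =>
    have hd : ∀ x : X ν, x ≠ 0 → HasFDerivAt (fun x => a (t • x))
        ((fderiv ℝ a (t • x)).comp (t • ContinuousLinearMap.id ℝ (X ν))) x := fun x hx =>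
      (ha.2.1 (t • x) (smul_ne_zero ht.ne' hx)).hasFDerivAt.comp x
        ((t • ContinuousLinearMap.id ℝ (X ν)).hasFDerivAt)
    refine ⟨key ha.1, fun x hx => (hd x hx).differentiableAt, fun j => ?_⟩
    -- Multiplication by a scalar with the exact factor `t`; `const_mul` would cost an additional `2
    -- ^ n` and spoil the induction.
    have h2 : ∀ {n : ℕ} {m C : ℝ} {b : X ν → ℂ}, Symb {x : X ν | x ≠ 0} n m C b →
        Symb {x : X ν | x ≠ 0} n m (t * C) (fun x => (t : ℂ) * b x) := by
      intro n
      induction n with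
      | zero =>
        intro m C b hb x hx
        rw [norm_mul, Complex.norm_real, Real.norm_of_nonneg ht.le, mul_assoc]
        exact mul_le_mul_of_nonneg_left (hb x hx) ht.le
      | succ n ihn =>
        intro m C b hb
        refine ⟨fun x hx => ?_, fun x hx => (hb.2.1 x hx).const_mul _, fun j => ?_⟩
        · rw [norm_mul, Complex.norm_real, Real.norm_of_nonneg ht.le, mul_assoc]
          exact mul_le_mul_of_nonneg_left (hb.1 x hx) ht.le
        · refine (ihn (hb.2.2 j)).congr isOpen_ne fun x hx => ?_
          change _ = fderiv ℝ (fun x => (t : ℂ) * b x) x _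
          rw [fderiv_const_mul (hb.2.1 x hx)]
          rfl
    have h3 := h2 (ih (ha.2.2 j))
    have h4 : t * (A * t ^ (m - 1)) = A * t ^ m := by
      rw [Real.rpow_sub_one ht.ne']; field_simp
    rw [h4] at h3
    refine h3.congr isOpen_ne fun x hx => ?_
    rw [pdf, pdf, (hd x hx).fderiv]
    simp

/-- The product `‖G x‖ ‖x‖^{-m}` is continuous, since `G` vanishes near the only singular point, and
has compact support. -/
theorem exists_bound_of_hasCompactSupport {G : X ν → ℂ} (hG : Continuous G)
    (hc : HasCompactSupport G) {c : ℝ} (hc0 : 0 < c) (hz : ∀ x, ‖x‖ < c → G x = 0) (m : ℝ) :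
    ∃ A, 0 ≤ A ∧ ∀ x ∈ {x : X ν | x ≠ 0}, ‖G x‖ ≤ A * ‖x‖ ^ m := by
  have hcont : Continuous fun x => ‖G x‖ * ‖x‖ ^ (-m) := by
    refine continuous_iff_continuousAt.2 fun x => ?_
    rcases eq_or_ne x 0 with rfl | hx
    · refine (continuousAt_const (y := (0 : ℝ))).congr ?_
      filter_upwards [Metric.ball_mem_nhds (0 : X ν) hc0] with y hy
      rw [hz y (by simpa using hy)]; simp
    · exact (hG.norm.continuousAt).mul
        (continuousAt_id.norm.rpow_const (Or.inl (norm_ne_zero_iff.2 hx)))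
  have hcs : HasCompactSupport fun x => ‖G x‖ * ‖x‖ ^ (-m) := hc.norm.mul_right
  obtain ⟨A, hA⟩ := hcs.exists_bound_of_continuous hcont
  refine ⟨A, (norm_nonneg _).trans (hA 0), fun x hx => ?_⟩
  have hx0 : 0 < ‖x‖ := norm_pos_iff.2 hx
  have h1 := (le_abs_self _).trans (hA x)
  rwa [Real.rpow_neg hx0.le, ← div_eq_mul_inv, div_le_iff₀ (by positivity)] at h1

/-- Compactly supported smooth functions vanishing near `0`. -/
theorem exists_of_hasCompactSupport {G : X ν → ℂ} (hG : ContDiff ℝ ∞ G) (hc : HasCompactSupport G)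
    {c : ℝ} (hc0 : 0 < c) (hz : ∀ x, ‖x‖ < c → G x = 0) (n : ℕ) (m : ℝ) :
    ∃ A, 0 ≤ A ∧ Symb {x : X ν | x ≠ 0} n m A G := by
  induction n generalizing G m with
  | zero => exact exists_bound_of_hasCompactSupport hG.continuous hc hc0 hz m
  | succ n ih =>
    obtain ⟨A, hA, h⟩ := exists_bound_of_hasCompactSupport hG.continuous hc hc0 hz m
    have h1 : ∀ j : Fin ν, ∃ A, 0 ≤ A ∧ Symb {x : X ν | x ≠ 0} n (m - 1) A (pdf j G) := fun j =>
      ih ((hG.fderiv_right (m := ∞) (by simp)).clm_apply contDiff_const)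
        (hc.fderiv_apply (𝕜 := ℝ) _) (fun x hx => pdf_eq_zero (s := {x | ‖x‖ < c})
          (isOpen_lt continuous_norm continuous_const) hz j x hx) (m - 1)
    choose B hB hBS using h1
    refine ⟨A + ∑ j, B j, add_nonneg hA (Finset.sum_nonneg fun j _ => hB j), fun x hx => ?_,
      fun x _ => hG.differentiable (by simp) x, fun j => (hBS j).mono_const ?_⟩
    · refine (h x hx).trans (mul_le_mul_of_nonneg_right ?_ (Real.rpow_nonneg (norm_nonneg _) _))
      exact le_add_of_nonneg_right (Finset.sum_nonneg fun j _ => hB j)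
    · exact (Finset.single_le_sum (f := B) (fun j _ => hB j) (Finset.mem_univ j)).trans
        (le_add_of_nonneg_left hA)

end Symb

end Symbols

end

section

/-! ### Symbols constant near infinity, and translates of symbols -/

section Symbols

variable {ν : ℕ}

namespace Symb

variable {n : ℕ} {m A : ℝ} {a : X ν → ℂ}

/-- Smooth functions vanishing near `0` and constant near infinity. -/
theorem exists_of_eventually_const {G : X ν → ℂ} (hG : ContDiff ℝ ∞ G) {c R : ℝ} (hc0 : 0 < c)
    (hz : ∀ x, ‖x‖ < c → G x = 0) {C : ℂ} (hR : ∀ x, R < ‖x‖ → G x = C) (n : ℕ) :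
    ∃ A, 0 ≤ A ∧ Symb {x : X ν | x ≠ 0} n 0 A G := by
  have hsupp : HasCompactSupport fun x => G x - C := by
    refine HasCompactSupport.of_support_subset_isCompact (isCompact_closedBall (0 : X ν) R) ?_
    intro x hx
    by_contra h
    rw [mem_closedBall_zero_iff, not_le] at h
    exact hx (by simp [hR x h])
  have hb : ∃ A, ∀ x, ‖G x‖ ≤ A := by
    obtain ⟨A, hA⟩ := hsupp.exists_bound_of_continuous (hG.continuous.sub continuous_const)
    refine ⟨A + ‖C‖, fun x => ?_⟩
    calc ‖G x‖ = ‖(G x - C) + C‖ := by rw [sub_add_cancel]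
      _ ≤ _ := (norm_add_le _ _).trans (by gcongr; exact hA x)
  obtain ⟨A, hA⟩ := hb
  have hA0 : 0 ≤ A := (norm_nonneg _).trans (hA 0)
  cases n with
  | zero => exact ⟨A, hA0, fun x _ => by simpa using hA x⟩
  | succ n =>
    have h1 : ∀ j : Fin ν, ∃ A, 0 ≤ A ∧ Symb {x : X ν | x ≠ 0} n (0 - 1) A (pdf j G) := fun j => by
      refine exists_of_hasCompactSupport
        ((hG.fderiv_right (m := ∞) (by simp)).clm_apply contDiff_const) ?_ hc0
        (fun x hx => pdf_eq_zero (s := {x | ‖x‖ < c})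
          (isOpen_lt continuous_norm continuous_const) hz j x hx) n (0 - 1)
      have := hsupp.fderiv_apply (𝕜 := ℝ) (EuclideanSpace.single j 1)
      simpa only [fderiv_sub_const] using this
    choose B hB hBS using h1
    refine ⟨A + ∑ j, B j, add_nonneg hA0 (Finset.sum_nonneg fun j _ => hB j), fun x hx => ?_,
      fun x _ => hG.differentiable (by simp) x, fun j => (hBS j).mono_const ?_⟩
    · rw [Real.rpow_zero, mul_one]
      exact (hA x).trans (le_add_of_nonneg_right (Finset.sum_nonneg fun j _ => hB j))
    · exact (Finset.single_le_sum (f := B) (fun j _ => hB j) (Finset.mem_univ j)).trans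
        (le_add_of_nonneg_left hA0)

/-- Away from the origin `‖y‖` and `‖y - v‖` are comparable with ratio at most `2 + 2‖v‖` either
way, which controls positive and negative powers alike. -/
theorem rpow_norm_sub_le {v y : X ν} (hy : 1 / 2 < ‖y‖) (h1 : 1 ≤ ‖y - v‖) {M : ℝ} (hM : |m| ≤ M) :
    ‖y - v‖ ^ m ≤ (2 + 2 * ‖v‖) ^ M * ‖y‖ ^ m := by
  have hv := norm_nonneg v
  have hc : 1 ≤ 2 + 2 * ‖v‖ := by linarith
  have hy0 : 0 < ‖y‖ := by linarith
  have a1 : ‖y - v‖ ≤ (2 + 2 * ‖v‖) * ‖y‖ := by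
    have := norm_sub_le y v
    nlinarith
  have a2 : ‖y‖ ≤ (2 + 2 * ‖v‖) * ‖y - v‖ := by
    have := norm_sub_norm_le y v
    nlinarith
  have a3 : (2 + 2 * ‖v‖) ^ |m| * ‖y‖ ^ m ≤ (2 + 2 * ‖v‖) ^ M * ‖y‖ ^ m :=
    mul_le_mul_of_nonneg_right (Real.rpow_le_rpow_of_exponent_le hc hM) (by positivity)
  refine le_trans ?_ a3
  rcases le_or_gt 0 m with hm | hm
  · rw [abs_of_nonneg hm, ← Real.mul_rpow (by linarith) hy0.le]
    exact Real.rpow_le_rpow (norm_nonneg _) a1 hm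
  · rw [abs_of_neg hm]
    have h2 : ‖y‖ / (2 + 2 * ‖v‖) ≤ ‖y - v‖ := by
      rw [div_le_iff₀ (by linarith), mul_comm]; exact a2
    refine (Real.rpow_le_rpow_of_nonpos (by positivity) h2 hm.le).trans (le_of_eq ?_)
    rw [Real.div_rpow hy0.le (by linarith), Real.rpow_neg (by linarith), div_eq_inv_mul]

/-- The exponent `M` dominates the absolute values of all the orders `m, m - 1, …, m - n` that
occur. Vanishing on the unit ball hides the displaced origin. -/
theorem translate (hA : 0 ≤ A) (v : X ν) {M : ℝ} (hM : |m| + n ≤ M) (ha : Symb {x : X ν | x ≠ 0} n m A a)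
    (hz : ∀ x, ‖x‖ < 1 → a x = 0) :
    Symb {x : X ν | 1 / 2 < ‖x‖} n m (A * (2 + 2 * ‖v‖) ^ M) (fun y => a (y - v)) := by
  have key : ∀ {m : ℝ} {a : X ν → ℂ}, |m| ≤ M → (∀ x ∈ {x : X ν | x ≠ 0}, ‖a x‖ ≤ A * ‖x‖ ^ m) →
      (∀ x, ‖x‖ < 1 → a x = 0) → ∀ y ∈ {x : X ν | 1 / 2 < ‖x‖},
        ‖a (y - v)‖ ≤ A * (2 + 2 * ‖v‖) ^ M * ‖y‖ ^ m := fun {m a} hm h hz y hy => by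
    rcases lt_or_ge ‖y - v‖ 1 with h1 | h1
    · rw [hz _ h1, norm_zero]; positivity
    · rw [mul_assoc]
      exact (h (y - v) (norm_pos_iff.1 (by linarith))).trans
        (mul_le_mul_of_nonneg_left (rpow_norm_sub_le hy h1 hm) hA)
  induction n generalizing m a with
  | zero => exact key (by simpa using hM) ha hz
  | succ n ih =>
    push_cast at hM
    have hd : ∀ x, DifferentiableAt ℝ a x := fun x => by
      rcases lt_or_ge ‖x‖ 1 with h1 | h1
      · refine (differentiableAt_const (0 : ℂ)).congr_of_eventuallyEq ?_
        filter_upwards [(isOpen_lt continuous_norm continuous_const).mem_nhds h1] with y hy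
          using hz y hy
      · exact ha.2.1 x (norm_pos_iff.1 (by linarith))
    have hd' : ∀ y, HasFDerivAt (fun y => a (y - v)) (fderiv ℝ a (y - v)) y := fun y =>
      ((hd (y - v)).hasFDerivAt.comp y ((hasFDerivAt_id y).sub_const v))
    refine ⟨key (by have : (0 : ℝ) ≤ n := n.cast_nonneg; linarith) ha.1 hz,
      fun y _ => (hd' y).differentiableAt, fun j => ?_⟩
    have h1 := ih (m := m - 1) (a := pdf j a) (by
      have h2 : |m - 1| ≤ |m| + |(1 : ℝ)| := abs_sub _ _
      rw [abs_one] at h2; linarith) (ha.2.2 j)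
      (fun x hx => pdf_eq_zero (s := {x | ‖x‖ < 1})
          (isOpen_lt continuous_norm continuous_const) hz j x hx)
    have h2 : pdf j (fun y => a (y - v)) = fun y => pdf j a (y - v) := by
      ext y; rw [pdf, (hd' y).fderiv]; rfl
    rw [h2]
    exact h1

end Symb

end Symbols

/-! ### Oscillatory integrals -/

section Oscillatory

variable {ν : ℕ}

theorem rpow_le_one_add_pow {x : X ν} (hx : 1 ≤ ‖x‖) (m : ℝ) :
    ‖x‖ ^ m ≤ (1 + ‖x‖) ^ ⌈|m|⌉₊ := by
  calc ‖x‖ ^ m ≤ ‖x‖ ^ (⌈|m|⌉₊ : ℝ) :=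
        Real.rpow_le_rpow_of_exponent_le hx ((le_abs_self m).trans (Nat.le_ceil _))
    _ = ‖x‖ ^ ⌈|m|⌉₊ := Real.rpow_natCast _ _
    _ ≤ _ := pow_le_pow_left₀ (norm_nonneg _) (by linarith) _

theorem memLp_mul_schwartz {g : X ν → ℂ} (hg : AEStronglyMeasurable g volume) {C : ℝ} {N : ℕ}
    (hC : ∀ x, ‖g x‖ ≤ C * (1 + ‖x‖) ^ N) (f : 𝓢(X ν, ℂ)) (p : ℝ≥0∞) :
    MemLp (fun x => g x * f x) p volume := by
  have h1 : Function.HasTemperateGrowth fun x : X ν => (1 + ‖x‖ ^ 2) ^ (N : ℝ) :=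
    Function.hasTemperateGrowth_one_add_norm_sq_rpow (X ν) N
  have h2 : Function.HasTemperateGrowth fun x : X ν => (((1 + ‖x‖ ^ 2) ^ (N : ℝ) : ℝ) : ℂ) := by
    fun_prop
  have h3 := (SchwartzMap.smulLeftCLM ℂ (fun x : X ν => (((1 + ‖x‖ ^ 2) ^ (N : ℝ) : ℝ) : ℂ)) f).memLp p volume
  refine h3.of_le_mul (c := C * 2 ^ N) (hg.mul f.continuous.aestronglyMeasurable)
    (Eventually.of_forall fun x => ?_)
  rw [SchwartzMap.smulLeftCLM_apply_apply h2, norm_mul, norm_smul, ← mul_assoc]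
  refine mul_le_mul_of_nonneg_right ?_ (norm_nonneg _)
  have hC0 : 0 ≤ C := by
    have := (norm_nonneg _).trans (hC 0)
    simpa using this
  rw [Complex.norm_real, Real.norm_of_nonneg (by positivity), Real.rpow_natCast, mul_assoc, ← mul_pow]
  refine (hC x).trans (mul_le_mul_of_nonneg_left (pow_le_pow_left₀ (by positivity) ?_ _) hC0)
  nlinarith [sq_nonneg (‖x‖ - 1), norm_nonneg x]

theorem integrable_mul_schwartz {g : X ν → ℂ} (hg : AEStronglyMeasurable g volume) {C : ℝ} {N : ℕ}
    (hC : ∀ x, ‖g x‖ ≤ C * (1 + ‖x‖) ^ N) (f : 𝓢(X ν, ℂ)) : Integrable (fun x => g x * f x) :=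
  memLp_one_iff_integrable.1 (memLp_mul_schwartz hg hC f 1)

/-- The oscillating factor `e^{ik|x|^α}`. -/
def osc (k α : ℝ) (x : X ν) : ℂ := Complex.exp (Complex.I * ((k * ‖x‖ ^ α : ℝ) : ℂ))

theorem norm_osc (k α : ℝ) (x : X ν) : ‖osc k α x‖ = 1 := by
  rw [osc, mul_comm]; exact Complex.norm_exp_ofReal_mul_I _

theorem measurable_osc (k α : ℝ) : Measurable (osc k α : X ν → ℂ) := by
  unfold osc; fun_prop

theorem hasFDerivAt_osc (k α : ℝ) {x : X ν} (hx : x ≠ 0) : HasFDerivAt (osc k α)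
    (osc k α x • (Complex.I * k) • Complex.ofRealCLM.comp ((α * ‖x‖ ^ (α - 2)) • innerSL ℝ x)) x := by
  have h1 := ((Symb.hasFDerivAt_rpow_norm α hx).const_mul (Complex.I * k)).cexp
  have h2 : (fun x : X ν => Complex.exp (Complex.I * k * ((‖x‖ ^ α : ℝ) : ℂ))) = osc k α := by
    ext y; rw [osc]; congr 1; push_cast; ring
  rw [h2] at h1
  refine h1.congr_fderiv ?_
  rw [show Complex.exp (Complex.I * k * ((‖x‖ ^ α : ℝ) : ℂ)) = osc k α x from congrFun h2 x]

theorem pdf_osc (k α : ℝ) (j : Fin ν) {x : X ν} (hx : x ≠ 0) :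
    pdf j (osc k α) x = osc k α x * (Complex.I * k * α * ((x j : ℝ) : ℂ) * ((‖x‖ ^ (α - 2) : ℝ) : ℂ)) := by
  rw [pdf, (hasFDerivAt_osc k α hx).fderiv]
  simp only [smul_apply, ContinuousLinearMap.comp_apply, innerSL_apply_apply, inner_single,
    smul_eq_mul, Complex.ofRealCLM_apply]
  push_cast
  ring

theorem differentiable_of_vanishing {a : X ν → ℂ} (hz : ∀ x, ‖x‖ < 1 → a x = 0)
    (h : ∀ x : X ν, 1 / 2 < ‖x‖ → DifferentiableAt ℝ a x) : Differentiable ℝ a := fun x => by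
  rcases lt_or_ge ‖x‖ 1 with h1 | h1
  · refine (differentiableAt_const (0 : ℂ)).congr_of_eventuallyEq ?_
    filter_upwards [(isOpen_lt continuous_norm continuous_const).mem_nhds h1] with y hy using hz y hy
  · exact h x (by linarith)

theorem measurable_pdf (j : Fin ν) (a : X ν → ℂ) : Measurable (pdf j a) :=
  measurable_fderiv_apply_const ℝ a _

/-- The region where the symbols of the potential live. -/
def outer (ν : ℕ) : Set (X ν) := {x | 1 / 2 < ‖x‖}

theorem isOpen_outer : IsOpen (outer ν) := isOpen_lt continuous_const continuous_norm

theorem zero_notMem_outer : (0 : X ν) ∉ outer ν := by simp [outer]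

theorem Symb.poly_bound {n : ℕ} {m A : ℝ} {a : X ν → ℂ} (hA : 0 ≤ A) (ha : Symb (outer ν) n m A a)
    (hz : ∀ x, ‖x‖ < 1 → a x = 0) (x : X ν) : ‖a x‖ ≤ A * (1 + ‖x‖) ^ ⌈|m|⌉₊ := by
  rcases lt_or_ge ‖x‖ 1 with h1 | h1
  · rw [hz x h1, norm_zero]; positivity
  · have hx : 1 / 2 < ‖x‖ := by linarith
    exact (ha.bound hx).trans (mul_le_mul_of_nonneg_left (rpow_le_one_add_pow h1 m) hA)

theorem vanishing_pdf {a : X ν → ℂ} (hz : ∀ x, ‖x‖ < 1 → a x = 0) (j : Fin ν) :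
    ∀ x, ‖x‖ < 1 → pdf j a x = 0 := fun x hx =>
  Symb.pdf_eq_zero (s := {x | ‖x‖ < 1}) (isOpen_lt continuous_norm continuous_const) hz j x hx

/-- Induction by non-stationary phase. With `F_j = x_j|x|^{-α} a`, the divergence of `F e^{ik|x|^α}`
is `(div F) e^{ik|x|^α} + ikα a e^{ik|x|^α}`. Both `F_j` and its derivatives are symbols of order at
most `n(α-1)`, one step below `a`, and the total divergence is integrated by parts onto `f`. -/
theorem exists_osc_bound {k α : ℝ} (hk : k ≠ 0) (hα : 0 < α) (n : ℕ) :
    ∃ K, 0 ≤ K ∧ ∀ (a : X ν → ℂ) (A : ℝ), 0 ≤ A → (∀ x, ‖x‖ < 1 → a x = 0) →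
      Symb (outer ν) n (n * (α - 1)) A a → ∀ f : 𝓢(X ν, ℂ),
        ‖∫ x, a x * osc k α x * f x‖ ≤ K * A * l1Deriv n f := by
  induction n with
  | zero =>
    refine ⟨1, zero_le_one, fun a A hA hz ha f => ?_⟩
    refine (norm_integral_le_integral_norm _).trans ?_
    rw [one_mul, l1Deriv, ← integral_const_mul]
    refine integral_mono_of_nonneg (Eventually.of_forall fun _ => norm_nonneg _)
      (f.integrable.norm.const_mul A) (Eventually.of_forall fun x => ?_)
    simp only [norm_mul, norm_osc, mul_one]
    refine mul_le_mul_of_nonneg_right ?_ (norm_nonneg _)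
    have h := Symb.poly_bound hA ha hz x
    simpa using h
  | succ n ih =>
    obtain ⟨K, hK, hKb⟩ := ih
    obtain ⟨B, hB, hBS⟩ := Symb.exists_rpow_norm (isOpen_outer (ν := ν)) zero_notMem_outer (n + 1) (-α)
    have hc : ∀ j : Fin ν, Symb (outer ν) (n + 1) (1 - α) (2 ^ (n + 1) * (1 * B))
        (fun x => ((x j : ℝ) : ℂ) * ((‖x‖ ^ (-α) : ℝ) : ℂ)) := fun j =>
      Symb.mul isOpen_outer zero_notMem_outer zero_le_one hB (Symb.coord j) hBS
    set D : ℝ := 2 ^ (n + 1) * (2 ^ (n + 1) * (1 * B)) with hD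
    have hD0 : 0 ≤ D := by positivity
    set c : ℂ := Complex.I * k * α with hcdef
    have hc0 : c ≠ 0 := mul_ne_zero (mul_ne_zero Complex.I_ne_zero (Complex.ofReal_ne_zero.2 hk))
      (Complex.ofReal_ne_zero.2 hα.ne')
    refine ⟨‖c‖⁻¹ * (K * D * (ν + 1)), by positivity, fun a A hA hz ha f => ?_⟩
    set F : Fin ν → X ν → ℂ := fun j x => ((x j : ℝ) : ℂ) * ((‖x‖ ^ (-α) : ℝ) : ℂ) * a x with hF
    have hFz : ∀ j x, ‖x‖ < 1 → F j x = 0 := fun j x hx => by simp only [hF, hz x hx, mul_zero]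
    have hFS : ∀ j, Symb (outer ν) (n + 1) (n * (α - 1)) (D * A) (F j) := fun j => by
      have h1 := Symb.mul isOpen_outer zero_notMem_outer (by positivity) hA (hc j) ha
      rw [show (1 - α) + ((n + 1 : ℕ) : ℝ) * (α - 1) = n * (α - 1) by push_cast; ring] at h1
      refine h1.mono_const (le_of_eq ?_)
      rw [hD]; ring
    have hFd : ∀ j, Differentiable ℝ (F j) := fun j =>
      differentiable_of_vanishing (hFz j) fun x hx => (hFS j).2.1 x hx
    -- The derivative has order `n(α-1) - 1`, better than needed; it is raised by `1` at no cost, as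
    -- it vanishes for `|x| < 1`.
    have hbS : ∀ j, Symb (outer ν) n (n * (α - 1)) (D * A) (pdf j (F j)) := fun j => by
      have h1 := ((hFS j).2.2 j).raise zero_notMem_outer (by positivity) zero_lt_one
        zero_le_one (vanishing_pdf (hFz j) j)
      rwa [sub_add_cancel, Real.one_rpow, mul_one] at h1
    have had : Differentiable ℝ a := differentiable_of_vanishing hz fun x hx => ha.2.1 x hx
    -- the oscillating vector field
    set G : Fin ν → X ν → ℂ := fun j x => F j x * osc k α x with hG
    have hGd : ∀ j, Differentiable ℝ (G j) := fun j =>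
      differentiable_of_vanishing (fun x hx => by simp only [hG, hFz j x hx, zero_mul])
        fun x hx => (hFd j x).mul
          (hasFDerivAt_osc k α (fun h => zero_notMem_outer (h ▸ hx))).differentiableAt
    have hpG' : ∀ j {x : X ν}, x ≠ 0 → pdf j (G j) x = pdf j (F j) x * osc k α x +
        F j x * (osc k α x * (c * ((x j : ℝ) : ℂ) * ((‖x‖ ^ (α - 2) : ℝ) : ℂ))) := by
      intro j x hx0
      rw [← pdf_osc k α j hx0]
      change fderiv ℝ (fun x => F j x * osc k α x) x _ = _
      rw [((hFd j x).hasFDerivAt.fun_mul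
        (hasFDerivAt_osc k α hx0).differentiableAt.hasFDerivAt).fderiv]
      simp only [add_apply, smul_apply, smul_eq_mul, pdf]
      ring
    -- Differentiating the phase gives `ikα a ∑ x_j² |x|^{-α} |x|^{α-2} = ikα a`: the factor
    -- `|x|^{-α}` in `F` was chosen for this.
    have hpG : ∀ x, ∑ j, pdf j (G j) x = (∑ j, pdf j (F j) x * osc k α x) + c * (a x * osc k α x) := by
      intro x
      rcases lt_or_ge ‖x‖ 1 with h1 | h1
      · have e1 : ∀ j, pdf j (G j) x = 0 := fun j =>
          vanishing_pdf (fun x hx => by simp only [hG, hFz j x hx, zero_mul]) j x h1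
        have e2 : ∀ j, pdf j (F j) x = 0 := fun j => vanishing_pdf (hFz j) j x h1
        simp [e1, e2, hz x h1]
      · have hx0 : x ≠ 0 := norm_pos_iff.1 (by linarith)
        have hxp : 0 < ‖x‖ := norm_pos_iff.2 hx0
        simp_rw [hpG' _ hx0]
        rw [Finset.sum_add_distrib]
        congr 1
        have e2 : ∀ j, F j x * (osc k α x * (c * ((x j : ℝ) : ℂ) * ((‖x‖ ^ (α - 2) : ℝ) : ℂ))) =
            c * (a x * osc k α x) * (((x j ^ 2 : ℝ) : ℂ) * ((‖x‖ ^ (-α) * ‖x‖ ^ (α - 2) : ℝ) : ℂ)) :=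
          fun j => by simp only [hF]; push_cast; ring
        simp_rw [e2]
        rw [← Finset.mul_sum, ← Finset.sum_mul, ← Complex.ofReal_sum, ← EuclideanSpace.real_norm_sq_eq,
          ← Complex.ofReal_mul, ← Real.rpow_add hxp, ← Real.rpow_natCast, ← Real.rpow_add hxp]
        rw [show ((2 : ℕ) : ℝ) + (-α + (α - 2)) = 0 by push_cast; ring, Real.rpow_zero,
          Complex.ofReal_one, mul_one]
    have mosc : AEStronglyMeasurable (osc k α : X ν → ℂ) volume :=
      (measurable_osc k α).aestronglyMeasurable
    have i1 : ∀ (j : Fin ν) (f : 𝓢(X ν, ℂ)), Integrable fun x => G j x * f x := fun j f =>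
      integrable_mul_schwartz (hGd j).continuous.aestronglyMeasurable
        (fun x => by
          rw [hG, norm_mul, norm_osc, mul_one]
          exact (hFS j).poly_bound (by positivity) (hFz j) x) f
    have i2 : ∀ j, Integrable fun x => pdf j (F j) x * osc k α x * f x := fun j =>
      integrable_mul_schwartz ((measurable_pdf j _).aestronglyMeasurable.mul mosc)
        (fun x => by
          change ‖pdf j (F j) x * osc k α x‖ ≤ _
          rw [norm_mul, norm_osc, mul_one]
          exact (hbS j).poly_bound (by positivity) (vanishing_pdf (hFz j) j) x) f
    have i3 : Integrable fun x => a x * osc k α x * f x :=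
      integrable_mul_schwartz (had.continuous.aestronglyMeasurable.mul mosc)
        (fun x => by
          change ‖a x * osc k α x‖ ≤ _
          rw [norm_mul, norm_osc, mul_one]
          exact ha.poly_bound hA hz x) f
    have i4 : ∀ j, Integrable fun x => pdf j (G j) x * f x := by
      -- Only integrability is at stake here, so any polynomial bound on the phase term is enough;
      -- decay comes from `f`.
      intro j
      have hGz : ∀ x, ‖x‖ < 1 → G j x = 0 := fun x hx => by simp only [hG, hFz j x hx, zero_mul]
      obtain ⟨B', hB', hBS'⟩ := Symb.exists_rpow_norm (isOpen_outer (ν := ν)) zero_notMem_outer 0 (α - 2)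
      have hL := Symb.mul isOpen_outer zero_notMem_outer (by positivity)
        (by positivity : 0 ≤ 2 ^ 0 * (1 * B'))
        (show Symb (outer ν) 0 (n * (α - 1)) (D * A) (F j) from fun x hx => (hFS j).bound hx)
        (Symb.mul isOpen_outer zero_notMem_outer zero_le_one hB' (Symb.coord (n := 0) j) hBS')
      have i5 : Integrable fun x => F j x * (((x j : ℝ) : ℂ) * ((‖x‖ ^ (α - 2) : ℝ) : ℂ)) *
          osc k α x * f x :=
        integrable_mul_schwartz
          (((hFd j).continuous.measurable.mul ((Complex.measurable_ofReal.comp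
            (by fun_prop)).mul (Complex.measurable_ofReal.comp
              (measurable_norm.pow_const _)))).mul (measurable_osc k α)).aestronglyMeasurable
          (fun x => by
            change ‖F j x * (((x j : ℝ) : ℂ) * ((‖x‖ ^ (α - 2) : ℝ) : ℂ)) * osc k α x‖ ≤ _
            rw [norm_mul, norm_osc, mul_one]
            exact hL.poly_bound (by positivity) (fun x hx => by rw [hFz j x hx, zero_mul]) x) f
      refine ((i2 j).add (i5.const_mul c)).congr (Eventually.of_forall fun x => ?_)
      change pdf j (F j) x * osc k α x * f x + c * (F j x * (((x j : ℝ) : ℂ) *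
        ((‖x‖ ^ (α - 2) : ℝ) : ℂ)) * osc k α x * f x) = pdf j (G j) x * f x
      rcases lt_or_ge ‖x‖ 1 with h1 | h1
      · rw [vanishing_pdf hGz j x h1, vanishing_pdf (hFz j) j x h1, hFz j x h1]
        ring
      · rw [hpG' j (norm_pos_iff.1 (by linarith))]
        ring
    have ibp : ∀ j, ∫ x, G j x * pd j f x = - ∫ x, pdf j (G j) x * f x := fun j => by
      have := integral_mul_fderiv_eq_neg_fderiv_mul_of_integrable (𝕜 := ℂ) (f := G j) (g := f)
        (v := EuclideanSpace.single j 1) (i4 j) (by simpa only [pd_apply] using i1 j (pd j f)) (i1 j f)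
        (fun x _ => hGd j x) (fun x _ => f.differentiable x)
      simpa only [pd_apply, pdf] using this
    -- Both terms on the right are oscillatory integrals of level `n`: the first against `∂_j f`,
    -- the second against `f`.
    have main : c * ∫ x, a x * osc k α x * f x =
        -(∑ j, ∫ x, G j x * pd j f x) - ∑ j, ∫ x, pdf j (F j) x * osc k α x * f x := by
      simp_rw [ibp]
      rw [Finset.sum_neg_distrib, neg_neg, ← integral_finsetSum _ fun j _ => i4 j,
        ← integral_finsetSum _ fun j _ => i2 j, ← integral_const_mul, eq_sub_iff_add_eq,
        ← integral_add (i3.const_mul c) (integrable_finsetSum _ fun j _ => i2 j)]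
      refine integral_congr_ae (Eventually.of_forall fun x => ?_)
      simp only
      have h := congrArg (fun z => z * f x) (hpG x)
      simp only [Finset.sum_mul, add_mul] at h ⊢
      rw [h]
      ring
    have b1 : ∀ j, ‖∫ x, G j x * pd j f x‖ ≤ K * (D * A) * l1Deriv n (pd j f) := fun j =>
      hKb (F j) (D * A) (by positivity) (hFz j) (hFS j).of_succ (pd j f)
    have b2 : ∀ j, ‖∫ x, pdf j (F j) x * osc k α x * f x‖ ≤ K * (D * A) * l1Deriv n f := fun j =>
      hKb (pdf j (F j)) (D * A) (by positivity) (vanishing_pdf (hFz j) j) (hbS j) f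
    have hn := l1Deriv_nonneg n f
    have hn' : 0 ≤ ∑ j, l1Deriv n (pd j f) := Finset.sum_nonneg fun _ _ => l1Deriv_nonneg _ _
    have b3 : ‖c‖ * ‖∫ x, a x * osc k α x * f x‖ ≤
        K * (D * A) * (∑ j, l1Deriv n (pd j f)) + ν * (K * (D * A) * l1Deriv n f) := by
      rw [← norm_mul, main]
      refine (norm_sub_le _ _).trans (add_le_add ?_ ?_)
      · rw [norm_neg, Finset.mul_sum]
        exact norm_sum_le_of_le _ fun j _ => b1 j
      · refine (norm_sum_le_of_le _ fun j _ => b2 j).trans (le_of_eq ?_)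
        simp
    have hcpos : 0 < ‖c‖ := norm_pos_iff.2 hc0
    rw [mul_assoc, mul_assoc, inv_mul_eq_div, le_div_iff₀ hcpos, mul_comm]
    refine b3.trans ?_
    have hKD : 0 ≤ K * (D * A) := by positivity
    have hν : (0 : ℝ) ≤ ν := ν.cast_nonneg
    rw [l1Deriv]
    nlinarith [mul_nonneg hKD hn, mul_nonneg hKD hn', mul_nonneg hν (mul_nonneg hKD hn')]

end Oscillatory

end

section

open FourierTransform LineDeriv

/-! ### Multiplication operators from form bounds -/

section MultiplicationForms

variable {ν : ℕ} {s : ℝ} {m m' : X ν → ℝ}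

/-- Measurable functions of at most polynomial growth. -/
def PolyGrowth (m : X ν → ℝ) : Prop :=
  Measurable m ∧ ∃ (C : ℝ) (N : ℕ), ∀ x, |m x| ≤ C * (1 + ‖x‖) ^ N

theorem PolyGrowth.memLp (hm : PolyGrowth m) (φ : 𝓢(X ν, ℂ)) :
    MemLp (fun x => (m x : ℂ) * φ x) 2 volume := by
  obtain ⟨h, C, N, hC⟩ := hm
  exact memLp_mul_schwartz (Complex.measurable_ofReal.comp h).aestronglyMeasurable
    (fun x => by rw [Function.comp_apply, Complex.norm_real]; exact hC x) φ 2

theorem PolyGrowth.integrable (hm : PolyGrowth m) (φ ψ : 𝓢(X ν, ℂ)) :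
    Integrable fun x => (m x : ℂ) * φ x * ψ x := by
  obtain ⟨h, C, N, hC⟩ := hm
  have := integrable_mul_schwartz (Complex.measurable_ofReal.comp h).aestronglyMeasurable
    (fun x => by rw [Function.comp_apply, Complex.norm_real]; exact hC x) (mulS φ ψ)
  simpa only [Function.comp_apply, mulS_apply, ← mul_assoc] using this

theorem PolyGrowth.mul (hm : PolyGrowth m) (hm' : PolyGrowth m') :
    PolyGrowth fun x => m x * m' x := by
  obtain ⟨h, C, N, hC⟩ := hm
  obtain ⟨h', C', N', hC'⟩ := hm'
  refine ⟨h.mul h', C * C', N + N', fun x => ?_⟩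
  rw [abs_mul, pow_add, mul_mul_mul_comm]
  exact mul_le_mul (hC x) (hC' x) (abs_nonneg _) ((abs_nonneg _).trans (hC x))

theorem PolyGrowth.of_le (hm : Measurable m) {C : ℝ} (hC : ∀ x, |m x| ≤ C) : PolyGrowth m :=
  ⟨hm, C, 0, fun x => by simpa using hC x⟩

/-- The product of a function of polynomial growth and a Schwartz function, in `L²`. -/
def PolyGrowth.toL2 (hm : PolyGrowth m) : 𝓢(X ν, ℂ) →ₗ[ℂ] L2 ν where
  toFun φ := (hm.memLp φ).toLp _
  map_add' φ ψ := by
    rw [← MemLp.toLp_add]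
    refine MemLp.toLp_congr _ _ (Eventually.of_forall fun x => ?_)
    change (m x : ℂ) * (φ x + ψ x) = m x * φ x + m x * ψ x
    ring
  map_smul' c φ := by
    rw [RingHom.id_apply, ← MemLp.toLp_const_smul]
    refine MemLp.toLp_congr _ _ (Eventually.of_forall fun x => ?_)
    change (m x : ℂ) * (c * φ x) = c * (m x * φ x)
    ring

theorem PolyGrowth.coeFn_toL2 (hm : PolyGrowth m) (φ : 𝓢(X ν, ℂ)) :
    hm.toL2 φ =ᵐ[volume] fun x => (m x : ℂ) * φ x :=
  (hm.memLp φ).coeFn_toLp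

theorem PolyGrowth.inner_toL2 (hm : PolyGrowth m) (φ ψ : 𝓢(X ν, ℂ)) :
    inner ℂ (hm.toL2 φ) (ψ.toLp 2 (volume : Measure (X ν))) =
      ∫ x, (m x : ℂ) * conjS φ x * ψ x := by
  rw [L2.inner_def]
  refine integral_congr_ae ?_
  filter_upwards [hm.coeFn_toL2 φ, ψ.coeFn_toLp 2 volume] with x h1 h2
  rw [h1, h2, RCLike.inner_apply, map_mul, Complex.conj_ofReal, conjS_apply]
  ring

theorem PolyGrowth.toDist_toL2 (hm : PolyGrowth m) (φ ψ : 𝓢(X ν, ℂ)) :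
    ((hm.toL2 φ : L2 ν) : 𝓢'(X ν, ℂ)) ψ = ∫ x, (m x : ℂ) * φ x * ψ x := by
  rw [Lp.toTemperedDistribution_apply]
  refine integral_congr_ae ?_
  filter_upwards [hm.coeFn_toL2 φ] with x h1
  rw [h1, smul_eq_mul, mul_comm]

theorem isMultiplicationBy_of_toDist {t : ℝ} (hm : PolyGrowth m) {V : Sob ν s →L[ℂ] Sob ν t}
    (h : ∀ φ, (V (Sob.ofSchwartz s φ)).toDist = ((hm.toL2 φ : L2 ν) : 𝓢'(X ν, ℂ))) :
    IsMultiplicationBy m V := fun φ ψ =>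
  ⟨hm.integrable φ ψ, by rw [h, hm.toDist_toL2]⟩

theorem isMultiplicationBy_iff_embed (hs : 0 ≤ s) (hm : PolyGrowth m)
    {V : Sob ν s →L[ℂ] Sob ν (-s)} :
    IsMultiplicationBy m V ↔ ∀ φ, V (Sob.ofSchwartz s φ) = embed hs (hm.toL2 φ) := by
  refine ⟨fun h φ => ?_, fun h => isMultiplicationBy_of_toDist hm fun φ => by
    rw [h, toDist_embed]⟩
  apply Sob.toDist_injective
  rw [toDist_embed]
  ext ψ
  rw [(h φ ψ).2, hm.toDist_toL2]

/-- The pairing is antilinear in its first variable and `m` is real, so the conjugate falls on the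
first test function alone. -/
theorem isMultiplicationBy_iff_pairing (hs : 0 ≤ s) (hm : PolyGrowth m)
    {V : Sob ν s →L[ℂ] Sob ν (-s)} :
    IsMultiplicationBy m V ↔ ∀ φ ψ, Sob.pairing (V (Sob.ofSchwartz s φ)) (Sob.ofSchwartz s ψ) =
      ∫ x, (m x : ℂ) * conjS φ x * ψ x := by
  rw [isMultiplicationBy_iff_embed hs hm]
  refine ⟨fun h φ ψ => by rw [h, pairing_embed, hm.inner_toL2], fun h φ => ?_⟩
  rw [← sub_eq_zero, ← norm_le_zero_iff]
  refine norm_le_of_pairing_schwartz le_rfl fun ψ => ?_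
  have : Sob.pairing (V (Sob.ofSchwartz s φ) - embed hs (hm.toL2 φ)) (Sob.ofSchwartz s ψ) =
      Sob.pairing (V (Sob.ofSchwartz s φ)) (Sob.ofSchwartz s ψ) -
        Sob.pairing (embed hs (hm.toL2 φ)) (Sob.ofSchwartz s ψ) := by
    simp only [pairing_eq, map_sub, inner_sub_left]
  rw [this, h, pairing_embed, hm.inner_toL2, sub_self, norm_zero, zero_mul]

theorem clm_ext_schwartz {t : ℝ} {V V' : Sob ν s →L[ℂ] Sob ν t}
    (h : ∀ φ, V (Sob.ofSchwartz s φ) = V' (Sob.ofSchwartz s φ)) : V = V' := by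
  ext1 g
  exact denseRange_ofSchwartz.induction_on (p := fun g => V g = V' g) g
    (isClosed_eq V.continuous V'.continuous) h

/-- Turns pointwise identities between multipliers into identities between operators, by density of
Schwartz functions; splittings and factorisations of the potential are obtained in this way. -/
theorem IsMultiplicationBy.unique {t : ℝ} {V V' : Sob ν s →L[ℂ] Sob ν t}
    (h : IsMultiplicationBy m V) (h' : IsMultiplicationBy m V') : V = V' := by
  refine clm_ext_schwartz fun φ => Sob.toDist_injective ?_
  ext ψ
  rw [(h φ ψ).2, (h' φ ψ).2]

theorem IsMultiplicationBy.add {t : ℝ} {V V' : Sob ν s →L[ℂ] Sob ν t}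
    (h : IsMultiplicationBy m V) (h' : IsMultiplicationBy m' V') :
    IsMultiplicationBy (fun x => m x + m' x) (V + V') := fun φ ψ => by
  have e : (fun x => ((m x + m' x : ℝ) : ℂ) * φ x * ψ x) =
      fun x => (m x : ℂ) * φ x * ψ x + (m' x : ℂ) * φ x * ψ x := by
    ext x; push_cast; ring
  rw [e]
  refine ⟨(h φ ψ).1.add (h' φ ψ).1, ?_⟩
  rw [integral_add (h φ ψ).1 (h' φ ψ).1, ← (h φ ψ).2, ← (h' φ ψ).2, add_apply, map_add]
  rfl

/-- The form bound `|∫ m φ ψ| ≤ C ‖φ‖_s ‖ψ‖_s`. -/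
def FormBound (s : ℝ) (m : X ν → ℝ) (C : ℝ) : Prop :=
  ∀ φ ψ : 𝓢(X ν, ℂ), ‖∫ x, (m x : ℂ) * conjS φ x * ψ x‖ ≤ C * sobNorm s φ * sobNorm s ψ

theorem FormBound.exists_clm (hs : 0 ≤ s) (hm : PolyGrowth m) {C : ℝ} (hC : 0 ≤ C)
    (h : FormBound s m C) :
    ∃ V : Sob ν s →L[ℂ] Sob ν (-s), IsMultiplicationBy m V ∧ ‖V‖ ≤ C := by
  obtain ⟨V, hV, hVC⟩ := exists_clm_of_schwartz (s := s) (t := -s)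
    ((embed hs).toLinearMap ∘ₗ hm.toL2) hC fun φ => by
      refine norm_le_of_pairing_schwartz (mul_nonneg hC (norm_nonneg _)) fun ψ => ?_
      change ‖Sob.pairing (embed hs (hm.toL2 φ)) (Sob.ofSchwartz s ψ)‖ ≤ _
      rw [pairing_embed, hm.inner_toL2]
      exact h φ ψ
  exact ⟨V, (isMultiplicationBy_iff_embed hs hm).2 hV, hVC⟩

theorem continuous_pairing {Y : Type*} [TopologicalSpace Y] {F : Y → Sob ν (-s)} {g : Y → Sob ν s}
    (hF : Continuous F) (hg : Continuous g) : Continuous fun y => Sob.pairing (F y) (g y) := by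
  have h1 : Continuous fun g : Sob ν s => mom ν s g := (mom ν s).continuous
  have h2 : Continuous fun g : Sob ν (-s) => mom ν (-s) g := (mom ν (-s)).continuous
  simp only [pairing_eq]
  exact (h2.comp hF).inner (h1.comp hg)

theorem IsMultiplicationBy.isSymm (hs : 0 ≤ s) (hm : PolyGrowth m) {V : Sob ν s →L[ℂ] Sob ν (-s)}
    (h : IsMultiplicationBy m V) : IsSymm V := by
  intro f g
  refine denseRange_ofSchwartz.induction_on₂ (p := fun f g => Sob.pairing (V f) g =
    starRingEnd ℂ (Sob.pairing (V g) f)) ?_ (fun φ ψ => ?_) f g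
  · exact isClosed_eq
      (continuous_pairing (V.continuous.comp continuous_fst) continuous_snd)
      (Complex.continuous_conj.comp
        (continuous_pairing (V.continuous.comp continuous_snd) continuous_fst))
  · change Sob.pairing (V (Sob.ofSchwartz s φ)) (Sob.ofSchwartz s ψ) =
      starRingEnd ℂ (Sob.pairing (V (Sob.ofSchwartz s ψ)) (Sob.ofSchwartz s φ))
    rw [(isMultiplicationBy_iff_pairing hs hm).1 h, (isMultiplicationBy_iff_pairing hs hm).1 h,
      ← integral_conj]
    refine integral_congr_ae (Eventually.of_forall fun x => ?_)
    simp only [map_mul, Complex.conj_ofReal, conjS_apply, Complex.conj_conj]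
    ring

end MultiplicationForms

/-! ### Form bounds for the oscillating potential -/

section PotentialForms

variable {ν : ℕ} {α β k : ℝ} {κ : ℝ → ℝ}

/-- The norm is not smooth at the origin, but the cutoff is constant there. -/
theorem contDiff_cutoff (hκ : ContDiff ℝ ∞ κ) (hκ1 : ∀ t ∈ Icc (-1 : ℝ) 1, κ t = 1) :
    ContDiff ℝ ∞ fun x : X ν => κ ‖x‖ := by
  rw [contDiff_iff_contDiffAt]
  intro x
  rcases eq_or_ne x 0 with rfl | hx
  · refine (contDiffAt_const (c := (1 : ℝ))).congr_of_eventuallyEq ?_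
    filter_upwards [Metric.ball_mem_nhds (0 : X ν) one_pos] with y hy
    rw [mem_ball_zero_iff] at hy
    exact hκ1 _ ⟨by linarith [norm_nonneg y], hy.le⟩
  · exact hκ.contDiffAt.comp x (contDiffAt_norm ℝ hx)

theorem exists_cutoff_radius (hκc : HasCompactSupport κ) : ∃ R, 1 ≤ R ∧ ∀ t, R < t → κ t = 0 := by
  obtain ⟨R, hR⟩ := hκc.isCompact.isBounded.subset_closedBall 0
  refine ⟨max R 1, le_max_right _ _, fun t ht => ?_⟩
  by_contra h
  have h1 := hR (subset_tsupport _ (Function.mem_support.2 h))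
  rw [mem_closedBall_zero_iff, Real.norm_eq_abs] at h1
  exact absurd ((le_abs_self t).trans h1) (not_le.2 ((le_max_left _ _).trans_lt ht))

theorem exists_symb_one_sub_cutoff (hκ : ContDiff ℝ ∞ κ) (hκc : HasCompactSupport κ)
    (hκ1 : ∀ t ∈ Icc (-1 : ℝ) 1, κ t = 1) (n : ℕ) :
    ∃ A, 0 ≤ A ∧ Symb {x : X ν | x ≠ 0} n 0 A (fun x => ((1 - κ ‖x‖ : ℝ) : ℂ)) := by
  obtain ⟨R, -, hR⟩ := exists_cutoff_radius hκc
  refine Symb.exists_of_eventually_const (C := 1) (R := R)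
    (Complex.ofRealCLM.contDiff.comp (contDiff_const.sub (contDiff_cutoff hκ hκ1))) one_pos ?_ ?_ n
  · intro x hx
    simp [hκ1 ‖x‖ ⟨by linarith [norm_nonneg x], hx.le⟩]
  · intro x hx
    simp [hR _ hx]

theorem measurable_oscPotential (hκ : ContDiff ℝ ∞ κ) : Measurable (oscPotential ν α β k κ) := by
  have := hκ.continuous.measurable
  unfold oscPotential
  fun_prop

theorem oscPotential_eq_osc (x : X ν) : ((oscPotential ν α β k κ x : ℝ) : ℂ) =
    ((1 - κ ‖x‖ : ℝ) : ℂ) * ((‖x‖ ^ (-β) : ℝ) : ℂ) *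
      ((osc k α x - osc (-k) α x) * (1 / (2 * Complex.I))) := by
  rw [oscPotential, Real.rpow_neg (norm_nonneg _), osc, osc]
  push_cast
  have e : (1 / (2 * Complex.I) : ℂ) = -Complex.I / 2 := by
    field_simp
    rw [Complex.I_sq, neg_neg]
  rw [Complex.sin, e, show Complex.I * (-(k : ℂ) * ((‖x‖ ^ α : ℝ) : ℂ)) =
    -(k * ((‖x‖ ^ α : ℝ) : ℂ)) * Complex.I by ring, mul_comm Complex.I]
  ring

theorem outer_subset : outer ν ⊆ {x : X ν | x ≠ 0} := fun _ hx h => zero_notMem_outer (h ▸ hx)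

theorem abs_oscPotential_le (hκ0 : ∀ t, 0 ≤ κ t ∧ κ t ≤ 1) (hκ1 : ∀ t ∈ Icc (-1 : ℝ) 1, κ t = 1)
    (x : X ν) : |oscPotential ν α β k κ x| ≤ ‖x‖ ^ (-β) ∧
      (‖x‖ < 1 → oscPotential ν α β k κ x = 0) := by
  constructor
  · rw [oscPotential, abs_mul, abs_div, Real.rpow_neg (norm_nonneg _), div_eq_mul_inv]
    have h1 : |1 - κ ‖x‖| ≤ 1 := abs_le.2 ⟨by linarith [(hκ0 ‖x‖).2], by linarith [(hκ0 ‖x‖).1]⟩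
    have h2 := Real.abs_sin_le_one (k * ‖x‖ ^ α)
    rw [abs_of_nonneg (Real.rpow_nonneg (norm_nonneg x) β)]
    have h3 : (0 : ℝ) ≤ (‖x‖ ^ β)⁻¹ := inv_nonneg.2 (Real.rpow_nonneg (norm_nonneg x) β)
    calc _ ≤ 1 * (1 * (‖x‖ ^ β)⁻¹) := by gcongr
      _ = _ := by ring
  · intro hx
    rw [oscPotential, hκ1 ‖x‖ ⟨by linarith [norm_nonneg x], hx.le⟩, sub_self, zero_mul]

theorem polyGrowth_oscPotential (hκ : ContDiff ℝ ∞ κ) (hκ0 : ∀ t, 0 ≤ κ t ∧ κ t ≤ 1)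
    (hκ1 : ∀ t ∈ Icc (-1 : ℝ) 1, κ t = 1) : PolyGrowth (oscPotential ν α β k κ) := by
  refine ⟨measurable_oscPotential hκ, 1, ⌈|-β|⌉₊, fun x => ?_⟩
  rw [one_mul]
  rcases lt_or_ge ‖x‖ 1 with h | h
  · rw [(abs_oscPotential_le hκ0 hκ1 x).2 h, abs_zero]; positivity
  · exact (abs_oscPotential_le hκ0 hκ1 x).1.trans (rpow_le_one_add_pow h _)

/-- The sine is a combination of the phases with `k` and `-k`. Their amplitude `(1-κ)|x|^{-β} g` has
order `δ - β`, at most `n(α-1)` by assumption, so `exists_osc_bound` applies. -/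
theorem exists_integral_oscPotential_le (hk : k ≠ 0) (hα : 0 < α) (hκ : ContDiff ℝ ∞ κ)
    (hκc : HasCompactSupport κ) (hκ1 : ∀ t ∈ Icc (-1 : ℝ) 1, κ t = 1) (n : ℕ) :
    ∃ K, 0 ≤ K ∧ ∀ (g : X ν → ℂ) (A δ : ℝ), Measurable g → 0 ≤ A → δ ≤ n * α + β - n →
      Symb (outer ν) n δ A g → ∀ f : 𝓢(X ν, ℂ),
        ‖∫ x, g x * (oscPotential ν α β k κ x : ℂ) * f x‖ ≤ K * A * l1Deriv n f := by
  obtain ⟨K, hK, hKb⟩ := exists_osc_bound (ν := ν) hk hα n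
  obtain ⟨K', hK', hKb'⟩ := exists_osc_bound (ν := ν) (neg_ne_zero.2 hk) hα n
  obtain ⟨B, hB, hBS⟩ := exists_symb_one_sub_cutoff (ν := ν) hκ hκc hκ1 n
  obtain ⟨D, hD, hDS⟩ := Symb.exists_rpow_norm (isOpen_outer (ν := ν)) zero_notMem_outer n (-β)
  have h1 := Symb.mul isOpen_outer zero_notMem_outer hB hD (hBS.mono_set outer_subset) hDS
  set M : ℝ := 2 ^ n * (2 ^ n * (B * D)) with hM
  have hM0 : 0 ≤ M := by positivity
  refine ⟨(K + K') * M, by positivity, fun g A δ hgm hA hδ hg f => ?_⟩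
  have h2 := Symb.mul isOpen_outer zero_notMem_outer (by positivity) hA h1 hg
  set a : X ν → ℂ := fun x => ((1 - κ ‖x‖ : ℝ) : ℂ) * ((‖x‖ ^ (-β) : ℝ) : ℂ) * g x with ha
  have hz : ∀ x, ‖x‖ < 1 → a x = 0 := fun x hx => by
    simp only [ha]
    rw [hκ1 ‖x‖ ⟨by linarith [norm_nonneg x], hx.le⟩]; simp
  -- The order is raised to exactly `n(α-1)`. The amplitude vanishes for `|x| < 1`, so the constant
  -- does not change.
  have h3 := h2.raise (δ := n * (α - 1) - (0 + -β + δ)) zero_notMem_outer (by positivity) one_pos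
    (by linarith) hz
  rw [add_sub_cancel, Real.one_rpow, mul_one] at h3
  have h4 : Symb (outer ν) n (n * (α - 1)) (M * A) a :=
    h3.mono_const (le_of_eq (by rw [hM]; ring))
  have b1 := hKb a (M * A) (by positivity) hz h4 f
  have b2 := hKb' a (M * A) (by positivity) hz h4 f
  have hp := fun x => h4.poly_bound (by positivity) hz x
  have ma : AEStronglyMeasurable a volume := by
    have := hκ.continuous.measurable
    exact Measurable.aestronglyMeasurable (by fun_prop)
  have i : ∀ k, Integrable fun x => a x * osc k α x * f x := fun k =>
    integrable_mul_schwartz (ma.mul (measurable_osc k α).aestronglyMeasurable)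
      (fun x => by
        change ‖a x * osc k α x‖ ≤ _
        rw [norm_mul, norm_osc, mul_one]
        exact hp x) f
  have e : ∫ x, g x * (oscPotential ν α β k κ x : ℂ) * f x =
      (1 / (2 * Complex.I)) * ((∫ x, a x * osc k α x * f x) - ∫ x, a x * osc (-k) α x * f x) := by
    rw [← integral_sub (i k) (i (-k)), ← integral_const_mul]
    refine integral_congr_ae (Eventually.of_forall fun x => ?_)
    simp only [ha, oscPotential_eq_osc]
    ring
  rw [e, norm_mul]
  have h5 : ‖(1 / (2 * Complex.I) : ℂ)‖ ≤ 1 := by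
    rw [norm_div, norm_mul, Complex.norm_I]; norm_num
  calc _ ≤ 1 * (K * (M * A) * l1Deriv n f + K' * (M * A) * l1Deriv n f) := by
        gcongr
        exact (norm_sub_le _ _).trans (add_le_add b1 b2)
    _ = _ := by ring

theorem exists_l1Deriv_conjS_mul_le (n : ℕ) : ∃ C, 0 ≤ C ∧ ∀ φ ψ : 𝓢(X ν, ℂ),
    l1Deriv n (mulS (conjS φ) ψ) ≤ C * sobNorm n φ * sobNorm n ψ := by
  obtain ⟨C, hC, h⟩ := exists_l2Deriv_le (ν := ν) n
  refine ⟨3 ^ n * (C * C), by positivity, fun φ ψ => (l1Deriv_mulS_le n _ _).trans ?_⟩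
  rw [l2Deriv_conjS]
  have h1 := mul_le_mul (h φ) (h ψ) (l2Deriv_nonneg _ _) (mul_nonneg hC (sobNorm_nonneg _ _))
  calc _ ≤ 3 ^ n * (C * sobNorm n φ * (C * sobNorm n ψ)) := by gcongr
    _ = _ := by ring

/-- The basic estimate: a symbol of order at most `nα + β - n` times the oscillating potential is
form bounded on `H^n`. -/
theorem exists_formBound_mul_oscPotential (hk : k ≠ 0) (hα : 0 < α) (hκ : ContDiff ℝ ∞ κ)
    (hκc : HasCompactSupport κ) (hκ1 : ∀ t ∈ Icc (-1 : ℝ) 1, κ t = 1) (n : ℕ) :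
    ∃ K, 0 ≤ K ∧ ∀ (g : X ν → ℝ) (A δ : ℝ), Measurable g → 0 ≤ A → δ ≤ n * α + β - n →
      Symb (outer ν) n δ A (fun x => (g x : ℂ)) →
        FormBound n (fun x => g x * oscPotential ν α β k κ x) (K * A) := by
  obtain ⟨K, hK, hKb⟩ :=
    exists_integral_oscPotential_le (ν := ν) (β := β) hk hα hκ hκc hκ1 n
  obtain ⟨C, hC, h⟩ := exists_l1Deriv_conjS_mul_le (ν := ν) n
  refine ⟨K * C, by positivity, fun g A δ hgm hA hδ hg φ ψ => ?_⟩
  have h1 := hKb (fun x => (g x : ℂ)) A δ (Complex.measurable_ofReal.comp hgm) hA hδ hg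
    (mulS (conjS φ) ψ)
  have e : ∀ x, ((g x * oscPotential ν α β k κ x : ℝ) : ℂ) * conjS φ x * ψ x =
      (g x : ℂ) * (oscPotential ν α β k κ x : ℂ) * mulS (conjS φ) ψ x := fun x => by
    rw [mulS_apply]; push_cast; ring
  simp_rw [e]
  calc _ ≤ K * A * (C * sobNorm n φ * sobNorm n ψ) := h1.trans (by gcongr; exact h φ ψ)
    _ = _ := by ring

end PotentialForms

end

section

open FourierTransform LineDeriv
open scoped BoundedContinuousFunction

/-! ### Negative powers of `1 + |x|²` have bounded derivatives -/

section BracketSmooth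

variable {E F G : Type*} [NormedAddCommGroup E] [NormedSpace ℝ E] [NormedAddCommGroup F]
  [NormedSpace ℝ F] [NormedAddCommGroup G] [NormedSpace ℝ G]

/-- Smooth functions whose derivatives of order at most `n` are bounded. -/
structure BddUpTo (n : ℕ) (f : E → F) : Prop where
  smooth : ContDiff ℝ ∞ f
  bounded : ∀ k ≤ n, ∃ C : ℝ, ∀ x, ‖iteratedFDeriv ℝ k f x‖ ≤ C

theorem BddUpTo.zero {f : E → F} (hf : ContDiff ℝ ∞ f) {C : ℝ} (hC : ∀ x, ‖f x‖ ≤ C) :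
    BddUpTo 0 f :=
  ⟨hf, fun k hk => ⟨C, fun x => by
    obtain rfl := Nat.le_zero.1 hk
    rw [norm_iteratedFDeriv_zero]; exact hC x⟩⟩

theorem BddUpTo.succ {n : ℕ} {f : E → F} (hf : BddUpTo n f) (h : BddUpTo n (fderiv ℝ f)) :
    BddUpTo (n + 1) f :=
  ⟨hf.smooth, fun k hk => by
    rcases Nat.le_or_eq_of_le_succ hk with h' | rfl
    · exact hf.bounded k h'
    · obtain ⟨C, hC⟩ := h.bounded n le_rfl
      exact ⟨C, fun x => by rw [← norm_iteratedFDeriv_fderiv]; exact hC x⟩⟩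

theorem BddUpTo.const (n : ℕ) (c : F) : BddUpTo n (fun _ : E => c) :=
  ⟨contDiff_const, fun k _ => (BddSmooth.const c).bounded k⟩

theorem BddUpTo.add {n : ℕ} {f g : E → F} (hf : BddUpTo n f) (hg : BddUpTo n g) :
    BddUpTo n (fun x => f x + g x) :=
  ⟨hf.smooth.add hg.smooth, fun k hk => by
    obtain ⟨C, hC⟩ := hf.bounded k hk
    obtain ⟨D, hD⟩ := hg.bounded k hk
    refine ⟨C + D, fun x => ?_⟩
    have : iteratedFDeriv ℝ k (fun x => f x + g x) x =
        iteratedFDeriv ℝ k f x + iteratedFDeriv ℝ k g x :=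
      iteratedFDeriv_add_apply (hf.smooth.contDiffAt.of_le (mod_cast le_top))
        (hg.smooth.contDiffAt.of_le (mod_cast le_top))
    rw [this]
    exact (norm_add_le _ _).trans (add_le_add (hC x) (hD x))⟩

theorem BddUpTo.bilin {H : Type*} [NormedAddCommGroup H] [NormedSpace ℝ H] (B : F →L[ℝ] G →L[ℝ] H)
    {n : ℕ} {f : E → F} {g : E → G} (hf : BddUpTo n f) (hg : BddUpTo n g) :
    BddUpTo n (fun x => B (f x) (g x)) :=
  ⟨(B.isBoundedBilinearMap.contDiff).comp (hf.smooth.prodMk hg.smooth), fun k hk => by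
    choose! C hC using hf.bounded
    choose! D hD using hg.bounded
    refine ⟨‖B‖ * ∑ i ∈ Finset.range (k + 1), (k.choose i : ℝ) * C i * D (k - i), fun x => ?_⟩
    refine (B.norm_iteratedFDeriv_le_of_bilinear hf.smooth hg.smooth x (n := k)
      (mod_cast le_top)).trans ?_
    gcongr with i hi
    · exact mul_nonneg (by positivity) ((norm_nonneg _).trans
        (hC i ((Finset.mem_range_succ_iff.1 hi).trans hk) x))
    · exact hC i ((Finset.mem_range_succ_iff.1 hi).trans hk) x
    · exact hD _ ((Nat.sub_le _ _).trans hk) x⟩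

theorem BddUpTo.clm_comp {n : ℕ} {f : E → F} (hf : BddUpTo n f) (L : F →L[ℝ] G) :
    BddUpTo n (fun x => L (f x)) :=
  (BddUpTo.const n L).bilin (ContinuousLinearMap.id ℝ (F →L[ℝ] G)) hf

variable {ν : ℕ}

/-- The real function `(1 + |x|²)^{s/2}`. -/
def bracketR (s : ℝ) (x : X ν) : ℝ := (1 + ‖x‖ ^ 2) ^ (s / 2)

theorem bracket_eq_ofReal (s : ℝ) (x : X ν) : bracket s x = (bracketR s x : ℂ) := rfl

theorem bracketR_add (s t : ℝ) (x : X ν) : bracketR (s + t) x = bracketR s x * bracketR t x := by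
  rw [bracketR, add_div, Real.rpow_add (one_add_normSq_pos x)]; rfl

theorem contDiff_bracketR (s : ℝ) : ContDiff ℝ ∞ (bracketR s : X ν → ℝ) :=
  (contDiff_const.add (contDiff_norm_sq ℝ)).rpow_const_of_ne fun x => (one_add_normSq_pos x).ne'

theorem fderiv_bracketR (s : ℝ) (x : X ν) : fderiv ℝ (bracketR s) x =
    (s * bracketR (s - 1) x) • innerSL ℝ (bracketR (-1) x • x) := by
  have h1 : HasFDerivAt (fun x : X ν => 1 + ‖x‖ ^ 2) (2 • innerSL ℝ x) x :=
    (hasStrictFDerivAt_norm_sq x).hasFDerivAt.const_add 1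
  have h2 := h1.rpow_const (p := s / 2) (Or.inl (one_add_normSq_pos x).ne')
  change fderiv ℝ (fun x : X ν => (1 + ‖x‖ ^ 2) ^ (s / 2)) x = _
  rw [h2.fderiv]
  ext y
  have h3 := bracketR_add (s - 1) (-1) x
  rw [bracketR, show (s - 1 + -1) / 2 = s / 2 - 1 by ring] at h3
  simp only [smul_apply, innerSL_apply_apply, smul_eq_mul, nsmul_eq_mul, inner_smul_left, h3]
  simp
  ring

theorem abs_bracketR_le_one {s : ℝ} (hs : s ≤ 0) (x : X ν) : ‖bracketR s x‖ ≤ 1 := by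
  have := norm_bracket_le_one hs x
  rwa [bracket_eq_ofReal, Complex.norm_real] at this

theorem norm_bracketR_smul_le (x : X ν) : ‖bracketR (-1) x • x‖ ≤ 1 := by
  have h0 := one_add_normSq_pos x
  rw [norm_smul, bracketR, Real.norm_of_nonneg (by positivity), neg_div, Real.rpow_neg h0.le,
    ← Real.sqrt_eq_rpow, inv_mul_le_one₀ (Real.sqrt_pos.2 h0)]
  exact Real.le_sqrt_of_sq_le (by linarith)

/-- The derivatives of `⟨x⟩^s` and of `x/⟨x⟩` are products of nonpositive powers of `⟨x⟩`, of
`x/⟨x⟩` and of constants. The two families are closed under differentiation together, whence the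
simultaneous induction on the order. -/
theorem bddUpTo_bracketR (n : ℕ) : (∀ s ≤ 0, BddUpTo n (bracketR s : X ν → ℝ)) ∧
    BddUpTo n (fun x : X ν => bracketR (-1) x • x) := by
  have hg : ContDiff ℝ ∞ (fun x : X ν => bracketR (-1) x • x) :=
    (contDiff_bracketR _).smul contDiff_id
  induction n with
  | zero => exact ⟨fun s hs => .zero (contDiff_bracketR s) (abs_bracketR_le_one hs),
      .zero hg norm_bracketR_smul_le⟩
  | succ n ih =>
    obtain ⟨h1, h2⟩ := ih
    have h3 : ∀ s ≤ 0, BddUpTo n (fderiv ℝ (bracketR s : X ν → ℝ)) := fun s hs => by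
      have e : fderiv ℝ (bracketR s : X ν → ℝ) = fun x =>
          (ContinuousLinearMap.lsmul ℝ ℝ (E := X ν →L[ℝ] ℝ)) (s * bracketR (s - 1) x)
            (innerSL ℝ (bracketR (-1) x • x)) := funext fun x => fderiv_bracketR s x
      rw [e]
      exact ((h1 (s - 1) (by linarith)).clm_comp (s • ContinuousLinearMap.id ℝ ℝ)).bilin _
        (h2.clm_comp (innerSL ℝ))
    refine ⟨fun s hs => (h1 s hs).succ (h3 s hs), h2.succ ?_⟩
    have e : fderiv ℝ (fun x : X ν => bracketR (-1) x • x) = fun x =>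
        ContinuousLinearMap.lsmul ℝ ℝ (E := X ν →L[ℝ] X ν) (bracketR (-1) x) (ContinuousLinearMap.id ℝ (X ν)) +
          ContinuousLinearMap.smulRightL ℝ (X ν) (X ν)
            (ContinuousLinearMap.lsmul ℝ ℝ (E := X ν →L[ℝ] ℝ) (-bracketR (-1) x) (innerSL ℝ (bracketR (-1) x • x)))
            (bracketR (-1) x • x) := by
      ext1 x
      have h4 : HasFDerivAt (bracketR (-1) : X ν → ℝ) _ x :=
        ((contDiff_bracketR (-1)).differentiable (by simp) x).hasFDerivAt
      have h6 : HasFDerivAt (fun x : X ν => bracketR (-1) x • x) _ x := h4.fun_smul (hasFDerivAt_id x)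
      rw [h6.fderiv, fderiv_bracketR]
      ext1 y
      have h5 : bracketR (-1 - 1) x = bracketR (-1) x * bracketR (-1) x := by
        rw [← bracketR_add]; norm_num
      simp only [add_apply, smul_apply, ContinuousLinearMap.smulRight_apply,
        ContinuousLinearMap.lsmul_apply, ContinuousLinearMap.smulRightL_apply_apply, h5,
        smul_smul, smul_eq_mul]
      congr 2
      ring
    rw [e]
    refine ((h1 (-1) (by norm_num)).bilin _ (BddUpTo.const n _)).add
      (BddUpTo.bilin _ (BddUpTo.bilin _ ((h1 (-1) (by norm_num)).clm_comp (-ContinuousLinearMap.id ℝ ℝ))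
        (h2.clm_comp (innerSL ℝ))) h2)

theorem bddSmooth_bracketR {s : ℝ} (hs : s ≤ 0) : BddSmooth (bracketR s : X ν → ℝ) :=
  ⟨contDiff_bracketR s, fun n => ((bddUpTo_bracketR n).1 s hs).bounded n le_rfl⟩

theorem bddSmooth_bracket {s : ℝ} (hs : s ≤ 0) : BddSmooth (bracket s : X ν → ℂ) :=
  (bddSmooth_bracketR hs).ofReal

theorem bddSmooth_coordBCF (j : Fin ν) : BddSmooth (coordBCF j : X ν → ℂ) := by
  have h : BddSmooth (fun x : X ν => bracketR (-1) x • x) :=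
    ⟨(contDiff_bracketR _).smul contDiff_id, fun n => (bddUpTo_bracketR n).2.bounded n le_rfl⟩
  have h2 := (h.clm_comp (innerSL ℝ (EuclideanSpace.single j (1 : ℝ)))).ofReal
  have e : (coordBCF j : X ν → ℂ) = fun x =>
      ((innerSL ℝ (EuclideanSpace.single j (1 : ℝ)) (bracketR (-1) x • x) : ℝ) : ℂ) := by
    ext x
    rw [coordBCF_apply, innerSL_apply_apply, real_inner_comm, inner_single, bracket_eq_ofReal,
      PiLp.smul_apply, smul_eq_mul]
    push_cast
    ring
  rw [e]
  exact h2

end BracketSmooth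

/-! ### The groups induced in Sobolev spaces -/

section SobolevGroup

variable {ν : ℕ} {v : X ν → X ν} {d : X ν → ℝ} {φ : ℝ → X ν → X ν} {z : ℝ → X ν → ℝ}
  {U : ℝ → (L2 ν ≃ₗᵢ[ℂ] L2 ν)} {s : ℝ}

theorem one_add_normSq_le (x y : X ν) :
    1 + ‖x‖ ^ 2 ≤ 2 * (1 + ‖y - x‖ ^ 2) * (1 + ‖y‖ ^ 2) := by
  have h1 : ‖x‖ ≤ ‖y‖ + ‖y - x‖ := by
    have := norm_sub_le y (y - x); rwa [sub_sub_cancel] at this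
  have h2 : ‖x‖ ^ 2 ≤ (‖y‖ + ‖y - x‖) ^ 2 := pow_le_pow_left₀ (norm_nonneg _) h1 2
  nlinarith [sq_nonneg (‖y‖ - ‖y - x‖), mul_nonneg (sq_nonneg ‖y‖) (sq_nonneg ‖y - x‖)]

/-- Peetre's inequality: the weights at two points differ by a factor depending only on their
distance. For negative `s` the points exchange roles. -/
theorem norm_bracket_mul_le (s : ℝ) (x y : X ν) :
    ‖bracket s x * bracket (-s) y‖ ≤ (2 * (1 + ‖y - x‖ ^ 2)) ^ (|s| / 2) := by
  have hx := one_add_normSq_pos x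
  have hy := one_add_normSq_pos y
  have key : ∀ {s : ℝ}, 0 ≤ s → ∀ x y : X ν,
      ‖bracket s x * bracket (-s) y‖ ≤ (2 * (1 + ‖y - x‖ ^ 2)) ^ (s / 2) := by
    intro s hs x y
    have hx := one_add_normSq_pos x
    have hy := one_add_normSq_pos y
    rw [norm_mul, norm_bracket, norm_bracket, neg_div, Real.rpow_neg hy.le,
      ← div_eq_mul_inv, ← Real.div_rpow hx.le hy.le]
    refine Real.rpow_le_rpow (by positivity) ?_ (by positivity)
    rw [div_le_iff₀ hy]
    exact one_add_normSq_le x y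
  rcases le_total 0 s with hs | hs
  · rw [abs_of_nonneg hs]; exact key hs x y
  · have := key (neg_nonneg.2 hs) y x
    rw [neg_neg, mul_comm, norm_sub_rev] at this
    rwa [abs_of_nonpos hs]

/-- The weight `⟨ξ⟩^s ⟨φ_τ ξ⟩^{-s}`. -/
def weightBCF (h : IsWeightedFlow v d φ z) (s τ : ℝ) : X ν →ᵇ ℂ :=
  BoundedContinuousFunction.ofNormedAddCommGroup (fun x => bracket s x * bracket (-s) (φ τ x))
    ((continuous_bracket s).mul ((continuous_bracket (-s)).comp (h.flow_contDiff τ).continuous))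
    ((2 * (1 + (h.norm_flow_sub_le.choose * |τ|) ^ 2)) ^ (|s| / 2)) fun x =>
      (norm_bracket_mul_le s x _).trans (by
        have := h.norm_flow_sub_le.choose_spec.2 τ x
        gcongr)

theorem weightBCF_apply (h : IsWeightedFlow v d φ z) (s τ : ℝ) (x : X ν) :
    weightBCF h s τ x = bracket s x * bracket (-s) (φ τ x) := rfl

/-- The operator that the group induces in `H^s`. -/
def sobGroup (h : IsWeightedFlow v d φ z) (U : ℝ → (L2 ν ≃ₗᵢ[ℂ] L2 ν)) (s τ : ℝ) :
    Sob ν s →L[ℂ] Sob ν s :=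
  ((mom ν s).symm.toContinuousLinearEquiv.toContinuousLinearMap ∘L mulL2 (weightBCF h s τ)) ∘L
    ((U τ).toContinuousLinearEquiv.toContinuousLinearMap ∘L
      (mom ν s).toContinuousLinearEquiv.toContinuousLinearMap)

theorem mom_sobGroup (h : IsWeightedFlow v d φ z) (s τ : ℝ) (g : Sob ν s) :
    mom ν s (sobGroup h U s τ g) = mulL2 (weightBCF h s τ) (U τ (mom ν s g)) :=
  (mom ν s).apply_symm_apply _

/-- For `|τ| ≤ 1` the flow moves frequencies by at most a fixed distance, so Peetre's inequality
bounds the weight uniformly. -/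
theorem exists_norm_sobGroup_le (h : IsWeightedFlow v d φ z) (U : ℝ → (L2 ν ≃ₗᵢ[ℂ] L2 ν)) (s : ℝ) :
    ∃ D, 0 ≤ D ∧ ∀ τ, |τ| ≤ 1 → ‖sobGroup h U s τ‖ ≤ D := by
  refine ⟨(2 * (1 + (h.norm_flow_sub_le.choose * 1) ^ 2)) ^ (|s| / 2), by positivity,
    fun τ hτ => ContinuousLinearMap.opNorm_le_bound _ (by positivity) fun g => ?_⟩
  rw [← (mom ν s).norm_map, mom_sobGroup]
  refine ((mulL2 _).le_opNorm _).trans ?_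
  rw [LinearIsometryEquiv.norm_map, LinearIsometryEquiv.norm_map]
  refine mul_le_mul_of_nonneg_right ((norm_mulL2_le _).trans ?_) (norm_nonneg _)
  refine (BoundedContinuousFunction.norm_ofNormedAddCommGroup_le _ (by positivity) _).trans ?_
  have := h.norm_flow_sub_le.choose_spec.1
  gcongr

theorem exists_norm_fderiv_bracket_le {s : ℝ} (hs : s ≤ 0) :
    ∃ C, ∀ x : X ν, ‖fderiv ℝ (bracketBCF hs : X ν → ℂ) x‖ ≤ C := by
  obtain ⟨C, hC⟩ := (bddSmooth_bracket (ν := ν) hs).bounded 1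
  refine ⟨C, fun x => ?_⟩
  have := hC x
  rw [← norm_iteratedFDeriv_fderiv, norm_iteratedFDeriv_zero] at this
  rwa [coe_bracketBCF]

/-- `U_τ` intertwines a weight with its composition with `φ_τ`. Only bounded weights are multipliers
of `L²`, so for `s ≥ 0` the power `-s` is put on the transported side, and for `s ≤ 0` the power `s`
on the given side. -/
theorem isInducedOn_sobGroup (hU : IsTransportGroup φ z U) (h : IsWeightedFlow v d φ z) (s : ℝ) :
    IsInducedOn s (positionGroup U) (sobGroup h U s) := by
  intro τ f g hg
  have hφ := (h.flow_contDiff τ).continuous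
  have key : ∀ {t : ℝ} (ht : t ≤ 0) (k : L2 ν), U τ (mulL2 (bracketBCF ht) k) =
      mulL2 ((bracketBCF ht).compContinuous ⟨φ τ, hφ⟩) (U τ k) := fun ht k => by
    obtain ⟨C, hC⟩ := exists_norm_fderiv_bracket_le (ν := ν) ht
    refine hU.apply_mulL2 τ _ _ ?_ hC (fun x => rfl) k
    rw [coe_bracketBCF]
    exact (bddSmooth_bracket ht).smooth.of_le (by simp)
  rcases le_total 0 s with hs | hs
  · rw [toDist_eq_iff_of_nonneg hs] at hg ⊢
    rw [mom_sobGroup, fourierL2_positionGroup, ← hg, key, mulL2_mulL2]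
    congr 2
    ext x
    rw [BoundedContinuousFunction.mul_apply, weightBCF_apply, coe_bracketBCF, ← mul_assoc,
      ← bracket_add, neg_add_cancel, bracket_zero, one_mul]
    rfl
  · rw [toDist_eq_iff_of_nonpos hs] at hg ⊢
    rw [mom_sobGroup, fourierL2_positionGroup, hg, key, mulL2_mulL2]
    congr 2
    ext x
    rw [BoundedContinuousFunction.mul_apply, weightBCF_apply, coe_bracketBCF,
      BoundedContinuousFunction.compContinuous_apply, coe_bracketBCF, mul_assoc]
    change _ * (bracket (-s) (φ τ x) * bracket s (φ τ x)) = _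
    rw [← bracket_add, neg_add_cancel, bracket_zero, mul_one]

theorem sobGroup_embed (hU : IsTransportGroup φ z U) (h : IsWeightedFlow v d φ z) (hs : 0 ≤ s)
    (τ : ℝ) (f : L2 ν) :
    sobGroup h U (-s) τ (embed hs f) = embed hs (positionGroup U τ f) := by
  apply Sob.toDist_injective
  rw [isInducedOn_sobGroup hU h (-s) τ f _ (toDist_embed hs f), toDist_embed]

theorem pairing_embed_of_toDist (hs : 0 ≤ s) (f f' : L2 ν) {g : Sob ν s}
    (hg : g.toDist = (f' : 𝓢'(X ν, ℂ))) : Sob.pairing (embed hs f) g = inner ℂ f f' := by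
  rw [pairing_eq, mom_embed, inner_mulL2_left, star_bracketBCF,
    (toDist_eq_iff_of_nonneg hs g f').1 hg, LinearIsometryEquiv.inner_map_map]

theorem pairing_ext_schwartz {Y Z : Sob ν (-s) →L[ℂ] Sob ν (-s)} {Y' Z' : Sob ν s →L[ℂ] Sob ν s}
    (h : ∀ φ ψ, Sob.pairing (Y (Sob.ofSchwartz (-s) φ)) (Z' (Sob.ofSchwartz s ψ)) =
      Sob.pairing (Z (Sob.ofSchwartz (-s) φ)) (Y' (Sob.ofSchwartz s ψ))) (F : Sob ν (-s)) (g : Sob ν s) :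
    Sob.pairing (Y F) (Z' g) = Sob.pairing (Z F) (Y' g) := by
  have h1 : ∀ φ, Sob.pairing (Y (Sob.ofSchwartz (-s) φ)) (Z' g) =
      Sob.pairing (Z (Sob.ofSchwartz (-s) φ)) (Y' g) := fun φ =>
    denseRange_ofSchwartz.induction_on (p := fun g =>
      Sob.pairing (Y (Sob.ofSchwartz (-s) φ)) (Z' g) =
        Sob.pairing (Z (Sob.ofSchwartz (-s) φ)) (Y' g)) g
      (isClosed_eq (continuous_pairing continuous_const Z'.continuous)
        (continuous_pairing continuous_const Y'.continuous)) (h φ)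
  exact denseRange_ofSchwartz.induction_on (p := fun F =>
      Sob.pairing (Y F) (Z' g) = Sob.pairing (Z F) (Y' g)) F
      (isClosed_eq (continuous_pairing Y.continuous continuous_const)
        (continuous_pairing Z.continuous continuous_const)) h1

/-- Unitarity in `L²`, extended by density. It transfers the estimates for the group from `H^{-n}`
to `H^n`. -/
theorem pairing_sobGroup (hU : IsTransportGroup φ z U) (h : IsWeightedFlow v d φ z) (hs : 0 ≤ s)
    (τ : ℝ) (F : Sob ν (-s)) (g : Sob ν s) :
    Sob.pairing (sobGroup h U (-s) τ F) g = Sob.pairing F (sobGroup h U s (-τ) g) := by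
  refine pairing_ext_schwartz (Y := sobGroup h U (-s) τ) (Z' := .id ℂ _) (Z := .id ℂ _)
    (Y' := sobGroup h U s (-τ)) (fun f ψ => ?_) F g
  have e : (Sob.ofSchwartz s ψ).toDist = ((ψ.toLp 2 volume : L2 ν) : 𝓢'(X ν, ℂ)) := by
    rw [Lp.toTemperedDistribution_toLp_eq]; rfl
  have e' := isInducedOn_sobGroup hU h s (-τ) _ _ e
  rw [← embed_toLp hs f, sobGroup_embed hU h hs, ContinuousLinearMap.id_apply,
    ContinuousLinearMap.id_apply, pairing_embed_of_toDist hs _ _ e, pairing_embed_of_toDist hs _ _ e',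
    positionGroup_apply, positionGroup_apply, ← hU.symm_eq h,
    ← LinearIsometryEquiv.inner_map_map (fourierL2 ν), LinearIsometryEquiv.apply_symm_apply,
    ← LinearIsometryEquiv.inner_map_map (fourierL2 ν) (f.toLp 2 volume),
    LinearIsometryEquiv.apply_symm_apply, ← LinearIsometryEquiv.inner_map_map (U τ) _ ((U τ).symm _),
    LinearIsometryEquiv.apply_symm_apply]

end SobolevGroup

end

section

open FourierTransform LineDeriv

/-! ### Weighted seminorms and the conjugate operator -/

section Moments

variable {ν : ℕ} {u : X ν → X ν} {s : ℝ}

theorem fourier_schwartz_injective {f g : 𝓢(X ν, ℂ)} (h : 𝓕 f = 𝓕 g) : f = g := by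
  rw [← FourierTransform.fourierInv_fourier_eq (F := 𝓢(X ν, ℂ)) f, h,
    FourierTransform.fourierInv_fourier_eq]

theorem fourier_fourierMultiplier (a : X ν → ℂ) (f : 𝓢(X ν, ℂ)) :
    𝓕 (SchwartzMap.fourierMultiplierCLM ℂ a f) = SchwartzMap.smulLeftCLM ℂ a (𝓕 f) := by
  rw [SchwartzMap.fourierMultiplierCLM_apply, FourierTransform.fourier_fourierInv_eq]

theorem qOp_fourierMultiplier {a : X ν → ℂ} (ha : BddSmooth a) (j : Fin ν) (f : 𝓢(X ν, ℂ)) :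
    qOp j (SchwartzMap.fourierMultiplierCLM ℂ a f) =
      SchwartzMap.fourierMultiplierCLM ℂ a (qOp j f) + (Complex.I / (2 * Real.pi)) •
        SchwartzMap.fourierMultiplierCLM ℂ
          (fun x => fderiv ℝ a x (EuclideanSpace.single j 1)) f := by
  apply fourier_schwartz_injective
  have h := pd_smulLeft ha.hasTemperateGrowth j (ha.pd j).hasTemperateGrowth (𝓕 f)
  simp only [pd] at h
  rw [fourier_qOp, FourierTransform.fourier_add, FourierTransform.fourier_smul,
    fourier_fourierMultiplier, fourier_fourierMultiplier, fourier_fourierMultiplier, fourier_qOp, h,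
    smul_add, map_smul, add_comm]

/-- The seminorm `∑ ‖x^J f‖_s` over words `J` of length at most `k` (with multiplicities). -/
def momNorm (s : ℝ) : ℕ → 𝓢(X ν, ℂ) → ℝ
  | 0, f => sobNorm s f
  | k + 1, f => momNorm s k f + ∑ j, momNorm s k (qOp j f)

theorem momNorm_nonneg (k : ℕ) (f : 𝓢(X ν, ℂ)) : 0 ≤ momNorm s k f := by
  induction k generalizing f with
  | zero => exact sobNorm_nonneg _ _
  | succ k ih => exact add_nonneg (ih f) (Finset.sum_nonneg fun _ _ => ih _)

theorem momNorm_add_le (k : ℕ) (f g : 𝓢(X ν, ℂ)) :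
    momNorm s k (f + g) ≤ momNorm s k f + momNorm s k g := by
  induction k generalizing f g with
  | zero => exact sobNorm_add_le _ _ _
  | succ k ih =>
    simp only [momNorm, map_add]
    refine (add_le_add (ih f g) (Finset.sum_le_sum fun j _ => ih _ _)).trans (le_of_eq ?_)
    rw [Finset.sum_add_distrib]
    ring

theorem momNorm_smul (k : ℕ) (c : ℂ) (f : 𝓢(X ν, ℂ)) :
    momNorm s k (c • f) = ‖c‖ * momNorm s k f := by
  induction k generalizing f with
  | zero => exact sobNorm_smul _ _ _
  | succ k ih => simp only [momNorm, map_smul, ih, mul_add, Finset.mul_sum]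

theorem momNorm_sum_le (k : ℕ) {ι : Type*} (t : Finset ι) (f : ι → 𝓢(X ν, ℂ)) :
    momNorm s k (∑ i ∈ t, f i) ≤ ∑ i ∈ t, momNorm s k (f i) := by
  refine Finset.le_sum_of_subadditive _ ?_ (momNorm_add_le k) _ _
  have := momNorm_smul (s := s) k (0 : ℂ) (0 : 𝓢(X ν, ℂ))
  rw [zero_smul, norm_zero, zero_mul] at this
  exact this.le

theorem momNorm_qOp_le (k : ℕ) (j : Fin ν) (f : 𝓢(X ν, ℂ)) :
    momNorm s k (qOp j f) ≤ momNorm s (k + 1) f :=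
  (Finset.single_le_sum (f := fun j => momNorm s k (qOp j f)) (fun _ _ => momNorm_nonneg _ _)
    (Finset.mem_univ j)).trans (le_add_of_nonneg_left (momNorm_nonneg _ _))

theorem momNorm_le_succ (k : ℕ) (f : 𝓢(X ν, ℂ)) : momNorm s k f ≤ momNorm s (k + 1) f :=
  le_add_of_nonneg_right (Finset.sum_nonneg fun _ _ => momNorm_nonneg _ _)

/-- Commuting `x_j` with `a(p)` gives a multiple of `(∂_j a)(p)`, again bounded and smooth, with one
moment fewer. -/
theorem exists_momNorm_fourierMultiplier_le (s : ℝ) (k : ℕ) {a : X ν → ℂ} (ha : BddSmooth a) :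
    ∃ C, 0 ≤ C ∧ ∀ f, momNorm s k (SchwartzMap.fourierMultiplierCLM ℂ a f) ≤ C * momNorm s k f := by
  induction k generalizing a with
  | zero =>
    obtain ⟨C, hC⟩ := ha.exists_norm_le
    exact ⟨C, (norm_nonneg _).trans (hC 0),
      fun f => sobNorm_fourierMultiplier_le ha.hasTemperateGrowth hC s f⟩
  | succ k ih =>
    obtain ⟨C, hC, h⟩ := ih ha
    choose D hD hd using fun j => ih (ha.pd j)
    set c : ℝ := ‖(Complex.I / (2 * Real.pi) : ℂ)‖ with hc
    have hc0 : 0 ≤ c := norm_nonneg _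
    have hS : 0 ≤ ∑ j, c * D j := Finset.sum_nonneg fun j _ => mul_nonneg hc0 (hD j)
    refine ⟨C + ∑ j, c * D j, by positivity, fun f => ?_⟩
    have h1 : ∀ j, momNorm s k (qOp j (SchwartzMap.fourierMultiplierCLM ℂ a f)) ≤
        C * momNorm s k (qOp j f) + c * D j * momNorm s k f := fun j => by
      rw [qOp_fourierMultiplier ha]
      refine (momNorm_add_le _ _ _).trans (add_le_add (h _) ?_)
      rw [momNorm_smul, mul_assoc]
      exact mul_le_mul_of_nonneg_left (hd j f) hc0
    calc _ ≤ C * momNorm s k f + ∑ j, (C * momNorm s k (qOp j f) + c * D j * momNorm s k f) :=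
          add_le_add (h f) (Finset.sum_le_sum fun j _ => h1 j)
      _ = C * momNorm s (k + 1) f + (∑ j, c * D j) * momNorm s k f := by
          rw [Finset.sum_add_distrib, ← Finset.mul_sum, ← Finset.sum_mul, momNorm]
          ring
      _ ≤ _ := by
          rw [add_mul]
          gcongr
          exact momNorm_le_succ k f

theorem conjSchwartz_eq (hu : BddSmooth u) (f : 𝓢(X ν, ℂ)) : conjSchwartz u f =
    ∑ j, SchwartzMap.fourierMultiplierCLM ℂ
      (fun ξ : X ν => ((u ((2 * Real.pi) • ξ) j : ℝ) : ℂ)) (qOp j f) +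
    (-Complex.I) • SchwartzMap.fourierMultiplierCLM ℂ (fun ξ : X ν => (freqDiv u ξ : ℂ)) f := by
  apply fourier_schwartz_injective
  ext ξ
  rw [fourier_conjSchwartz_apply hu, FourierTransform.fourier_add, FourierTransform.fourier_smul,
    fourier_fourierMultiplier]
  have e : 𝓕 (∑ j, SchwartzMap.fourierMultiplierCLM ℂ
      (fun ξ : X ν => ((u ((2 * Real.pi) • ξ) j : ℝ) : ℂ)) (qOp j f)) =
      ∑ j, SchwartzMap.smulLeftCLM ℂ (fun ξ : X ν => ((u ((2 * Real.pi) • ξ) j : ℝ) : ℂ))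
        (𝓕 (qOp j f)) := by
    rw [← FourierTransform.fourierCLM_apply (R := ℂ), map_sum]
    exact Finset.sum_congr rfl fun j _ => fourier_fourierMultiplier _ _
  rw [e, add_apply, sum_apply, smul_apply, SchwartzMap.smulLeftCLM_apply_apply
    (bddSmooth_freqDiv hu).ofReal.hasTemperateGrowth]
  simp_rw [SchwartzMap.smulLeftCLM_apply_apply (hasTemperateGrowth_scaled hu _)]
  simp only [smul_eq_mul]
  ring

/-- With all `q_j` on the right, the conjugate operator costs exactly one moment. -/
theorem exists_momNorm_conjSchwartz_le (hu : BddSmooth u) (s : ℝ) (k : ℕ) :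
    ∃ C, 0 ≤ C ∧ ∀ f, momNorm s k (conjSchwartz u f) ≤ C * momNorm s (k + 1) f := by
  choose C hC h using fun j => exists_momNorm_fourierMultiplier_le s k (bddSmooth_coord hu j).ofReal
  obtain ⟨D, hD, hd⟩ := exists_momNorm_fourierMultiplier_le s k (bddSmooth_freqDiv hu).ofReal
  refine ⟨(∑ j, C j) + D, add_nonneg (Finset.sum_nonneg fun j _ => hC j) hD, fun f => ?_⟩
  rw [conjSchwartz_eq hu, add_mul, Finset.sum_mul]
  refine (momNorm_add_le _ _ _).trans (add_le_add ((momNorm_sum_le _ _ _).trans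
    (Finset.sum_le_sum fun j _ => (h j _).trans
      (mul_le_mul_of_nonneg_left (momNorm_qOp_le k j f) (hC j)))) ?_)
  rw [momNorm_smul, norm_neg, Complex.norm_I, one_mul]
  exact (hd f).trans (mul_le_mul_of_nonneg_left (momNorm_le_succ k f) hD)

theorem smulLeft_bracket_add (a b : ℝ) (f : 𝓢(X ν, ℂ)) :
    SchwartzMap.smulLeftCLM ℂ (bracket (a + b)) f =
      SchwartzMap.smulLeftCLM ℂ (bracket a) (SchwartzMap.smulLeftCLM ℂ (bracket b) f) := by
  ext x
  rw [SchwartzMap.smulLeftCLM_apply_apply (hasTemperateGrowth_bracket _),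
    SchwartzMap.smulLeftCLM_apply_apply (hasTemperateGrowth_bracket _),
    SchwartzMap.smulLeftCLM_apply_apply (hasTemperateGrowth_bracket _), bracket_add, mul_smul]

theorem qOp_smulLeft_bracket (a : ℝ) (j : Fin ν) (f : 𝓢(X ν, ℂ)) :
    qOp j (SchwartzMap.smulLeftCLM ℂ (bracket (a + -1)) f) =
      SchwartzMap.smulLeftCLM ℂ (bracket a) (SchwartzMap.smulLeftCLM ℂ (coordBCF j) f) := by
  ext x
  rw [qOp, SchwartzMap.smulLeftCLM_apply_apply (hasTemperateGrowth_coord j),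
    SchwartzMap.smulLeftCLM_apply_apply (hasTemperateGrowth_bracket _),
    SchwartzMap.smulLeftCLM_apply_apply (hasTemperateGrowth_bracket _),
    SchwartzMap.smulLeftCLM_apply_apply (hasTemperateGrowth_coordBCF j), bracket_add,
    coordBCF_apply]
  simp only [smul_eq_mul]
  ring

/-- Each factor `⟨x⟩⁻¹` pays for one moment, since `x_j⟨x⟩⁻¹` is smooth and bounded with all its
derivatives, hence a multiplier of `H^{-n}`. -/
theorem exists_momNorm_bracket_le (n k : ℕ) : ∃ C, 0 ≤ C ∧ ∀ f : 𝓢(X ν, ℂ),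
    momNorm (-n) k (SchwartzMap.smulLeftCLM ℂ (bracket (-k)) f) ≤ C * sobNorm (-n) f := by
  induction k with
  | zero =>
    obtain ⟨C, hC, h⟩ := (bddSmooth_bracket (ν := ν) (s := -((0 : ℕ) : ℝ)) (by simp)).exists_sobNorm_neg_smulLeft_le n
    exact ⟨C, hC, h⟩
  | succ k ih =>
    obtain ⟨C, hC, h⟩ := ih
    obtain ⟨D, hD, hd⟩ := (bddSmooth_bracket (ν := ν) (s := -1) (by simp)).exists_sobNorm_neg_smulLeft_le n
    choose E hE he using fun j => (bddSmooth_coordBCF (ν := ν) j).exists_sobNorm_neg_smulLeft_le n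
    refine ⟨C * D + ∑ j, C * E j, add_nonneg (mul_nonneg hC hD)
      (Finset.sum_nonneg fun j _ => mul_nonneg hC (hE j)), fun f => ?_⟩
    rw [show (-((k + 1 : ℕ) : ℝ)) = -(k : ℝ) + -1 by push_cast; ring, momNorm, add_mul,
      Finset.sum_mul]
    simp_rw [qOp_smulLeft_bracket]
    rw [smulLeft_bracket_add]
    refine add_le_add ?_ (Finset.sum_le_sum fun j _ => ?_)
    · rw [mul_assoc]
      exact (h _).trans (mul_le_mul_of_nonneg_left (hd f) hC)
    · rw [mul_assoc]
      exact (h _).trans (mul_le_mul_of_nonneg_left (he j f) hC)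

/-- Boundedness of `A⟨q⟩⁻¹` and `A²⟨q⟩⁻²` in `H^{-n}`: this is all that the regularity argument uses
about the domain of `A`. -/
theorem exists_sobNorm_conj_bracket_le (hu : BddSmooth u) (n : ℕ) : ∃ C, 0 ≤ C ∧ ∀ f : 𝓢(X ν, ℂ),
    sobNorm (-n) (conjSchwartz u (SchwartzMap.smulLeftCLM ℂ (bracket (-1)) f)) ≤
      C * sobNorm (-n) f ∧
    sobNorm (-n) (conjSchwartz u (conjSchwartz u (SchwartzMap.smulLeftCLM ℂ (bracket (-2)) f))) ≤
      C * sobNorm (-n) f := by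
  obtain ⟨A, hA, ha⟩ := exists_momNorm_conjSchwartz_le hu (-n) 0
  obtain ⟨B, hB, hb⟩ := exists_momNorm_conjSchwartz_le hu (-n) 1
  obtain ⟨C, hC, hc⟩ := exists_momNorm_bracket_le (ν := ν) n 1
  obtain ⟨D, hD, hd⟩ := exists_momNorm_bracket_le (ν := ν) n 2
  refine ⟨A * C + A * B * D, by positivity, fun f => ?_⟩
  have hf := sobNorm_nonneg (-n) f
  have h1 := hc f
  have h2 := hd f
  rw [show (-((1 : ℕ) : ℝ)) = -1 by norm_num] at h1
  rw [show (-((2 : ℕ) : ℝ)) = -2 by norm_num] at h2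
  constructor
  · calc _ ≤ A * _ := ha _
      _ ≤ A * (C * sobNorm (-n) f) := mul_le_mul_of_nonneg_left h1 hA
      _ ≤ _ := by rw [add_mul, mul_assoc]; exact le_add_of_nonneg_right (by positivity)
  · calc _ ≤ A * _ := ha _
      _ ≤ A * (B * _) := mul_le_mul_of_nonneg_left (hb _) hA
      _ ≤ A * (B * (D * sobNorm (-n) f)) := by gcongr
      _ ≤ _ := by
          rw [add_mul, ← mul_assoc, ← mul_assoc]; exact le_add_of_nonneg_left (by positivity)

end Moments

/-! ### Differentiability of the group on weighted spaces -/

section GroupEstimates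

variable {ν : ℕ} {u : X ν → X ν} {φ : ℝ → X ν → X ν} {z : ℝ → X ν → ℝ}
  {U : ℝ → (L2 ν ≃ₗᵢ[ℂ] L2 ν)} {s : ℝ}

/-- In a space of nonpositive order the derivative is inherited from `L²` through the continuous
embedding; this is why the estimates are first proved there. -/
theorem hasDerivAt_sobGroup (hu : BddSmooth u) (hU : IsTransportGroup φ z U)
    (h : IsWeightedFlow (freqField u) (freqDiv u) φ z) (hs : 0 ≤ s) (f : 𝓢(X ν, ℂ)) (t : ℝ) :
    HasDerivAt (fun t => sobGroup h U (-s) t (Sob.ofSchwartz (-s) f))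
      (Complex.I • sobGroup h U (-s) t (Sob.ofSchwartz (-s) (conjSchwartz u f))) t := by
  have h1 := hasDerivAt_group (positionGroup_map_add hU h)
    (hasDerivAt_positionGroup_schwartz hu hU h f) t
  have e : (fun t => sobGroup h U (-s) t (Sob.ofSchwartz (-s) f)) =
      fun t => (embed hs).restrictScalars ℝ (positionGroup U t (f.toLp 2 volume)) := by
    funext t
    rw [← embed_toLp hs, sobGroup_embed hU h hs]
    rfl
  have e' : Complex.I • sobGroup h U (-s) t (Sob.ofSchwartz (-s) (conjSchwartz u f)) =
      (embed hs).restrictScalars ℝ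
        (positionGroup U t (Complex.I • (conjSchwartz u f).toLp 2 (volume : Measure (X ν)))) := by
    rw [← embed_toLp hs, sobGroup_embed hU h hs, ContinuousLinearMap.coe_restrictScalars', map_smul,
      map_smul]
  rw [e, e']
  exact ((embed hs).restrictScalars ℝ).hasFDerivAt.comp_hasDerivAt t h1

theorem sobGroup_zero (hU : IsTransportGroup φ z U)
    (h : IsWeightedFlow (freqField u) (freqDiv u) φ z) (hs : 0 ≤ s) (f : 𝓢(X ν, ℂ)) :
    sobGroup h U (-s) 0 (Sob.ofSchwartz (-s) f) = Sob.ofSchwartz (-s) f := by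
  rw [← embed_toLp hs, sobGroup_embed hU h hs, positionGroup_apply, hU.map_zero h,
    LinearIsometryEquiv.symm_apply_apply]

theorem norm_sobGroup_sub_le (hu : BddSmooth u) (hU : IsTransportGroup φ z U)
    (h : IsWeightedFlow (freqField u) (freqDiv u) φ z) (hs : 0 ≤ s) {D : ℝ}
    (hD : ∀ τ, |τ| ≤ 1 → ‖sobGroup h U (-s) τ‖ ≤ D) (f : 𝓢(X ν, ℂ)) {a b : ℝ} (ha : |a| ≤ 1)
    (hb : |b| ≤ 1) :
    ‖sobGroup h U (-s) b (Sob.ofSchwartz (-s) f) - sobGroup h U (-s) a (Sob.ofSchwartz (-s) f)‖ ≤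
      D * sobNorm (-s) (conjSchwartz u f) * |b - a| := by
  have hb' : ∀ t ∈ Icc (-1 : ℝ) 1, ‖Complex.I • sobGroup h U (-s) t
      (Sob.ofSchwartz (-s) (conjSchwartz u f))‖ ≤ D * sobNorm (-s) (conjSchwartz u f) := fun t ht => by
    rw [norm_smul, Complex.norm_I, one_mul]
    exact ((sobGroup h U (-s) t).le_opNorm _).trans
      (mul_le_mul_of_nonneg_right (hD t (abs_le.2 ht)) (norm_nonneg _))
  have key := (convex_Icc (-1 : ℝ) 1).norm_image_sub_le_of_norm_hasDerivWithin_le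
    (fun t _ => (hasDerivAt_sobGroup hu hU h hs f t).hasDerivWithinAt) hb'
    (abs_le.1 ha) (abs_le.1 hb)
  exact key

theorem norm_sobGroup_second_difference_le (hu : BddSmooth u) (hU : IsTransportGroup φ z U)
    (h : IsWeightedFlow (freqField u) (freqDiv u) φ z) (hs : 0 ≤ s) {D : ℝ} (hD0 : 0 ≤ D)
    (hD : ∀ τ, |τ| ≤ 1 → ‖sobGroup h U (-s) τ‖ ≤ D) (f : 𝓢(X ν, ℂ)) {τ : ℝ} (h0 : 0 ≤ τ)
    (h1 : τ ≤ 1) :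
    ‖sobGroup h U (-s) τ (Sob.ofSchwartz (-s) f) + sobGroup h U (-s) (-τ) (Sob.ofSchwartz (-s) f) -
      (2 : ℂ) • Sob.ofSchwartz (-s) f‖ ≤
      2 * D * sobNorm (-s) (conjSchwartz u (conjSchwartz u f)) * τ ^ 2 := by
  set c : ℝ → Sob ν (-s) := fun t => sobGroup h U (-s) t (Sob.ofSchwartz (-s) f) with hc
  -- The derivative of the symmetric sum is a first difference of the orbit of `Af`, between times
  -- at distance `2t ≤ 2τ`. The mean value theorem is applied to it, and then once more.
  have hd : ∀ t, HasDerivAt (fun t => c t + c (-t)) (Complex.I • sobGroup h U (-s) t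
      (Sob.ofSchwartz (-s) (conjSchwartz u f)) - Complex.I • sobGroup h U (-s) (-t)
      (Sob.ofSchwartz (-s) (conjSchwartz u f))) t := fun t => by
    have e1 := hasDerivAt_sobGroup hu hU h hs f t
    have e2 := (hasDerivAt_sobGroup hu hU h hs f (-t)).scomp t (hasDerivAt_neg t)
    rw [neg_one_smul] at e2
    exact e1.add e2
  have hA := sobNorm_nonneg (-s) (conjSchwartz u (conjSchwartz u f))
  have key := (convex_Icc (0 : ℝ) τ).norm_image_sub_le_of_norm_hasDerivWithin_le
    (fun t _ => (hd t).hasDerivWithinAt)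
    (C := D * sobNorm (-s) (conjSchwartz u (conjSchwartz u f)) * (2 * τ)) (fun t ht => by
      rw [← smul_sub, norm_smul, Complex.norm_I, one_mul]
      have ht1 : |t| ≤ 1 := abs_le.2 ⟨by linarith [ht.1], ht.2.trans h1⟩
      refine (norm_sobGroup_sub_le hu hU h hs hD _ (by rwa [abs_neg]) ht1).trans ?_
      have : |t - -t| ≤ 2 * τ := by
        rw [sub_neg_eq_add, abs_of_nonneg (by linarith [ht.1])]; linarith [ht.2]
      gcongr) (left_mem_Icc.2 h0) (right_mem_Icc.2 h0)
  have e0 : c 0 = Sob.ofSchwartz (-s) f := sobGroup_zero hU h hs f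
  rw [neg_zero, e0, ← two_smul ℂ (Sob.ofSchwartz (-s) f), sub_zero, Real.norm_of_nonneg h0] at key
  refine key.trans (le_of_eq ?_)
  ring

end GroupEstimates

end

section

open FourierTransform LineDeriv

/-! ### A criterion for the class `C^{1,1}` -/

section Commutators

variable {ν : ℕ} {u : X ν → X ν} {φ : ℝ → X ν → X ν} {z : ℝ → X ν → ℝ}
  {U : ℝ → (L2 ν ≃ₗᵢ[ℂ] L2 ν)} {s t : ℝ}

theorem opNorm_le_of_schwartz {V : Sob ν s →L[ℂ] Sob ν t} {C : ℝ} (hC : 0 ≤ C)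
    (h : ∀ f, ‖V (Sob.ofSchwartz s f)‖ ≤ C * ‖Sob.ofSchwartz s f‖) : ‖V‖ ≤ C :=
  V.opNorm_le_bound hC fun g => denseRange_ofSchwartz.induction_on
    (p := fun g => ‖V g‖ ≤ C * ‖g‖) g
    (isClosed_le V.continuous.norm (continuous_const.mul continuous_norm)) h

theorem opNorm_le_of_pairing {A : Sob ν s →L[ℂ] Sob ν s} {B : Sob ν (-s) →L[ℂ] Sob ν (-s)}
    (h : ∀ F g, Sob.pairing (B F) g = Sob.pairing F (A g)) : ‖A‖ ≤ ‖B‖ := by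
  refine A.opNorm_le_bound (norm_nonneg _) fun g => ?_
  have h1 := h ((mom ν (-s)).symm (mom ν s (A g))) g
  have h2 := norm_pairing_le (B ((mom ν (-s)).symm (mom ν s (A g)))) g
  rw [h1, pairing_eq, LinearIsometryEquiv.apply_symm_apply, inner_self_eq_norm_sq_to_K] at h2
  simp only [Complex.coe_algebraMap, norm_pow, Complex.norm_real, norm_norm,
    LinearIsometryEquiv.norm_map] at h2
  have h3 := B.le_opNorm ((mom ν (-s)).symm (mom ν s (A g)))
  rw [LinearIsometryEquiv.norm_map, LinearIsometryEquiv.norm_map] at h3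
  rcases eq_or_lt_of_le (norm_nonneg (A g)) with h4 | h4
  · rw [← h4]; positivity
  · refine le_of_mul_le_mul_right (a := ‖A g‖) ?_ h4
    calc ‖A g‖ * ‖A g‖ = ‖A g‖ ^ 2 := (sq _).symm
      _ ≤ _ := h2
      _ ≤ ‖B‖ * ‖A g‖ * ‖g‖ := mul_le_mul_of_nonneg_right h3 (norm_nonneg _)
      _ = _ := by ring

/-- `Q` acts on Schwartz functions as multiplication by `⟨x⟩^a`. -/
def IsBracketMul (a : ℝ) (Q : Sob ν s →L[ℂ] Sob ν s) : Prop :=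
  ∀ f, Q (Sob.ofSchwartz s f) = Sob.ofSchwartz s (SchwartzMap.smulLeftCLM ℂ (bracket a) f)

theorem isBracketMul_id : IsBracketMul 0 (ContinuousLinearMap.id ℂ (Sob ν s)) := fun f => by
  rw [ContinuousLinearMap.id_apply]
  congr 1
  ext x
  rw [SchwartzMap.smulLeftCLM_apply_apply (hasTemperateGrowth_bracket _), bracket_zero, one_smul]

theorem exists_isBracketMul (n : ℕ) {a : ℝ} (ha : a ≤ 0) :
    (∃ Q : Sob ν n →L[ℂ] Sob ν n, IsBracketMul a Q) ∧
      ∃ Q : Sob ν (-n) →L[ℂ] Sob ν (-n), IsBracketMul a Q := by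
  obtain ⟨C, hC, h⟩ := (bddSmooth_bracket (ν := ν) ha).exists_sobNorm_smulLeft_le n
  obtain ⟨D, hD, h'⟩ := (bddSmooth_bracket (ν := ν) ha).exists_sobNorm_neg_smulLeft_le n
  obtain ⟨Q, hQ, -⟩ := exists_clm_of_schwartz (s := n) (ofSchwartzₗ n ∘ₗ
    (SchwartzMap.smulLeftCLM ℂ (bracket a : X ν → ℂ)).toLinearMap) hC h
  obtain ⟨Q', hQ', -⟩ := exists_clm_of_schwartz (s := -n) (ofSchwartzₗ (-n) ∘ₗ
    (SchwartzMap.smulLeftCLM ℂ (bracket a : X ν → ℂ)).toLinearMap) hD h'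
  exact ⟨⟨Q, hQ⟩, ⟨Q', hQ'⟩⟩

theorem IsBracketMul.pairing (hs : 0 ≤ s) {a : ℝ} {Q : Sob ν s →L[ℂ] Sob ν s}
    {Q' : Sob ν (-s) →L[ℂ] Sob ν (-s)} (hQ : IsBracketMul a Q) (hQ' : IsBracketMul a Q')
    (F : Sob ν (-s)) (g : Sob ν s) : Sob.pairing (Q' F) g = Sob.pairing F (Q g) := by
  refine pairing_ext_schwartz (Y := Q') (Z' := .id ℂ _) (Z := .id ℂ _) (Y' := Q)
    (fun f ψ => ?_) F g
  have e : (fun x : X ν => starRingEnd ℂ (bracket a x)) = bracket a :=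
    funext fun x => Complex.conj_ofReal _
  rw [ContinuousLinearMap.id_apply, ContinuousLinearMap.id_apply, hQ, hQ', pairing_ofSchwartz hs,
    pairing_ofSchwartz hs, inner_smulLeft (hasTemperateGrowth_bracket _)
      (by rw [e]; exact hasTemperateGrowth_bracket _), e]

theorem isMultiplicationBy_bracket_comp (hs : 0 ≤ s) {a b : ℝ} {m w : X ν → ℝ} (hm : PolyGrowth m)
    (hw : PolyGrowth w) (hwm : ∀ x, w x = bracketR a x * m x * bracketR b x)
    {T : Sob ν s →L[ℂ] Sob ν (-s)} (hT : IsMultiplicationBy m T)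
    {Q Q₁ : Sob ν s →L[ℂ] Sob ν s} {Q' : Sob ν (-s) →L[ℂ] Sob ν (-s)} (hQ : IsBracketMul a Q)
    (hQ' : IsBracketMul a Q') (hQ₁ : IsBracketMul b Q₁) :
    IsMultiplicationBy w (Q' ∘L T ∘L Q₁) := by
  refine (isMultiplicationBy_iff_pairing hs hw).2 fun f ψ => ?_
  change Sob.pairing (Q' (T (Q₁ _))) _ = _
  rw [hQ.pairing hs hQ', hQ₁, hQ, (isMultiplicationBy_iff_pairing hs hm).1 hT]
  refine integral_congr_ae (Eventually.of_forall fun x => ?_)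
  simp only [conjS_apply, SchwartzMap.smulLeftCLM_apply_apply (hasTemperateGrowth_bracket _), hwm,
    smul_eq_mul, map_mul, bracket_eq_ofReal, Complex.conj_ofReal]
  push_cast
  ring

/-- Weighted Taylor estimates for the group: the weights `⟨x⟩⁻¹` and `⟨x⟩⁻²` compensate the one or
two applications of `A` in the remainders. -/
theorem exists_group_bracket_le (hu : BddSmooth u) (hU : IsTransportGroup φ z U)
    (h : IsWeightedFlow (freqField u) (freqDiv u) φ z) (n : ℕ)
    {Q₁ : Sob ν (-n) →L[ℂ] Sob ν (-n)} {Q₂ : Sob ν (-n) →L[ℂ] Sob ν (-n)}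
    (hQ₁ : IsBracketMul (-1) Q₁) (hQ₂ : IsBracketMul (-2) Q₂) :
    ∃ C, 0 ≤ C ∧ ∀ τ, 0 ≤ τ → τ ≤ 1 →
      ‖(sobGroup h U (-n) τ - .id ℂ _) ∘L Q₁‖ ≤ C * τ ∧
      ‖(sobGroup h U (-n) (-τ) - .id ℂ _) ∘L Q₁‖ ≤ C * τ ∧
      ‖(sobGroup h U (-n) τ + sobGroup h U (-n) (-τ) - (2 : ℂ) • .id ℂ _) ∘L Q₂‖ ≤ C * τ ^ 2 := by
  have hn : (0 : ℝ) ≤ n := n.cast_nonneg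
  obtain ⟨D, hD, hDb⟩ := exists_norm_sobGroup_le h U (-n)
  obtain ⟨B, hB, hBb⟩ := exists_sobNorm_conj_bracket_le hu n
  have first : ∀ τ, |τ| ≤ 1 → ‖(sobGroup h U (-n) τ - .id ℂ _) ∘L Q₁‖ ≤ 2 * D * B * |τ| :=
    fun τ hτ => opNorm_le_of_schwartz (by positivity) fun f => by
      change ‖sobGroup h U (-n) τ (Q₁ _) - Q₁ _‖ ≤ _
      rw [hQ₁]
      have e := norm_sobGroup_sub_le hu hU h hn hDb (SchwartzMap.smulLeftCLM ℂ (bracket (-1)) f)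
        (a := 0) (b := τ) (by simp) hτ
      rw [sobGroup_zero hU h hn, sub_zero] at e
      refine e.trans ?_
      have h1 : D * sobNorm (-n) (conjSchwartz u (SchwartzMap.smulLeftCLM ℂ (bracket (-1)) f)) ≤
        D * (B * sobNorm (-n) f) := mul_le_mul_of_nonneg_left (hBb f).1 hD
      have h2 : 0 ≤ D * (B * sobNorm (-n) f) :=
        mul_nonneg hD (mul_nonneg hB (sobNorm_nonneg _ _))
      calc _ ≤ (2 * (D * (B * sobNorm (-n) f))) * |τ| :=
            mul_le_mul_of_nonneg_right (by linarith) (abs_nonneg _)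
        _ = 2 * D * B * |τ| * sobNorm (-n) f := by ring
  refine ⟨2 * D * B, by positivity, fun τ h0 h1 => ⟨?_, ?_, ?_⟩⟩
  · simpa only [abs_of_nonneg h0] using first τ (by rwa [abs_of_nonneg h0])
  · simpa only [abs_neg, abs_of_nonneg h0] using first (-τ) (by rwa [abs_neg, abs_of_nonneg h0])
  · refine opNorm_le_of_schwartz (by positivity) fun f => ?_
    change ‖sobGroup h U (-n) τ (Q₂ _) + sobGroup h U (-n) (-τ) (Q₂ _) - (2 : ℂ) • Q₂ _‖ ≤ _
    rw [hQ₂]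
    refine (norm_sobGroup_second_difference_le hu hU h hn hD hDb _ h0 h1).trans ?_
    calc _ ≤ 2 * D * (B * sobNorm (-n) f) * τ ^ 2 := by
          gcongr; exact (hBb f).2
      _ = 2 * D * B * τ ^ 2 * sobNorm (-n) f := by ring

theorem pairing_sub_left (F F' : Sob ν (-s)) (g : Sob ν s) :
    Sob.pairing (F - F') g = Sob.pairing F g - Sob.pairing F' g := by
  simp only [pairing_eq, map_sub, inner_sub_left]

theorem pairing_sub_right (F : Sob ν (-s)) (g g' : Sob ν s) :
    Sob.pairing F (g - g') = Sob.pairing F g - Sob.pairing F g' := by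
  simp only [pairing_eq, map_sub, inner_sub_right]

theorem pairing_add_left (F F' : Sob ν (-s)) (g : Sob ν s) :
    Sob.pairing (F + F') g = Sob.pairing F g + Sob.pairing F' g := by
  simp only [pairing_eq, map_add, inner_add_left]

theorem pairing_add_right (F : Sob ν (-s)) (g g' : Sob ν s) :
    Sob.pairing F (g + g') = Sob.pairing F g + Sob.pairing F g' := by
  simp only [pairing_eq, map_add, inner_add_right]

/-- Transposition reverses the order of the factors, so in `H^n` the weight stands to the left of
the difference, where it meets the potential. -/
theorem norm_comp_sub_id_le_dual {P Q' : Sob ν (-s) →L[ℂ] Sob ν (-s)} {q Q : Sob ν s →L[ℂ] Sob ν s}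
    (hP : ∀ F g, Sob.pairing (P F) g = Sob.pairing F (q g))
    (hQ : ∀ F g, Sob.pairing (Q' F) g = Sob.pairing F (Q g)) :
    ‖Q ∘L (q - .id ℂ _)‖ ≤ ‖(P - .id ℂ _) ∘L Q'‖ :=
  opNorm_le_of_pairing fun F g => by
    change Sob.pairing (P (Q' F) - Q' F) g = Sob.pairing F (Q (q g - g))
    rw [pairing_sub_left, hP, hQ, hQ, map_sub, pairing_sub_right]

theorem norm_comp_add_sub_id_le_dual {P M Q' : Sob ν (-s) →L[ℂ] Sob ν (-s)}
    {p q Q : Sob ν s →L[ℂ] Sob ν s}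
    (hP : ∀ F g, Sob.pairing (P F) g = Sob.pairing F (q g))
    (hM : ∀ F g, Sob.pairing (M F) g = Sob.pairing F (p g))
    (hQ : ∀ F g, Sob.pairing (Q' F) g = Sob.pairing F (Q g)) :
    ‖Q ∘L (p + q - (2 : ℂ) • .id ℂ _)‖ ≤ ‖(P + M - (2 : ℂ) • .id ℂ _) ∘L Q'‖ :=
  opNorm_le_of_pairing fun F g => by
    change Sob.pairing (P (Q' F) + M (Q' F) - (2 : ℂ) • Q' F) g =
      Sob.pairing F (Q (p g + q g - (2 : ℂ) • g))
    rw [two_smul, two_smul, pairing_sub_left, pairing_add_left, pairing_add_left, hP, hM,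
      map_sub, map_add, map_add, pairing_sub_right, pairing_add_right, pairing_add_right,
      hQ, hQ, hQ, add_comm (Sob.pairing _ _)]

/-- For `T₁` the identity `PTq + MTp - 2T = (P+M-2)T + T(p+q-2) + (P-1)T(q-1) + (M-1)T(p-1)` is
used. The factor `⟨x⟩⁻²` of `T₁` is put on the left, on the right, or half on each side, so that
every term is `O(τ²)‖T₃‖`. For `T₂` only the boundedness of the group is used. -/
theorem norm_second_difference_le {E F : Type*} [NormedAddCommGroup E] [NormedSpace ℂ E]
    [NormedAddCommGroup F] [NormedSpace ℂ F] {P M Q₁' Q₂' : F →L[ℂ] F} {p q Q₁ Q₂ : E →L[ℂ] E}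
    {T₁ T₂ T₃ : E →L[ℂ] F} {C D D' τ : ℝ} (h0 : 0 ≤ τ) (hC : 0 ≤ C) (hD : 0 ≤ D)
    (f1 : T₁ = Q₂' ∘L T₃) (f2 : T₁ = T₃ ∘L Q₂) (f3 : T₁ = Q₁' ∘L T₃ ∘L Q₁)
    (hP : ‖P‖ ≤ D) (hM : ‖M‖ ≤ D) (hp : ‖p‖ ≤ D') (hq : ‖q‖ ≤ D')
    (b1 : ‖(P - .id ℂ _) ∘L Q₁'‖ ≤ C * τ) (b2 : ‖(M - .id ℂ _) ∘L Q₁'‖ ≤ C * τ)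
    (b3 : ‖(P + M - (2 : ℂ) • .id ℂ _) ∘L Q₂'‖ ≤ C * τ ^ 2)
    (c1 : ‖Q₁ ∘L (q - .id ℂ _)‖ ≤ C * τ) (c2 : ‖Q₁ ∘L (p - .id ℂ _)‖ ≤ C * τ)
    (c3 : ‖Q₂ ∘L (p + q - (2 : ℂ) • .id ℂ _)‖ ≤ C * τ ^ 2) :
    ‖P ∘L (T₁ + T₂) ∘L q + M ∘L (T₁ + T₂) ∘L p - (2 : ℂ) • (T₁ + T₂)‖ ≤
      (2 * C + 2 * C ^ 2 + (2 * D * D' + 2)) * (τ ^ 2 * ‖T₃‖ + ‖T₂‖) := by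
  have hD' : 0 ≤ D' := (norm_nonneg _).trans hp
  have e : P ∘L (T₁ + T₂) ∘L q + M ∘L (T₁ + T₂) ∘L p - (2 : ℂ) • (T₁ + T₂) =
      (((P + M - (2 : ℂ) • .id ℂ _) ∘L Q₂') ∘L T₃ + T₃ ∘L (Q₂ ∘L (p + q - (2 : ℂ) • .id ℂ _)) +
        ((P - .id ℂ _) ∘L Q₁') ∘L T₃ ∘L (Q₁ ∘L (q - .id ℂ _)) +
        ((M - .id ℂ _) ∘L Q₁') ∘L T₃ ∘L (Q₁ ∘L (p - .id ℂ _))) +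
      (P ∘L T₂ ∘L q + M ∘L T₂ ∘L p - (2 : ℂ) • T₂) := by
    have a1 : ((P + M - (2 : ℂ) • .id ℂ _) ∘L Q₂') ∘L T₃ = (P + M - (2 : ℂ) • .id ℂ _) ∘L T₁ := by
      rw [f1]; rfl
    have a2 : T₃ ∘L (Q₂ ∘L (p + q - (2 : ℂ) • .id ℂ _)) = T₁ ∘L (p + q - (2 : ℂ) • .id ℂ _) := by
      rw [f2]; rfl
    have a3 : ∀ (Y : F →L[ℂ] F) (Z : E →L[ℂ] E),
        (Y ∘L Q₁') ∘L T₃ ∘L (Q₁ ∘L Z) = Y ∘L T₁ ∘L Z := fun Y Z => by rw [f3]; rfl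
    rw [a1, a2, a3, a3]
    ext1 g
    simp only [add_apply, sub_apply, smul_apply, ContinuousLinearMap.comp_apply, map_add, map_sub,
      map_smul, ContinuousLinearMap.id_apply]
    module
  rw [e]
  have n3 := norm_nonneg T₃
  have n2 := norm_nonneg T₂
  have comp3 : ∀ (Y : F →L[ℂ] F) (T : E →L[ℂ] F)
      (Z : E →L[ℂ] E) {y z : ℝ}, 0 ≤ y → ‖Y‖ ≤ y → ‖Z‖ ≤ z →
      ‖Y ∘L T ∘L Z‖ ≤ y * (‖T‖ * z) := fun Y T Z y z hy hY hZ =>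
    (ContinuousLinearMap.opNorm_comp_le _ _).trans (mul_le_mul hY
      ((ContinuousLinearMap.opNorm_comp_le _ _).trans
        (mul_le_mul_of_nonneg_left hZ (norm_nonneg _))) (norm_nonneg _) hy)
  have d1 : ‖((P + M - (2 : ℂ) • .id ℂ _) ∘L Q₂') ∘L T₃‖ ≤ C * τ ^ 2 * ‖T₃‖ :=
    (ContinuousLinearMap.opNorm_comp_le _ _).trans (mul_le_mul_of_nonneg_right b3 n3)
  have d2 : ‖T₃ ∘L (Q₂ ∘L (p + q - (2 : ℂ) • .id ℂ _))‖ ≤ ‖T₃‖ * (C * τ ^ 2) :=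
    (ContinuousLinearMap.opNorm_comp_le _ _).trans (mul_le_mul_of_nonneg_left c3 n3)
  have d3 := comp3 _ T₃ _ (by positivity) b1 c1
  have d4 := comp3 _ T₃ _ (by positivity) b2 c2
  have d5 := comp3 P T₂ q hD hP hq
  have d6 := comp3 M T₂ p hD hM hp
  have d7 : ‖(2 : ℂ) • T₂‖ = 2 * ‖T₂‖ := by rw [norm_smul]; simp
  have s1 := norm_add₄_le (a := ((P + M - (2 : ℂ) • .id ℂ _) ∘L Q₂') ∘L T₃)
    (b := T₃ ∘L (Q₂ ∘L (p + q - (2 : ℂ) • .id ℂ _)))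
    (c := ((P - .id ℂ _) ∘L Q₁') ∘L T₃ ∘L (Q₁ ∘L (q - .id ℂ _)))
    (d := ((M - .id ℂ _) ∘L Q₁') ∘L T₃ ∘L (Q₁ ∘L (p - .id ℂ _)))
  have s2 := norm_sub_le (P ∘L T₂ ∘L q + M ∘L T₂ ∘L p) ((2 : ℂ) • T₂)
  have s3 := norm_add_le (P ∘L T₂ ∘L q) (M ∘L T₂ ∘L p)
  refine (norm_add_le _ _).trans ((add_le_add s1 s2).trans ?_)
  have g1 : 0 ≤ τ ^ 2 * ‖T₃‖ := by positivity
  have g2 : 0 ≤ C * ‖T₂‖ := by positivity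
  have g3 : 0 ≤ C ^ 2 * ‖T₂‖ := by positivity
  have g4 : 0 ≤ D * D' * (τ ^ 2 * ‖T₃‖) := by positivity
  linarith

/-- The second difference of `τ ↦ T_τ` for a multiplication operator `T = T₁ + T₂` such that
`⟨x⟩² T₁` is bounded. -/
theorem exists_second_difference_le (hu : BddSmooth u) (hU : IsTransportGroup φ z U)
    (h : IsWeightedFlow (freqField u) (freqDiv u) φ z) (n : ℕ) :
    ∃ C, 0 ≤ C ∧ ∀ (w m : X ν → ℝ) (T₁ T₂ T₃ : Sob ν n →L[ℂ] Sob ν (-n)),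
      PolyGrowth w → PolyGrowth m → (∀ x, w x = bracketR (-2) x * m x) →
      IsMultiplicationBy w T₁ → IsMultiplicationBy m T₃ → ∀ τ, 0 ≤ τ → τ ≤ 1 →
      ‖sobGroup h U (-n) τ ∘L (T₁ + T₂) ∘L sobGroup h U n (-τ) +
        sobGroup h U (-n) (-τ) ∘L (T₁ + T₂) ∘L sobGroup h U n τ - (2 : ℂ) • (T₁ + T₂)‖ ≤
        C * (τ ^ 2 * ‖T₃‖ + ‖T₂‖) := by
  have hn : (0 : ℝ) ≤ n := n.cast_nonneg
  obtain ⟨⟨Q₁, hQ₁⟩, ⟨Q₁', hQ₁'⟩⟩ := exists_isBracketMul (ν := ν) n (a := -1) (by norm_num)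
  obtain ⟨⟨Q₂, hQ₂⟩, ⟨Q₂', hQ₂'⟩⟩ := exists_isBracketMul (ν := ν) n (a := -2) (by norm_num)
  obtain ⟨D, hD, hDb⟩ := exists_norm_sobGroup_le h U (-n)
  obtain ⟨D', hD', hDb'⟩ := exists_norm_sobGroup_le h U n
  obtain ⟨C, hC, hCb⟩ := exists_group_bracket_le hu hU h n hQ₁' hQ₂'
  refine ⟨2 * C + 2 * C ^ 2 + (2 * D * D' + 2), by positivity,
    fun w m T₁ T₂ T₃ hw hm hwm hT₁ hT₃ τ h0 h1 => ?_⟩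
  let P := sobGroup h U (-n) τ
  let M := sobGroup h U (-n) (-τ)
  let p := sobGroup h U n τ
  let q := sobGroup h U n (-τ)
  have hPq : ∀ F g, Sob.pairing (P F) g = Sob.pairing F (q g) := pairing_sobGroup hU h hn τ
  have hMp : ∀ F g, Sob.pairing (M F) g = Sob.pairing F (p g) := fun F g => by
    have := pairing_sobGroup hU h hn (-τ) F g
    rwa [neg_neg] at this
  obtain ⟨b1, b2, b3⟩ := hCb τ h0 h1
  have c1 := (norm_comp_sub_id_le_dual hPq (hQ₁.pairing hn hQ₁')).trans b1
  have c2 := (norm_comp_sub_id_le_dual hMp (hQ₁.pairing hn hQ₁')).trans b2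
  have c3 := (norm_comp_add_sub_id_le_dual hPq hMp (hQ₂.pairing hn hQ₂')).trans b3
  have z0 : ∀ x : X ν, bracketR 0 x = 1 := fun x => by rw [bracketR, zero_div, Real.rpow_zero]
  -- Three factorisations of the same operator: `T₁ = ⟨q⟩⁻² T₃ = T₃ ⟨q⟩⁻² = ⟨q⟩⁻¹ T₃ ⟨q⟩⁻¹`.
  have f1 := hT₁.unique <|
    isMultiplicationBy_bracket_comp hn hm hw (fun x => by rw [hwm, z0, mul_one]) hT₃ hQ₂ hQ₂'
      isBracketMul_id
  have f2 := hT₁.unique <|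
    isMultiplicationBy_bracket_comp hn hm hw (fun x => by rw [hwm, z0]; ring) hT₃ isBracketMul_id
      isBracketMul_id hQ₂
  rw [ContinuousLinearMap.comp_id] at f1
  rw [ContinuousLinearMap.id_comp] at f2
  have f3 : T₁ = Q₁' ∘L T₃ ∘L Q₁ := hT₁.unique <|
    isMultiplicationBy_bracket_comp hn hm hw (fun x => by
      rw [hwm, show (-2 : ℝ) = -1 + -1 by norm_num, bracketR_add]; ring) hT₃ hQ₁ hQ₁' hQ₁
  exact norm_second_difference_le h0 hC hD f1 f2 f3
    (hDb τ (by rwa [abs_of_nonneg h0])) (hDb (-τ) (by rwa [abs_neg, abs_of_nonneg h0]))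
    (hDb' τ (by rwa [abs_of_nonneg h0])) (hDb' (-τ) (by rwa [abs_neg, abs_of_nonneg h0]))
    b1 b2 b3 c1 c2 c3

end Commutators

end

section

/-! ### The potential is of class `C^{1,1}` -/

section PotentialRegularity

variable {ν : ℕ} {α β k : ℝ} {κ : ℝ → ℝ} {u : X ν → X ν}

/-- On `outer` one has `2‖x‖ ≥ 1`, so the order may be raised without any vanishing condition. -/
theorem Symb.raise_outer {n : ℕ} {m A δ : ℝ} {a : X ν → ℂ} (hA : 0 ≤ A) (hδ : 0 ≤ δ)
    (ha : Symb (outer ν) n m A a) : Symb (outer ν) n (m + δ) (A * 2 ^ δ) a := by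
  have key : ∀ {m : ℝ} {a : X ν → ℂ}, (∀ x ∈ outer ν, ‖a x‖ ≤ A * ‖x‖ ^ m) →
      ∀ x ∈ outer ν, ‖a x‖ ≤ A * 2 ^ δ * ‖x‖ ^ (m + δ) := by
    intro m a h x hx
    have hx' : 1 / 2 < ‖x‖ := hx
    have hx0 : 0 < ‖x‖ := by linarith
    have h1 : 1 ≤ (2 * ‖x‖) ^ δ := Real.one_le_rpow (by linarith) hδ
    rw [Real.mul_rpow zero_le_two hx0.le] at h1
    refine (h x hx).trans ?_
    rw [Real.rpow_add hx0]
    calc A * ‖x‖ ^ m = A * ‖x‖ ^ m * 1 := (mul_one _).symm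
      _ ≤ A * ‖x‖ ^ m * (2 ^ δ * ‖x‖ ^ δ) := by gcongr
      _ = _ := by ring
  induction n generalizing m a with
  | zero => exact key ha
  | succ n ih =>
    refine ⟨key ha.1, ha.2.1, fun j => ?_⟩
    have := ih (ha.2.2 j)
    rwa [show m - 1 + δ = m + δ - 1 by ring] at this

theorem exists_symb_bracket_sq (n : ℕ) : ∃ A, 0 ≤ A ∧
    Symb (outer ν) n 2 A (fun x => ((1 + ‖x‖ ^ 2 : ℝ) : ℂ)) := by
  obtain ⟨B, hB, hBS⟩ := Symb.exists_rpow_norm (isOpen_outer (ν := ν)) zero_notMem_outer n 2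
  have h1 := Symb.raise_outer (δ := 2) (norm_nonneg (1 : ℂ)) zero_le_two
    (Symb.const (O := outer ν) (n := n) 1)
  rw [zero_add] at h1
  refine ⟨_, by positivity, (Symb.add isOpen_outer h1 hBS).congr isOpen_outer fun x _ => ?_⟩
  push_cast
  rw [show (2 : ℝ) = (2 : ℕ) by norm_num, Real.rpow_natCast]
  push_cast
  rfl

theorem exists_symb_cutoff (hκ : ContDiff ℝ ∞ κ) (hκc : HasCompactSupport κ)
    (hκ1 : ∀ t ∈ Icc (-1 : ℝ) 1, κ t = 1) (n : ℕ) :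
    ∃ A, 0 ≤ A ∧ Symb {x : X ν | x ≠ 0} n 0 A (fun x => ((κ ‖x‖ : ℝ) : ℂ)) := by
  obtain ⟨B, hB, hBS⟩ := exists_symb_one_sub_cutoff (ν := ν) hκ hκc hκ1 n
  have hO : IsOpen {x : X ν | x ≠ 0} := isOpen_ne
  have h0 : (0 : X ν) ∉ {x : X ν | x ≠ 0} := fun h => h rfl
  refine ⟨_, by positivity, ((Symb.const (1 : ℂ)).add hO (Symb.const_mul hO h0 hB (-1) hBS)).congr hO
    fun x _ => ?_⟩
  push_cast
  ring

theorem measurable_cutoff_scaled (hκ : ContDiff ℝ ∞ κ) (τ : ℝ) :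
    Measurable fun x : X ν => κ ‖τ • x‖ :=
  hκ.continuous.measurable.comp (by fun_prop)

theorem polyGrowth_one_add_normSq : PolyGrowth fun x : X ν => 1 + ‖x‖ ^ 2 :=
  ⟨by fun_prop, 1, 2, fun x => by
    rw [abs_of_pos (one_add_normSq_pos x), one_mul]
    nlinarith [norm_nonneg x]⟩

/-- Scaled cutoffs have order `0` with constants independent of `τ`. As symbols of order `δ`, the
outer one, supported in `|x| ≥ 1/τ`, has constant `O(τ^δ)`, and `(1+|x|²)κ(τx)`, supported in `|x| ≤
R/τ`, has constant `O(τ^{δ-2})`. The basic form bound then gives the operator norms. -/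
theorem exists_potential_splitting (hk : k ≠ 0) (hα : 0 < α) (hκ : ContDiff ℝ ∞ κ)
    (hκc : HasCompactSupport κ) (hκ1 : ∀ t ∈ Icc (-1 : ℝ) 1, κ t = 1)
    (hκ0 : ∀ t, 0 ≤ κ t ∧ κ t ≤ 1) (n : ℕ) {δ : ℝ} (h0 : 0 ≤ δ) (h2 : δ ≤ 2)
    (hδ : δ ≤ n * α + β - n) :
    ∃ K, 0 ≤ K ∧ ∀ τ, 0 < τ →
      ∃ T₁ T₂ T₃ : Sob ν n →L[ℂ] Sob ν (-n),
        IsMultiplicationBy (fun x => κ ‖τ • x‖ * oscPotential ν α β k κ x) T₁ ∧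
        IsMultiplicationBy (fun x => (1 - κ ‖τ • x‖) * oscPotential ν α β k κ x) T₂ ∧
        IsMultiplicationBy
          (fun x => (1 + ‖x‖ ^ 2) * κ ‖τ • x‖ * oscPotential ν α β k κ x) T₃ ∧
        ‖T₂‖ ≤ K * τ ^ δ ∧ ‖T₃‖ ≤ K * τ ^ (δ - 2) := by
  obtain ⟨K, hK, hKb⟩ := exists_formBound_mul_oscPotential (ν := ν) (β := β) hk hα hκ hκc hκ1 n
  obtain ⟨A, hA, hAS⟩ := exists_symb_one_sub_cutoff (ν := ν) hκ hκc hκ1 n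
  obtain ⟨B, hB, hBS⟩ := exists_symb_cutoff (ν := ν) hκ hκc hκ1 n
  obtain ⟨D, hD, hDS⟩ := exists_symb_bracket_sq (ν := ν) n
  obtain ⟨R, hR1, hR⟩ := exists_cutoff_radius hκc
  have hW := polyGrowth_oscPotential (ν := ν) (α := α) (β := β) (k := k) hκ hκ0 hκ1
  have hn : (0 : ℝ) ≤ n := n.cast_nonneg
  refine ⟨K * A + K * (2 ^ n * (D * (B * R ^ (2 - δ)))), by positivity, fun τ hτ => ?_⟩
  have hR0 : 0 < R := by linarith
  have mκ := measurable_cutoff_scaled (ν := ν) hκ τ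
  have pκ : PolyGrowth fun x : X ν => κ ‖τ • x‖ := .of_le mκ (C := 1) fun x => by
    rw [abs_of_nonneg (hκ0 _).1]; exact (hκ0 _).2
  have pκ' : PolyGrowth fun x : X ν => 1 - κ ‖τ • x‖ :=
    .of_le (measurable_const.sub mκ) (C := 1) fun x =>
      abs_le.2 ⟨by linarith [(hκ0 ‖τ • x‖).2], by linarith [(hκ0 ‖τ • x‖).1]⟩
  have s1 := hBS.scale hτ
  have s2 := hAS.scale hτ
  rw [Real.rpow_zero, mul_one] at s1 s2
  have b1 : FormBound n (fun x => κ ‖τ • x‖ * oscPotential ν α β k κ x) (K * B) :=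
    hKb (fun x => κ ‖τ • x‖) B 0 mκ hB (h0.trans hδ) (s1.mono_set outer_subset)
  have s3 := (s2.mono_set outer_subset).raise (R := τ⁻¹) (δ := δ) zero_notMem_outer hA
    (inv_pos.2 hτ) h0 fun x hx => by
      rw [hκ1 ‖τ • x‖ ⟨by linarith [norm_nonneg (τ • x)], by
        rw [norm_smul, Real.norm_of_nonneg hτ.le, ← le_inv_mul_iff₀ hτ, mul_one]; exact hx.le⟩]
      simp
  rw [zero_add, Real.inv_rpow hτ.le, Real.rpow_neg hτ.le, inv_inv] at s3
  have b2 : FormBound n (fun x => (1 - κ ‖τ • x‖) * oscPotential ν α β k κ x) (K * (A * τ ^ δ)) :=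
    hKb (fun x => 1 - κ ‖τ • x‖) _ δ (measurable_const.sub mκ) (by positivity) hδ s3
  -- Lowered by `2 - δ`, so that the product with `1 + |x|²`, of order `2`, has order exactly `δ`.
  have s4 := (s1.mono_set outer_subset).lower (R := R / τ) (δ := 2 - δ) zero_notMem_outer hB
    (by positivity) (by linarith) fun x hx => by
      rw [hR]
      · simp
      · rw [norm_smul, Real.norm_of_nonneg hτ.le]
        rwa [div_lt_iff₀' hτ] at hx
  have s5 := Symb.mul isOpen_outer zero_notMem_outer hD (by positivity) hDS s4
  have s6 : Symb (outer ν) n δ (2 ^ n * (D * (B * (R / τ) ^ (2 - δ))))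
      (fun x => (((1 + ‖x‖ ^ 2) * κ ‖τ • x‖ : ℝ) : ℂ)) := by
    rw [show (2 : ℝ) + (0 - (2 - δ)) = δ by ring] at s5
    exact s5.congr isOpen_outer fun x _ => (Complex.ofReal_mul _ _).symm
  have b3 : FormBound n (fun x => (1 + ‖x‖ ^ 2) * κ ‖τ • x‖ * oscPotential ν α β k κ x) _ :=
    hKb (fun x => (1 + ‖x‖ ^ 2) * κ ‖τ • x‖) _ δ
      ((by fun_prop : Measurable fun x : X ν => 1 + ‖x‖ ^ 2).mul mκ) (by positivity) hδ s6
  obtain ⟨T₁, hT₁, -⟩ := b1.exists_clm hn (pκ.mul hW) (by positivity)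
  obtain ⟨T₂, hT₂, hT₂'⟩ := b2.exists_clm hn (pκ'.mul hW) (by positivity)
  obtain ⟨T₃, hT₃, hT₃'⟩ := b3.exists_clm hn ((polyGrowth_one_add_normSq.mul pκ).mul hW)
    (by positivity)
  refine ⟨T₁, T₂, T₃, hT₁, hT₂, hT₃, hT₂'.trans ?_, hT₃'.trans ?_⟩
  · rw [add_mul, ← mul_assoc]
    exact le_add_of_nonneg_right (by positivity)
  · rw [add_mul, Real.div_rpow hR0.le hτ.le, show δ - 2 = -(2 - δ) by ring, Real.rpow_neg hτ.le]
    refine le_trans (le_of_eq ?_) (le_add_of_nonneg_left (by positivity))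
    ring

theorem lintegral_rpow_lt_top (C : ℝ) {δ : ℝ} (hδ : 1 < δ) :
    ∫⁻ τ in Ioc (0 : ℝ) 1, ENNReal.ofReal (C * τ ^ (δ - 2)) < ⊤ := by
  have h1 : IntervalIntegrable (fun τ : ℝ => C * τ ^ (δ - 2)) volume 0 1 :=
    (intervalIntegral.intervalIntegrable_rpow' (by linarith)).const_mul C
  rw [intervalIntegrable_iff_integrableOn_Ioc_of_le zero_le_one] at h1
  exact h1.lintegral_lt_top

theorem isC11_of_isMultiplicationBy (hu : BddSmooth u) (hk : k ≠ 0) (hα : 0 < α)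
    (hκ : ContDiff ℝ ∞ κ) (hκc : HasCompactSupport κ) (hκ1 : ∀ t ∈ Icc (-1 : ℝ) 1, κ t = 1)
    (hκ0 : ∀ t, 0 ≤ κ t ∧ κ t ≤ 1) (n : ℕ) (hn : 1 < n * α + β - n)
    {V : Sob ν n →L[ℂ] Sob ν (-n)} (hV : IsMultiplicationBy (oscPotential ν α β k κ) V) :
    IsC11 (conjOp u) V := by
  obtain ⟨φ, z, h⟩ := exists_isWeightedFlow (bddSmooth_freqField hu) (bddSmooth_freqDiv hu)
  obtain ⟨U, hU⟩ := h.exists_isTransportGroup (bddSmooth_freqField hu) (bddSmooth_freqDiv hu)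
    fun x => rfl
  refine ⟨positionGroup U, sobGroup h U n, sobGroup h U (-n),
    isUnitaryGroupOf_positionGroup hu hU h, isInducedOn_sobGroup hU h _,
    isInducedOn_sobGroup hU h _, ?_⟩
  -- Any exponent above `1` makes `τ^{δ-2}` integrable at `0`; it is capped below `2` because the
  -- splitting requires `δ ≤ 2`.
  set δ : ℝ := min (n * α + β - n) (3 / 2) with hδ
  have hδ1 : 1 < δ := lt_min hn (by norm_num)
  have hδ2 : δ ≤ 3 / 2 := min_le_right _ _
  obtain ⟨C, hC, hCb⟩ := exists_second_difference_le hu hU h n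
  obtain ⟨K, hK, hKb⟩ := exists_potential_splitting (ν := ν) (β := β) hk hα hκ hκc hκ1 hκ0 n
    (δ := δ) (by linarith) (by linarith) (min_le_left _ _)
  have hW := polyGrowth_oscPotential (ν := ν) (α := α) (β := β) (k := k) hκ hκ0 hκ1
  refine lt_of_le_of_lt (setLIntegral_mono' measurableSet_Ioc fun τ hτ => ?_)
    (lintegral_rpow_lt_top (C * (K + K)) hδ1)
  obtain ⟨h0, h1⟩ := hτ
  obtain ⟨T₁, T₂, T₃, hT₁, hT₂, hT₃, n2, n3⟩ := hKb τ h0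
  have e : V = T₁ + T₂ := by
    have := hT₁.add hT₂
    refine hV.unique ?_
    convert this using 2 with x
    ring
  have mκ := measurable_cutoff_scaled (ν := ν) hκ τ
  have pκ : PolyGrowth fun x : X ν => κ ‖τ • x‖ := .of_le mκ (C := 1) fun x => by
    rw [abs_of_nonneg (hκ0 _).1]; exact (hκ0 _).2
  have key := hCb _ _ T₁ T₂ T₃ (pκ.mul hW) ((polyGrowth_one_add_normSq.mul pκ).mul hW)
    (fun x => by
      have hx := one_add_normSq_pos x
      rw [bracketR, show (-2 : ℝ) / 2 = -1 by norm_num, Real.rpow_neg_one]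
      field_simp) hT₁ hT₃ τ h0.le h1
  rw [← e] at key
  have e2 : τ ^ (2 : ℕ) * τ ^ (δ - 2) = τ ^ δ := by
    rw [← Real.rpow_natCast, ← Real.rpow_add h0]; congr 1; push_cast; ring
  have key2 : C * (τ ^ 2 * ‖T₃‖ + ‖T₂‖) ≤ C * (K + K) * τ ^ (δ - 2) * τ ^ 2 := by
    calc _ ≤ C * (τ ^ 2 * (K * τ ^ (δ - 2)) + K * τ ^ δ) := by gcongr
      _ = _ := by rw [← e2]; ring
  rw [ENNReal.div_le_iff (by simpa using h0.ne') ENNReal.ofReal_ne_top,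
    ← ENNReal.ofReal_mul (by positivity), ← ofReal_norm]
  exact ENNReal.ofReal_le_ofReal (key.trans key2)

end PotentialRegularity

end

section

/-! ### The condition on the differences of the potential -/

section Differences

variable {ν : ℕ} {α β k : ℝ} {κ : ℝ → ℝ}

/-- Translation of Schwartz functions. -/
def translS (v : X ν) (f : 𝓢(X ν, ℂ)) : 𝓢(X ν, ℂ) := f.compSubConstCLM ℂ v

theorem translS_apply (v : X ν) (f : 𝓢(X ν, ℂ)) (x : X ν) : translS v f x = f (x - v) := rfl

theorem pd_translS (j : Fin ν) (v : X ν) (f : 𝓢(X ν, ℂ)) :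
    pd j (translS v f) = translS v (pd j f) := by
  ext x
  rw [pd_apply, translS_apply, pd_apply]
  have h : (translS v f : X ν → ℂ) = fun x => f (x - v) := rfl
  rw [h, fderiv_comp_sub]

theorem l1Deriv_translS (n : ℕ) (v : X ν) (f : 𝓢(X ν, ℂ)) :
    l1Deriv n (translS v f) = l1Deriv n f := by
  induction n generalizing f with
  | zero => exact integral_sub_right_eq_self (fun x => ‖f x‖) v
  | succ n ih => simp only [l1Deriv, pd_translS, ih]

theorem PolyGrowth.comp_add (v : X ν) {m : X ν → ℝ} (hm : PolyGrowth m) :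
    PolyGrowth fun x => m (x + v) := by
  obtain ⟨h, C, N, hC⟩ := hm
  have hC0 : 0 ≤ C := by simpa using (abs_nonneg _).trans (hC 0)
  refine ⟨h.comp (measurable_add_const v), C * (1 + ‖v‖) ^ N, N, fun x => (hC _).trans ?_⟩
  rw [mul_assoc, ← mul_pow]
  have h1 := norm_add_le x v
  have h2 := mul_nonneg (norm_nonneg x) (norm_nonneg v)
  gcongr
  linarith

/-- The two terms are estimated separately. In the first, translation moves the shift from `W` to
the symbol and to the test function, where it costs only a constant depending on `v`, since
`l1Deriv` is translation invariant. -/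
theorem exists_formBound_difference (hk : k ≠ 0) (hα : 0 < α) (hκ : ContDiff ℝ ∞ κ)
    (hκc : HasCompactSupport κ) (hκ1 : ∀ t ∈ Icc (-1 : ℝ) 1, κ t = 1)
    (hκ0 : ∀ t, 0 ≤ κ t ∧ κ t ≤ 1) (n : ℕ) {δ : ℝ} (h1 : 1 ≤ δ) (hδ : δ ≤ n * α + β - n)
    {ξ : X ν → ℝ} (hξ : ContDiff ℝ ∞ ξ) (hξ0 : ∀ x, ‖x‖ < 1 → ξ x = 0)
    (hξ1 : ∀ x, 2 < ‖x‖ → ξ x = 1) (v : X ν) :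
    ∃ K, 0 ≤ K ∧ ∀ r, 1 ≤ r →
      PolyGrowth (fun x => ξ (r⁻¹ • x) * ‖x‖ *
        (oscPotential ν α β k κ (x + v) - oscPotential ν α β k κ x)) ∧
      FormBound n (fun x => ξ (r⁻¹ • x) * ‖x‖ *
        (oscPotential ν α β k κ (x + v) - oscPotential ν α β k κ x)) (K * r ^ (1 - δ)) := by
  obtain ⟨K, hK, hKb⟩ :=
    exists_integral_oscPotential_le (ν := ν) (β := β) hk hα hκ hκc hκ1 n
  obtain ⟨C, hC, hCb⟩ := exists_l1Deriv_conjS_mul_le (ν := ν) n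
  have hO : IsOpen {x : X ν | x ≠ 0} := isOpen_ne
  have h0 : (0 : X ν) ∉ {x : X ν | x ≠ 0} := fun h => h rfl
  obtain ⟨A, hA, hAS⟩ := Symb.exists_of_eventually_const (G := fun x : X ν => ((ξ x : ℝ) : ℂ))
    (C := 1) (R := 2) (Complex.ofRealCLM.contDiff.comp hξ) one_pos
    (fun x hx => by rw [hξ0 x hx, Complex.ofReal_zero])
    (fun x hx => by rw [hξ1 x hx, Complex.ofReal_one]) n
  obtain ⟨B, hB, hBS⟩ := Symb.exists_rpow_norm hO h0 n 1
  have hW := polyGrowth_oscPotential (ν := ν) (α := α) (β := β) (k := k) hκ hκ0 hκ1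
  set D : ℝ := 2 ^ n * (A * B) with hD
  have hD0 : 0 ≤ D := by positivity
  set E : ℝ := (2 + 2 * ‖v‖) ^ (|δ| + n) with hE
  have hE0 : 0 ≤ E := by positivity
  refine ⟨K * D * (E + 1) * C, by positivity, fun r hr => ?_⟩
  have hr0 : 0 < r := by linarith
  set g : X ν → ℝ := fun x => ξ (r⁻¹ • x) * ‖x‖ with hg
  have hgm : Measurable g :=
    (hξ.continuous.measurable.comp (measurable_const_smul r⁻¹)).mul measurable_norm
  have hgr : ∀ x : X ν, ‖x‖ < r → g x = 0 := fun x hx => by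
    simp only [hg]
    rw [hξ0, zero_mul]
    rwa [norm_smul, norm_inv, Real.norm_of_nonneg hr0.le, inv_mul_lt_iff₀ hr0, mul_one]
  have hgz : ∀ x : X ν, ‖x‖ < r → ((g x : ℝ) : ℂ) = 0 := fun x hx => by
    rw [hgr x hx, Complex.ofReal_zero]
  have s1 := hAS.scale (inv_pos.2 hr0)
  rw [Real.rpow_zero, mul_one] at s1
  have s2 : Symb {x : X ν | x ≠ 0} n 1 D (fun x => ((g x : ℝ) : ℂ)) := by
    have := Symb.mul hO h0 hA hB s1 hBS
    rw [zero_add] at this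
    refine this.congr hO fun x _ => ?_
    simp only [hg, Real.rpow_one]
    push_cast
    rfl
  -- The order goes from `1` to `δ`; vanishing for `|x| < r` yields the factor `r^{1-δ}`.
  have s3 := s2.raise (δ := δ - 1) h0 hD0 hr0 (by linarith) hgz
  rw [add_sub_cancel, neg_sub] at s3
  have s4 := s3.translate (by positivity) v (M := |δ| + n) le_rfl
    fun x hx => hgz x (hx.trans_le hr)
  have pg : PolyGrowth g := by
    refine ⟨hgm, D * r ^ (1 - δ), ⌈|δ|⌉₊, fun x => ?_⟩
    have := (s3.mono_set outer_subset).poly_bound (by positivity)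
      (fun x hx => hgz x (hx.trans_le hr)) x
    rwa [Complex.norm_real] at this
  refine ⟨?_, fun φ ψ => ?_⟩
  · have p1 := pg.mul (hW.comp_add v)
    have p2 := pg.mul hW
    obtain ⟨q1, C1, N1, b1⟩ := p1
    obtain ⟨q2, C2, N2, b2⟩ := p2
    refine ⟨?_, C1 + C2, N1 + N2, fun x => ?_⟩
    · exact hgm.mul ((hW.comp_add v).1.sub hW.1)
    · have e : ξ (r⁻¹ • x) * ‖x‖ * (oscPotential ν α β k κ (x + v) - oscPotential ν α β k κ x) =
        g x * oscPotential ν α β k κ (x + v) - g x * oscPotential ν α β k κ x := by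
        simp only [hg]; ring
      beta_reduce
      rw [e]
      have c1 : 0 ≤ C1 := by simpa using (abs_nonneg _).trans (b1 0)
      have c2 : 0 ≤ C2 := by simpa using (abs_nonneg _).trans (b2 0)
      have o : 1 ≤ 1 + ‖x‖ := by linarith [norm_nonneg x]
      refine (norm_sub_le (g x * _) _).trans ((add_le_add (b1 x) (b2 x)).trans ?_)
      rw [add_mul]
      gcongr <;> omega
  · set f := mulS (conjS φ) ψ with hf
    have i1 := (pg.mul (hW.comp_add v)).integrable (conjS φ) ψ
    have i2 := (pg.mul hW).integrable (conjS φ) ψ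
    have e : ∫ x, ((ξ (r⁻¹ • x) * ‖x‖ * (oscPotential ν α β k κ (x + v) -
        oscPotential ν α β k κ x) : ℝ) : ℂ) * conjS φ x * ψ x =
        (∫ x, ((g x * oscPotential ν α β k κ (x + v) : ℝ) : ℂ) * conjS φ x * ψ x) -
        ∫ x, ((g x * oscPotential ν α β k κ x : ℝ) : ℂ) * conjS φ x * ψ x := by
      rw [← integral_sub i1 i2]
      refine integral_congr_ae (Eventually.of_forall fun x => ?_)
      simp only [hg]
      push_cast
      ring
    have e1 : ∫ x, ((g x * oscPotential ν α β k κ (x + v) : ℝ) : ℂ) * conjS φ x * ψ x =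
        ∫ y, ((g (y - v) : ℝ) : ℂ) * (oscPotential ν α β k κ y : ℂ) * translS v f y := by
      rw [← integral_add_right_eq_self
        (fun y => ((g (y - v) : ℝ) : ℂ) * (oscPotential ν α β k κ y : ℂ) * translS v f y) v]
      refine integral_congr_ae (Eventually.of_forall fun x => ?_)
      simp only [add_sub_cancel_right, translS_apply, hf, mulS_apply]
      push_cast
      ring
    have e2 : ∫ x, ((g x * oscPotential ν α β k κ x : ℝ) : ℂ) * conjS φ x * ψ x =
        ∫ y, ((g y : ℝ) : ℂ) * (oscPotential ν α β k κ y : ℂ) * f y := by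
      refine integral_congr_ae (Eventually.of_forall fun x => ?_)
      simp only [hf, mulS_apply]
      push_cast
      ring
    have b1 := hKb _ _ δ (Complex.measurable_ofReal.comp (hgm.comp (measurable_sub_const v)))
      (by positivity) hδ s4 (translS v f)
    have b2 := hKb _ _ δ (Complex.measurable_ofReal.comp hgm) (by positivity) hδ
      (s3.mono_set outer_subset) f
    rw [l1Deriv_translS] at b1
    rw [e, e1, e2]
    calc _ ≤ K * (D * r ^ (1 - δ) * E) * l1Deriv n f + K * (D * r ^ (1 - δ)) * l1Deriv n f :=
          (norm_sub_le _ _).trans (add_le_add b1 b2)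
      _ = K * D * (E + 1) * r ^ (1 - δ) * l1Deriv n f := by ring
      _ ≤ K * D * (E + 1) * r ^ (1 - δ) * (C * sobNorm n φ * sobNorm n ψ) := by
          gcongr; exact hCb φ ψ
      _ = _ := by ring

theorem differenceCondition_oscPotential (hk : k ≠ 0) (hα : 0 < α) (hκ : ContDiff ℝ ∞ κ)
    (hκc : HasCompactSupport κ) (hκ1 : ∀ t ∈ Icc (-1 : ℝ) 1, κ t = 1)
    (hκ0 : ∀ t, 0 ≤ κ t ∧ κ t ≤ 1) (n : ℕ) (hn : 1 < n * α + β - n) (a : ℝ) :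
    DifferenceCondition n (oscPotential ν α β k κ) a := by
  intro j ξ hξ hξ0 hξ1
  obtain ⟨K, hK, h⟩ := exists_formBound_difference (ν := ν) hk hα hκ hκc hκ1 hκ0 n hn.le le_rfl hξ
    hξ0 hξ1 (a • EuclideanSpace.single j 1)
  have hn0 : (0 : ℝ) ≤ n := n.cast_nonneg
  set δ : ℝ := n * α + β - n with hδ
  -- For `r < 1` the operator is irrelevant and is set to `0`, so that a choice can be made for
  -- every real `r`.
  have key : ∀ r : ℝ, ∃ V : Sob ν n →L[ℂ] Sob ν (-n), 1 ≤ r → IsMultiplicationBy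
      (fun x => ξ (r⁻¹ • x) * ‖x‖ * (oscPotential ν α β k κ (x + a • EuclideanSpace.single j 1) -
        oscPotential ν α β k κ x)) V ∧ ‖V‖ ≤ K * r ^ (1 - δ) := fun r => by
    by_cases hr : 1 ≤ r
    · obtain ⟨V, hV, hV'⟩ := (h r hr).2.exists_clm hn0 (h r hr).1 (by positivity)
      exact ⟨V, fun _ => ⟨hV, hV'⟩⟩
    · exact ⟨0, fun h => absurd h hr⟩
  choose B hB using key
  refine ⟨B, fun r hr => (hB r hr).1, ?_⟩
  -- The norm `r^{1-δ}` against `dr/r` is `r^{-δ}`, integrable at infinity as `δ > 1`.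
  have hint : IntegrableOn (fun r : ℝ => K * r ^ (-δ)) (Ici 1) := by
    rw [integrableOn_Ici_iff_integrableOn_Ioi]
    exact (integrableOn_Ioi_rpow_of_lt (by linarith) one_pos).const_mul K
  refine lt_of_le_of_lt (setLIntegral_mono' measurableSet_Ici fun r hr => ?_) hint.lintegral_lt_top
  have hr0 : 0 < r := lt_of_lt_of_le one_pos hr
  rw [ENNReal.div_le_iff (by simpa using hr0) ENNReal.ofReal_ne_top,
    ← ENNReal.ofReal_mul (by positivity), ← ofReal_norm]
  refine ENNReal.ofReal_le_ofReal ((hB r hr).2.trans (le_of_eq ?_))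
  rw [sub_eq_add_neg, Real.rpow_add hr0, Real.rpow_one]
  ring

end Differences

end

section

open FourierTransform
open scoped BoundedContinuousFunction

/-! ### Compactness -/

section Kernels

variable {H : Type*} [NormedAddCommGroup H] [NormedSpace ℂ H] {Y : Type*} [MeasurableSpace Y]
  {μ : Measure Y}

/-- The operator `f ↦ (x ↦ k(x) f)` with a square integrable kernel `k`. -/
def kernelOp (k : Lp (H →L[ℂ] ℂ) 2 μ) : H →L[ℂ] Lp ℂ 2 μ :=
  ((ContinuousLinearMap.id ℂ (H →L[ℂ] ℂ)).flip.compLpL₂ 2 μ).flip k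

theorem coeFn_kernelOp (k : Lp (H →L[ℂ] ℂ) 2 μ) (f : H) : kernelOp k f =ᵐ[μ] fun x => k x f :=
  ((ContinuousLinearMap.id ℂ (H →L[ℂ] ℂ)).flip f).coeFn_compLp' k

/-- Indicator kernels give operators of rank at most one, simple functions are dense in `L²`, the
operator depends continuously on its kernel, and compact operators are closed in norm. -/
theorem isCompactOperator_kernelOp (k : Lp (H →L[ℂ] ℂ) 2 μ) : IsCompactOperator (kernelOp k) := by
  refine Lp.induction (by simp) (motive := fun k => IsCompactOperator (kernelOp k)) ?_ ?_ ?_ k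
  · intro c s hs hμ
    have e : kernelOp (Lp.simpleFunc.indicatorConst 2 hs hμ.ne c : Lp (H →L[ℂ] ℂ) 2 μ) =
        (ContinuousLinearMap.toSpanSingleton ℂ (indicatorConstLp 2 hs hμ.ne (1 : ℂ))).comp c := by
      ext1 f
      refine Lp.ext ?_
      rw [Lp.simpleFunc.coe_indicatorConst]
      filter_upwards [coeFn_kernelOp (indicatorConstLp 2 hs hμ.ne c) f,
        indicatorConstLp_coeFn (p := 2) (hs := hs) (hμs := hμ.ne) (c := c),
        indicatorConstLp_coeFn (p := 2) (hs := hs) (hμs := hμ.ne) (c := (1 : ℂ)),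
        Lp.coeFn_smul (c f) (indicatorConstLp 2 hs hμ.ne (1 : ℂ))] with x h1 h2 h3 h4
      rw [h1, h2, ContinuousLinearMap.comp_apply, ContinuousLinearMap.toSpanSingleton_apply, h4,
        Pi.smul_apply, h3]
      by_cases hx : x ∈ s <;> simp [hx]
    rw [e]
    exact (isCompactOperator_of_locallyCompactSpace_rng
      (ContinuousLinearMap.toSpanSingleton ℂ (indicatorConstLp 2 hs hμ.ne (1 : ℂ)))).comp_clm c
  · intro f g hf hg _ h1 h2
    have e : kernelOp (hf.toLp f + hg.toLp g) = kernelOp (hf.toLp f) + kernelOp (hg.toLp g) :=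
      map_add _ _ _
    rw [e]
    exact h1.add h2
  · exact isClosed_setOfPred_isCompactOperator.preimage
      (((ContinuousLinearMap.id ℂ (H →L[ℂ] ℂ)).flip.compLpL₂ 2 μ).flip).continuous

end Kernels

/-! ### Compactness of `a(q) b(p)` -/

section FourierKernels

variable {ν : ℕ} {s : ℝ}

/-- The operator `a(q) b(p)`. -/
def mulFourierMul (a b : X ν →ᵇ ℂ) : L2 ν →L[ℂ] L2 ν :=
  mulL2 a ∘L (fourierL2 ν).symm.toContinuousLinearEquiv.toContinuousLinearMap ∘L mulL2 b

theorem mulFourierMul_apply (a b : X ν →ᵇ ℂ) (f : L2 ν) :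
    mulFourierMul a b f = mulL2 a ((fourierL2 ν).symm (mulL2 b f)) := rfl

/-- The function `ξ ↦ e^{-2πi x·ξ} conj (b ξ)`. -/
def fourierKernel (b : 𝓢(X ν, ℂ)) (x ξ : X ν) : ℂ :=
  Complex.exp (Complex.I * ((-(2 * Real.pi * inner ℝ ξ x) : ℝ) : ℂ)) * starRingEnd ℂ (b ξ)

theorem memLp_fourierKernel (b : 𝓢(X ν, ℂ)) (x : X ν) : MemLp (fourierKernel b x) 2 volume := by
  refine (b.memLp 2 volume).of_le ?_ (Eventually.of_forall fun ξ => ?_)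
  · refine Continuous.aestronglyMeasurable ?_
    unfold fourierKernel
    have := b.continuous
    fun_prop
  · rw [fourierKernel, norm_mul, mul_comm Complex.I, Complex.norm_exp_ofReal_mul_I, one_mul,
      RCLike.norm_conj]

theorem norm_exp_sub_exp_le (a b : ℝ) :
    ‖Complex.exp (Complex.I * a) - Complex.exp (Complex.I * b)‖ ≤ |a - b| := by
  have e : Complex.exp (Complex.I * a) - Complex.exp (Complex.I * b) =
      Complex.exp (Complex.I * b) * (Complex.exp (Complex.I * ((a - b : ℝ) : ℂ)) - 1) := by
    rw [mul_sub, ← Complex.exp_add, mul_one]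
    congr 2
    push_cast
    ring
  rw [e, norm_mul, mul_comm Complex.I (b : ℂ), Complex.norm_exp_ofReal_mul_I, one_mul]
  exact Real.norm_exp_I_mul_ofReal_sub_one_le

/-- The characters at `x` and `y` differ by at most `2π|ξ||x - y|`, and `|ξ| b` is still square
integrable. -/
theorem continuous_fourierKernel (b : 𝓢(X ν, ℂ)) :
    Continuous fun x => (memLp_fourierKernel b x).toLp (fourierKernel b x) := by
  set B : L2 ν := (SchwartzMap.smulLeftCLM ℂ (bracket 1) b).toLp 2 with hB
  have h : LipschitzWith (2 * Real.pi * ‖B‖).toNNReal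
      fun x => (memLp_fourierKernel b x).toLp (fourierKernel b x) := by
    refine LipschitzWith.of_dist_le_mul fun x y => ?_
    rw [Real.coe_toNNReal _ (by positivity), dist_eq_norm, dist_eq_norm, mul_right_comm]
    rw [← MemLp.toLp_sub]
    refine Lp.norm_le_mul_norm_of_ae_le_mul ?_
    filter_upwards [((memLp_fourierKernel b x).sub (memLp_fourierKernel b y)).coeFn_toLp,
      (SchwartzMap.smulLeftCLM ℂ (bracket 1) b).coeFn_toLp 2 volume] with ξ h1 h2
    rw [h1, hB, h2, SchwartzMap.smulLeftCLM_apply_apply (hasTemperateGrowth_bracket 1), Pi.sub_apply,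
      fourierKernel, fourierKernel, ← sub_mul, norm_mul, RCLike.norm_conj, norm_smul, ← mul_assoc]
    refine mul_le_mul_of_nonneg_right ((norm_exp_sub_exp_le _ _).trans ?_) (norm_nonneg _)
    have h3 : ‖ξ‖ ≤ ‖bracket 1 ξ‖ := by
      rw [norm_bracket, ← Real.sqrt_eq_rpow]
      exact Real.le_sqrt_of_sq_le (by linarith)
    have h4 : |inner ℝ ξ (x - y)| ≤ ‖ξ‖ * ‖x - y‖ := abs_real_inner_le_norm _ _
    rw [show -(2 * Real.pi * inner ℝ ξ x) - -(2 * Real.pi * inner ℝ ξ y) =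
      -(2 * Real.pi * inner ℝ ξ (x - y)) by rw [inner_sub_right]; ring, abs_neg, abs_mul,
      abs_of_pos (by positivity : (0 : ℝ) < 2 * Real.pi), mul_assoc (2 * Real.pi) ‖x - y‖]
    refine mul_le_mul_of_nonneg_left (h4.trans ?_) Real.two_pi_pos.le
    rw [mul_comm]
    exact mul_le_mul_of_nonneg_left h3 (norm_nonneg _)
  exact h.continuous

/-- The inverse Fourier integral read as a scalar product. The scalar product is antilinear in its
first variable, hence the conjugates in `fourierKernel`. -/
theorem symm_fourierL2_mulL2_schwartz {b : X ν →ᵇ ℂ} (c : 𝓢(X ν, ℂ)) (hcb : ∀ ξ, c ξ = b ξ)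
    (f : 𝓢(X ν, ℂ)) : ∀ᵐ x, (fourierL2 ν).symm (mulL2 b (f.toLp 2)) x =
      inner ℂ ((memLp_fourierKernel c x).toLp (fourierKernel c x)) (f.toLp 2 volume) := by
  have hbt : Function.HasTemperateGrowth b := by
    have : (b : X ν → ℂ) = c := funext fun ξ => (hcb ξ).symm
    rw [this]
    exact c.hasTemperateGrowth
  obtain ⟨F, hF⟩ : ∃ F, F = 𝓕⁻ (SchwartzMap.smulLeftCLM ℂ b f) := ⟨_, rfl⟩
  have e : (fourierL2 ν).symm (mulL2 b (f.toLp 2)) = F.toLp 2 := by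
    rw [mulL2_schwartz b hbt, LinearIsometryEquiv.symm_apply_eq, fourierL2_schwartz, hF,
      FourierTransform.fourier_fourierInv_eq]
  rw [e]
  filter_upwards [F.coeFn_toLp 2 volume] with x h2
  rw [h2, hF, SchwartzMap.fourierInv_coe, Real.fourierInv_eq', L2.inner_def]
  refine integral_congr_ae ?_
  filter_upwards [(memLp_fourierKernel c x).coeFn_toLp, f.coeFn_toLp 2 volume] with ξ g1 g2
  rw [g1, g2, RCLike.inner_apply, fourierKernel, map_mul, Complex.conj_conj, ← Complex.exp_conj,
    map_mul, Complex.conj_I, Complex.conj_ofReal, SchwartzMap.smulLeftCLM_apply_apply hbt, hcb,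
    smul_eq_mul, smul_eq_mul]
  rw [show -Complex.I * ((-(2 * Real.pi * inner ℝ ξ x) : ℝ) : ℂ) =
    ((2 * Real.pi * inner ℝ ξ x : ℝ) : ℂ) * Complex.I by push_cast; ring]
  ring

theorem mulFourierMul_eq_kernelOp {a b : X ν →ᵇ ℂ} (c : 𝓢(X ν, ℂ)) (hcb : ∀ ξ, c ξ = b ξ)
    {K : X ν → (L2 ν →L[ℂ] ℂ)}
    (hK : ∀ x, K x = a x • innerSL ℂ ((memLp_fourierKernel c x).toLp (fourierKernel c x)))
    (hKL : MemLp K 2 (volume : Measure (X ν))) : mulFourierMul a b = kernelOp (hKL.toLp K) := by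
  ext1 f
  refine denseRange_toLp_schwartz.induction_on
    (p := fun f => mulFourierMul a b f = kernelOp (hKL.toLp K) f) f
    (isClosed_eq (mulFourierMul a b).continuous (kernelOp _).continuous) fun f => ?_
  rw [mulFourierMul_apply]
  refine Lp.ext ?_
  filter_upwards [coeFn_mulL2 a ((fourierL2 ν).symm (mulL2 b (f.toLp 2))),
    symm_fourierL2_mulL2_schwartz c hcb f,
    coeFn_kernelOp (hKL.toLp K) (f.toLp 2 volume), hKL.coeFn_toLp] with x h1 h2 h3 h4
  rw [h1, h2, h3, h4, hK, smul_apply, innerSL_apply_apply, smul_eq_mul]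

/-- The vector-valued kernel `x ↦ a(x)⟨k_x, ·⟩` is continuous with compact support, hence square
integrable. -/
theorem isCompactOperator_mulFourierMul_of_hasCompactSupport {a b : X ν →ᵇ ℂ}
    (ha : HasCompactSupport a) (hb : ContDiff ℝ ∞ b) (hbc : HasCompactSupport b) :
    IsCompactOperator (mulFourierMul a b) := by
  obtain ⟨c, hcb⟩ : ∃ c : 𝓢(X ν, ℂ), ∀ ξ, c ξ = b ξ := ⟨hbc.toSchwartzMap hb, fun ξ => rfl⟩
  obtain ⟨K, hK⟩ : ∃ K : X ν → (L2 ν →L[ℂ] ℂ), ∀ x, K x = a x •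
      innerSL ℂ ((memLp_fourierKernel c x).toLp (fourierKernel c x)) := ⟨_, fun _ => rfl⟩
  have hKc : Continuous K := by
    rw [funext hK]
    exact a.continuous.smul ((innerSL ℂ).continuous.comp (continuous_fourierKernel c))
  have hKs : HasCompactSupport K := by
    refine ha.mono fun x hx => ?_
    rw [Function.mem_support, hK] at hx
    exact fun h => hx (ContinuousLinearMap.ext fun y => by
      rw [h, smul_apply, smul_eq_mul, zero_mul]; rfl)
  have hKL : MemLp K 2 (volume : Measure (X ν)) := hKc.memLp_of_hasCompactSupport hKs
  rw [mulFourierMul_eq_kernelOp c hcb hK hKL]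
  exact isCompactOperator_kernelOp _

/-- A smooth cutoff at scale `i + 1`. -/
def cutoffBCF (ν : ℕ) (i : ℕ) : X ν →ᵇ ℂ :=
  BoundedContinuousFunction.ofNormedAddCommGroup
    (fun x => (((⟨1, 2, one_pos, one_lt_two⟩ : ContDiffBump (0 : X ν)) ((i + 1 : ℝ)⁻¹ • x) : ℝ) : ℂ))
    (Complex.continuous_ofReal.comp ((ContDiffBump.continuous _).comp (by fun_prop))) 1 fun x => by
      rw [Complex.norm_real, Real.norm_of_nonneg (ContDiffBump.nonneg _)]
      exact ContDiffBump.le_one _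

theorem cutoffBCF_apply (i : ℕ) (x : X ν) : cutoffBCF ν i x =
    (((⟨1, 2, one_pos, one_lt_two⟩ : ContDiffBump (0 : X ν)) ((i + 1 : ℝ)⁻¹ • x) : ℝ) : ℂ) := rfl

theorem contDiff_cutoffBCF (i : ℕ) : ContDiff ℝ ∞ (cutoffBCF ν i) :=
  Complex.ofRealCLM.contDiff.comp ((ContDiffBump.contDiff _).comp (contDiff_const_smul _))

theorem hasCompactSupport_cutoffBCF (i : ℕ) : HasCompactSupport (cutoffBCF ν i) := by
  have h : HasCompactSupport fun x : X ν =>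
      (⟨1, 2, one_pos, one_lt_two⟩ : ContDiffBump (0 : X ν)) ((i + 1 : ℝ)⁻¹ • x) :=
    (ContDiffBump.hasCompactSupport _).comp_smul (by positivity)
  exact h.comp_left (g := fun t : ℝ => (t : ℂ)) Complex.ofReal_zero

theorem tendsto_cutoffBCF_mul {a : X ν →ᵇ ℂ} (ha : Tendsto a (cocompact (X ν)) (𝓝 0)) :
    Tendsto (fun i => cutoffBCF ν i * a) atTop (𝓝 a) := by
  rw [Metric.tendsto_atTop]
  intro ε hε
  have h1 : ∀ᶠ x in cocompact (X ν), ‖a x‖ < ε / 2 := by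
    have := ha.norm
    rw [norm_zero] at this
    exact this.eventually_lt_const (by positivity)
  obtain ⟨R, hR'⟩ := Metric.closedBall_compl_subset_of_mem_cocompact h1 (0 : X ν)
  have hR : ∀ x ∉ Metric.closedBall (0 : X ν) R, ‖a x‖ < ε / 2 := fun x hx => hR' hx
  obtain ⟨N, hN⟩ := exists_nat_gt R
  refine ⟨N, fun i hi => lt_of_le_of_lt ?_ (half_lt_self hε)⟩
  rw [dist_eq_norm]
  refine (BoundedContinuousFunction.norm_le (by positivity)).2 fun x => ?_
  rw [BoundedContinuousFunction.sub_apply, BoundedContinuousFunction.mul_apply, cutoffBCF_apply]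
  by_cases hx : x ∈ Metric.closedBall (0 : X ν) R
  · have hx' : ‖x‖ ≤ R := by simpa using hx
    have hiR : R ≤ (i : ℝ) + 1 := by
      have : (N : ℝ) ≤ i := Nat.cast_le.2 hi
      linarith
    rw [ContDiffBump.one_of_mem_closedBall]
    · simpa using (half_pos hε).le
    · rw [mem_closedBall_zero_iff, norm_smul, norm_inv, Real.norm_of_nonneg (by positivity),
        inv_mul_le_iff₀ (by positivity), mul_one]
      exact hx'.trans hiR
  · have h2 := (hR x hx).le
    set t := (⟨1, 2, one_pos, one_lt_two⟩ : ContDiffBump (0 : X ν)) ((i + 1 : ℝ)⁻¹ • x)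
    have ht0 : 0 ≤ t := ContDiffBump.nonneg _
    have ht1 : t ≤ 1 := ContDiffBump.le_one _
    rw [← sub_one_mul, norm_mul, ← Complex.ofReal_one, ← Complex.ofReal_sub, Complex.norm_real]
    have h3 : ‖t - 1‖ ≤ 1 := abs_le.2 ⟨by linarith, by linarith⟩
    exact (mul_le_of_le_one_left (norm_nonneg _) h3).trans h2

theorem tendsto_mulL2 {ι : Type*} {l : Filter ι} {a : ι → X ν →ᵇ ℂ} {b : X ν →ᵇ ℂ}
    (h : Tendsto a l (𝓝 b)) : Tendsto (fun i => mulL2 (a i)) l (𝓝 (mulL2 b)) := by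
  rw [tendsto_iff_norm_sub_tendsto_zero] at h ⊢
  refine squeeze_zero (fun _ => norm_nonneg _) (fun i => ?_) h
  have e : mulL2 (a i) - mulL2 b = mulL2 (a i - b) := by
    ext1 f
    refine Lp.ext ?_
    filter_upwards [coeFn_mulL2 (a i) f, coeFn_mulL2 b f, coeFn_mulL2 (a i - b) f,
      Lp.coeFn_sub (mulL2 (a i) f) (mulL2 b f)] with x h1 h2 h3 h4
    rw [sub_apply, h4, Pi.sub_apply, h1, h2, h3, BoundedContinuousFunction.sub_apply, sub_mul]
  rw [e]
  exact norm_mulL2_le _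

/-- Truncation converges uniformly for functions vanishing at infinity, hence in operator norm, and
compactness passes to the limit. -/
theorem isCompactOperator_mulFourierMul {a b : X ν →ᵇ ℂ} (ha : Tendsto a (cocompact (X ν)) (𝓝 0))
    (hb : ContDiff ℝ ∞ b) (hb0 : Tendsto b (cocompact (X ν)) (𝓝 0)) :
    IsCompactOperator (mulFourierMul a b) := by
  have ta := tendsto_mulL2 (tendsto_cutoffBCF_mul ha)
  have tb := tendsto_mulL2 (tendsto_cutoffBCF_mul hb0)
  have t : Tendsto (fun i => mulFourierMul (cutoffBCF ν i * a) (cutoffBCF ν i * b)) atTop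
      (𝓝 (mulFourierMul a b)) := by
    have hc : Continuous fun p : (L2 ν →L[ℂ] L2 ν) × (L2 ν →L[ℂ] L2 ν) =>
        p.1 ∘L (fourierL2 ν).symm.toContinuousLinearEquiv.toContinuousLinearMap ∘L p.2 := by
      fun_prop
    exact (hc.tendsto _).comp (ta.prodMk_nhds tb)
  refine isCompactOperator_of_tendsto t (Eventually.of_forall fun i => ?_)
  refine isCompactOperator_mulFourierMul_of_hasCompactSupport
    (hasCompactSupport_cutoffBCF i).mul_right ((contDiff_cutoffBCF i).mul hb)
    (hasCompactSupport_cutoffBCF i).mul_right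

theorem tendsto_bracketBCF (hs : s < 0) :
    Tendsto (bracketBCF hs.le : X ν → ℂ) (cocompact (X ν)) (𝓝 0) := by
  rw [tendsto_zero_iff_norm_tendsto_zero, coe_bracketBCF]
  simp_rw [norm_bracket]
  have h1 : Tendsto (fun t : ℝ => t ^ (s / 2)) atTop (𝓝 0) := by
    have := tendsto_rpow_neg_atTop (y := -(s / 2)) (by linarith)
    rwa [neg_neg] at this
  refine h1.comp (tendsto_atTop_add_const_left _ _ ?_)
  exact (tendsto_pow_atTop two_ne_zero).comp (tendsto_norm_cocompact_atTop)

/-- Multiplication by `a`, from `H^s` to `L²`, for `s ≥ 0`. -/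
def sobMul (hs : 0 ≤ s) (a : X ν →ᵇ ℂ) : Sob ν s →L[ℂ] L2 ν :=
  mulFourierMul a (bracketBCF (neg_nonpos.2 hs)) ∘L
    (mom ν s).toContinuousLinearEquiv.toContinuousLinearMap

theorem sobMul_ofSchwartz (hs : 0 ≤ s) (a : X ν →ᵇ ℂ) (φ : 𝓢(X ν, ℂ)) :
    sobMul hs a (Sob.ofSchwartz s φ) = mulL2 a (φ.toLp 2) := by
  change mulFourierMul a _ (mom ν s (Sob.ofSchwartz s φ)) = _
  rw [mulFourierMul_apply]
  congr 1
  rw [LinearIsometryEquiv.symm_apply_eq]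
  refine (toDist_eq_iff_of_nonneg hs _ _).1 ?_
  rw [Lp.toTemperedDistribution_toLp_eq]
  rfl

theorem isCompactOperator_sobMul (hs : 0 < s) {a : X ν →ᵇ ℂ}
    (ha : Tendsto a (cocompact (X ν)) (𝓝 0)) : IsCompactOperator (sobMul hs.le a) := by
  refine (isCompactOperator_mulFourierMul ha ?_ (tendsto_bracketBCF (by linarith))).comp_clm
    (mom ν s).toContinuousLinearEquiv.toContinuousLinearMap
  rw [coe_bracketBCF]
  exact (bddSmooth_bracket (by linarith)).smooth

theorem mulL2_schwartz_eq_toL2 {m : X ν → ℝ} (hm : PolyGrowth m) {a : X ν →ᵇ ℂ}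
    (h : ∀ x, a x = m x) (φ : 𝓢(X ν, ℂ)) : mulL2 a (φ.toLp 2) = hm.toL2 φ := by
  refine Lp.ext ?_
  filter_upwards [coeFn_mulL2 a (φ.toLp 2), φ.coeFn_toLp 2 volume, hm.coeFn_toL2 φ] with x h1 h2 h3
  rw [h1, h2, h3, h]

end FourierKernels

end

section

open scoped BoundedContinuousFunction ZeroAtInfty

/-! ### Compactness of the potential, and assembly of all the hypotheses -/

section Compactness

variable {ν : ℕ} {α β k : ℝ} {κ : ℝ → ℝ} {m : X ν → ℝ} {s t : ℝ}

theorem exists_embed (ht : t ≤ 0) :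
    ∃ J : L2 ν →L[ℂ] Sob ν t, ∀ f, (J f).toDist = (f : 𝓢'(X ν, ℂ)) := by
  obtain ⟨r, rfl⟩ : ∃ r, t = -r := ⟨-t, (neg_neg t).symm⟩
  exact ⟨embed (by linarith), toDist_embed _⟩

/-- The multiplication is `m(q)⟨p⟩^{-s}` after the isometry of `H^s` with `L²`, followed by the
embedding of `L²` in `H^t`; for `s > 0` both functions vanish at infinity. -/
theorem exists_isCompactOperator_isMultiplicationBy (hs : 0 < s) (ht : t ≤ 0) (hm : Continuous m)
    (h0 : Tendsto m (cocompact (X ν)) (𝓝 0)) :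
    ∃ V : Sob ν s →L[ℂ] Sob ν t, IsMultiplicationBy m V ∧ IsCompactOperator V := by
  have h0' : Tendsto (fun x => (m x : ℂ)) (cocompact (X ν)) (𝓝 0) := by
    have := (Complex.continuous_ofReal.tendsto 0).comp h0
    rwa [Complex.ofReal_zero] at this
  obtain ⟨a, ha⟩ : ∃ a : X ν →ᵇ ℂ, ∀ x, a x = m x :=
    ⟨ZeroAtInftyContinuousMap.toBCF
      ⟨⟨fun x => (m x : ℂ), Complex.continuous_ofReal.comp hm⟩, h0'⟩, fun _ => rfl⟩
  have hp : PolyGrowth m := .of_le hm.measurable (C := ‖a‖) fun x => by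
    have := a.norm_coe_le_norm x
    rwa [ha, Complex.norm_real] at this
  obtain ⟨J, hJ⟩ := exists_embed (ν := ν) ht
  refine ⟨J ∘L sobMul hs.le a, isMultiplicationBy_of_toDist hp fun φ => ?_,
    (isCompactOperator_sobMul hs (by rwa [← funext ha] at h0')).clm_comp J⟩
  rw [ContinuousLinearMap.comp_apply, hJ, sobMul_ofSchwartz, mulL2_schwartz_eq_toL2 hp ha]

theorem continuous_oscPotential (hκ : ContDiff ℝ ∞ κ) (hκ1 : ∀ t ∈ Icc (-1 : ℝ) 1, κ t = 1) :
    Continuous (oscPotential ν α β k κ) := by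
  have := hκ.continuous
  refine continuous_iff_continuousAt.2 fun x => ?_
  rcases eq_or_ne x 0 with rfl | hx
  · refine (continuousAt_const (y := (0 : ℝ))).congr ?_
    filter_upwards [Metric.ball_mem_nhds (0 : X ν) one_pos] with y hy
    rw [mem_ball_zero_iff] at hy
    rw [oscPotential, hκ1 _ ⟨by linarith [norm_nonneg y], hy.le⟩, sub_self, zero_mul]
  · have hx' : ‖x‖ ≠ 0 := norm_ne_zero_iff.2 hx
    unfold oscPotential
    refine ContinuousAt.mul (by fun_prop) (ContinuousAt.div ?_ ?_ ?_)
    · exact Real.continuous_sin.continuousAt.comp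
        (continuousAt_const.mul (continuous_norm.continuousAt.rpow_const (Or.inl hx')))
    · exact continuous_norm.continuousAt.rpow_const (Or.inl hx')
    · exact (Real.rpow_pos_of_pos (norm_pos_iff.2 hx) β).ne'

theorem tendsto_oscPotential (hβ : 0 < β) (hκ1 : ∀ t ∈ Icc (-1 : ℝ) 1, κ t = 1)
    (hκ0 : ∀ t, 0 ≤ κ t ∧ κ t ≤ 1) :
    Tendsto (oscPotential ν α β k κ) (cocompact (X ν)) (𝓝 0) :=
  squeeze_zero_norm (fun x => (abs_oscPotential_le hκ0 hκ1 x).1)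
    ((tendsto_rpow_neg_atTop hβ).comp tendsto_norm_cocompact_atTop)

theorem tendsto_cutoff_mul_oscPotential (hκc : HasCompactSupport κ) {τ : ℝ} (hτ : 0 < τ) :
    Tendsto (fun x => κ ‖τ • x‖ * oscPotential ν α β k κ x) (cocompact (X ν)) (𝓝 0) := by
  obtain ⟨R, -, hR⟩ := exists_cutoff_radius hκc
  refine tendsto_const_nhds.congr' ?_
  filter_upwards [(tendsto_norm_cocompact_atTop (E := X ν)).eventually_gt_atTop (R / τ)] with x hx
  rw [hR, zero_mul]
  rw [norm_smul, Real.norm_of_nonneg hτ.le, mul_comm]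
  exact (div_lt_iff₀ hτ).1 hx

/-- The truncations `κ(τ|q|)W` are compact, and the remainder tends to zero in norm like a positive
power of `τ`. Decay comes from the oscillation here, so `W` itself may be unbounded. -/
theorem isCompactOperator_oscPotential (hk : k ≠ 0) (hα : 0 < α) (hκ : ContDiff ℝ ∞ κ)
    (hκc : HasCompactSupport κ) (hκ1 : ∀ t ∈ Icc (-1 : ℝ) 1, κ t = 1)
    (hκ0 : ∀ t, 0 ≤ κ t ∧ κ t ≤ 1) {n : ℕ} (hn0 : n ≠ 0) (hn : 0 < n * α + β - n)
    {V : Sob ν n →L[ℂ] Sob ν (-n)} (hV : IsMultiplicationBy (oscPotential ν α β k κ) V) :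
    IsCompactOperator V := by
  have hn' : (0 : ℝ) < n := Nat.cast_pos.2 (Nat.pos_of_ne_zero hn0)
  -- Any positive exponent suffices for convergence; the splitting requires it to be at most `2`.
  have hδ0 : 0 < min 2 (n * α + β - n) := lt_min two_pos hn
  obtain ⟨K, hK, h⟩ := exists_potential_splitting (ν := ν) hk hα hκ hκc hκ1 hκ0 n hδ0.le
    (min_le_left _ _) (min_le_right _ _)
  choose T₁ T₂ T₃ hT using fun i : ℕ => h ((i : ℝ) + 1)⁻¹ (by positivity)
  have e : ∀ i, V - T₁ i = T₂ i := fun i => by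
    rw [sub_eq_iff_eq_add']
    refine hV.unique ?_
    convert (hT i).1.add (hT i).2.1 using 2 with x
    ring
  have ht : Tendsto T₁ atTop (𝓝 V) := by
    rw [tendsto_iff_norm_sub_tendsto_zero]
    refine squeeze_zero (g := fun i : ℕ => K * ((i : ℝ) + 1)⁻¹ ^ min 2 (n * α + β - n))
      (fun _ => norm_nonneg _) (fun i => ?_) ?_
    · rw [norm_sub_rev, e]
      exact (hT i).2.2.2.1
    · have h1 : Tendsto (fun i : ℕ => ((i : ℝ) + 1)⁻¹) atTop (𝓝 0) := by
        simpa using tendsto_one_div_add_atTop_nhds_zero_nat (𝕜 := ℝ)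
      have h2 := (h1.rpow_const (p := min 2 (n * α + β - n)) (Or.inr hδ0.le)).const_mul K
      rwa [Real.zero_rpow hδ0.ne', mul_zero] at h2
  refine isCompactOperator_of_tendsto ht (Eventually.of_forall fun i => ?_)
  have hc : Continuous fun x : X ν => κ ‖((i : ℝ) + 1)⁻¹ • x‖ * oscPotential ν α β k κ x :=
    (hκ.continuous.comp (by fun_prop)).mul (continuous_oscPotential hκ hκ1)
  obtain ⟨V', h1, h2⟩ := exists_isCompactOperator_isMultiplicationBy (t := -(n : ℝ)) hn'
    (by linarith) hc (tendsto_cutoff_mul_oscPotential hκc (by positivity))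
  rwa [(hT i).1.unique h1]

/-- Both cases at once, for an integer order `n`. The separate real `s` lets the result be used at
the literals `1` and `2`, which are not syntactically casts. -/
theorem exists_isMultiplicationBy_oscPotential (hk : k ≠ 0) (hα : 0 < α) (hκ : ContDiff ℝ ∞ κ)
    (hκc : HasCompactSupport κ) (hκ1 : ∀ t ∈ Icc (-1 : ℝ) 1, κ t = 1)
    (hκ0 : ∀ t, 0 ≤ κ t ∧ κ t ≤ 1) {u : X ν → X ν} (hu : IsInClassU u) {n : ℕ} (hn0 : n ≠ 0)
    (hn : 1 < n * α + β - n) {s : ℝ} (hs : s = n) :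
    (∃ V : Sob ν s →L[ℂ] Sob ν (-s), IsMultiplicationBy (oscPotential ν α β k κ) V ∧
      IsCompactOperator V ∧ IsSymm V ∧ IsC11 (conjOp u) V) ∧
    ∀ a : ℝ, DifferenceCondition s (oscPotential ν α β k κ) a := by
  subst hs
  refine ⟨?_, differenceCondition_oscPotential hk hα hκ hκc hκ1 hκ0 n hn⟩
  have hp : PolyGrowth (oscPotential ν α β k κ) := polyGrowth_oscPotential hκ hκ0 hκ1
  obtain ⟨K, hK, h⟩ :=
    exists_formBound_mul_oscPotential (ν := ν) (β := β) hk hα hκ hκc hκ1 n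
  -- The potential alone is the case of the constant symbol, of order `0`, allowed because `nα + β -
  -- n` is positive.
  have hb := h (fun _ => 1) _ 0 measurable_const (norm_nonneg _) (by linarith)
    (Symb.const ((1 : ℝ) : ℂ))
  simp only [one_mul] at hb
  obtain ⟨V, hV, -⟩ := hb.exists_clm n.cast_nonneg hp (by positivity)
  exact ⟨V, hV, isCompactOperator_oscPotential hk hα hκ hκc hκ1 hκ0 hn0 (by linarith) hV,
    hV.isSymm n.cast_nonneg hp, isC11_of_isMultiplicationBy hu.bddSmooth hk hα hκ hκc hκ1 hκ0 n hn hV⟩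

theorem IsInClassU.exists_le_inner {u : X ν → X ν} (hu : IsInClassU u) {a : ℝ} (ha : 0 < a)
    (b : ℝ) : ∃ c : ℝ, 0 < c ∧ ∀ x : X ν, ‖x‖ ^ 2 ∈ Ioo a b → c ≤ inner ℝ x (u x) := by
  obtain ⟨S, hS⟩ : ∃ S : Set (X ν), S = {x | ‖x‖ ^ 2 ∈ Icc a b} := ⟨_, rfl⟩
  have hSc : IsCompact S := by
    refine Metric.isCompact_of_isClosed_isBounded ?_ ?_
    · rw [hS]
      exact isClosed_Icc.preimage (by fun_prop)
    · refine isBounded_iff_forall_norm_le.2 ⟨√b, fun x hx => ?_⟩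
      rw [hS] at hx
      exact Real.le_sqrt_of_sq_le hx.2
  have hc : Continuous fun x => inner ℝ x (u x) := continuous_id.inner hu.smooth.continuous
  rcases S.eq_empty_or_nonempty with h | h
  · refine ⟨1, one_pos, fun x hx => ?_⟩
    have : x ∈ S := hS ▸ Ioo_subset_Icc_self hx
    rw [h] at this
    exact this.elim
  -- The minimum over the closed annulus is attained, and positive because `a > 0` keeps the origin
  -- out.
  · obtain ⟨y, hy, hmin⟩ := hSc.exists_isMinOn h hc.continuousOn
    refine ⟨_, hu.pos y ?_, fun x hx => hmin (hS ▸ Ioo_subset_Icc_self hx : x ∈ S)⟩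
    rintro rfl
    rw [hS] at hy
    have : a ≤ ‖(0 : X ν)‖ ^ 2 := hy.1
    rw [norm_zero] at this
    linarith

end Compactness

end

end OscPot

end

theorem lemmal (ν : ℕ) (hν : 0 < ν) (α β k : ℝ) (hα : 0 < α) (hk : k ≠ 0)
    (κ : ℝ → ℝ) (hκ : ContDiff ℝ ∞ κ) (hκc : HasCompactSupport κ)
    (hκ1 : ∀ t ∈ Icc (-1 : ℝ) 1, κ t = 1) (hκ0 : ∀ t, 0 ≤ κ t ∧ κ t ≤ 1)
    (u : X ν → X ν) (hu : IsInClassU u) :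
    -- first case, with the hypotheses of both limiting absorption theorems in form version
    (2 < α + β →
      ∃ V : Sob ν 1 →L[ℂ] Sob ν (-1),
        IsMultiplicationBy (oscPotential ν α β k κ) V ∧ IsCompactOperator V ∧ IsSymm V ∧
        IsC11 (conjOp u) V ∧
        ∀ a : ℝ, DifferenceCondition 1 (oscPotential ν α β k κ) a) ∧
    -- second case, with the hypotheses of both limiting absorption theorems in operator version
    (3 < 2 * α + β → 0 < β →
      (∃ V₀ : Sob ν 2 →L[ℂ] Sob ν 0,
        IsMultiplicationBy (oscPotential ν α β k κ) V₀ ∧ IsCompactOperator V₀) ∧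
      (∃ V : Sob ν 2 →L[ℂ] Sob ν (-2),
        IsMultiplicationBy (oscPotential ν α β k κ) V ∧ IsSymm V ∧ IsC11 (conjOp u) V) ∧
      ∀ a : ℝ, DifferenceCondition 2 (oscPotential ν α β k κ) a) ∧
    -- positivity of the conjugate operator on every bounded energy interval away from zero
    (∀ a b : ℝ, 0 < a → ∃ c : ℝ, 0 < c ∧
      ∀ x : X ν, ‖x‖ ^ 2 ∈ Ioo a b → c ≤ inner ℝ x (u x)) := by
  refine ⟨fun h => ?_, fun h hβ => ?_, fun a b ha => hu.exists_le_inner ha b⟩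
  · obtain ⟨⟨V, h1, h2, h3, h4⟩, h5⟩ := exists_isMultiplicationBy_oscPotential (β := β) hk hα hκ hκc
      hκ1 hκ0 hu one_ne_zero (by push_cast; linarith) (s := 1) Nat.cast_one.symm
    exact ⟨V, h1, h2, h3, h4, h5⟩
  · obtain ⟨⟨V, h1, -, h3, h4⟩, h5⟩ := exists_isMultiplicationBy_oscPotential (β := β) hk hα hκ hκc
      hκ1 hκ0 hu two_ne_zero (by push_cast; linarith) (s := 2) Nat.cast_two.symm
    -- The operator into `L²` is obtained without oscillatory estimates: `β > 0` makes `W`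
    -- continuous and vanishing at infinity.
    exact ⟨exists_isCompactOperator_isMultiplicationBy two_pos le_rfl
      (continuous_oscPotential hκ hκ1) (tendsto_oscPotential hβ hκ1 hκ0), ⟨V, h1, h3, h4⟩, h5⟩
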